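/- **Theorem (Classical diagonalisation method).** *Setting.* Let $d\ge 1$, $L,T,\alpha,\zeta>0$, $\epsilon\in(0,1)$. Let $u(\mathbf x,t)$, $t\in[0,T]$, be $L$-periodic in each of the $d$ spatial coordinates, four times continuously differentiable in $\mathbf x$ at each time, a classical solution of $\partial u/\partial t=\alpha\sum_{i=1}^d\partial^2u/\partial x_i^2$, with $u_0=u(\cdot,0)\ge 0$ and $$\Big|\frac{\partial^4u}{\partial x_i^2\partial x_j^2}\Big|\le\frac{\zeta}{L^d}\quad\text{on }[0,L]^d\times[0,T]\text{ for all }i,j .$$ Put $\bar n=L\sqrt{d\alpha\zeta T/(3\epsilon)}$, $\bar m=2T^2d^2\alpha^2\zeta/(3\epsilon)$, $n=\lceil\bar n\rceil$, $m=\lceil\bar m\rceil$. The grid $G$ consists of the points $(\mathbf x,t)$ with $\mathbf x\in\{0,\tfrac Ln,\dots,\tfrac{(n-1)L}{n}\}^d$ and $t=iT/m$, $0\le i\le m$. Assume the normalisation $\sum_{(\mathbf x,0)\in G}u_0(\mathbf x)=(n/L)^d$. Write $X=TL^2d\alpha\zeta/\epsilon=3\bar n^2$. *Machine.* Algorithms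 are fixed programs (assignments, sequencing, if, while) of a random access machine with integer registers and integer memory. Each step is charged one unit plus the number of binary digits it handles, addresses included; multiplication and integer division are charged the product of the operand lengths (up to the additive units). The program receives $d,n,m$ and the index $i$ of the target time. For any $k\ge 0$ of its choice it may ask for $\lfloor 2^kL^du_0(\mathbf x)\rfloor$ at a grid point $\mathbf x$, for $\lfloor 2^k\alpha T/L^2\rfloor$ and for $\lfloor 2^k\epsilon\rfloor$; nothing is charged for computing $u_0$, only the length of the question and answer plus $k$. It outputs $\widetilde u(\mathbf x,t)$ as an integer in memory (one for each grid point $\mathbf x$) divided by a common integer, in the unit $L^{-d}$. *Claim.* There is a program such that for every $K\in\mathbb N$ there is a constant $C$, depending only on $K$, with the following property. For all data as above with $$\bar n\ge 1,\qquad n^d\le K\,\bar n^{\,d},\qquad m\le X^K,\qquad 1/\epsilon\le X^K,$$ and every target time $t=iT/m$, $0\le i\le m$, the program halts with an output satisfying $|\widetilde u(\mathbf x,t)-u(\mathbf x,t)|\le\epsilon/L^d$ at all grid points $\mathbf x$, in time at most $$C\cdot 3^{-d/2}L^dd^{d/2+3}\Big(\frac{T\alpha\zeta}{\epsilon}\Big)^{d/2}\log^3\Big(\frac{TL^2d\alpha\zeta}{\epsilon}\Big).$$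 -/

import Mathlib

open Set

noncomputable section

namespace HeatFFT

/-! ## The heat equation on the periodic box -/

/-- The partial derivative `∂f/∂x_i`. -/
def partialD {d : ℕ} (i : Fin d) (f : (Fin d → ℝ) → ℝ) : (Fin d → ℝ) → ℝ :=
  fun x => fderiv ℝ f x (Pi.single i 1)

/-- `u x t` is a classical solution, for times in `[0,T]`, of
`∂u/∂t = α (∂²u/∂x_1² + ⋯ + ∂²u/∂x_d²)` on the box `[0,L]^d` with periodic boundary conditions.
The function is extended periodically to `ℝ^d`; at each time it is four times continuously
differentiable in space, and the time derivative is one-sided at the two ends of `[0,T]`. -/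
structure IsPeriodicHeatSolution {d : ℕ} (α L T : ℝ) (u : (Fin d → ℝ) → ℝ → ℝ) : Prop where
  periodic : ∀ (x : Fin d → ℝ) (i : Fin d), ∀ t ∈ Icc 0 T, u (x + Pi.single i L) t = u x t
  smooth : ∀ t ∈ Icc 0 T, ContDiff ℝ 4 (fun x => u x t)
  heat : ∀ (x : Fin d → ℝ), ∀ t ∈ Icc 0 T,
    HasDerivWithinAt (fun s => u x s)
      (α * ∑ i : Fin d, partialD i (partialD i (fun y => u y t)) x) (Icc 0 T) t

/-- The smoothness bound `|∂⁴u/∂x_i²∂x_j²| ≤ ζ / L^d` on `[0,L]^d × [0,T]`. -/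
def FourthDerivBound {d : ℕ} (ζ L T : ℝ) (u : (Fin d → ℝ) → ℝ → ℝ) : Prop :=
  ∀ (i j : Fin d) (x : Fin d → ℝ), (∀ k, x k ∈ Icc 0 L) → ∀ t ∈ Icc 0 T,
    |partialD i (partialD i (partialD j (partialD j (fun y => u y t)))) x| ≤ ζ / L ^ d

/-- The grid point with coordinates `j_k L / n`. -/
def gridPoint {d : ℕ} (L : ℝ) (n : ℕ) (j : Fin d → ℕ) : Fin d → ℝ :=
  fun k => (j k : ℝ) * (L / n)

/-- The number of the grid point `j` when grid points are enumerated by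
`j_0 + j_1 n + j_2 n² + ⋯`. -/
def gridIndex {d : ℕ} (n : ℕ) (j : Fin d → Fin n) : ℕ :=
  ∑ k : Fin d, (j k : ℕ) * n ^ (k : ℕ)

/-- The real number `L √(d α ζ T / (3 ε))`; the grid has this number of points per direction,
rounded up. -/
def spaceSteps (d : ℕ) (L T α ζ ε : ℝ) : ℝ := L * √((d : ℝ) * α * ζ * T / (3 * ε))

/-- The real number `2 T² d² α² ζ / (3 ε)`; the grid has this number of time steps,
rounded up. -/
def timeSteps (d : ℕ) (T α ζ ε : ℝ) : ℝ := 2 * T ^ 2 * (d : ℝ) ^ 2 * α ^ 2 * ζ / (3 * ε)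

/-! ## The machine

A random access machine on integers. Every operation is charged by the number of binary digits it
handles, with schoolbook cost for multiplication and division. Real data (the initial values and
two real parameters) are consulted through their binary expansions, each consulted digit being
charged. -/

/-- The real data a program may consult: a real number `sample q` for each `q`, and real
parameters `param r`. -/
structure Input where
  sample : ℕ → ℝ
  param : ℕ → ℝ

/-- The store of the machine: registers and memory, holding integers. -/
structure Store where
  reg : ℕ → ℤ
  mem : ℕ → ℤ

/-- Instructions; the arguments `x y z a q k` are names of registers. -/
inductive Instr where
  /-- `x := c` for an integer constant `c` -/
  | const (x : ℕ) (c : ℤ)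
  /-- `x := y + z` -/
  | add (x y z : ℕ)
  /-- `x := y - z` -/
  | sub (x y z : ℕ)
  /-- `x := y * z` -/
  | mul (x y z : ℕ)
  /-- `x :=` the integer quotient of `y` by `z` -/
  | div (x y z : ℕ)
  /-- `x := mem[a]` -/
  | load (x a : ℕ)
  /-- `mem[a] := y` -/
  | store (a y : ℕ)
  /-- `x := ⌊2^k * param r⌋`, where `r` is a constant -/
  | param (x r k : ℕ)
  /-- `x := ⌊2^k * sample q⌋` -/
  | sample (x q k : ℕ)

/-- The number of binary digits of an integer. -/
def bits (z : ℤ) : ℕ := Nat.size z.natAbs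

/-- The effect of an instruction. -/
def Instr.exec (inp : Input) (s : Store) : Instr → Store
  | const x c => { s with reg := Function.update s.reg x c }
  | add x y z => { s with reg := Function.update s.reg x (s.reg y + s.reg z) }
  | sub x y z => { s with reg := Function.update s.reg x (s.reg y - s.reg z) }
  | mul x y z => { s with reg := Function.update s.reg x (s.reg y * s.reg z) }
  | div x y z => { s with reg := Function.update s.reg x (s.reg y / s.reg z) }
  | load x a => { s with reg := Function.update s.reg x (s.mem (s.reg a).toNat) }
  | store a y => { s with mem := Function.update s.mem (s.reg a).toNat (s.reg y) }
  | param x r k =>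
      { s with reg := Function.update s.reg x ⌊(2 : ℝ) ^ (s.reg k).toNat * inp.param r⌋ }
  | sample x q k =>
      { s with reg := Function.update s.reg x
                ⌊(2 : ℝ) ^ (s.reg k).toNat * inp.sample (s.reg q).toNat⌋ }

/-- The time charged for an instruction: one plus the number of binary digits of the integers
involved (addresses included), and the product of the lengths for a multiplication or a
division. -/
def Instr.cost (inp : Input) (s : Store) : Instr → ℕ
  | const _ c => 1 + bits c
  | add _ y z => 1 + bits (s.reg y) + bits (s.reg z)
  | sub _ y z => 1 + bits (s.reg y) + bits (s.reg z)
  | mul _ y z => (1 + bits (s.reg y)) * (1 + bits (s.reg z))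
  | div _ y z => (1 + bits (s.reg y)) * (1 + bits (s.reg z))
  | load _ a => 1 + bits (s.reg a) + bits (s.mem (s.reg a).toNat)
  | store a y => 1 + bits (s.reg a) + bits (s.reg y)
  | param _ r k =>
      1 + (s.reg k).natAbs + bits ⌊(2 : ℝ) ^ (s.reg k).toNat * inp.param r⌋
  | sample _ q k =>
      1 + bits (s.reg q) + (s.reg k).natAbs
        + bits ⌊(2 : ℝ) ^ (s.reg k).toNat * inp.sample (s.reg q).toNat⌋

/-- Programs; `ite x y` tests `x ≤ y` and `loop x y` repeats its body while `x < y`, where `x`, `y`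
are registers. -/
inductive Prog where
  | instr (o : Instr)
  | seq (p q : Prog)
  | ite (x y : ℕ) (p q : Prog)
  | loop (x y : ℕ) (p : Prog)

/-- The time charged for comparing two registers. -/
def testCost (s : Store) (x y : ℕ) : ℕ := 1 + bits (s.reg x) + bits (s.reg y)

/-- `Run inp p s s' c`: the program `p`, started in the store `s`, halts in the store `s'` after
time exactly `c`. -/
inductive Run (inp : Input) : Prog → Store → Store → ℕ → Prop where
  | instr (o : Instr) (s : Store) : Run inp (.instr o) s (o.exec inp s) (o.cost inp s)
  | seq {p q : Prog} {s s' s'' : Store} {c c' : ℕ} :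
      Run inp p s s' c → Run inp q s' s'' c' → Run inp (.seq p q) s s'' (c + c')
  | ite_pos {x y : ℕ} {p q : Prog} {s s' : Store} {c : ℕ} :
      s.reg x ≤ s.reg y → Run inp p s s' c → Run inp (.ite x y p q) s s' (testCost s x y + c)
  | ite_neg {x y : ℕ} {p q : Prog} {s s' : Store} {c : ℕ} :
      ¬ s.reg x ≤ s.reg y → Run inp q s s' c → Run inp (.ite x y p q) s s' (testCost s x y + c)
  | loop_stop {x y : ℕ} {p : Prog} {s : Store} :
      ¬ s.reg x < s.reg y → Run inp (.loop x y p) s s (testCost s x y)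
  | loop_step {x y : ℕ} {p : Prog} {s s' s'' : Store} {c c' : ℕ} :
      s.reg x < s.reg y → Run inp p s s' c → Run inp (.loop x y p) s' s'' c' →
      Run inp (.loop x y p) s s'' (testCost s x y + c + c')

/-- A program has at most one outcome and one running time. -/
theorem Run.det {inp : Input} {p : Prog} {s s₁ s₂ : Store} {c₁ c₂ : ℕ}
    (h₁ : Run inp p s s₁ c₁) (h₂ : Run inp p s s₂ c₂) : s₁ = s₂ ∧ c₁ = c₂ := by
  induction h₁ generalizing s₂ c₂ with
  | instr o s => cases h₂; exact ⟨rfl, rfl⟩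
  | seq _ _ ih ih' =>
    cases h₂ with
    | seq a b =>
      obtain ⟨rfl, rfl⟩ := ih a
      obtain ⟨rfl, rfl⟩ := ih' b
      exact ⟨rfl, rfl⟩
  | ite_pos h _ ih =>
    cases h₂ with
    | ite_pos _ a => obtain ⟨rfl, rfl⟩ := ih a; exact ⟨rfl, rfl⟩
    | ite_neg h' _ => exact absurd h h'
  | ite_neg h _ ih =>
    cases h₂ with
    | ite_pos h' _ => exact absurd h' h
    | ite_neg _ a => obtain ⟨rfl, rfl⟩ := ih a; exact ⟨rfl, rfl⟩
  | loop_stop h =>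
    cases h₂ with
    | loop_stop _ => exact ⟨rfl, rfl⟩
    | loop_step h' _ _ => exact absurd h' h
  | loop_step h _ _ ih ih' =>
    cases h₂ with
    | loop_stop h' => exact absurd h h'
    | loop_step _ a b =>
      obtain ⟨rfl, rfl⟩ := ih a
      obtain ⟨rfl, rfl⟩ := ih' b
      exact ⟨rfl, rfl⟩

/-- The initial store: registers `0,1,2,3` hold `d`, `n`, `m`, `i`; all else is zero. -/
def initStore (d n m i : ℕ) : Store where
  reg := fun r => if r = 0 then d else if r = 1 then n else if r = 2 then m
    else if r = 3 then i else 0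
  mem := fun _ => 0

/-- The real data a program may consult: the initial values at the grid points (in the unit
`1 / L^d`), the number `α T / L²` (the final time in the unit `L²/α`), and the accuracy `ε`. -/
def heatInput {d : ℕ} (L T α ε : ℝ) (n : ℕ) (u₀ : (Fin d → ℝ) → ℝ) : Input where
  sample := fun q => L ^ d * u₀ (gridPoint L n (fun k : Fin d => q / n ^ (k : ℕ) % n))
  param := fun r => if r = 0 then α * T / L ^ 2 else if r = 1 then ε else 0

/-- The approximate solution written by the machine: at the grid point `j` it is the integer found
in memory at address `gridIndex n j`, divided by the integer in register `0`, in the unit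
`1 / L^d`. -/
def output {d : ℕ} (L : ℝ) (n : ℕ) (s : Store) (j : Fin d → Fin n) : ℝ :=
  (s.mem (gridIndex n j) : ℝ) / (s.reg 0 : ℝ) / L ^ d

/-- The claimed running time, up to a constant factor. -/
def timeBound (d : ℕ) (L T α ζ ε : ℝ) : ℝ :=
  (3 : ℝ) ^ (-(d : ℝ) / 2) * L ^ d * (d : ℝ) ^ ((d : ℝ) / 2 + 3)
    * (T * α * ζ / ε) ^ ((d : ℝ) / 2) * Real.log (T * L ^ 2 * d * α * ζ / ε) ^ 3

end HeatFFT

end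

open Set
noncomputable section
namespace HeatFFT

/-! ## Verification of programs -/

/-! The proof combines a discretisation estimate, a cheap approximate evaluation of the discrete
evolution, and a verified count of bit operations.

Discretisation. On the grid the solution obeys the method-of-lines equation up to a consistency
error controlled by the fourth derivatives (`gridFun_hasDeriv`). Explicit steps, factored into
one-coordinate steps `heatStep`, do not increase the sup norm, so local errors merely add up
(`semidiscrete_global`). Periodicity turns the bound on fourth differences into bounds on second
differences and oscillations, at the price of factors `n ^ 2` and `n ^ 4` (`periodic_secondDiff_le`,
`periodic_osc`). The choice of `n` makes the spatial error at most `ε / 4`, and `2 ^ q ≥ 1600 m n ^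
2` time steps make the temporal error at most `ε / 16` (`gridFun_splitStep`).

Evaluation. The one-coordinate steps commute, so all `2 ^ q` steps in one coordinate may be taken
together: a power of `1 + c δ²` has to be applied to every line. Cosines diagonalise it. With `τ = c
2 ^ q`, two truncations keep only about `log X` modes. Values outside a window of half length `a`,
of order `max(l, √(τ l))` or `n` if that is smaller, may be replaced by the periodic continuation of
the window (`fullKernel_sub_le`, by comparison with a hyperbolic cosine). On such a window either
all modes are kept or those beyond `8 l` are damped below `exp (-4 l)` (`damping_le_exp`). Both
effects are collected in `kernel_spec`, together with the stability factor `1 + 1 / d`, harmless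
over `d` passes. The remaining window sums slide along a line by a three-term recurrence
(`yExact_succ`), whose rounding errors grow only quadratically (`linear_recurrence_bound`). Cosines
and damping factors come from fixed-point arithmetic (`cosFix_err`, `dampFix_err`). A pass reads
lines at the largest stride and writes them contiguously, which rotates the digits of the addresses;
`d` passes treat every coordinate and restore the order (`dig_line`, `dig_succ_line`,
`Params.Fit.passes_spec`).

Cost. There are `d` passes, `O(log X)` modes per pass and `O(n ^ d)` operations per mode, on
integers of `O(d log X)` bits (`Task.Valid.R_le_log`, `Task.Valid.bdd`). Schoolbook arithmetic costs
the square of the length, whence `d ^ 3 n ^ d log ^ 3 X`, which is the claimed bound by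
`timeBound_eq` and the hypothesis on `n ^ d`. A grid with one point is separate: there the answer is
the constant `1` (`gridFun_one`). -/

lemma bits_le_iff {z : ℤ} {k : ℕ} : bits z ≤ k ↔ |z| < 2 ^ k := by
  unfold bits
  rw [Nat.size_le, Int.abs_eq_natAbs]
  exact_mod_cast Iff.rfl

lemma abs_lt_two_pow_bits (z : ℤ) : |z| < 2 ^ bits z := bits_le_iff.1 le_rfl

lemma bits_add_le (x y : ℤ) : bits (x + y) ≤ bits x + bits y + 1 := by
  rw [bits_le_iff]
  have hx := abs_lt_two_pow_bits x
  have hy := abs_lt_two_pow_bits y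
  have h1 : (2 : ℤ) ^ bits x ≤ 2 ^ (bits x + bits y) := pow_le_pow_right₀ (by norm_num) (by omega)
  have h2 : (2 : ℤ) ^ bits y ≤ 2 ^ (bits x + bits y) := pow_le_pow_right₀ (by norm_num) (by omega)
  have := abs_add_le x y
  rw [pow_succ]
  linarith

lemma bits_neg (x : ℤ) : bits (-x) = bits x := by simp [bits]

lemma bits_sub_le (x y : ℤ) : bits (x - y) ≤ bits x + bits y + 1 := by
  rw [sub_eq_add_neg, ← bits_neg y]
  exact bits_add_le _ _

lemma bits_mul_le (x y : ℤ) : bits (x * y) ≤ bits x + bits y := by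
  rw [bits_le_iff, abs_mul, pow_add]
  exact mul_lt_mul'' (abs_lt_two_pow_bits x) (abs_lt_two_pow_bits y) (abs_nonneg _) (abs_nonneg _)

lemma bits_div_le (x y : ℤ) : bits (x / y) ≤ bits x := by
  unfold bits
  exact Nat.size_le_size (Int.natAbs_ediv_le_natAbs x y)

/-! ### Arithmetic expressions and their compilation. -/

/-- Arithmetic expressions over registers and memory. -/
inductive Expr where
  | var (r : ℕ)
  | lit (c : ℤ)
  | add (a b : Expr)
  | sub (a b : Expr)
  | mul (a b : Expr)
  | div (a b : Expr)
  | load (a : Expr)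

namespace Expr

/-- The value of an expression. -/
def eval (s : Store) : Expr → ℤ
  | var r => s.reg r
  | lit c => c
  | add a b => a.eval s + b.eval s
  | sub a b => a.eval s - b.eval s
  | mul a b => a.eval s * b.eval s
  | div a b => a.eval s / b.eval s
  | load a => s.mem (a.eval s).toNat

/-- The number of nodes of an expression. -/
def size : Expr → ℕ
  | var _ => 1
  | lit _ => 1
  | add a b => a.size + b.size + 1
  | sub a b => a.size + b.size + 1
  | mul a b => a.size + b.size + 1
  | div a b => a.size + b.size + 1
  | load a => a.size + 1

/-- Only registers below `100` and small literals occur. -/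
def ok : Expr → Bool
  | var r => decide (r < 100)
  | lit c => decide (c.natAbs < 128)
  | add a b => a.ok && b.ok
  | sub a b => a.ok && b.ok
  | mul a b => a.ok && b.ok
  | div a b => a.ok && b.ok
  | load a => a.ok

/-- Code that puts the value of an expression into register `x`, using the registers from `x` on. -/
def code : Expr → ℕ → Prog
  | var r, x => .seq (.instr (.const x 0)) (.instr (.add x x r))
  | lit c, x => .instr (.const x c)
  | add a b, x => .seq (a.code x) (.seq (b.code (x + 1)) (.instr (.add x x (x + 1))))
  | sub a b, x => .seq (a.code x) (.seq (b.code (x + 1)) (.instr (.sub x x (x + 1))))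
  | mul a b, x => .seq (a.code x) (.seq (b.code (x + 1)) (.instr (.mul x x (x + 1))))
  | div a b, x => .seq (a.code x) (.seq (b.code (x + 1)) (.instr (.div x x (x + 1))))
  | load a, x => .seq (a.code x) (.instr (.load x x))

lemma one_le_size (e : Expr) : 1 ≤ e.size := by cases e <;> simp [size]

lemma eval_congr {s s' : Store} (hm : s.mem = s'.mem) (hr : ∀ r < 100, s.reg r = s'.reg r) :
    ∀ e : Expr, e.ok = true → e.eval s = e.eval s' := by
  intro e
  induction e with
  | var r => intro h; simpa [eval] using hr r (by simpa [ok] using h)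
  | lit c => intro _; rfl
  | add a b iha ihb | sub a b iha ihb | mul a b iha ihb | div a b iha ihb =>
    intro h
    simp only [ok, Bool.and_eq_true] at h
    simp [eval, iha h.1, ihb h.2]
  | load a iha => intro h; simp [eval, iha h, hm]

end Expr

/-- All registers below `100` and all memory cells hold integers of at most `β` bits. -/
def Small (β : ℕ) (s : Store) : Prop :=
  (∀ r < 100, bits (s.reg r) ≤ β) ∧ ∀ a, bits (s.mem a) ≤ β

/-- Each operation produces at most the sum of the operand lengths plus one digit, and a quotient is
no longer than its dividend. Keeping one spare unit on the left lets the induction absorb this extra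
digit. -/
lemma Expr.bits_eval_le {β : ℕ} {s : Store} (hs : Small β s) (hβ : 7 ≤ β) :
    ∀ e : Expr, e.ok = true → bits (e.eval s) + 1 ≤ e.size * (β + 1) := by
  intro e
  induction e with
  | var r => intro h; simpa [eval, size] using hs.1 r (by simpa [ok] using h)
  | lit c =>
    intro h
    have : c.natAbs < 128 := by simpa [ok] using h
    have : bits c ≤ 7 := Nat.size_le.2 (by simpa using this)
    simp only [eval, size]; omega
  | add a b iha ihb =>
    intro h
    simp only [ok, Bool.and_eq_true] at h
    have := bits_add_le (a.eval s) (b.eval s)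
    have h1 := iha h.1
    have h2 := ihb h.2
    simp only [eval, size, add_mul]; omega
  | sub a b iha ihb =>
    intro h
    simp only [ok, Bool.and_eq_true] at h
    have := bits_sub_le (a.eval s) (b.eval s)
    have h1 := iha h.1
    have h2 := ihb h.2
    simp only [eval, size, add_mul]; omega
  | mul a b iha ihb =>
    intro h
    simp only [ok, Bool.and_eq_true] at h
    have := bits_mul_le (a.eval s) (b.eval s)
    have h1 := iha h.1
    have h2 := ihb h.2
    simp only [eval, size, add_mul]; omega
  | div a b iha ihb =>
    intro h
    simp only [ok, Bool.and_eq_true] at h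
    have := bits_div_le (a.eval s) (b.eval s)
    have h1 := iha h.1
    have h2 := ihb h.2
    simp only [eval, size, add_mul]; omega
  | load a iha =>
    intro h
    have := hs.2 (a.eval s).toNat
    have h1 := iha h
    simp only [eval, size, add_mul]; omega

/-- The registers from `x` on act as a stack: the left operand rests in `x` while the right one is
computed from `x + 1` upwards. Evaluation touches neither the memory nor the registers below `x`, so
the right operand has the same value after the left one has been computed. Every node costs at most
a constant times the square of the largest possible operand length. -/
lemma Expr.code_spec (inp : Input) {β : ℕ} (hβ : 7 ≤ β) :
    ∀ (e : Expr), e.ok = true → ∀ (x : ℕ), 100 ≤ x → ∀ s : Store, Small β s →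
    ∃ s' c, Run inp (e.code x) s s' c ∧ s'.mem = s.mem ∧ s'.reg x = e.eval s ∧
      (∀ r < x, s'.reg r = s.reg r) ∧ c ≤ 2 * e.size * (e.size * (β + 1)) ^ 2 := by
  -- One argument for the four binary operations: the linear charges for sums and differences are
  -- also bounded by the product of the lengths.
  have bin : ∀ (a b : Expr) (o : ℕ → ℕ → ℕ → Instr) (f : ℤ → ℤ → ℤ),
      (∀ x y z s, (o x y z).exec inp s
        = { s with reg := Function.update s.reg x (f (s.reg y) (s.reg z)) }) →
      (∀ x y z s, (o x y z).cost inp s ≤ (1 + bits (s.reg y)) * (1 + bits (s.reg z))) →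
      (∀ x : ℕ, 100 ≤ x → ∀ s : Store, Small β s →
        ∃ s' c, Run inp (a.code x) s s' c ∧ s'.mem = s.mem ∧ s'.reg x = a.eval s ∧
        (∀ r < x, s'.reg r = s.reg r) ∧ c ≤ 2 * a.size * (a.size * (β + 1)) ^ 2) →
      (∀ x : ℕ, 100 ≤ x → ∀ s : Store, Small β s →
        ∃ s' c, Run inp (b.code x) s s' c ∧ s'.mem = s.mem ∧ s'.reg x = b.eval s ∧
        (∀ r < x, s'.reg r = s.reg r) ∧ c ≤ 2 * b.size * (b.size * (β + 1)) ^ 2) →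
      a.ok = true → b.ok = true → ∀ x : ℕ, 100 ≤ x → ∀ s : Store, Small β s →
      ∃ s' c, Run inp (.seq (a.code x) (.seq (b.code (x + 1)) (.instr (o x x (x + 1))))) s s' c ∧
        s'.mem = s.mem ∧ s'.reg x = f (a.eval s) (b.eval s) ∧
        (∀ r < x, s'.reg r = s.reg r) ∧
        c ≤ 2 * (a.size + b.size + 1) * ((a.size + b.size + 1) * (β + 1)) ^ 2 := by
    intro a b o f hx hc iha ihb ha hb x h100 s hs
    obtain ⟨s1, c1, r1, m1, v1, k1, b1⟩ := iha x h100 s hs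
    have hs1 : Small β s1 := ⟨fun r hr => by rw [k1 r (by omega)]; exact hs.1 r hr,
      by rw [m1]; exact hs.2⟩
    obtain ⟨s2, c2, r2, m2, v2, k2, b2⟩ := ihb (x + 1) (by omega) s1 hs1
    refine ⟨_, _, .seq r1 (.seq r2 (.instr _ _)), ?_, ?_, ?_, ?_⟩
    · rw [hx]; simp [m1, m2]
    · rw [hx]
      have := Expr.eval_congr m1 (fun r hr => k1 r (by omega)) b hb
      simp [k2, v1, v2, this]
    · intro r hr
      rw [hx]
      simp [Function.update_of_ne hr.ne, k2 r (by omega), k1 r hr]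
    · have hcost := hc x x (x + 1) s2
      rw [k2 x (by omega), v1, v2] at hcost
      have e1 := Expr.bits_eval_le hs hβ a ha
      have e2 := Expr.bits_eval_le hs1 hβ b hb
      have p1 := a.one_le_size
      have p2 := b.one_le_size
      set A := a.size
      set B := b.size
      have h1 : (1 + bits (a.eval s)) * (1 + bits (b.eval s1)) ≤ (A * (β + 1)) * (B * (β + 1)) :=
        Nat.mul_le_mul (by omega) (by omega)
      have h3 : (A * (β + 1)) * (B * (β + 1)) ≤ ((A + B + 1) * (β + 1)) ^ 2 := by
        rw [pow_two]; gcongr <;> omega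
      have h4 : (A * (β + 1)) ^ 2 ≤ ((A + B + 1) * (β + 1)) ^ 2 := by gcongr; omega
      have h5 : (B * (β + 1)) ^ 2 ≤ ((A + B + 1) * (β + 1)) ^ 2 := by gcongr; omega
      have h6 := Nat.mul_le_mul_left (2 * A) h4
      have h7 := Nat.mul_le_mul_left (2 * B) h5
      have : 2 * (A + B + 1) * ((A + B + 1) * (β + 1)) ^ 2
        = 2 * A * ((A + B + 1) * (β + 1)) ^ 2 + 2 * B * ((A + B + 1) * (β + 1)) ^ 2
          + 2 * ((A + B + 1) * (β + 1)) ^ 2 := by ring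
      rw [this]
      omega
  intro e
  induction e with
  | var r =>
    intro h x hx s hs
    have hr : r < 100 := by simpa [ok] using h
    refine ⟨_, _, .seq (.instr _ _) (.instr _ _), rfl, ?_, ?_, ?_⟩
    · have : r ≠ x := by omega
      simp [Instr.exec, eval, Function.update_of_ne this]
    · intro r' hr'
      simp [Instr.exec, Function.update_of_ne hr'.ne]
    · have : r ≠ x := by omega
      have h1 := hs.1 r hr
      simp only [Instr.cost, Instr.exec, Function.update_self, Function.update_of_ne this, size]
      simp only [bits, Int.natAbs_zero, Nat.size_zero] at *
      nlinarith
  | lit c =>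
    intro h x hx s hs
    refine ⟨_, _, .instr _ _, rfl, by simp [Instr.exec, eval], ?_, ?_⟩
    · intro r' hr'
      simp [Instr.exec, Function.update_of_ne hr'.ne]
    · have : c.natAbs < 128 := by simpa [ok] using h
      have : bits c ≤ 7 := Nat.size_le.2 (by simpa using this)
      simp only [Instr.cost, size]
      nlinarith
  | add a b iha ihb =>
    intro h
    simp only [ok, Bool.and_eq_true] at h
    exact bin a b .add (· + ·) (fun _ _ _ _ => rfl)
      (fun _ _ _ _ => by simp only [Instr.cost]; ring_nf; omega) (iha h.1) (ihb h.2) h.1 h.2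
  | sub a b iha ihb =>
    intro h
    simp only [ok, Bool.and_eq_true] at h
    exact bin a b .sub (· - ·) (fun _ _ _ _ => rfl)
      (fun _ _ _ _ => by simp only [Instr.cost]; ring_nf; omega) (iha h.1) (ihb h.2) h.1 h.2
  | mul a b iha ihb =>
    intro h
    simp only [ok, Bool.and_eq_true] at h
    exact bin a b .mul (· * ·) (fun _ _ _ _ => rfl) (fun _ _ _ _ => le_rfl)
      (iha h.1) (ihb h.2) h.1 h.2
  | div a b iha ihb =>
    intro h
    simp only [ok, Bool.and_eq_true] at h
    exact bin a b .div (· / ·) (fun _ _ _ _ => rfl) (fun _ _ _ _ => le_rfl)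
      (iha h.1) (ihb h.2) h.1 h.2
  | load a iha =>
    intro h x hx s hs
    obtain ⟨s1, c1, r1, m1, v1, k1, b1⟩ := iha h x hx s hs
    refine ⟨_, _, .seq r1 (.instr _ _), ?_, ?_, ?_, ?_⟩
    · simp [Instr.exec, m1]
    · simp [Instr.exec, v1, m1, eval]
    · intro r hr
      simp [Instr.exec, Function.update_of_ne hr.ne, k1 r hr]
    · have e1 := Expr.bits_eval_le hs hβ a h
      have e2 := hs.2 (a.eval s).toNat
      have p1 := a.one_le_size
      simp only [Instr.cost, v1, m1, size]
      set A := a.size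
      have h4 : (A * (β + 1)) ^ 2 ≤ ((A + 1) * (β + 1)) ^ 2 := by gcongr; omega
      have h6 := Nat.mul_le_mul_left (2 * A) h4
      have h7 : (A + 1) * (β + 1) ≤ ((A + 1) * (β + 1)) ^ 2 := Nat.le_self_pow (by norm_num) _
      have : 2 * (A + 1) * ((A + 1) * (β + 1)) ^ 2
        = 2 * A * ((A + 1) * (β + 1)) ^ 2 + 2 * ((A + 1) * (β + 1)) ^ 2 := by ring
      rw [this]
      have : (A + 1) * (β + 1) = A * (β + 1) + (β + 1) := by ring
      omega

/-! ### A program logic with time bounds. -/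

/-- The time allotted to a statement. -/
def unitCost (β : ℕ) : ℕ := 2000000 * (β + 1) ^ 2

/-- The store without the auxiliary registers. -/
def view (s : Store) : Store := { reg := fun r => if r < 100 then s.reg r else 0, mem := s.mem }

lemma view_reg {s : Store} {r : ℕ} (h : r < 100) : (view s).reg r = s.reg r := by simp [view, h]

lemma small_view {β : ℕ} {s : Store} : Small β (view s) ↔ Small β s := by
  unfold Small
  refine and_congr (forall₂_congr fun r hr => by rw [view_reg hr]) Iff.rfl

/-- Started in a store which looks like `σ` and whose entries have at most `β` bits, the program
halts within `k` units of time in such a store, satisfying `Q`. -/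
def Ends (inp : Input) (β : ℕ) (p : Prog) (σ : Store) (k : ℕ) (Q : Store → Prop) : Prop :=
  Small β σ → ∀ s, view s = σ → ∃ s' c, Run inp p s s' c ∧ c ≤ k * unitCost β ∧
    Small β (view s') ∧ Q (view s')

/-- `x := e` -/
def assign (x : ℕ) (e : Expr) : Prog :=
  .seq (e.code 100) (.seq (.instr (.const 101 0)) (.instr (.add x 100 101)))

/-- `mem[a] := e` -/
def write (a e : Expr) : Prog :=
  .seq (a.code 100) (.seq (e.code 101) (.instr (.store 100 101)))

variable {inp : Input} {β : ℕ} {σ : Store} {k k' : ℕ} {p q : Prog} {Q R : Store → Prop}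

/-- The postcondition of the first program is the judgement about the second, so straight-line code
is verified without naming intermediate assertions. -/
lemma Ends.seq (h : Ends inp β p σ k (fun σ' => Ends inp β q σ' k' Q)) :
    Ends inp β (.seq p q) σ (k + k') Q := by
  intro hs s hv
  obtain ⟨s1, c1, r1, b1, m1, q1⟩ := h hs s hv
  obtain ⟨s2, c2, r2, b2, m2, q2⟩ := q1 m1 s1 rfl
  exact ⟨s2, _, .seq r1 r2, by rw [add_mul]; omega, m2, q2⟩

lemma Ends.mono (h : Ends inp β p σ k Q) (hk : k ≤ k') (hQ : ∀ σ', Small β σ' → Q σ' → R σ') :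
    Ends inp β p σ k' R := by
  intro hs s hv
  obtain ⟨s1, c1, r1, b1, m1, q1⟩ := h hs s hv
  exact ⟨s1, _, r1, b1.trans (Nat.mul_le_mul_right _ hk), m1, hQ _ m1 q1⟩

lemma Ends.of_small (h : Small β σ → Ends inp β p σ k Q) : Ends inp β p σ k Q :=
  fun hs => h hs hs

/-- The value is built in the auxiliary register `100` and then copied by adding a zero held in
`101`. Only `x` changes in the `view`, even if `x` occurs in `e`. -/
lemma Ends.assign {x : ℕ} {e : Expr} (hβ : 7 ≤ β) (hx : x < 100)
    (he : (e.ok && decide (e.size ≤ 60)) = true)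
    (hb : |e.eval σ| < 2 ^ β) (hQ : Q { σ with reg := Function.update σ.reg x (e.eval σ) }) :
    Ends inp β (assign x e) σ 1 Q := by
  intro hs s hv
  simp only [Bool.and_eq_true, decide_eq_true_eq] at he
  have hs' : Small β s := by rw [← small_view, hv]; exact hs
  obtain ⟨s1, c1, r1, m1, v1, k1, b1⟩ := Expr.code_spec inp hβ e he.1 100 le_rfl s hs'
  have hev : e.eval s = e.eval σ :=
    Expr.eval_congr (by rw [← hv]; rfl) (fun r hr => by rw [← hv, view_reg hr]) e he.1
  have hfin : view (Instr.exec inp (Instr.exec inp s1 (.const 101 0)) (.add x 100 101))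
      = { σ with reg := Function.update σ.reg x (e.eval σ) } := by
    rw [← hv] at hev ⊢
    simp only [view, Instr.exec, m1, Store.mk.injEq, and_true]
    funext r
    by_cases h : r = x
    · subst h; simp [hx, v1, hev, view]
    · by_cases h2 : r < 100
      · have h3 : r ≠ 101 := by omega
        simp [h, h2, h3, k1 r h2]
      · simp [h, h2]
  refine ⟨_, _, .seq r1 (.seq (.instr _ _) (.instr _ _)), ?_, ?_, ?_⟩
  · have e1 := Expr.bits_eval_le hs' hβ e he.1
    have h3 : bits 0 = 0 := by simp [bits]
    have h4 : e.size * (β + 1) ≤ 60 * (β + 1) := Nat.mul_le_mul_right _ he.2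
    -- Here `120 * 60 ^ 2 = 432000`, which leaves ample room for the copy below the constant of
    -- `unitCost`.
    have h6 : 2 * e.size * (e.size * (β + 1)) ^ 2 ≤ 120 * (60 * (β + 1)) ^ 2 :=
      Nat.mul_le_mul (by omega) (Nat.pow_le_pow_left h4 2)
    simp [Instr.cost, Instr.exec, unitCost, v1, h3]
    nlinarith
  · rw [hfin]
    refine ⟨fun r hr => ?_, hs.2⟩
    by_cases h : r = x
    · subst h; simpa using bits_le_iff.2 hb
    · simpa [h] using hs.1 r hr
  · rw [hfin]; exact hQ

lemma Ends.write {a e : Expr} (hβ : 7 ≤ β)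
    (ha : (a.ok && decide (a.size ≤ 30)) = true) (he : (e.ok && decide (e.size ≤ 30)) = true)
    (hb : |e.eval σ| < 2 ^ β)
    (hQ : Q { σ with mem := Function.update σ.mem (a.eval σ).toNat (e.eval σ) }) :
    Ends inp β (write a e) σ 1 Q := by
  intro hs s hv
  simp only [Bool.and_eq_true, decide_eq_true_eq] at he ha
  have hs' : Small β s := by rw [← small_view, hv]; exact hs
  obtain ⟨s1, c1, r1, m1, v1, k1, b1⟩ := Expr.code_spec inp hβ a ha.1 100 le_rfl s hs'
  have hs1 : Small β s1 := ⟨fun r hr => by rw [k1 r hr]; exact hs'.1 r hr, by rw [m1]; exact hs'.2⟩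
  obtain ⟨s2, c2, r2, m2, v2, k2, b2⟩ := Expr.code_spec inp hβ e he.1 101 (by norm_num) s1 hs1
  have hea : a.eval s = a.eval σ :=
    Expr.eval_congr (by rw [← hv]; rfl) (fun r hr => by rw [← hv, view_reg hr]) a ha.1
  have hee : e.eval s1 = e.eval σ :=
    Expr.eval_congr (by rw [← hv]; exact m1) (fun r hr => by rw [← hv, view_reg hr, k1 r hr]) e he.1
  have w1 : s2.reg 100 = a.eval σ := by rw [k2 100 (by norm_num), v1, hea]
  have w2 : s2.reg 101 = e.eval σ := by rw [v2, hee]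
  have hfin : view (Instr.exec inp s2 (.store 100 101))
      = { σ with mem := Function.update σ.mem (a.eval σ).toNat (e.eval σ) } := by
    simp only [view, Instr.exec, w1, w2, m1, m2, Store.mk.injEq]
    constructor
    · funext r
      by_cases h2 : r < 100
      · simp only [h2, if_true]
        rw [k2 r (by omega), k1 r h2, ← hv, view_reg h2]
      · rw [← hv]; simp [view, h2]
    · rw [← hv]; rfl
  refine ⟨_, _, .seq r1 (.seq r2 (.instr _ _)), ?_, ?_, ?_⟩
  · have e1 := Expr.bits_eval_le hs' hβ a ha.1
    have e2 := Expr.bits_eval_le hs1 hβ e he.1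
    have h4 : a.size * (β + 1) ≤ 30 * (β + 1) := Nat.mul_le_mul_right _ ha.2
    have h5 : e.size * (β + 1) ≤ 30 * (β + 1) := Nat.mul_le_mul_right _ he.2
    have h6 : 2 * a.size * (a.size * (β + 1)) ^ 2 ≤ 60 * (30 * (β + 1)) ^ 2 :=
      Nat.mul_le_mul (by omega) (Nat.pow_le_pow_left h4 2)
    have h7 : 2 * e.size * (e.size * (β + 1)) ^ 2 ≤ 60 * (30 * (β + 1)) ^ 2 :=
      Nat.mul_le_mul (by omega) (Nat.pow_le_pow_left h5 2)
    rw [hea] at e1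
    rw [hee] at e2
    simp only [Instr.cost, unitCost, w1, w2]
    nlinarith
  · rw [hfin]
    refine ⟨hs.1, fun r => ?_⟩
    by_cases h : r = (a.eval σ).toNat
    · subst h; simpa using bits_le_iff.2 hb
    · simpa [h] using hs.2 r
  · rw [hfin]; exact hQ

lemma testCost_le {x y : ℕ} {s : Store} (hx : x < 100) (hy : y < 100) (hs : Small β s) :
    testCost s x y ≤ unitCost β := by
  have h1 := hs.1 x hx
  have h2 := hs.1 y hy
  unfold testCost unitCost
  nlinarith

lemma Ends.ite {x y : ℕ} (hx : x < 100) (hy : y < 100)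
    (hp : σ.reg x ≤ σ.reg y → Ends inp β p σ k Q) (hq : ¬ σ.reg x ≤ σ.reg y → Ends inp β q σ k Q) :
    Ends inp β (.ite x y p q) σ (k + 1) Q := by
  intro hs s hv
  have hs' : Small β s := by rw [← small_view, hv]; exact hs
  have ht := testCost_le hx hy hs'
  have hx' : s.reg x = σ.reg x := by rw [← hv, view_reg hx]
  have hy' : s.reg y = σ.reg y := by rw [← hv, view_reg hy]
  by_cases h : σ.reg x ≤ σ.reg y
  · obtain ⟨s1, c1, r1, b1, m1, q1⟩ := hp h hs s hv
    exact ⟨s1, _, .ite_pos (by rwa [hx', hy']) r1, by rw [add_mul]; omega, m1, q1⟩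
  · obtain ⟨s1, c1, r1, b1, m1, q1⟩ := hq h hs s hv
    exact ⟨s1, _, .ite_neg (by rwa [hx', hy']) r1, by rw [add_mul]; omega, m1, q1⟩

/-- The number `T` of rounds is known beforehand and the invariant is indexed by the round.
Induction on the remaining rounds gives termination and cost at once. -/
lemma Ends.loop {x y : ℕ} (hx : x < 100) (hy : y < 100) (I : ℕ → Store → Prop) (T : ℕ)
    (h0 : I 0 σ)
    (hstep : ∀ t < T, ∀ σ', I t σ' → σ'.reg x < σ'.reg y ∧ Ends inp β p σ' k (I (t + 1)))
    (hend : ∀ σ', I T σ' → ¬ σ'.reg x < σ'.reg y ∧ Q σ') :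
    Ends inp β (.loop x y p) σ (T * (k + 1) + 1) Q := by
  have key : ∀ r t, t + r = T → ∀ σ', I t σ' → Ends inp β (.loop x y p) σ' (r * (k + 1) + 1) Q := by
    intro r
    induction r with
    | zero =>
      intro t ht σ' hI hs s hv
      obtain rfl : t = T := by omega
      have hs' : Small β s := by rw [← small_view, hv]; exact hs
      obtain ⟨h1, h2⟩ := hend σ' hI
      refine ⟨s, _, Run.loop_stop ?_, by simpa using testCost_le hx hy hs', hv ▸ hs, hv ▸ h2⟩
      rw [← hv, view_reg hx, view_reg hy] at h1
      exact h1
    | succ r ih =>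
      intro t ht σ' hI hs s hv
      have hs' : Small β s := by rw [← small_view, hv]; exact hs
      obtain ⟨h1, h2⟩ := hstep t (by omega) σ' hI
      obtain ⟨s1, c1, r1, b1, m1, q1⟩ := h2 hs s hv
      obtain ⟨s2, c2, r2, b2, m2, q2⟩ := ih (t + 1) (by omega) _ q1 m1 s1 rfl
      rw [← hv, view_reg hx, view_reg hy] at h1
      refine ⟨s2, _, .loop_step h1 r1 r2, ?_, m2, q2⟩
      have ht := testCost_le hx hy hs'
      have : ((r + 1) * (k + 1) + 1) * unitCost β
        = unitCost β + k * unitCost β + (r * (k + 1) + 1) * unitCost β := by ring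
      omega
  exact key T 0 (by omega) σ h0

/-- The charge is linear in the number of digits asked for, so even `β ^ 2` digits fit into one
`unitCost β`. -/
lemma Ends.param {x r : ℕ} {κ : ℕ} (hx : x < 100) (hκ : κ < 100) {v : ℕ} (hv : σ.reg κ = v)
    (hvb : v ≤ β ^ 2)
    (hb : |⌊(2 : ℝ) ^ v * inp.param r⌋| < 2 ^ β)
    (hQ : Q { σ with reg := Function.update σ.reg x ⌊(2 : ℝ) ^ v * inp.param r⌋ }) :
    Ends inp β (.instr (.param x r κ)) σ 1 Q := by
  intro hs s hw
  have e1 : s.reg κ = v := by rw [← hv, ← hw, view_reg hκ]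
  have hfin : view (Instr.exec inp s (.param x r κ))
      = { σ with reg := Function.update σ.reg x ⌊(2 : ℝ) ^ v * inp.param r⌋ } := by
    rw [← hw]
    simp only [view, Instr.exec, e1, Int.toNat_natCast, Store.mk.injEq, and_true]
    funext r'
    by_cases h : r' = x
    · subst h; simp [hx]
    · simp [h]
  refine ⟨_, _, .instr _ _, ?_, ?_, ?_⟩
  · have := bits_le_iff.2 hb
    simp only [Instr.cost, e1, Int.toNat_natCast, unitCost, Int.natAbs_natCast]
    nlinarith
  · rw [hfin]
    refine ⟨fun r' hr => ?_, hs.2⟩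
    by_cases h : r' = x
    · subst h; simpa using bits_le_iff.2 hb
    · simpa [h] using hs.1 r' hr
  · rw [hfin]; exact hQ

lemma Ends.sample {x z : ℕ} {κ : ℕ} (hx : x < 100) (hκ : κ < 100) (hz : z < 100) {v w : ℕ}
    (hv : σ.reg κ = v) (hw : σ.reg z = w) (hvb : v ≤ β ^ 2)
    (hb : |⌊(2 : ℝ) ^ v * inp.sample w⌋| < 2 ^ β)
    (hQ : Q { σ with reg := Function.update σ.reg x ⌊(2 : ℝ) ^ v * inp.sample w⌋ }) :
    Ends inp β (.instr (.sample x z κ)) σ 1 Q := by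
  intro hs s hs1
  have hs' : Small β s := by rw [← small_view, hs1]; exact hs
  have e1 : s.reg κ = v := by rw [← hv, ← hs1, view_reg hκ]
  have e2 : s.reg z = w := by rw [← hw, ← hs1, view_reg hz]
  have hfin : view (Instr.exec inp s (.sample x z κ))
      = { σ with reg := Function.update σ.reg x ⌊(2 : ℝ) ^ v * inp.sample w⌋ } := by
    rw [← hs1]
    simp only [view, Instr.exec, e1, e2, Int.toNat_natCast, Store.mk.injEq, and_true]
    funext r'
    by_cases h : r' = x
    · subst h; simp [hx]
    · simp [h]
  refine ⟨_, _, .instr _ _, ?_, ?_, ?_⟩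
  · have := bits_le_iff.2 hb
    have h2 := hs'.1 z hz
    rw [e2] at h2
    simp only [Instr.cost, e1, e2, Int.toNat_natCast, unitCost, Int.natAbs_natCast]
    nlinarith
  · rw [hfin]
    refine ⟨fun r' hr => ?_, hs.2⟩
    by_cases h : r' = x
    · subst h; simpa using bits_le_iff.2 hb
    · simpa [h] using hs.1 r' hr
  · rw [hfin]; exact hQ

end HeatFFT
end

open Set
noncomputable section
namespace HeatFFT

/-! ## The discrete heat operator on functions on a lattice -/

/-- Functions of finitely or infinitely many integer coordinates. -/
abbrev Lat := (ℕ → ℤ) → ℝ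

/-- The unit vector of coordinate `k`. -/
def unitVec (k : ℕ) : ℕ → ℤ := Pi.single k 1

/-- Translation of functions. -/
def translate (v : ℕ → ℤ) : Module.End ℝ Lat where
  toFun f j := f (j + v)
  map_add' _ _ := rfl
  map_smul' _ _ := rfl

@[simp] lemma translate_apply (v : ℕ → ℤ) (f : Lat) (j : ℕ → ℤ) : translate v f j = f (j + v) := rfl

/-- The second difference in coordinate `k`. -/
def secondDiff (k : ℕ) : Module.End ℝ Lat :=
  translate (unitVec k) + translate (-unitVec k) - (2 : ℝ) • 1

lemma secondDiff_apply (k : ℕ) (f : Lat) (j : ℕ → ℤ) :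
    secondDiff k f j = f (j + unitVec k) + f (j - unitVec k) - 2 * f j := by
  simp [secondDiff, sub_eq_add_neg]

/-- One explicit step of the heat equation in coordinate `k`. -/
def heatStep (c : ℝ) (k : ℕ) : Module.End ℝ Lat := 1 + c • secondDiff k

lemma heatStep_apply (c : ℝ) (k : ℕ) (f : Lat) (j : ℕ → ℤ) :
    heatStep c k f j = f j + c * secondDiff k f j := by
  simp [heatStep]

/-- One split step in the first `d` coordinates. -/
def splitStep (c : ℝ) : ℕ → Module.End ℝ Lat
  | 0 => 1
  | d + 1 => heatStep c d * splitStep c d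

lemma commute_translate (v w : ℕ → ℤ) : Commute (translate v) (translate w) := by
  apply LinearMap.ext; intro f
  funext j
  simp [Module.End.mul_apply, add_right_comm]

/-- Second differences are linear combinations of translations. All commutation relations in the
proof go back to this. -/
lemma commute_secondDiff_of {A : Module.End ℝ Lat} (h : ∀ v, Commute A (translate v)) (k : ℕ) :
    Commute A (secondDiff k) :=
  ((h _).add_right (h _)).sub_right ((Commute.one_right _).smul_right _)

lemma commute_heatStep_of {A : Module.End ℝ Lat} (h : ∀ v, Commute A (translate v)) (c : ℝ) (k : ℕ) :
    Commute A (heatStep c k) :=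
  (Commute.one_right _).add_right ((commute_secondDiff_of h k).smul_right _)

lemma commute_heatStep_translate (c : ℝ) (k : ℕ) (v : ℕ → ℤ) :
    Commute (heatStep c k) (translate v) :=
  (commute_heatStep_of (fun w => commute_translate v w) c k).symm

lemma commute_splitStep_translate (c : ℝ) (d : ℕ) (v : ℕ → ℤ) :
    Commute (splitStep c d) (translate v) := by
  induction d with
  | zero => exact Commute.one_left _
  | succ d ih => exact (commute_heatStep_translate c d v).mul_left ih

/-- Since the coordinate steps commute, the `s` time steps of one coordinate can be gathered. This
is what allows the algorithm to treat the coordinates one after another, each with all its time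
steps. -/
lemma splitStep_succ_pow (c : ℝ) (d s : ℕ) :
    splitStep c (d + 1) ^ s = splitStep c d ^ s * heatStep c d ^ s := by
  have h := (commute_heatStep_of (commute_splitStep_translate c d) c d).symm
  rw [splitStep, h.mul_pow, (h.pow_pow s s).eq]

/-! ### Maximum principle and consistency of the split steps. -/

/-- `|f| ≤ B` everywhere -/
def BoundedBy (B : ℝ) (f : Lat) : Prop := ∀ j, |f j| ≤ B

lemma BoundedBy.secondDiff {B : ℝ} {f : Lat} (h : BoundedBy B f) (k : ℕ) :
    BoundedBy (4 * B) (secondDiff k f) := by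
  intro j
  rw [secondDiff_apply]
  have h1 := abs_le.1 (h (j + unitVec k))
  have h2 := abs_le.1 (h (j - unitVec k))
  have h3 := abs_le.1 (h j)
  exact abs_le.2 ⟨by linarith, by linarith⟩

section
variable {c : ℝ} (hc0 : 0 ≤ c) (hc : c ≤ 1 / 4)
include hc0 hc

/-- The new value is a convex combination with weights `c`, `1 - 2c`, `c`: the discrete maximum
principle. -/
lemma BoundedBy.heatStep {B : ℝ} {f : Lat} (h : BoundedBy B f) (k : ℕ) :
    BoundedBy B (heatStep c k f) := by
  intro j
  rw [heatStep_apply, secondDiff_apply]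
  have h1 := abs_le.1 (h (j + unitVec k))
  have h2 := abs_le.1 (h (j - unitVec k))
  have h3 := abs_le.1 (h j)
  exact abs_le.2 ⟨by nlinarith, by nlinarith⟩

lemma BoundedBy.heatStep_pow {B : ℝ} {f : Lat} (h : BoundedBy B f) (k s : ℕ) :
    BoundedBy B ((HeatFFT.heatStep c k ^ s) f) := by
  induction s with
  | zero => simpa using h
  | succ s ih => rw [pow_succ']; exact ih.heatStep hc0 hc k

lemma BoundedBy.splitStep {B : ℝ} {f : Lat} (h : BoundedBy B f) (d : ℕ) :
    BoundedBy B (splitStep c d f) := by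
  induction d with
  | zero => exact h
  | succ d ih => exact ih.heatStep hc0 hc d

lemma BoundedBy.splitStep_pow {B : ℝ} {f : Lat} (h : BoundedBy B f) (d s : ℕ) :
    BoundedBy B ((HeatFFT.splitStep c d ^ s) f) := by
  induction s with
  | zero => simpa using h
  | succ s ih => rw [pow_succ']; exact ih.splitStep hc0 hc d

/-- Each coordinate factor moves a function bounded by `B` by at most `4 c B`, and the earlier
factors preserve the bound, so the moves telescope. -/
lemma splitStep_sub_self {B : ℝ} {f : Lat} (h : BoundedBy B f) (d : ℕ) :
    BoundedBy (4 * c * d * B) (splitStep c d f - f) := by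
  induction d with
  | zero => intro j; simp [splitStep]
  | succ d ih =>
    intro j
    have h1 := ih j
    have h2 := (h.splitStep hc0 hc d).secondDiff d j
    have h3 := mul_le_mul_of_nonneg_left h2 hc0
    have e : (splitStep c (d + 1) f - f) j
        = (splitStep c d f - f) j + c * secondDiff d (splitStep c d f) j := by
      simp only [splitStep, Module.End.mul_apply, Pi.sub_apply, heatStep_apply]; ring
    rw [e]
    refine (abs_add_le _ _).trans ?_
    rw [abs_mul, abs_of_nonneg hc0]
    push_cast
    linarith

/-- A new factor adds to the deviation from the Euler step the term `c (S - 1) δ² f`, where `S`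
collects the earlier factors, because `δ²` commutes with `S`. As `δ² f` is bounded by `Y`,
`splitStep_sub_self` makes this term quadratic in `c`. -/
lemma splitStep_sub_linear {Y : ℝ} {f : Lat} (d : ℕ) (h : ∀ k < d, BoundedBy Y (secondDiff k f)) :
    BoundedBy (4 * c ^ 2 * d ^ 2 * Y)
      (splitStep c d f - f - c • ∑ k ∈ Finset.range d, secondDiff k f) := by
  induction d with
  | zero => intro j; simp [splitStep]
  | succ d ih =>
    intro j
    have h1 := ih (fun k hk => h k (by omega)) j
    have hY := h d (by omega)
    have hY0 : 0 ≤ Y := (abs_nonneg _).trans (hY 0)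
    have h2 := splitStep_sub_self hc0 hc hY d j
    have h3 := mul_le_mul_of_nonneg_left h2 hc0
    have hcomm : secondDiff d (splitStep c d f) = splitStep c d (secondDiff d f) := by
      have := (commute_secondDiff_of (commute_splitStep_translate c d) d).eq
      exact (DFunLike.congr_fun this f).symm
    have e : (splitStep c (d + 1) f - f - c • ∑ k ∈ Finset.range (d + 1), secondDiff k f) j
        = (splitStep c d f - f - c • ∑ k ∈ Finset.range d, secondDiff k f) j
          + c * (splitStep c d (secondDiff d f) - secondDiff d f) j := by
      simp only [splitStep, Module.End.mul_apply, Pi.sub_apply, heatStep_apply, hcomm,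
        Finset.sum_range_succ, smul_add, Pi.add_apply, Pi.smul_apply, smul_eq_mul]; ring
    rw [e]
    refine (abs_add_le _ _).trans ?_
    rw [abs_mul, abs_of_nonneg hc0]
    have : (0 : ℝ) ≤ c ^ 2 * Y * (d + 1) := by positivity
    push_cast
    nlinarith

end

/-- Telescoping over the coordinates: exchanging the parameter in one factor costs `|c - c'|` times
a second difference, and all other factors are stable. It accounts for the rounding of the step
parameter. -/
lemma splitStep_param {c c' B : ℝ} (hc0 : 0 ≤ c) (hc : c ≤ 1 / 4) (hc0' : 0 ≤ c') (hc' : c' ≤ 1 / 4)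
    {f : Lat} (h : BoundedBy B f) (d : ℕ) :
    BoundedBy (4 * d * |c - c'| * B) (splitStep c d f - splitStep c' d f) := by
  induction d with
  | zero => intro j; simp [splitStep]
  | succ d ih =>
    intro j
    have h1 := ih.heatStep hc0 hc d j
    have h2 := (h.splitStep hc0' hc' d).secondDiff d j
    have h3 := mul_le_mul_of_nonneg_left h2 (abs_nonneg (c - c'))
    have e : (splitStep c (d + 1) f - splitStep c' (d + 1) f) j
        = heatStep c d (splitStep c d f - splitStep c' d f) j
          + (c - c') * secondDiff d (splitStep c' d f) j := by
      simp only [splitStep, Module.End.mul_apply, Pi.sub_apply, heatStep_apply, map_sub]; ring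
    rw [e]
    refine (abs_add_le _ _).trans ?_
    rw [abs_mul]
    push_cast
    linarith

lemma splitStep_pow_param {c c' B : ℝ} (hc0 : 0 ≤ c) (hc : c ≤ 1 / 4) (hc0' : 0 ≤ c')
    (hc' : c' ≤ 1 / 4) {f : Lat} (h : BoundedBy B f) (d s : ℕ) :
    BoundedBy (s * (4 * d * |c - c'| * B)) ((splitStep c d ^ s) f - (splitStep c' d ^ s) f) := by
  induction s with
  | zero => intro j; simp
  | succ s ih =>
    intro j
    have h1 := ih.splitStep hc0 hc d j
    have h2 := splitStep_param hc0 hc hc0' hc' (h.splitStep_pow hc0' hc' d s) d j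
    have e : ((splitStep c d ^ (s + 1)) f - (splitStep c' d ^ (s + 1)) f) j
        = splitStep c d ((splitStep c d ^ s) f - (splitStep c' d ^ s) f) j
          + (splitStep c d ((splitStep c' d ^ s) f) - splitStep c' d ((splitStep c' d ^ s) f)) j := by
      simp only [pow_succ', Module.End.mul_apply, Pi.sub_apply, map_sub]; ring
    rw [e]
    refine (abs_add_le _ _).trans ?_
    push_cast
    linarith

/-! ## From the semidiscrete equation to split steps -/

/-- The solution is Lipschitz in time with constant `a d Y + ρ`. Hence freezing the difference
operator at the start of the step changes the derivative by at most `4 a d (a d Y + ρ) δ`, and the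
Euler step so obtained differs from the split step by `splitStep_sub_linear`. -/
lemma semidiscrete_local {F : ℝ → Lat} {r : ℝ → Lat} {T a ρ Y : ℝ} {d : ℕ} (ha : 0 ≤ a)
    (hF : ∀ t ∈ Icc 0 T, ∀ j, HasDerivWithinAt (fun s => F s j)
      (a * ∑ k ∈ Finset.range d, secondDiff k (F t) j + r t j) (Icc 0 T) t)
    (hr : ∀ t ∈ Icc 0 T, BoundedBy ρ (r t))
    (hY : ∀ t ∈ Icc 0 T, ∀ k < d, BoundedBy Y (secondDiff k (F t)))
    {t δ : ℝ} (ht : 0 ≤ t) (hδ : 0 ≤ δ) (htδ : t + δ ≤ T) (hc : a * δ ≤ 1 / 4) :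
    BoundedBy (δ * (4 * a * d * (a * d * Y + ρ) * δ + ρ) + 4 * (a * δ) ^ 2 * d ^ 2 * Y)
      (F (t + δ) - splitStep (a * δ) d (F t)) := by
  have hmem : ∀ x ∈ Icc t (t + δ), x ∈ Icc 0 T := fun x hx => ⟨ht.trans hx.1, hx.2.trans htδ⟩
  have htm : t ∈ Icc t (t + δ) := ⟨le_rfl, by linarith⟩
  have hsub : Icc t (t + δ) ⊆ Icc 0 T := hmem
  set G := a * d * Y + ρ with hG
  have hρ0 : 0 ≤ ρ := (abs_nonneg _).trans (hr t (hmem t htm) 0)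
  have hsum : ∀ x ∈ Icc 0 T, ∀ j, |∑ k ∈ Finset.range d, secondDiff k (F x) j| ≤ d * Y := by
    intro x hx j
    refine (Finset.abs_sum_le_sum_abs _ _).trans ?_
    refine (Finset.sum_le_sum fun k hk => hY x hx k (Finset.mem_range.1 hk) j).trans ?_
    simp
  have hG0 : 0 ≤ G := by
    have := (abs_nonneg _).trans (hsum t (hmem t htm) 0)
    have := mul_nonneg ha this
    rw [hG]; linarith
  have hlip : ∀ x ∈ Icc t (t + δ), BoundedBy (G * δ) (F x - F t) := by
    intro x hx j
    have := (convex_Icc t (t + δ)).norm_image_sub_le_of_norm_hasDerivWithin_le (C := G)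
      (fun y hy => (hF y (hmem y hy) j).mono hsub) (fun y hy => ?_) htm hx
    · rw [Real.norm_eq_abs, Real.norm_eq_abs] at this
      refine this.trans (mul_le_mul_of_nonneg_left ?_ hG0)
      rw [abs_of_nonneg (by linarith [hx.1])]; linarith [hx.2]
    · rw [Real.norm_eq_abs]
      refine (abs_add_le _ _).trans ?_
      rw [abs_mul, abs_of_nonneg ha]
      have h1 := mul_le_mul_of_nonneg_left (hsum y (hmem y hy) j) ha
      have h2 := hr y (hmem y hy) j
      rw [hG]; linarith
  intro j
  -- Subtracting the line with the frozen slope turns the deviation from the Euler step into an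
  -- increment with small derivative.
  have hstep := (convex_Icc t (t + δ)).norm_image_sub_le_of_norm_hasDerivWithin_le
      (C := 4 * a * d * G * δ + ρ)
      (f := fun x => F x j - x * (a * ∑ k ∈ Finset.range d, secondDiff k (F t) j))
      (fun y hy => ((hF y (hmem y hy) j).mono hsub).sub
        ((hasDerivWithinAt_id y _).mul_const _)) (fun y hy => ?_) htm ⟨by linarith, le_rfl⟩
  · rw [Real.norm_eq_abs, Real.norm_eq_abs, add_sub_cancel_left, abs_of_nonneg hδ] at hstep
    have hlin := splitStep_sub_linear (c := a * δ) (mul_nonneg ha hδ) hc d (hY t (hmem t htm)) j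
    simp only [Pi.sub_apply, Pi.smul_apply, Finset.sum_apply, smul_eq_mul] at hlin ⊢
    have e : F (t + δ) j - splitStep (a * δ) d (F t) j
        = (F (t + δ) j - (t + δ) * (a * ∑ k ∈ Finset.range d, secondDiff k (F t) j)
            - (F t j - t * (a * ∑ k ∈ Finset.range d, secondDiff k (F t) j)))
          - (splitStep (a * δ) d (F t) j - F t j
            - a * δ * ∑ k ∈ Finset.range d, secondDiff k (F t) j) := by ring
    rw [e]
    refine (abs_sub _ _).trans ?_
    linarith
  · have e : a * ∑ k ∈ Finset.range d, secondDiff k (F y) j + r y j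
        - 1 * (a * ∑ k ∈ Finset.range d, secondDiff k (F t) j)
        = a * (∑ k ∈ Finset.range d, secondDiff k (F y - F t) j) + r y j := by
      simp only [map_sub, Pi.sub_apply, Finset.sum_sub_distrib]; ring
    rw [e, Real.norm_eq_abs]
    refine (abs_add_le _ _).trans ?_
    rw [abs_mul, abs_of_nonneg ha]
    have h1 : |∑ k ∈ Finset.range d, secondDiff k (F y - F t) j| ≤ d * (4 * (G * δ)) := by
      refine (Finset.abs_sum_le_sum_abs _ _).trans ?_
      refine (Finset.sum_le_sum fun k _ => (hlip y hy).secondDiff k j).trans ?_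
      simp
    have h2 := mul_le_mul_of_nonneg_left h1 ha
    have h3 := hr y (hmem y hy) j
    linarith

/-- By the maximum principle an error once made is not amplified, so the global error is at most the
number of steps times the local one. -/
lemma semidiscrete_global {F : ℝ → Lat} {r : ℝ → Lat} {T a ρ Y : ℝ} {d : ℕ} (ha : 0 ≤ a)
    (hF : ∀ t ∈ Icc 0 T, ∀ j, HasDerivWithinAt (fun s => F s j)
      (a * ∑ k ∈ Finset.range d, secondDiff k (F t) j + r t j) (Icc 0 T) t)
    (hr : ∀ t ∈ Icc 0 T, BoundedBy ρ (r t))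
    (hY : ∀ t ∈ Icc 0 T, ∀ k < d, BoundedBy Y (secondDiff k (F t)))
    {δ : ℝ} (s : ℕ) (hδ : 0 ≤ δ) (htδ : s * δ ≤ T) (hc : a * δ ≤ 1 / 4) :
    BoundedBy (s * (δ * (4 * a * d * (a * d * Y + ρ) * δ + ρ) + 4 * (a * δ) ^ 2 * d ^ 2 * Y))
      (F (s * δ) - (splitStep (a * δ) d ^ s) (F 0)) := by
  induction s with
  | zero => intro j; simp
  | succ s ih =>
    push_cast at htδ ⊢
    intro j
    have h1 := (ih (by linarith)).splitStep (mul_nonneg ha hδ) hc d j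
    have h2 := semidiscrete_local ha hF hr hY (t := s * δ) (by positivity) hδ (by linarith) hc j
    have e : (F ((s + 1) * δ) - (splitStep (a * δ) d ^ (s + 1)) (F 0)) j
        = splitStep (a * δ) d (F (s * δ) - (splitStep (a * δ) d ^ s) (F 0)) j
          + (F (s * δ + δ) - splitStep (a * δ) d (F (s * δ))) j := by
      simp only [pow_succ', Module.End.mul_apply, Pi.sub_apply, map_sub, add_mul, one_mul]; ring
    rw [e]
    refine (abs_add_le _ _).trans ?_
    linarith

/-! ## Finite differences of smooth periodic functions -/

/-- A derivative bound is integrated by comparison with `C y ^ (m + 1) / (m + 1)`, without integrals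
and without continuity of `g'`. -/
lemma abs_sub_le_of_deriv_le_pow {g g' : ℝ → ℝ} {C : ℝ} (m : ℕ)
    (hg : ∀ y, HasDerivAt g (g' y) y) (hb : ∀ y, 0 ≤ y → |g' y| ≤ C * y ^ m) {y : ℝ} (hy : 0 ≤ y) :
    |g y - g 0| ≤ C * y ^ (m + 1) / (m + 1) := by
  have hP : ∀ x, HasDerivAt (fun x : ℝ => C * x ^ (m + 1) / (m + 1)) (C * x ^ m) x := by
    intro x
    have h := ((hasDerivAt_pow (m + 1) x).const_mul C).div_const ((m : ℝ) + 1)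
    have hm : (m : ℝ) + 1 ≠ 0 := by positivity
    refine h.congr_deriv ?_
    push_cast
    field_simp
  have h := image_norm_le_of_norm_deriv_right_le_deriv_boundary (a := 0) (b := y)
    (f := fun x => g x - g 0) (f' := g') (B := fun x => C * x ^ (m + 1) / (m + 1))
    (B' := fun x => C * x ^ m)
    (fun x _ => ((hg x).continuousAt.sub continuousAt_const).continuousWithinAt)
    (fun x _ => ((hg x).sub_const _).hasDerivWithinAt) (by simp) hP
    (fun x hx => by simpa using hb x hx.1) ⟨hy, le_rfl⟩
  simpa using h

/-- The symmetric difference is a function of `y` whose derivative vanishes at `0` and whose second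
derivative is at most `2 B`; the bound is integrated twice. -/
lemma secondDifference_le {φ φ₁ φ₂ : ℝ → ℝ} {B : ℝ} (h1 : ∀ x, HasDerivAt φ (φ₁ x) x)
    (h2 : ∀ x, HasDerivAt φ₁ (φ₂ x) x) (hB : ∀ x, |φ₂ x| ≤ B) (x : ℝ) {y : ℝ} (hy : 0 ≤ y) :
    |φ (x + y) + φ (x - y) - 2 * φ x| ≤ y ^ 2 * B := by
  have d1 : ∀ y, HasDerivAt (fun y => φ (x + y) + φ (x - y)) (φ₁ (x + y) - φ₁ (x - y)) y := by
    intro y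
    have := ((h1 (x + y)).comp_const_add x y).add ((h1 (x - y)).comp_const_sub x y)
    exact this.congr_deriv (by ring_nf)
  have d2 : ∀ y, HasDerivAt (fun y => φ₁ (x + y) - φ₁ (x - y)) (φ₂ (x + y) + φ₂ (x - y)) y := by
    intro y
    have := ((h2 (x + y)).comp_const_add x y).sub ((h2 (x - y)).comp_const_sub x y)
    exact this.congr_deriv (by norm_num)
  have b1 : ∀ y, 0 ≤ y → |φ₁ (x + y) - φ₁ (x - y)| ≤ 2 * B * y ^ 1 := by
    intro y hy
    have := abs_sub_le_of_deriv_le_pow (C := 2 * B) 0 d2 (fun y _ => ?_) hy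
    · simpa using this
    · have := abs_add_le (φ₂ (x + y)) (φ₂ (x - y))
      have := hB (x + y)
      have := hB (x - y)
      simp; linarith
  have := abs_sub_le_of_deriv_le_pow 1 d1 b1 hy
  have e : φ (x + y) + φ (x - y) - (φ (x + 0) + φ (x - 0)) = φ (x + y) + φ (x - y) - 2 * φ x := by
    simp; ring
  rw [e] at this
  refine this.trans (le_of_eq ?_)
  norm_num; ring

/-- After subtraction of `y ^ 2 φ₂ x`, the second derivative in `y` is the second difference of
`φ₂`, hence at most `y ^ 2 B`. Integrating twice divides by `3` and `4`. -/
lemma secondDifference_sub_le {φ φ₁ φ₂ φ₃ φ₄ : ℝ → ℝ} {B : ℝ} (h1 : ∀ x, HasDerivAt φ (φ₁ x) x)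
    (h2 : ∀ x, HasDerivAt φ₁ (φ₂ x) x) (h3 : ∀ x, HasDerivAt φ₂ (φ₃ x) x)
    (h4 : ∀ x, HasDerivAt φ₃ (φ₄ x) x)
    (hB : ∀ x, |φ₄ x| ≤ B) (x : ℝ) {y : ℝ} (hy : 0 ≤ y) :
    |φ (x + y) + φ (x - y) - 2 * φ x - y ^ 2 * φ₂ x| ≤ y ^ 4 * B / 12 := by
  have d1 : ∀ y, HasDerivAt (fun y => φ (x + y) + φ (x - y) - y ^ 2 * φ₂ x)
      (φ₁ (x + y) - φ₁ (x - y) - 2 * y * φ₂ x) y := by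
    intro y
    have := (((h1 (x + y)).comp_const_add x y).add ((h1 (x - y)).comp_const_sub x y)).sub
      ((hasDerivAt_pow 2 y).mul_const (φ₂ x))
    exact this.congr_deriv (by norm_num; ring_nf)
  have d2 : ∀ y, HasDerivAt (fun y => φ₁ (x + y) - φ₁ (x - y) - 2 * y * φ₂ x)
      (φ₂ (x + y) + φ₂ (x - y) - 2 * φ₂ x) y := by
    intro y
    have := (((h2 (x + y)).comp_const_add x y).sub ((h2 (x - y)).comp_const_sub x y)).sub
      (((hasDerivAt_id y).const_mul 2).mul_const (φ₂ x))
    exact this.congr_deriv (by norm_num)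
  have b1 : ∀ y, 0 ≤ y → |φ₁ (x + y) - φ₁ (x - y) - 2 * y * φ₂ x| ≤ B / 3 * y ^ 3 := by
    intro y hy
    have := abs_sub_le_of_deriv_le_pow (C := B) 2 d2 (fun y hy => ?_) hy
    · simp only [add_zero, sub_zero, mul_zero, zero_mul, sub_self] at this
      refine this.trans (le_of_eq ?_)
      norm_num; ring
    · exact (secondDifference_le h3 h4 hB x hy).trans (le_of_eq (mul_comm _ _))
  have := abs_sub_le_of_deriv_le_pow 3 d1 b1 hy
  have e : φ (x + y) + φ (x - y) - y ^ 2 * φ₂ x - (φ (x + 0) + φ (x - 0) - 0 ^ 2 * φ₂ x)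
      = φ (x + y) + φ (x - y) - 2 * φ x - y ^ 2 * φ₂ x := by
    simp; ring
  rw [e] at this
  refine this.trans (le_of_eq ?_)
  norm_num; ring

end HeatFFT
end

open Set
noncomputable section
namespace HeatFFT

/-! ## Partial derivatives -/

lemma partialD_contDiff {d m : ℕ} {f : (Fin d → ℝ) → ℝ} (hf : ContDiff ℝ (m + 1 : ℕ) f) (i : Fin d) :
    ContDiff ℝ m (partialD i f) := by
  unfold partialD
  have := hf.fderiv_right (m := m) (by norm_cast)
  exact this.clm_apply contDiff_const

lemma hasDerivAt_line {d : ℕ} {f : (Fin d → ℝ) → ℝ} (hf : Differentiable ℝ f) (i : Fin d)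
    (x : Fin d → ℝ) (y : ℝ) :
    HasDerivAt (fun y => f (x + Pi.single i y)) (partialD i f (x + Pi.single i y)) y := by
  have h1 : HasDerivAt (fun y : ℝ => x + y • (Pi.single i 1 : Fin d → ℝ)) (Pi.single i 1) y := by
    simpa using ((hasDerivAt_id y).smul_const (Pi.single i (1 : ℝ) : Fin d → ℝ)).const_add x
  have e : ∀ y : ℝ, y • (Pi.single i 1 : Fin d → ℝ) = Pi.single i y := by
    intro y; rw [← Pi.single_smul]; simp
  have h2 := (hf (x + y • (Pi.single i 1 : Fin d → ℝ))).hasFDerivAt.comp_hasDerivAt y h1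
  simp only [e, Function.comp_def] at h2
  exact h2

lemma partialD_periodic {d : ℕ} {f : (Fin d → ℝ) → ℝ} {v : Fin d → ℝ} (h : ∀ x, f (x + v) = f x)
    (i : Fin d) (x : Fin d → ℝ) : partialD i f (x + v) = partialD i f x := by
  unfold partialD
  rw [← fderiv_comp_add_right]
  simp [h]

lemma periodic_int {d : ℕ} {L : ℝ} {f : (Fin d → ℝ) → ℝ} (h : ∀ x i, f (x + Pi.single i L) = f x)
    (v : Fin d → ℤ) (x : Fin d → ℝ) : f (x + fun k => (v k : ℝ) * L) = f x := by
  have h1 : ∀ (i : Fin d) (z : ℤ) (x), f (x + Pi.single i (z * L)) = f x := by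
    intro i z x
    have hp : Function.Periodic (fun s : ℝ => f (x + Pi.single i s)) L := by
      intro s
      have := h (x + Pi.single i s) i
      simpa only [Pi.single_add, add_assoc] using this
    have := hp.int_mul z 0
    simpa using this
  have h2 : ∀ S : Finset (Fin d), f (x + ∑ k ∈ S, Pi.single k ((v k : ℝ) * L)) = f x := by
    intro S
    induction S using Finset.induction_on with
    | empty => simp
    | insert a S ha ih => rw [Finset.sum_insert ha, add_comm (Pi.single a _), ← add_assoc, h1, ih]
  have := h2 Finset.univ
  rwa [Finset.univ_sum_single] at this

/-! ## Periodic sequences -/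

lemma int_lipschitz {w : ℤ → ℝ} {δ : ℝ} (h : ∀ x, |w (x + 1) - w x| ≤ δ) (x : ℤ) (i : ℕ) :
    |w (x + i) - w x| ≤ i * δ := by
  induction i with
  | zero => simp
  | succ i ih =>
    have h1 := h (x + i)
    push_cast
    rw [← add_assoc]
    have : w (x + i + 1) - w x = (w (x + i + 1) - w (x + i)) + (w (x + i) - w x) := by ring
    rw [this]
    refine (abs_add_le _ _).trans ?_
    linarith

/-- A discrete mean value argument: a sequence with zero sum over a period takes values of both
signs, so its oscillation bounds its size. -/
lemma exists_between_of_sum_zero {w : ℤ → ℝ} {n : ℕ} (hn : 0 < n) {x : ℤ}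
    (hs : ∑ i ∈ Finset.range n, w (x + i) = 0) :
    (∃ i < n, w (x + i) ≤ 0) ∧ ∃ i < n, 0 ≤ w (x + i) := by
  constructor
  · by_contra! h
    have := Finset.sum_pos (fun i hi => h i (Finset.mem_range.1 hi)) ⟨0, Finset.mem_range.2 hn⟩
    linarith
  · by_contra! h
    have := Finset.sum_neg (fun i hi => h i (Finset.mem_range.1 hi)) ⟨0, Finset.mem_range.2 hn⟩
    linarith

lemma sum_diff_eq_zero {g : ℤ → ℝ} {n : ℕ} (hg : ∀ x, g (x + n) = g x) (x : ℤ) :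
    ∑ i ∈ Finset.range n, (g (x + i + 1) - g (x + i)) = 0 := by
  have := Finset.sum_range_sub (fun i : ℕ => g (x + i)) n
  simp only [Nat.cast_add, Nat.cast_one, ← add_assoc] at this
  rw [this]; simp [hg]

lemma periodic_exists_nat {g : ℤ → ℝ} {n : ℕ} (hn : 0 < n) (hg : ∀ x, g (x + n) = g x) (x y : ℤ) :
    ∃ i < n, g y = g (x + i) := by
  have hp : Function.Periodic g (n : ℤ) := hg
  have h0 : (0 : ℤ) < n := by exact_mod_cast hn
  refine ⟨((y - x) % n).toNat, ?_, ?_⟩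
  · have := Int.emod_lt_of_pos (y - x) h0
    have := Int.emod_nonneg (y - x) h0.ne'
    omega
  · rw [Int.toNat_of_nonneg (Int.emod_nonneg _ h0.ne')]
    have := Int.mul_ediv_add_emod (y - x) n
    have e : y = x + (y - x) % n + (y - x) / n * n := by linarith
    conv_lhs => rw [e]
    exact hp.int_mul _ _

/-- First differences sum to zero over a period and change by at most `Z` per step, so they are at
most `n Z`. Any two values of `g` are fewer than `n` steps apart up to periodicity. -/
lemma periodic_osc {g : ℤ → ℝ} {n : ℕ} {Z : ℝ} (hn : 0 < n) (hg : ∀ x, g (x + n) = g x)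
    (hZ : ∀ x, |g (x + 1) + g (x - 1) - 2 * g x| ≤ Z) (x y : ℤ) : |g y - g x| ≤ n ^ 2 * Z := by
  have hZ0 : 0 ≤ Z := (abs_nonneg _).trans (hZ 0)
  have h1 : ∀ x, |g (x + 1) - g x| ≤ n * Z := by
    intro x
    have hl : ∀ x, |(g (x + 1 + 1) - g (x + 1)) - (g (x + 1) - g x)| ≤ Z := by
      intro x
      have := hZ (x + 1)
      rw [add_sub_cancel_right] at this
      convert this using 2; ring
    have hle : ∀ i < n, (i : ℝ) * Z ≤ n * Z := fun i hi =>
      mul_le_mul_of_nonneg_right (by exact_mod_cast hi.le) hZ0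
    obtain ⟨⟨i, hi, hi'⟩, ⟨i', hj, hj'⟩⟩ := exists_between_of_sum_zero (w := fun x => g (x + 1) - g x) hn
      (sum_diff_eq_zero hg x)
    have a1 := abs_le.1 (int_lipschitz (w := fun x => g (x + 1) - g x) hl x i)
    have a2 := abs_le.1 (int_lipschitz (w := fun x => g (x + 1) - g x) hl x i')
    have a3 := hle i hi
    have a4 := hle i' hj
    rw [abs_le]
    constructor <;> linarith [a1.1, a1.2, a2.1, a2.2]
  obtain ⟨i, hi, e⟩ := periodic_exists_nat hn hg x y
  rw [e]
  refine (int_lipschitz h1 x i).trans ?_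
  have : (i : ℝ) ≤ n := by exact_mod_cast hi.le
  rw [pow_two, mul_assoc]
  exact mul_le_mul_of_nonneg_right this (by positivity)

/-- The second differences form a periodic sequence with zero sum whose own second differences are
bounded by `Z`. By `periodic_osc` their oscillation is at most `n ^ 2 Z`, and the zero sum turns
this into a bound on their size. -/
lemma periodic_secondDiff_le {g : ℤ → ℝ} {n : ℕ} {Z : ℝ} (hn : 0 < n) (hg : ∀ x, g (x + n) = g x)
    (hZ : ∀ x, |(g (x + 2) + g x - 2 * g (x + 1)) + (g x + g (x - 2) - 2 * g (x - 1))
      - 2 * (g (x + 1) + g (x - 1) - 2 * g x)| ≤ Z) (x : ℤ) :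
    |g (x + 1) + g (x - 1) - 2 * g x| ≤ n ^ 2 * Z := by
  set w : ℤ → ℝ := fun x => g (x + 1) + g (x - 1) - 2 * g x with hw
  have hwp : ∀ x, w (x + n) = w x := by
    intro x
    simp only [hw]
    rw [show x + (n : ℤ) + 1 = (x + 1) + n by ring, show x + (n : ℤ) - 1 = (x - 1) + n by ring,
      hg, hg, hg]
  have hosc : ∀ x y, |w y - w x| ≤ n ^ 2 * Z := by
    intro x y
    refine periodic_osc hn hwp (fun x => ?_) x y
    convert hZ x using 2
    simp only [hw]
    rw [show x + 1 + 1 = x + 2 by ring, show x + 1 - 1 = x by ring, show x - 1 + 1 = x by ring,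
      show x - 1 - 1 = x - 2 by ring]
  have hsum : ∑ i ∈ Finset.range n, w (x + i) = 0 := by
    have h1 := sum_diff_eq_zero hg x
    have h2 := sum_diff_eq_zero hg (x - 1)
    have h3 := congrArg₂ (· - ·) h1 h2
    simp only [← Finset.sum_sub_distrib, sub_zero] at h3
    rw [← h3]
    refine Finset.sum_congr rfl fun i _ => ?_
    simp only [hw]
    rw [show x - 1 + (i : ℤ) + 1 = x + i by ring, show x - 1 + (i : ℤ) = x + i - 1 by ring]
    ring
  obtain ⟨⟨i, -, hi'⟩, ⟨i', -, hj'⟩⟩ := exists_between_of_sum_zero hn hsum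
  have a1 := abs_le.1 (hosc (x + i) x)
  have a2 := abs_le.1 (hosc (x + i') x)
  rw [abs_le]
  constructor <;> linarith [a1.1, a1.2, a2.1, a2.2]

/-! ## The solution on the grid -/

/-- The solution in the unit `L^{-d}` at the points of the periodic grid. -/
def gridFun {d : ℕ} (L : ℝ) (n : ℕ) (u : (Fin d → ℝ) → ℝ → ℝ) (t : ℝ) : Lat :=
  fun j => L ^ d * u (fun k : Fin d => (j k : ℝ) * (L / n)) t

variable {d : ℕ} {L T α ζ : ℝ} {u : (Fin d → ℝ) → ℝ → ℝ} {n : ℕ}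

lemma gridFun_add_periodic (hu : IsPeriodicHeatSolution α L T u) (hn : 0 < n)
    {t : ℝ} (ht : t ∈ Icc 0 T) (j v : ℕ → ℤ) :
    gridFun L n u t (j + fun k => v k * n) = gridFun L n u t j := by
  unfold gridFun
  congr 1
  have := periodic_int (f := fun x => u x t) (fun x i => hu.periodic x i t ht) (fun k => v k)
    (fun k : Fin d => (j k : ℝ) * (L / n))
  rw [← this]
  congr 1
  funext k
  have : (n : ℝ) ≠ 0 := by positivity
  simp only [Pi.add_apply]
  push_cast
  field_simp

lemma gridFun_shift (t : ℝ) (j : ℕ → ℤ) (k : Fin d) (z : ℤ) :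
    gridFun L n u t (j + z • unitVec k)
      = L ^ d * u ((fun k : Fin d => (j k : ℝ) * (L / n)) + Pi.single k (z * (L / n))) t := by
  unfold gridFun
  congr 2
  funext i
  simp only [Pi.add_apply, Pi.smul_apply, unitVec, smul_eq_mul]
  by_cases h : i = k
  · subst h; simp; ring
  · have : (i : ℕ) ≠ k := fun h' => h (Fin.ext h')
    simp [h, this]

lemma fourthDeriv_bound_everywhere (hL : 0 < L) (hu : IsPeriodicHeatSolution α L T u)
    (hb : FourthDerivBound ζ L T u) (i : Fin d) {t : ℝ} (ht : t ∈ Icc 0 T) (x : Fin d → ℝ) :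
    |partialD i (partialD i (partialD i (partialD i (fun y => u y t)))) x| ≤ ζ / L ^ d := by
  have hper := periodic_int
    (f := partialD i (partialD i (partialD i (partialD i (fun y => u y t))))) (L := L)
    (fun x k => partialD_periodic (partialD_periodic (partialD_periodic (partialD_periodic
      (fun x => hu.periodic x k t ht) i) i) i) i x) (fun k => -⌊x k / L⌋) x
  rw [← hper]
  refine hb i i _ (fun k => ?_) t ht
  have h1 := Int.floor_le (x k / L)
  have h2 := Int.lt_floor_add_one (x k / L)
  rw [le_div_iff₀ hL] at h1
  rw [div_lt_iff₀ hL] at h2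
  simp only [Pi.add_apply]
  push_cast
  constructor <;> linarith

/-- Both uses of the fourth derivative bound: the fourth difference is small, and the second
difference approximates the second derivative. Everything reduces to functions of one variable on
lines parallel to a coordinate axis. -/
lemma gridFun_facts (hL : 0 < L) (hu : IsPeriodicHeatSolution α L T u)
    (hb : FourthDerivBound ζ L T u) (hn : 0 < n) {t : ℝ} (ht : t ∈ Icc 0 T) (k : Fin d) :
    BoundedBy ((L / n) ^ 4 * ζ) (secondDiff k (secondDiff k (gridFun L n u t))) ∧
    ∀ j, |secondDiff k (gridFun L n u t) j - (L / n) ^ 2 *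
      (L ^ d * partialD k (partialD k (fun y => u y t)) (fun k : Fin d => (j k : ℝ) * (L / n)))|
      ≤ (L / n) ^ 4 * ζ / 12 := by
  set f : (Fin d → ℝ) → ℝ := fun y => u y t with hf
  have c0 : ContDiff ℝ (4 : ℕ) f := hu.smooth t ht
  have c1 := partialD_contDiff (m := 3) c0 k
  have c2 := partialD_contDiff (m := 2) c1 k
  have c3 := partialD_contDiff (m := 1) c2 k
  have hLd : 0 < L ^ d := by positivity
  have hh : 0 ≤ L / n := by positivity
  have main : ∀ x : Fin d → ℝ, _ := fun x =>
    And.intro (hasDerivAt_line (c0.differentiable (by norm_num)) k x)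
      (And.intro (hasDerivAt_line (c1.differentiable (by norm_num)) k x)
      (And.intro (hasDerivAt_line (c2.differentiable (by norm_num)) k x)
      (hasDerivAt_line (c3.differentiable (by norm_num)) k x)))
  have hB := fun x => fourthDeriv_bound_everywhere hL hu hb k ht x
  have hd : ∀ (x : Fin d → ℝ) (y : ℝ), 0 ≤ y →
      |partialD k (partialD k f) (x + Pi.single k y)
        + partialD k (partialD k f) (x - Pi.single k y) - 2 * partialD k (partialD k f) x|
      ≤ y ^ 2 * (ζ / L ^ d) := by
    intro x y hy
    have := secondDifference_le (main x).2.2.1 (main x).2.2.2 (fun y => hB _) 0 hy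
    simpa [sub_eq_add_neg, Pi.single_neg] using this
  have hsh : ∀ j, secondDiff k (gridFun L n u t) j =
      L ^ d * (f ((fun k : Fin d => (j k : ℝ) * (L / n)) + Pi.single k (L / n))
      + f ((fun k : Fin d => (j k : ℝ) * (L / n)) - Pi.single k (L / n))
      - 2 * f (fun k : Fin d => (j k : ℝ) * (L / n))) := by
    intro j
    have h1 := gridFun_shift (L := L) (n := n) (u := u) t j k 1
    have h2 := gridFun_shift (L := L) (n := n) (u := u) t j k (-1)
    simp only [one_smul, neg_smul, Int.cast_one, one_mul, Int.cast_neg, ← sub_eq_add_neg,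
      neg_mul, Pi.single_neg] at h1 h2
    rw [secondDiff_apply, h1, h2]
    unfold gridFun
    ring
  constructor
  · intro j
    rw [secondDiff_apply, hsh, hsh, hsh]
    set x : Fin d → ℝ := fun k : Fin d => (j k : ℝ) * (L / n) with hx
    have e1 : (fun i : Fin d => (((j + unitVec k) i : ℤ) : ℝ) * (L / n)) = x + Pi.single k (L / n) := by
      funext i
      by_cases h : i = k
      · subst h; simp [unitVec, hx]; ring
      · have : (i : ℕ) ≠ k := fun h' => h (Fin.ext h')
        simp [unitVec, h, this, hx]
    have e2 : (fun i : Fin d => (((j - unitVec k) i : ℤ) : ℝ) * (L / n)) = x - Pi.single k (L / n) := by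
      funext i
      by_cases h : i = k
      · subst h; simp [unitVec, hx]; ring
      · have : (i : ℕ) ≠ k := fun h' => h (Fin.ext h')
        simp [unitVec, h, this, hx]
    rw [e1, e2]
    -- The second difference with step `L / n` is itself a smooth function along direction `k`, with
    -- second derivative bounded by `hd`; its second difference gains the other factor `(L / n) ^
    -- 2`.
    have hq := secondDifference_le
      (φ := fun y => f (x + Pi.single k (L / n) + Pi.single k y)
        + f (x - Pi.single k (L / n) + Pi.single k y) - 2 * f (x + Pi.single k y))
      (fun y => (((main (x + Pi.single k (L / n))).1 y).add
        ((main (x - Pi.single k (L / n))).1 y)).sub (((main x).1 y).const_mul 2))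
      (fun y => (((main (x + Pi.single k (L / n))).2.1 y).add
        ((main (x - Pi.single k (L / n))).2.1 y)).sub (((main x).2.1 y).const_mul 2))
      (B := (L / n) ^ 2 * (ζ / L ^ d)) (fun y => ?_) 0 hh
    · have e3 : (L / n) ^ 4 * ζ = L ^ d * ((L / n) ^ 2 * ((L / n) ^ 2 * (ζ / L ^ d))) := by
        field_simp
      rw [e3]
      refine le_trans (le_of_eq ?_) (mul_le_mul_of_nonneg_left hq hLd.le)
      rw [← abs_of_pos hLd, ← abs_mul, abs_of_pos hLd]
      congr 1
      simp only [zero_add, zero_sub, Pi.single_zero, add_zero, Pi.single_neg, ← sub_eq_add_neg]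
      ring
    · convert hd (x + Pi.single k y) _ hh using 5 <;> abel
  · intro j
    rw [hsh]
    have hq := secondDifference_sub_le (main (fun k : Fin d => (j k : ℝ) * (L / n))).1
      (main _).2.1 (main _).2.2.1 (main _).2.2.2 (fun y => hB _) 0 hh
    have e3 : (L / n) ^ 4 * ζ / 12 = L ^ d * ((L / n) ^ 4 * (ζ / L ^ d) / 12) := by
      field_simp
    rw [e3]
    refine le_trans (le_of_eq ?_) (mul_le_mul_of_nonneg_left hq hLd.le)
    rw [← abs_of_pos hLd, ← abs_mul, abs_of_pos hLd]
    congr 1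
    simp only [zero_add, zero_sub, Pi.single_zero, add_zero, Pi.single_neg, ← sub_eq_add_neg]
    ring

lemma add_smul_unitVec (j : ℕ → ℤ) (k : ℕ) (n : ℕ) :
    j + (n : ℤ) • unitVec k = j + fun i => unitVec k i * n := by
  funext i; simp [mul_comm]

lemma line_succ (f : Lat) (j : ℕ → ℤ) (k : ℕ) (x : ℤ) :
    f (j + (x + 1) • unitVec k) = f (j + x • unitVec k + unitVec k) := by
  rw [add_smul, one_smul, add_assoc]

lemma line_pred (f : Lat) (j : ℕ → ℤ) (k : ℕ) (x : ℤ) :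
    f (j + (x - 1) • unitVec k) = f (j + x • unitVec k - unitVec k) := by
  rw [sub_smul, one_smul, add_sub_assoc]

lemma gridFun_line_periodic (hu : IsPeriodicHeatSolution α L T u) (hn : 0 < n)
    {t : ℝ} (ht : t ∈ Icc 0 T) (j : ℕ → ℤ) (k : ℕ) (x : ℤ) :
    gridFun L n u t (j + (x + n) • unitVec k) = gridFun L n u t (j + x • unitVec k) := by
  rw [add_smul, ← add_assoc, add_smul_unitVec, gridFun_add_periodic hu hn ht]

/-- No bound on second derivatives is assumed: periodicity recovers one from the fourth differences,
at the cost of `n ^ 2`. -/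
lemma gridFun_secondDiff_le (hL : 0 < L) (hu : IsPeriodicHeatSolution α L T u)
    (hb : FourthDerivBound ζ L T u) (hn : 0 < n) {t : ℝ} (ht : t ∈ Icc 0 T) {k : ℕ} (hk : k < d) :
    BoundedBy (n ^ 2 * ((L / n) ^ 4 * ζ)) (secondDiff k (gridFun L n u t)) := by
  intro j
  have h1 := (gridFun_facts hL hu hb hn ht ⟨k, hk⟩).1
  have := periodic_secondDiff_le (g := fun x => gridFun L n u t (j + x • unitVec k)) hn
    (gridFun_line_periodic hu hn ht j k) (Z := (L / n) ^ 4 * ζ) (fun x => ?_) 0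
  · simpa [secondDiff_apply, sub_eq_add_neg] using this
  · have := h1 (j + x • unitVec k)
    simp only [secondDiff_apply] at this
    convert this using 2
    simp only [show x + 2 = x + 1 + 1 by ring, show x - 2 = x - 1 - 1 by ring, line_succ, line_pred,
      add_sub_cancel_right, sub_add_cancel]
    ring_nf

lemma gridFun_osc (hL : 0 < L) (hu : IsPeriodicHeatSolution α L T u)
    (hb : FourthDerivBound ζ L T u) (hn : 0 < n) {t : ℝ} (ht : t ∈ Icc 0 T) {k : ℕ} (hk : k < d)
    (j : ℕ → ℤ) (x : ℤ) :
    |gridFun L n u t (j + x • unitVec k) - gridFun L n u t j| ≤ n ^ 4 * ((L / n) ^ 4 * ζ) := by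
  have := periodic_osc (g := fun x => gridFun L n u t (j + x • unitVec k)) hn
    (gridFun_line_periodic hu hn ht j k) (Z := n ^ 2 * ((L / n) ^ 4 * ζ)) (fun x => ?_) 0 x
  · refine le_trans (le_of_eq (by simp)) (this.trans (le_of_eq (by ring)))
  · have := gridFun_secondDiff_le hL hu hb hn ht hk (j + x • unitVec k)
    simpa only [secondDiff_apply, line_succ, line_pred] using this

/-- The remainder is minus the scaled sum of the `d` consistency errors, which turns the heat
equation on the grid into a perturbed system of ordinary differential equations. -/
lemma gridFun_hasDeriv (hL : 0 < L) (hα : 0 ≤ α) (hu : IsPeriodicHeatSolution α L T u)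
    (hb : FourthDerivBound ζ L T u) (hn : 0 < n) :
    ∃ r : ℝ → Lat, (∀ t ∈ Icc 0 T, ∀ j, HasDerivWithinAt (fun s => gridFun L n u s j)
      (α / (L / n) ^ 2 * ∑ k ∈ Finset.range d, secondDiff k (gridFun L n u t) j + r t j)
      (Icc 0 T) t) ∧
      ∀ t ∈ Icc 0 T, BoundedBy (α / (L / n) ^ 2 * d * ((L / n) ^ 4 * ζ) / 12) (r t) := by
  have hh : 0 < L / n := by positivity
  refine ⟨fun t j => -(α / (L / n) ^ 2 * ∑ k : Fin d, (secondDiff k (gridFun L n u t) j -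
    (L / n) ^ 2 * (L ^ d * partialD k (partialD k (fun y => u y t))
      (fun k : Fin d => (j k : ℝ) * (L / n))))), fun t ht j => ?_, fun t ht j => ?_⟩
  · have := (hu.heat (fun k : Fin d => (j k : ℝ) * (L / n)) t ht).const_mul (L ^ d)
    refine this.congr_deriv ?_
    simp only []
    rw [Finset.sum_range, Finset.sum_sub_distrib, ← Finset.mul_sum, ← Finset.mul_sum]
    generalize ∑ i : Fin d, partialD i (partialD i fun y => u y t) _ = S
    field_simp
    ring
  · simp only [abs_neg, abs_mul]
    rw [abs_of_nonneg (by positivity)]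
    have : |∑ k : Fin d, (secondDiff k (gridFun L n u t) j -
        (L / n) ^ 2 * (L ^ d * partialD k (partialD k (fun y => u y t))
        (fun k : Fin d => (j k : ℝ) * (L / n))))| ≤ d * ((L / n) ^ 4 * ζ / 12) := by
      refine (Finset.abs_sum_le_sum_abs _ _).trans ?_
      refine (Finset.sum_le_sum fun k _ => (gridFun_facts hL hu hb hn ht k).2 j).trans ?_
      simp
    refine (mul_le_mul_of_nonneg_left this (by positivity)).trans (le_of_eq ?_)
    ring

/-- All summands in the normalisation are nonnegative, so each is at most the total `(n / L) ^ d`.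
Other lattice points reduce to the grid modulo `n`. -/
lemma gridFun_initial_le (hL : 0 < L) (hu : IsPeriodicHeatSolution α L T u) (hT : 0 < T)
    (hn : 0 < n) (hpos : ∀ x, 0 ≤ u x 0)
    (hsum : ∑ j : Fin d → Fin n, u (gridPoint L n (fun k => (j k : ℕ))) 0 = ((n : ℝ) / L) ^ d) :
    BoundedBy ((n : ℝ) ^ d) (gridFun L n u 0) ∧ ∀ j, 0 ≤ gridFun L n u 0 j := by
  have hnn : ∀ j, 0 ≤ gridFun L n u 0 j := fun j => mul_nonneg (by positivity) (hpos _)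
  refine ⟨fun j => ?_, hnn⟩
  rw [abs_of_nonneg (hnn j)]
  have hn0 : (0 : ℤ) < n := by exact_mod_cast hn
  rw [← gridFun_add_periodic hu hn ⟨le_rfl, hT.le⟩ j (fun k => -(j k / n))]
  let J : Fin d → Fin n := fun k => ⟨(j k % n).toNat, by
    have := Int.emod_lt_of_pos (j k) hn0
    have := Int.emod_nonneg (j k) hn0.ne'
    omega⟩
  have h1 := Finset.single_le_sum (f := fun j : Fin d → Fin n =>
    u (gridPoint L n (fun k => (j k : ℕ))) 0) (fun i _ => hpos _) (Finset.mem_univ J)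
  rw [hsum] at h1
  have h2 : (j + fun k => -(j k / n) * (n : ℤ)) = fun k => j k % n := by
    funext k
    have := Int.mul_ediv_add_emod (j k) n
    simp only [Pi.add_apply]
    linarith
  have h3 : gridFun L n u 0 (j + fun k => -(j k / n) * (n : ℤ))
      = L ^ d * u (gridPoint L n (fun k => (J k : ℕ))) 0 := by
    rw [h2]
    unfold gridFun gridPoint
    congr 3
    funext k
    have : (((j k % n).toNat : ℕ) : ℝ) = ((j k % n : ℤ) : ℝ) := by
      rw [← Int.cast_natCast, Int.toNat_of_nonneg (Int.emod_nonneg _ hn0.ne')]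
    simp only [J]
    rw [← this]
  rw [h3]
  refine (mul_le_mul_of_nonneg_left h1 (by positivity)).trans (le_of_eq ?_)
  rw [div_pow]; field_simp

/-- Split steps approximate the solution. -/
lemma gridFun_splitStep (hL : 0 < L) (hα : 0 ≤ α) (hu : IsPeriodicHeatSolution α L T u)
    (hb : FourthDerivBound ζ L T u) (hζ : 0 ≤ ζ) (hn : 0 < n) {t : ℝ} (ht : t ∈ Icc 0 T) {s : ℕ} (hs : 0 < s)
    {ε : ℝ} {m : ℕ} (hτ : d * (α * t * n ^ 2 / L ^ 2) ≤ 2 * m)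
    (hτZ : d * (α * t * n ^ 2 / L ^ 2) * ((L / n) ^ 4 * ζ) ≤ 3 * ε)
    (hc : α * t * n ^ 2 / L ^ 2 / s ≤ 1 / 4) (hε : 0 ≤ ε) (hsm : 1600 * m * n ^ 2 ≤ s) :
    BoundedBy (ε / 4 + ε / 16)
      (gridFun L n u t - (splitStep (α * t * n ^ 2 / L ^ 2 / s) d ^ s) (gridFun L n u 0)) := by
  obtain ⟨r, hr1, hr2⟩ := gridFun_hasDeriv hL hα hu hb hn
  have hs' : (0 : ℝ) < s := by exact_mod_cast hs
  have hn' : (0 : ℝ) < n := by exact_mod_cast hn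
  have ea : α / (L / n) ^ 2 * (t / s) = α * t * n ^ 2 / L ^ 2 / s := by field_simp
  have est : s * (t / s) = t := by field_simp
  have key := semidiscrete_global (a := α / (L / n) ^ 2) (by positivity) hr1 hr2
    (fun t ht k hk => gridFun_secondDiff_le hL hu hb hn ht hk) (δ := t / s) s
    (div_nonneg ht.1 hs'.le) (by rw [est]; exact ht.2) (by rw [ea]; exact hc)
  rw [est, ea] at key
  intro j
  refine (key j).trans ?_
  set τ := α * t * n ^ 2 / L ^ 2 with hτd
  set Z := (L / n) ^ 4 * ζ with hZ
  set a := α / (L / n) ^ 2 with had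
  have hZ0 : 0 ≤ Z := by positivity
  have hτ0 : 0 ≤ τ := div_nonneg (mul_nonneg (mul_nonneg hα ht.1) (by positivity)) (by positivity)
  have eat : a * t = τ := by rw [had, hτd]; field_simp
  have n1 : (1 : ℝ) ≤ n := by exact_mod_cast hn
  have n2 : (1 : ℝ) ≤ n ^ 2 := one_le_pow₀ n1
  -- The first summand is the spatial error, at most `3 ε / 12`. The second is of order `1 / s`: its
  -- numerator is at most `54 m n ^ 2 ε`, and `16 * 54 ≤ 1600`.
  have e1 : s * (t / s * (4 * a * d * (a * d * (n ^ 2 * Z) + a * d * Z / 12) * (t / s)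
      + a * d * Z / 12) + 4 * (τ / s) ^ 2 * d ^ 2 * (n ^ 2 * Z))
      = (d * τ * Z) / 12 + (d * τ) * (d * τ * Z) * (8 * n ^ 2 + 1 / 3) / s := by
    rw [← eat]; field_simp; ring
  rw [e1]
  have h2 : (d * τ) * (d * τ * Z) * (8 * n ^ 2 + 1 / 3) ≤ (2 * m) * (3 * ε) * (9 * n ^ 2) := by
    gcongr
    linarith
  have h3 : (d * τ) * (d * τ * Z) * (8 * n ^ 2 + 1 / 3) / s ≤ ε / 16 := by
    rw [div_le_iff₀ hs']
    refine h2.trans ?_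
    have : (1600 : ℝ) * m * n ^ 2 ≤ s := by exact_mod_cast hsm
    nlinarith
  linarith

end HeatFFT
end

open Set
noncomputable section
namespace HeatFFT

/-! ## One coordinate direction: powers of the step as a window sum -/

/-- One explicit step of the heat equation for sequences. -/
def lineStep (c : ℝ) : Module.End ℝ (ℤ → ℝ) where
  toFun g x := g x + c * (g (x + 1) + g (x - 1) - 2 * g x)
  map_add' f g := by funext x; simp only [Pi.add_apply]; ring
  map_smul' a g := by funext x; simp only [Pi.smul_apply, smul_eq_mul, RingHom.id_apply]; ring

lemma lineStep_apply (c : ℝ) (g : ℤ → ℝ) (x : ℤ) :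
    lineStep c g x = g x + c * (g (x + 1) + g (x - 1) - 2 * g x) := rfl

lemma lineStep_pow_succ (c : ℝ) (s : ℕ) (g : ℤ → ℝ) :
    (lineStep c ^ (s + 1)) g = lineStep c ((lineStep c ^ s) g) := by
  rw [pow_succ', Module.End.mul_apply]

lemma heatStep_pow_line (c : ℝ) (k s : ℕ) (f : Lat) (j : ℕ → ℤ) (x : ℤ) :
    (heatStep c k ^ s) f (j + x • unitVec k)
      = (lineStep c ^ s) (fun x => f (j + x • unitVec k)) x := by
  induction s generalizing x with
  | zero => simp
  | succ s ih =>
    rw [pow_succ', Module.End.mul_apply, lineStep_pow_succ, heatStep_apply, lineStep_apply,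
      secondDiff_apply, ← line_succ ((heatStep c k ^ s) f), ← line_pred ((heatStep c k ^ s) f), ih, ih, ih]

lemma lineStep_pow_translate (c : ℝ) (s : ℕ) (g : ℤ → ℝ) (x y : ℤ) :
    (lineStep c ^ s) (fun l => g (y + l)) x = (lineStep c ^ s) g (y + x) := by
  induction s generalizing x with
  | zero => simp
  | succ s ih =>
    rw [lineStep_pow_succ, lineStep_pow_succ, lineStep_apply, lineStep_apply, ih, ih, ih]
    simp only [add_assoc, add_sub_assoc]

/-- Used three times: for constants (`μ = 2`), for cosines in the Fourier expansion, and for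
hyperbolic cosines as barriers. -/
lemma lineStep_pow_eigen {μ : ℝ} (c : ℝ) (s : ℕ) {g : ℤ → ℝ}
    (h : ∀ x, g (x + 1) + g (x - 1) = μ * g x) :
    (lineStep c ^ s) g = (1 - c * (2 - μ)) ^ s • g := by
  have h1 : lineStep c g = (1 - c * (2 - μ)) • g := by
    funext x; rw [lineStep_apply, h]; simp; ring
  induction s with
  | zero => simp
  | succ s ih => rw [lineStep_pow_succ, ih, map_smul, h1, smul_smul, pow_succ]

lemma lineStep_pow_const (c : ℝ) (s : ℕ) (B : ℝ) : (lineStep c ^ s) (fun _ => B) = fun _ => B := by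
  rw [lineStep_pow_eigen (μ := 2) c s (g := fun _ => B) (fun _ => by ring)]
  simp

lemma lineStep_pow_mono {c : ℝ} (hc0 : 0 ≤ c) (hc : c ≤ 1 / 4) (s : ℕ) {f g : ℤ → ℝ}
    (h : ∀ x, f x ≤ g x) (x : ℤ) : (lineStep c ^ s) f x ≤ (lineStep c ^ s) g x := by
  induction s generalizing x with
  | zero => simpa using h x
  | succ s ih =>
    rw [lineStep_pow_succ, lineStep_pow_succ, lineStep_apply, lineStep_apply]
    have h1 := ih x
    have h2 := mul_le_mul_of_nonneg_left (ih (x + 1)) hc0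
    have h3 := mul_le_mul_of_nonneg_left (ih (x - 1)) hc0
    nlinarith

/-- The comparison principle with a variable majorant; it lets an explicit eigenfunction control the
spread of an error. -/
lemma lineStep_pow_abs_le {c : ℝ} (hc0 : 0 ≤ c) (hc : c ≤ 1 / 4) (s : ℕ) {f g : ℤ → ℝ}
    (h : ∀ x, |f x| ≤ g x) (x : ℤ) : |(lineStep c ^ s) f x| ≤ (lineStep c ^ s) g x := by
  have h1 := lineStep_pow_mono hc0 hc s (fun x => (abs_le.1 (h x)).2) x
  have h2 := lineStep_pow_mono hc0 hc s (f := -g) (fun x => (abs_le.1 (h x)).1) x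
  rw [map_neg] at h2
  exact abs_le.2 ⟨h2, h1⟩

/-! ### Fourier inversion on a window and the error of windowing. -/

/-- The angle of mode `k` for period `2a`. -/
def angle (a k : ℕ) : ℝ := Real.pi * k / a

/-- The Dirichlet kernel: multiplication by `2 sin (φ / 2)` makes the sum telescope. -/
lemma sum_cos_mul (φ : ℝ) (K : ℕ) :
    2 * Real.sin (φ / 2) * ∑ k ∈ Finset.range K, Real.cos (k * φ)
      = Real.sin ((K - 1 / 2) * φ) + Real.sin (φ / 2) := by
  induction K with
  | zero =>
    have : ((0 : ℕ) - 1 / 2 : ℝ) * φ = -(φ / 2) := by push_cast; ring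
    rw [this, Real.sin_neg]; simp
  | succ K ih =>
    rw [Finset.sum_range_succ, mul_add, ih]
    have e1 : ((K : ℝ) - 1 / 2) * φ = K * φ - φ / 2 := by ring
    have e2 : (((K + 1 : ℕ) : ℝ) - 1 / 2) * φ = K * φ + φ / 2 := by push_cast; ring
    rw [e1, e2, Real.sin_sub, Real.sin_add]; ring

/-- Orthogonality of characters. If `2a` does not divide `m`, the right side of `sum_cos_mul`
vanishes while the sine on the left does not. -/
lemma sum_cos_angle {a : ℕ} (ha : 0 < a) (m : ℤ) :
    ∑ k ∈ Finset.range (2 * a), Real.cos (angle a k * m)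
      = if (2 * a : ℤ) ∣ m then (2 * a : ℝ) else 0 := by
  have ha' : (a : ℝ) ≠ 0 := by positivity
  split_ifs with h
  · obtain ⟨z, rfl⟩ := h
    have : ∀ k ∈ Finset.range (2 * a), Real.cos (angle a k * ((2 * a * z : ℤ) : ℝ)) = 1 := by
      intro k _
      have : angle a k * ((2 * a * z : ℤ) : ℝ) = ((k * z : ℤ) : ℝ) * (2 * Real.pi) := by
        unfold angle; push_cast; field_simp
      rw [this, Real.cos_int_mul_two_pi]
    rw [Finset.sum_congr rfl this]; simp
  · have key := sum_cos_mul (Real.pi * m / a) (2 * a)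
    have e1 : (((2 * a : ℕ) : ℝ) - 1 / 2) * (Real.pi * m / a)
        = m * (2 * Real.pi) - Real.pi * m / a / 2 := by
      push_cast; field_simp
    rw [e1, Real.sin_int_mul_two_pi_sub, neg_add_cancel] at key
    have hne : Real.sin (Real.pi * m / a / 2) ≠ 0 := by
      intro h0
      rw [Real.sin_eq_zero_iff] at h0
      obtain ⟨z, hz⟩ := h0
      apply h
      refine ⟨z, ?_⟩
      have hpi := Real.pi_pos.ne'
      field_simp at hz
      have : (m : ℝ) = 2 * a * z := by linarith
      exact_mod_cast this
    have : ∑ k ∈ Finset.range (2 * a), Real.cos (k * (Real.pi * m / a)) = 0 := by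
      rcases mul_eq_zero.1 key with h1 | h1
      · exact absurd h1 (mul_ne_zero two_ne_zero hne)
      · exact h1
    rw [← this]
    refine Finset.sum_congr rfl fun k _ => ?_
    congr 1; unfold angle; ring

/-- The factor by which mode `k` is damped. -/
def damping (c : ℝ) (s a k : ℕ) : ℝ := (1 - c * (2 - 2 * Real.cos (angle a k))) ^ s

/-- The window of one period. -/
def window (a : ℕ) : Finset ℤ := Finset.Ioc (-a : ℤ) a

lemma card_window (a : ℕ) : (window a).card = 2 * a := by
  simp [window]; omega

/-- The window is listed backwards because this is the order in which a sliding sum meets the most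
recent entries. -/
lemma sum_window (a : ℕ) (f : ℤ → ℝ) :
    ∑ x ∈ window a, f x = ∑ l ∈ Finset.range (2 * a), f (a - l) := by
  refine Finset.sum_nbij' (fun x => (a - x).toNat) (fun l => (a - l : ℤ)) ?_ ?_ ?_ ?_ ?_
  · intro x hx
    simp only [window, Finset.mem_Ioc] at hx
    simp only [Finset.mem_range]; omega
  · intro l hl
    simp only [Finset.mem_range] at hl
    simp only [window, Finset.mem_Ioc]; omega
  · intro x hx
    simp only [window, Finset.mem_Ioc] at hx
    omega
  · intro l _
    omega
  · intro x hx
    simp only [window, Finset.mem_Ioc] at hx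
    congr 1; omega

/-- The coefficient of mode `k` in the window around `j`. -/
def modeSum (a : ℕ) (g : ℤ → ℝ) (j : ℤ) (k : ℕ) : ℝ :=
  ∑ x ∈ window a, Real.cos (angle a k * x) * g (j + x)

/-- Smoothing by all modes. -/
def fullKernel (c : ℝ) (s a : ℕ) (g : ℤ → ℝ) (j : ℤ) : ℝ :=
  1 / (2 * a) * ∑ k ∈ Finset.range (2 * a), damping c s a k * modeSum a g j k

/-- The representative in the window. -/
def wrap (a : ℕ) (l : ℤ) : ℤ := if h : 0 < (2 * a : ℤ) then toIocMod h (-a) l else 0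

section
variable {a : ℕ} (ha : 0 < a)
include ha

lemma wrap_mem (l : ℤ) : wrap a l ∈ window a := by
  have h : 0 < (2 * a : ℤ) := by omega
  have := toIocMod_mem_Ioc h (-a) l
  simp only [wrap, h, dif_pos, window, Finset.mem_Ioc]
  rw [Set.mem_Ioc] at this
  constructor <;> linarith [this.1, this.2]

lemma wrap_dvd (l : ℤ) : (2 * a : ℤ) ∣ l - wrap a l := by
  have h : 0 < (2 * a : ℤ) := by omega
  simp only [wrap, h, dif_pos]
  rw [self_sub_toIocMod]
  simp

lemma wrap_unique {l x : ℤ} (hx : x ∈ window a) (h : (2 * a : ℤ) ∣ l - x) : x = wrap a l := by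
  have h1 := wrap_mem ha l
  have h2 := wrap_dvd ha l
  simp only [window, Finset.mem_Ioc] at hx h1
  have h3 : (2 * a : ℤ) ∣ x - wrap a l := by
    have := dvd_sub h2 h
    rwa [show l - wrap a l - (l - x) = x - wrap a l by ring] at this
  obtain ⟨z, hz⟩ := h3
  have hz0 : z = 0 := by
    have : (2 * a : ℤ) * z < (2 * a : ℤ) * 1 := by linarith
    have : (2 * a : ℤ) * (-1) < (2 * a : ℤ) * z := by linarith
    have h5 : 0 < (2 * a : ℤ) := by omega
    have := lt_of_mul_lt_mul_left ‹(2 * a : ℤ) * z < (2 * a : ℤ) * 1› h5.le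
    have := lt_of_mul_lt_mul_left ‹(2 * a : ℤ) * (-1) < (2 * a : ℤ) * z› h5.le
    omega
  rw [hz0] at hz; linarith

lemma wrap_eq_self {l : ℤ} (h : l ∈ window a) : wrap a l = l :=
  (wrap_unique ha h (by simp)).symm

/-- Fourier inversion: after exchange of the sums only `x = wrap a l` survives. Hence the cosine
expansion is automatically the `2a`-periodic continuation of the window values. -/
lemma fourier_expand (q : ℤ → ℝ) (l : ℤ) :
    q (wrap a l) = 1 / (2 * a) * ∑ k ∈ Finset.range (2 * a), ∑ x ∈ window a,
      q x * Real.cos (angle a k * (l - x)) := by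
  have ha' : (a : ℝ) ≠ 0 := by positivity
  rw [Finset.sum_comm]
  have : ∀ x ∈ window a, ∑ k ∈ Finset.range (2 * a), q x * Real.cos (angle a k * (l - x))
      = if x = wrap a l then q x * (2 * a) else 0 := by
    intro x hx
    rw [← Finset.mul_sum]
    have h1 := sum_cos_angle ha (l - x)
    push_cast at h1
    rw [h1]
    by_cases hxw : x = wrap a l
    · rw [if_pos hxw, if_pos (hxw ▸ wrap_dvd ha l)]
    · rw [if_neg hxw, if_neg (fun h => hxw (wrap_unique ha hx h)), mul_zero]
  rw [Finset.sum_congr rfl this, Finset.sum_ite_eq' , if_pos (wrap_mem ha l)]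
  field_simp

/-- The mode formula is the exact evolution of the periodically continued window. Stability and
error bounds for `fullKernel` are read off from this, not from the trigonometric sum. -/
lemma lineStep_pow_wrap (c : ℝ) (s : ℕ) (g : ℤ → ℝ) (j : ℤ) :
    (lineStep c ^ s) (fun l => g (j + wrap a l)) 0 = fullKernel c s a g j := by
  have e1 : (fun l => g (j + wrap a l)) = (1 / (2 * a : ℝ)) • ∑ k ∈ Finset.range (2 * a),
      ∑ x ∈ window a, g (j + x) • (fun l : ℤ => Real.cos (angle a k * (l - x))) := by
    funext l
    rw [fourier_expand ha (fun x => g (j + x)) l]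
    simp
  have e2 : ∀ k x, (lineStep c ^ s) (fun l : ℤ => Real.cos (angle a k * (l - x))) 0
      = damping c s a k * Real.cos (angle a k * x) := by
    intro k x
    rw [lineStep_pow_eigen (μ := 2 * Real.cos (angle a k))]
    · rw [Pi.smul_apply, smul_eq_mul, damping, ← Real.cos_neg (angle a k * x)]
      simp
    · intro l
      have h1 : angle a k * (((l + 1 : ℤ) : ℝ) - x) = angle a k * (l - x) + angle a k := by
        push_cast; ring
      have h2 : angle a k * (((l - 1 : ℤ) : ℝ) - x) = angle a k * (l - x) - angle a k := by
        push_cast; ring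
      rw [h1, h2, Real.cos_add, Real.cos_sub]; ring
  rw [e1]
  simp only [map_smul, map_sum, Pi.smul_apply, Finset.sum_apply, smul_eq_mul, e2, fullKernel,
    modeSum]
  congr 1
  refine Finset.sum_congr rfl fun k _ => ?_
  rw [Finset.mul_sum]
  refine Finset.sum_congr rfl fun x _ => ?_
  ring

lemma fullKernel_abs_le {c : ℝ} (hc0 : 0 ≤ c) (hc : c ≤ 1 / 4) (s : ℕ) {g : ℤ → ℝ} {B : ℝ}
    (h : ∀ x, |g x| ≤ B) (j : ℤ) : |fullKernel c s a g j| ≤ B := by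
  rw [← lineStep_pow_wrap ha]
  have := lineStep_pow_abs_le hc0 hc s (f := fun l => g (j + wrap a l)) (g := fun _ => B)
    (fun x => h _) 0
  rwa [lineStep_pow_const] at this

/-- If the window length is already a period, continuing the window changes nothing. -/
lemma fullKernel_of_periodic (c : ℝ) (s : ℕ) {g : ℤ → ℝ} (h : Function.Periodic g (2 * a : ℤ)) (j : ℤ) :
    fullKernel c s a g j = (lineStep c ^ s) g j := by
  rw [← lineStep_pow_wrap ha]
  have : (fun l => g (j + wrap a l)) = fun l => g (j + l) := by
    funext l
    obtain ⟨z, hz⟩ := wrap_dvd ha l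
    have e : j + l = j + wrap a l + z * (2 * a) := by linarith
    rw [e]
    exact (h.int_mul z _).symm
  rw [this, lineStep_pow_translate, add_zero]

/-- The data and its wrapped version differ only outside the window, by at most `Ω`, and there a
normalised `cosh (l x) - 1` exceeds `Ω`. Comparison with this majorant, built from eigenfunctions,
replaces a tail estimate for the random walk. -/
lemma fullKernel_sub_le {c : ℝ} (hc0 : 0 ≤ c) (hc : c ≤ 1 / 4) (s : ℕ) {g : ℤ → ℝ} {Ω : ℝ}
    (h : ∀ x y, |g x - g y| ≤ Ω) (j : ℤ) {l : ℝ} (hl : 0 < l) :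
    |fullKernel c s a g j - (lineStep c ^ s) g j| * (Real.cosh (l * a) - 1) ≤
      Ω * ((1 + c * (2 * Real.cosh l - 2)) ^ s - 1) := by
  have hΩ : 0 ≤ Ω := (abs_nonneg _).trans (h 0 0)
  have hla : 1 < Real.cosh (l * a) := Real.one_lt_cosh.2 (by positivity)
  have e1 : fullKernel c s a g j - (lineStep c ^ s) g j
      = (lineStep c ^ s) (fun x => g (j + wrap a x) - g (j + x)) 0 := by
    rw [← lineStep_pow_wrap ha]
    have h2 := lineStep_pow_translate c s g 0 j
    rw [add_zero] at h2
    rw [← h2, ← Pi.sub_apply, ← map_sub]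
    rfl
  -- The majorant is nonnegative inside the window, where the difference vanishes, and at least `Ω`
  -- outside it.
  have e2 := lineStep_pow_abs_le hc0 hc s (f := fun x => g (j + wrap a x) - g (j + x))
    (g := (Ω / (Real.cosh (l * a) - 1)) • ((fun x : ℤ => Real.cosh (l * x)) - fun _ => 1))
    (fun x => ?_) 0
  · rw [← e1, map_smul, map_sub, lineStep_pow_const,
      lineStep_pow_eigen (μ := 2 * Real.cosh l) c s (g := fun x : ℤ => Real.cosh (l * x))] at e2
    · simp only [Pi.smul_apply, Pi.sub_apply, smul_eq_mul, Int.cast_zero, mul_zero, Real.cosh_zero,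
        mul_one] at e2
      have h3 : 1 - c * (2 - 2 * Real.cosh l) = 1 + c * (2 * Real.cosh l - 2) := by ring
      rw [h3, div_mul_eq_mul_div, le_div_iff₀ (by linarith)] at e2
      exact e2
    · intro x
      have h1 : l * ((x + 1 : ℤ) : ℝ) = l * x + l := by push_cast; ring
      have h2 : l * ((x - 1 : ℤ) : ℝ) = l * x - l := by push_cast; ring
      rw [h1, h2, Real.cosh_add, Real.cosh_sub]; ring
  · simp only [Pi.smul_apply, Pi.sub_apply, smul_eq_mul]
    have hx1 := Real.one_le_cosh (l * x)
    by_cases hx : x ∈ window a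
    · rw [wrap_eq_self ha hx, sub_self, abs_zero]
      exact mul_nonneg (div_nonneg hΩ (by linarith)) (by linarith)
    · refine (h _ _).trans ?_
      rw [div_mul_eq_mul_div, le_div_iff₀ (by linarith)]
      refine mul_le_mul_of_nonneg_left ?_ hΩ
      have : Real.cosh (l * a) ≤ Real.cosh (l * x) := by
        rw [Real.cosh_le_cosh, abs_mul, abs_mul]
        refine mul_le_mul_of_nonneg_left ?_ (abs_nonneg _)
        rw [Nat.abs_cast]
        simp only [window, Finset.mem_Ioc, not_and, not_le] at hx
        have : (a : ℤ) ≤ |x| := by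
          by_cases hx' : -(a : ℤ) < x
          · exact (hx hx').le.trans (le_abs_self _)
          · exact le_trans (by linarith) (neg_le_abs x)
        exact_mod_cast this
      linarith

end

/-! ### Truncation of the modes. -/

/-- The multiplicity of mode `k` for period `2a`. -/
def weight (a k : ℕ) : ℝ := if k = 0 ∨ k = a then 1 else 2

lemma sum_symm_eq {a : ℕ} (ha : 0 < a) (b : ℕ → ℝ) (hb : ∀ k ≤ 2 * a, b (2 * a - k) = b k) :
    ∑ k ∈ Finset.range (2 * a), b k = ∑ k ∈ Finset.range (a + 1), weight a k * b k := by
  obtain ⟨a, rfl⟩ : ∃ a', a = a' + 1 := ⟨a - 1, by omega⟩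
  have h1 : ∑ k ∈ Finset.range (2 * (a + 1)), b k
      = ∑ k ∈ Finset.range (a + 2), b k + ∑ k ∈ Finset.range a, b (a + 2 + k) := by
    rw [← Finset.sum_range_add]; congr 2; ring
  have h2 : ∑ k ∈ Finset.range a, b (a + 2 + k) = ∑ k ∈ Finset.range a, b (k + 1) := by
    rw [← Finset.sum_range_reflect]
    refine Finset.sum_congr rfl fun k hk => ?_
    have hk := Finset.mem_range.1 hk
    rw [← hb (k + 1) (by omega)]
    congr 1; omega
  have h3 : ∑ k ∈ Finset.range (a + 2), weight (a + 1) k * b k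
      = b 0 + 2 * ∑ k ∈ Finset.range a, b (k + 1) + b (a + 1) := by
    rw [Finset.sum_range_succ, Finset.sum_range_succ', Finset.mul_sum]
    have : ∀ k ∈ Finset.range a, weight (a + 1) (k + 1) * b (k + 1) = 2 * b (k + 1) := by
      intro k hk
      have := Finset.mem_range.1 hk
      rw [weight, if_neg (by omega)]
    rw [Finset.sum_congr rfl this]
    simp [weight]; ring
  rw [h1, h2, h3, Finset.sum_range_succ, Finset.sum_range_succ']; ring

/-- Smoothing by the modes up to `p`. -/
def kernel (c : ℝ) (s a p : ℕ) (g : ℤ → ℝ) (j : ℤ) : ℝ :=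
  1 / (2 * a) * ∑ k ∈ Finset.range (p + 1), weight a k * (damping c s a k * modeSum a g j k)

lemma cos_angle_symm {a : ℕ} (ha : 0 < a) {k : ℕ} (hk : k ≤ 2 * a) (x : ℤ) :
    Real.cos (angle a (2 * a - k) * x) = Real.cos (angle a k * x) := by
  have ha' : (a : ℝ) ≠ 0 := by positivity
  have : angle a (2 * a - k) * x = x * (2 * Real.pi) - angle a k * x := by
    unfold angle; rw [Nat.cast_sub hk]; push_cast; field_simp
  rw [this, Real.cos_int_mul_two_pi_sub]

lemma fullKernel_eq_kernel {a : ℕ} (ha : 0 < a) (c : ℝ) (s : ℕ) (g : ℤ → ℝ) (j : ℤ) :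
    fullKernel c s a g j = kernel c s a a g j := by
  unfold fullKernel kernel
  rw [sum_symm_eq ha]
  intro k hk
  have h1 : damping c s a (2 * a - k) = damping c s a k := by
    have := cos_angle_symm ha hk 1
    simp only [Int.cast_one, mul_one] at this
    rw [damping, damping, this]
  have h2 : modeSum a g j (2 * a - k) = modeSum a g j k :=
    Finset.sum_congr rfl fun x _ => by rw [cos_angle_symm ha hk]
  rw [h1, h2]

lemma modeSum_abs_le {a : ℕ} {g : ℤ → ℝ} {B : ℝ} {j : ℤ} (h : ∀ x ∈ window a, |g (j + x)| ≤ B) (k : ℕ) :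
    |modeSum a g j k| ≤ 2 * a * B := by
  refine (Finset.abs_sum_le_sum_abs _ _).trans ?_
  refine (Finset.sum_le_card_nsmul _ _ B fun x hx => ?_).trans (le_of_eq ?_)
  · rw [abs_mul]
    have h1 := Real.abs_cos_le_one (angle a k * x)
    have h2 := h x hx
    have := abs_nonneg (g (j + x))
    nlinarith [abs_nonneg (Real.cos (angle a k * x))]
  · rw [card_window]; simp

/-- Modes other than zero do not see constants, so their coefficients can be bounded by the
oscillation of the data instead of its size. -/
lemma modeSum_const {a : ℕ} (ha : 0 < a) {k : ℕ} (hk0 : 0 < k) (hk : k < 2 * a) (B : ℝ) (j : ℤ) :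
    modeSum a (fun _ => B) j k = 0 := by
  have h1 := sum_cos_angle ha k
  rw [if_neg] at h1
  · unfold modeSum
    rw [sum_window, ← Finset.sum_mul]
    have : ∀ l ∈ Finset.range (2 * a), Real.cos (angle a k * ((a - l : ℤ) : ℝ))
        = (-1) ^ k * Real.cos (angle a l * (k : ℤ)) := by
      intro l _
      have e : angle a k * ((a - l : ℤ) : ℝ) = k * Real.pi - angle a l * (k : ℤ) := by
        have ha' : (a : ℝ) ≠ 0 := by positivity
        unfold angle; push_cast; field_simp
      rw [e, Real.cos_nat_mul_pi_sub]
    rw [Finset.sum_congr rfl this, ← Finset.mul_sum, h1]; simp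
  · intro h
    have := Int.le_of_dvd (by omega) h
    omega

lemma weight_abs_le (a k : ℕ) : |weight a k| ≤ 2 := by
  unfold weight; split_ifs <;> norm_num

/-- At most `a` modes are dropped, each of weight at most `2`, damping at most `η` and coefficient
at most `2 a B`; the normalisation divides by `2 a`. -/
lemma kernel_diff_abs_le {a p : ℕ} (ha : 0 < a) (hp : p ≤ a) {c : ℝ} {s : ℕ} {η B : ℝ} {g : ℤ → ℝ} {j : ℤ}
    (hη : ∀ k, p < k → k ≤ a → |damping c s a k| ≤ η) (hη0 : 0 ≤ η)
    (hm : ∀ k, p < k → k ≤ a → |modeSum a g j k| ≤ 2 * a * B) (hB : 0 ≤ B) :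
    |fullKernel c s a g j - kernel c s a p g j| ≤ 2 * a * η * B := by
  have ha' : (0 : ℝ) < a := by positivity
  rw [fullKernel_eq_kernel ha]
  unfold kernel
  rw [← mul_sub, ← Finset.sum_sdiff (Finset.range_mono (show p + 1 ≤ a + 1 by omega)),
    add_sub_cancel_right, abs_mul, abs_of_pos (by positivity)]
  have h1 : |∑ k ∈ Finset.range (a + 1) \ Finset.range (p + 1),
      weight a k * (damping c s a k * modeSum a g j k)| ≤ a * (2 * (η * (2 * a * B))) := by
    refine (Finset.abs_sum_le_sum_abs _ _).trans ?_
    refine (Finset.sum_le_card_nsmul _ _ (2 * (η * (2 * a * B))) fun k hk => ?_).trans ?_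
    · simp only [Finset.mem_sdiff, Finset.mem_range, not_lt] at hk
      rw [abs_mul, abs_mul]
      exact mul_le_mul (weight_abs_le a k) (mul_le_mul (hη k (by omega) (by omega))
        (hm k (by omega) (by omega)) (abs_nonneg _) hη0) (by positivity) (by norm_num)
    · rw [nsmul_eq_mul]
      refine mul_le_mul_of_nonneg_right ?_ (by positivity)
      rw [Finset.card_sdiff_of_subset (Finset.range_mono (by omega))]
      simp only [Finset.card_range]
      exact_mod_cast (by omega)
  rw [div_mul_eq_mul_div, one_mul, div_le_iff₀ (by positivity)]
  refine h1.trans (le_of_eq ?_)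
  ring

lemma one_sub_cos_ge {x : ℝ} (hx : |x| ≤ Real.pi) : 4 * x ^ 2 / Real.pi ^ 2 ≤ 2 - 2 * Real.cos x := by
  have := Real.cos_le_one_sub_mul_cos_sq hx
  have e : 4 * x ^ 2 / Real.pi ^ 2 = 2 * (2 / Real.pi ^ 2 * x ^ 2) := by ring
  linarith

/-- With `c ≤ 1 / 4` the factor `1 - c λ` lies in `[0, 1]`, so its power is at most `exp (-c s λ)`;
the quadratic lower bound for `λ = 2 - 2 cos` finishes the estimate. -/
lemma damping_le_exp {c : ℝ} (hc0 : 0 ≤ c) (hc : c ≤ 1 / 4) (s : ℕ) {a k : ℕ} (ha : 0 < a) (hk : k ≤ a) :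
    |damping c s a k| ≤ Real.exp (-(c * s * (4 * k ^ 2 / a ^ 2))) := by
  have ha' : (0 : ℝ) < a := by positivity
  have hang : |angle a k| ≤ Real.pi := by
    unfold angle
    rw [abs_of_nonneg (by positivity), div_le_iff₀ ha']
    exact mul_le_mul_of_nonneg_left (by exact_mod_cast hk) Real.pi_pos.le
  have h1 := one_sub_cos_ge hang
  have e1 : 4 * (angle a k) ^ 2 / Real.pi ^ 2 = 4 * k ^ 2 / a ^ 2 := by
    unfold angle; field_simp
  rw [e1] at h1
  have hcos := Real.neg_one_le_cos (angle a k)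
  unfold damping
  set lam := 2 - 2 * Real.cos (angle a k)
  have h0 : 0 ≤ 1 - c * lam := by nlinarith
  rw [abs_of_nonneg (pow_nonneg h0 s)]
  calc (1 - c * lam) ^ s ≤ Real.exp (-(c * lam)) ^ s := by
        gcongr
        have := Real.add_one_le_exp (-(c * lam)); linarith
    _ = Real.exp (-(c * s * lam)) := by rw [← Real.exp_nat_mul]; congr 1; ring
    _ ≤ _ := by
      rw [Real.exp_le_exp]
      have : c * s * (4 * k ^ 2 / a ^ 2) ≤ c * s * lam := mul_le_mul_of_nonneg_left h1 (by positivity)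
      linarith

/-- A Chernoff argument: the rate `lam` is chosen so that the eigenvalue grows at most to `exp (2
l)`, while the barrier at distance `w` is of size `exp (4 l)`. -/
lemma cosh_tail {c : ℝ} (hc0 : 0 ≤ c) (s : ℕ) {l : ℝ} (hl : 1 ≤ l) {w : ℝ} (hw : 4 * l ≤ w)
    (hw2 : 16 * (c * s) * l ≤ w ^ 2) :
    ∃ lam : ℝ, 0 < lam ∧ 0 < Real.cosh (lam * w) - 1 ∧
      (1 + c * (2 * Real.cosh lam - 2)) ^ s - 1
        ≤ 8 * (c * s) * Real.exp (-(2 * l)) * (Real.cosh (lam * w) - 1) := by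
  set τ := c * s with hτ
  have hτ0 : 0 ≤ τ := by positivity
  have hw0 : 0 < w := by linarith
  -- The choice is `min 1 √(l / τ)`; the two lower bounds on `w` serve the two cases.
  obtain ⟨lam, h0, h1, h2, h3⟩ : ∃ lam : ℝ, 0 < lam ∧ lam ≤ 1 ∧ τ * lam ^ 2 ≤ l ∧ 4 * l ≤ lam * w := by
    by_cases h : τ ≤ l
    · exact ⟨1, one_pos, le_rfl, by simpa using h, by simpa using hw⟩
    · push Not at h
      have hτ' : 0 < τ := by linarith
      refine ⟨√(l / τ), Real.sqrt_pos.2 (by positivity), ?_, ?_, ?_⟩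
      · rw [Real.sqrt_le_one, div_le_one hτ']; exact h.le
      · rw [Real.sq_sqrt (by positivity)]; apply le_of_eq; field_simp
      · refine abs_le_of_sq_le_sq' ?_ (by positivity) |>.2
        rw [mul_pow (√_), Real.sq_sqrt (by positivity), div_mul_eq_mul_div, le_div_iff₀ hτ']
        nlinarith
  have hcosh : Real.exp (4 * l) / 4 ≤ Real.cosh (lam * w) - 1 := by
    have h4 : Real.cosh (4 * l) ≤ Real.cosh (lam * w) := by
      rw [Real.cosh_le_cosh, abs_of_nonneg (by linarith), abs_of_nonneg (by positivity)]
      exact h3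
    have h5 : Real.exp (4 * l) / 2 ≤ Real.cosh (4 * l) := by
      rw [Real.cosh_eq]
      have := Real.exp_pos (-(4 * l))
      linarith
    have h6 := Real.add_one_le_exp (4 * l)
    linarith
  refine ⟨lam, h0, by linarith [Real.exp_pos (4 * l)], ?_⟩
  have hlam2 : Real.cosh lam - 1 ≤ lam ^ 2 := by
    have h4 := Real.cosh_le_exp_half_sq lam
    have h5 : lam ^ 2 / 2 ≤ 1 := by nlinarith
    have h6 := Real.abs_exp_sub_one_le (x := lam ^ 2 / 2) (by rw [abs_of_nonneg (by positivity)]; exact h5)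
    have h7 := (le_abs_self _).trans h6
    rw [abs_of_nonneg (by positivity)] at h7
    linarith
  have hc1 : 0 ≤ Real.cosh lam - 1 := by linarith [Real.one_le_cosh lam]
  have hy : (1 + c * (2 * Real.cosh lam - 2)) ^ s ≤ Real.exp (2 * (τ * lam ^ 2)) := by
    calc (1 + c * (2 * Real.cosh lam - 2)) ^ s ≤ Real.exp (c * (2 * lam ^ 2)) ^ s := by
          have h8 : c * (2 * Real.cosh lam - 2) ≤ c * (2 * lam ^ 2) :=
            mul_le_mul_of_nonneg_left (by linarith) hc0
          have h9 : 0 ≤ c * (2 * Real.cosh lam - 2) := mul_nonneg hc0 (by linarith)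
          gcongr
          have := Real.add_one_le_exp (c * (2 * lam ^ 2)); linarith
      _ = _ := by rw [← Real.exp_nat_mul]; congr 1; rw [hτ]; ring
  have hy0 : 0 ≤ 2 * (τ * lam ^ 2) := by positivity
  -- Keeping the factor `τ` matters: the final error is then proportional to `τ`, and `d τ` times
  -- the fourth difference bound is of order `ε`.
  have hexp : Real.exp (2 * (τ * lam ^ 2)) - 1 ≤ 2 * (τ * lam ^ 2) * Real.exp (2 * (τ * lam ^ 2)) := by
    have h1 := Real.add_one_le_exp (-(2 * (τ * lam ^ 2)))
    have h2 := Real.exp_pos (2 * (τ * lam ^ 2))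
    have h3 : Real.exp (-(2 * (τ * lam ^ 2))) * Real.exp (2 * (τ * lam ^ 2)) = 1 := by
      rw [← Real.exp_add]; simp
    nlinarith
  have hlam1 : lam ^ 2 ≤ 1 := by nlinarith
  calc (1 + c * (2 * Real.cosh lam - 2)) ^ s - 1
      ≤ 2 * (τ * lam ^ 2) * Real.exp (2 * (τ * lam ^ 2)) := by linarith
    _ ≤ 2 * (τ * 1) * Real.exp (2 * l) := by gcongr
    _ = 8 * τ * Real.exp (-(2 * l)) * (Real.exp (4 * l) / 4) := by
      have : Real.exp (-(2 * l)) * Real.exp (4 * l) = Real.exp (2 * l) := by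
        rw [← Real.exp_add]; congr 1; ring
      linear_combination (-2 * τ) * this
    _ ≤ _ := by gcongr

/-- The smoothing by few modes is close to the power of the step. -/
lemma kernel_spec {c : ℝ} (hc0 : 0 ≤ c) (hc : c ≤ 1 / 4) {s n a p l d m : ℕ} (ha : 0 < a) (hp : p ≤ a)
    (han : a ≤ n) (hd : 0 < d) (hl : 1 ≤ l) (hnl : n ≤ 2 ^ l) (hnm : 4 * n * m ≤ 2 ^ (4 * l))
    (hdτ : d * (c * s) ≤ 2 * m)
    (hwin : a = n ∨ 4 * (l : ℝ) ≤ a ∧ 16 * (c * s) * l ≤ (a : ℝ) ^ 2)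
    (htr : p = a ∨ 8 * l ≤ p ∧ (a : ℝ) ^ 2 ≤ 64 * (c * s) * l) :
    (∀ (g : ℤ → ℝ) (Ω : ℝ), (∀ x y, |g x - g y| ≤ Ω) → (∀ x, g (x + n) = g x) → ∀ j,
      |kernel c s a p g j - (lineStep c ^ s) g j| ≤ 10 * (c * s) * Real.exp (-(2 * l)) * Ω) ∧
    ∀ (g : ℤ → ℝ) (B : ℝ), (∀ x, |g x| ≤ B) → ∀ j, |kernel c s a p g j| ≤ (1 + 1 / d) * B := by
  have ha' : (0 : ℝ) < a := by exact_mod_cast ha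
  have hl' : (1 : ℝ) ≤ l := by exact_mod_cast hl
  set τ := c * s with hτ
  have hτ0 : 0 ≤ τ := by positivity
  have hd' : (0 : ℝ) < d := by exact_mod_cast hd
  have h2e : (2 : ℝ) ^ l ≤ Real.exp l := by
    have : (2 : ℝ) ≤ Real.exp 1 := by linarith [Real.add_one_le_exp (1 : ℝ)]
    calc (2 : ℝ) ^ l ≤ Real.exp 1 ^ l := by gcongr
      _ = _ := by rw [← Real.exp_nat_mul]; simp
  have hne : (n : ℝ) ≤ Real.exp l := by
    refine le_trans ?_ h2e
    exact_mod_cast hnl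
  have han' : (a : ℝ) ≤ n := by exact_mod_cast han
  obtain ⟨η, hη0, hη, hη1, hη2⟩ : ∃ η : ℝ, 0 ≤ η ∧ (∀ k, p < k → k ≤ a → |damping c s a k| ≤ η) ∧
      2 * a * η ≤ 2 * τ * Real.exp (-(2 * l)) ∧ 2 * a * η ≤ 1 / d := by
    by_cases hpa : p = a
    · exact ⟨0, le_rfl, fun k h1 h2 => by omega, by rw [mul_zero]; positivity,
        by rw [mul_zero]; positivity⟩
    obtain ⟨hp8, ha2⟩ := htr.resolve_left hpa
    have hpa' : p < a := by omega
    have hal : 8 * (l : ℝ) ≤ a := by exact_mod_cast hp8.trans hpa'.le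
    have hτ1 : 1 ≤ τ := by
      by_contra h
      push Not at h
      have : (8 * (l : ℝ)) ^ 2 ≤ a ^ 2 := by gcongr
      nlinarith
    -- For `k > 8 l` the damping exponent `4 τ k ^ 2 / a ^ 2` is at least `256 τ l ^ 2 / (64 τ l) =
    -- 4 l`.
    refine ⟨Real.exp (-(4 * l)), (Real.exp_pos _).le, fun k h1 h2 => ?_, ?_, ?_⟩
    · refine (damping_le_exp hc0 hc s ha h2).trans ?_
      rw [Real.exp_le_exp, neg_le_neg_iff]
      have hk : 8 * (l : ℝ) ≤ k := by exact_mod_cast hp8.trans h1.le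
      have : (8 * (l : ℝ)) ^ 2 ≤ k ^ 2 := by gcongr
      rw [← hτ, ← mul_div_assoc, le_div_iff₀ (by positivity)]
      calc 4 * (l : ℝ) * a ^ 2 ≤ 4 * l * (64 * τ * l) := by gcongr
        _ = τ * (4 * (8 * l) ^ 2) := by ring
        _ ≤ _ := by gcongr
    · have e1 : Real.exp (-(4 * l : ℝ)) = Real.exp (-(2 * l)) * Real.exp (-(2 * l)) := by
        rw [← Real.exp_add]; congr 1; ring
      have e2 : (a : ℝ) * Real.exp (-(2 * l)) ≤ 1 := by
        calc (a : ℝ) * Real.exp (-(2 * l)) ≤ Real.exp l * Real.exp (-(2 * l)) := by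
              gcongr; linarith
          _ = Real.exp (-l) := by rw [← Real.exp_add]; congr 1; ring
          _ ≤ 1 := Real.exp_le_one_iff.2 (by linarith)
      rw [e1]
      have h3 := Real.exp_pos (-(2 * l : ℝ))
      calc 2 * (a : ℝ) * (Real.exp (-(2 * l)) * Real.exp (-(2 * l)))
          = 2 * Real.exp (-(2 * l)) * (a * Real.exp (-(2 * l))) := by ring
        _ ≤ 2 * Real.exp (-(2 * l)) * τ := by gcongr; linarith
        _ = _ := by ring
    -- From `τ ≥ 1` and `d τ ≤ 2 m`. Then `2 a d ≤ 4 n m`, and `nm_le` is designed so that `exp (4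
    -- l)` absorbs this product.
    · have h3 : (d : ℝ) ≤ 2 * m := by nlinarith
      have h4 : (4 * n * m : ℝ) ≤ Real.exp (4 * l) := by
        calc (4 * n * m : ℝ) ≤ (2 : ℝ) ^ (4 * l) := by exact_mod_cast hnm
          _ = ((2 : ℝ) ^ l) ^ 4 := by rw [mul_comm, pow_mul]
          _ ≤ Real.exp l ^ 4 := by gcongr
          _ = _ := by rw [← Real.exp_nat_mul]; push_cast; rfl
      rw [le_div_iff₀ hd', Real.exp_neg, mul_assoc, inv_mul_eq_div, mul_div_assoc',
        div_le_one (Real.exp_pos _)]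
      refine le_trans ?_ h4
      have : (a : ℝ) * d ≤ n * (2 * m) := by gcongr
      linarith
  constructor
  · intro g Ω hg hper j
    have hΩ : 0 ≤ Ω := (abs_nonneg _).trans (hg 0 0)
    have h1 : |fullKernel c s a g j - (lineStep c ^ s) g j| ≤ 8 * τ * Real.exp (-(2 * l)) * Ω := by
      -- If `a = n`, the window length `2 n` is a multiple of the period and windowing is exact.
      rcases hwin with rfl | ⟨hw1, hw2⟩
      · rw [fullKernel_of_periodic ha, sub_self, abs_zero]
        · positivity
        · intro x
          rw [two_mul, ← add_assoc, hper, hper]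
      · obtain ⟨lam, hlam, hpos, hle⟩ := cosh_tail hc0 s hl' hw1 hw2
        have h2 := fullKernel_sub_le ha hc0 hc s hg j hlam
        have h3 := h2.trans (mul_le_mul_of_nonneg_left hle hΩ)
        rw [← mul_assoc] at h3
        refine (le_of_mul_le_mul_right h3 hpos).trans (le_of_eq ?_)
        ring
    have h2 : |fullKernel c s a g j - kernel c s a p g j| ≤ 2 * a * η * Ω := by
      refine kernel_diff_abs_le ha hp hη hη0 (fun k hk1 hk2 => ?_) hΩ
      -- The dropped modes satisfy `k > p ≥ 0`, so a constant may be subtracted and `Ω` bounds what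
      -- remains.
      have e : modeSum a g j k = modeSum a (fun x => g x - g j) j k := by
        have h3 := modeSum_const ha (k := k) (by omega) (by omega) (g j) j
        unfold modeSum at h3 ⊢
        rw [← sub_zero (∑ x ∈ window a, _), ← h3, ← Finset.sum_sub_distrib]
        exact Finset.sum_congr rfl fun x _ => by ring
      rw [e]
      exact modeSum_abs_le (fun x _ => hg _ _) k
    have h3 := mul_le_mul_of_nonneg_right hη1 hΩ
    have e : kernel c s a p g j - (lineStep c ^ s) g j
        = (fullKernel c s a g j - (lineStep c ^ s) g j) - (fullKernel c s a g j - kernel c s a p g j) := by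
      ring
    rw [e]
    refine (abs_sub _ _).trans ?_
    linarith
  · intro g B hB j
    have hB0 : 0 ≤ B := (abs_nonneg _).trans (hB 0)
    have h1 := fullKernel_abs_le ha hc0 hc s hB j
    have h2 : |fullKernel c s a g j - kernel c s a p g j| ≤ 2 * a * η * B :=
      kernel_diff_abs_le ha hp hη hη0 (fun k _ _ => modeSum_abs_le (fun x _ => hB _) k) hB0
    have h3 := mul_le_mul_of_nonneg_right hη2 hB0
    have e : kernel c s a p g j = fullKernel c s a g j - (fullKernel c s a g j - kernel c s a p g j) := by
      ring
    rw [e]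
    refine (abs_sub _ _).trans ?_
    linarith

end HeatFFT
end

open Set
noncomputable section
namespace HeatFFT

/-! ## Fixed-point arithmetic -/

/-- The remainder lies in `[0, |y|)` for either sign of `y`. The negative case is needed for the
alternating series. -/
lemma abs_ediv_sub_le (x : ℤ) {y : ℤ} (hy : y ≠ 0) : |((x / y : ℤ) : ℝ) - (x : ℝ) / y| ≤ 1 := by
  have hy' : (y : ℝ) ≠ 0 := by exact_mod_cast hy
  have h1 : (y : ℝ) * (x / y : ℤ) + (x % y : ℤ) = x := by exact_mod_cast Int.mul_ediv_add_emod x y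
  have h2 : ((x % y : ℤ) : ℝ) < |(y : ℝ)| := by exact_mod_cast Int.emod_lt_abs x hy
  have h3 : (0 : ℝ) ≤ (x % y : ℤ) := by exact_mod_cast Int.emod_nonneg x hy
  have e : ((x / y : ℤ) : ℝ) - (x : ℝ) / y = -((x % y : ℤ) / y) := by
    rw [← h1]; field_simp; ring
  rw [e, abs_neg, abs_div, abs_of_nonneg h3, div_le_one (abs_pos.2 hy')]
  exact h2.le

/-! ### Fixed-point approximation of `π`. -/

/-- Repeated division, starting from `B / r`. -/
def quotSeq (B r e : ℤ) : ℕ → ℤ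
  | 0 => B / r
  | t + 1 => quotSeq B r e t / e

/-- Partial sums for `π / 4` in units `1 / B`. -/
def piSum (B : ℤ) : ℕ → ℤ
  | 0 => 0
  | t + 1 => piSum B t + (quotSeq B 2 (-4) t + quotSeq B 3 (-9) t) / (2 * t + 1)

/-- Division by `-r ^ 2` contracts the accumulated error by at least `4` and adds at most `1`, so it
never exceeds `2`. The limit terms are those of the series for `arctan (1 / r)`, up to the
denominators. -/
lemma quotSeq_err (B : ℤ) (r : ℕ) (hr : 2 ≤ r) (t : ℕ) :
    |(quotSeq B r (-(r ^ 2 : ℕ)) t : ℝ) - B * ((-1) ^ t * ((r : ℝ)⁻¹) ^ (2 * t + 1))| ≤ 2 := by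
  have hr' : (2 : ℝ) ≤ r := by exact_mod_cast hr
  have hr0 : (r : ℝ) ≠ 0 := by positivity
  induction t with
  | zero =>
    have := abs_ediv_sub_le B (y := r) (by omega)
    have e : (B : ℝ) * ((-1) ^ 0 * ((r : ℝ)⁻¹) ^ (2 * 0 + 1)) = B / r := by
      simp [div_eq_mul_inv]
    rw [quotSeq, e]
    push_cast at this
    linarith
  | succ t ih =>
    have h1 := abs_ediv_sub_le (quotSeq B r (-(r ^ 2 : ℕ)) t) (y := -(r ^ 2 : ℕ))
      (by simp; omega)
    rw [quotSeq]
    push_cast at h1 ih ⊢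
    set Q : ℝ := (quotSeq B r (-(r : ℤ) ^ 2) t : ℝ)
    have e : (B : ℝ) * ((-1) ^ (t + 1) * ((r : ℝ)⁻¹) ^ (2 * (t + 1) + 1))
        = B * ((-1) ^ t * ((r : ℝ)⁻¹) ^ (2 * t + 1)) / -(r : ℝ) ^ 2 := by
      have : 2 * (t + 1) + 1 = 2 * t + 1 + 2 := by ring
      rw [this, pow_add _ (2 * t + 1) 2, pow_succ (-1 : ℝ)]
      field_simp
    have h2 : |Q / -(r : ℝ) ^ 2 - B * ((-1) ^ (t + 1) * ((r : ℝ)⁻¹) ^ (2 * (t + 1) + 1))| ≤ 1 := by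
      rw [e, ← sub_div, abs_div, abs_neg, abs_of_pos (show (0 : ℝ) < (r : ℝ) ^ 2 by positivity),
        div_le_one (by positivity)]
      nlinarith
    calc _ ≤ _ := abs_sub_le _ (Q / -(r : ℝ) ^ 2) _
      _ ≤ 2 := by linarith

lemma arctan_partial (x : ℝ) (hx0 : 0 ≤ x) (hx : x ≤ 1 / 2) (t : ℕ) :
    |∑ k ∈ Finset.range t, (-1) ^ k * x ^ (2 * k + 1) / ((2 * k + 1 : ℕ) : ℝ) - Real.arctan x|
      ≤ 1 / 4 ^ t := by
  have h := norm_sub_le_of_geometric_bound_of_hasSum (r := 1 / 4) (C := 1 / 2) (by norm_num)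
    (fun k => ?_) (Real.hasSum_arctan (x := x) (by rw [Real.norm_eq_abs, abs_of_nonneg hx0]; linarith)) t
  · refine h.trans ?_
    rw [one_div_pow]
    have : (0 : ℝ) < 1 / 4 ^ t := by positivity
    rw [div_le_iff₀ (by norm_num)]
    linarith
  · rw [norm_div, norm_mul, norm_pow, norm_neg, norm_one, one_pow, one_mul, norm_pow,
      Real.norm_eq_abs, abs_of_nonneg hx0, Real.norm_eq_abs, Nat.abs_cast]
    have h1 : x ^ (2 * k + 1) ≤ (1 / 2) ^ (2 * k + 1) := by gcongr
    have h2 : (1 / 2 : ℝ) ^ (2 * k + 1) = 1 / 2 * (1 / 4) ^ k := by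
      rw [pow_succ, pow_mul]; norm_num; ring
    rw [← h2]
    refine (div_le_self (by positivity) ?_).trans h1
    exact_mod_cast (by omega : 1 ≤ 2 * k + 1)

/-- Euler's identity `arctan (1/2) + arctan (1/3) = π / 4`. Each term loses at most five units: two
from each repeated quotient and one from the final division. The tails of both series are geometric.
-/
lemma piSum_err {B : ℤ} (hB : 0 < B) (t : ℕ) :
    |4 * (piSum B t : ℝ) / B - Real.pi| ≤ 20 * t / B + 8 / 4 ^ t := by
  have hB' : (0 : ℝ) < B := by exact_mod_cast hB
  have h1 : |(piSum B t : ℝ) - B * ∑ k ∈ Finset.range t,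
      ((-1) ^ k * (2⁻¹ : ℝ) ^ (2 * k + 1) / ((2 * k + 1 : ℕ) : ℝ)
        + (-1) ^ k * (3⁻¹ : ℝ) ^ (2 * k + 1) / ((2 * k + 1 : ℕ) : ℝ))| ≤ 5 * t := by
    induction t with
    | zero => simp [piSum]
    | succ t ih =>
      rw [piSum, Finset.sum_range_succ, mul_add]
      have a1 := quotSeq_err B 2 (by norm_num) t
      have a2 := quotSeq_err B 3 (by norm_num) t
      norm_num at a1 a2
      have a3 := abs_ediv_sub_le (quotSeq B 2 (-4) t + quotSeq B 3 (-9) t) (y := 2 * t + 1) (by omega)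
      have hk : (1 : ℝ) ≤ 2 * t + 1 := by linarith [(Nat.cast_nonneg t : (0 : ℝ) ≤ t)]
      push_cast at a3 ih ⊢
      set q2 : ℝ := (quotSeq B 2 (-4) t : ℝ)
      set q3 : ℝ := (quotSeq B 3 (-9) t : ℝ)
      have a4 : |(q2 + q3) / (2 * t + 1) - B * ((-1) ^ t * (2⁻¹ : ℝ) ^ (2 * t + 1) / (2 * t + 1)
          + (-1) ^ t * (3⁻¹ : ℝ) ^ (2 * t + 1) / (2 * t + 1))| ≤ 4 := by
        have e : (q2 + q3) / (2 * t + 1) - B * ((-1) ^ t * (2⁻¹ : ℝ) ^ (2 * t + 1) / (2 * t + 1)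
          + (-1) ^ t * (3⁻¹ : ℝ) ^ (2 * t + 1) / (2 * t + 1))
          = ((q2 - B * ((-1) ^ t * (2⁻¹ : ℝ) ^ (2 * t + 1)))
            + (q3 - B * ((-1) ^ t * (3⁻¹ : ℝ) ^ (2 * t + 1)))) / (2 * t + 1) := by
          field_simp; ring
        rw [e, abs_div, abs_of_pos (show (0 : ℝ) < 2 * t + 1 by linarith)]
        refine (div_le_self (abs_nonneg _) hk).trans ((abs_add_le _ _).trans ?_)
        have b1 : |q2 - B * ((-1) ^ t * (2⁻¹ : ℝ) ^ (2 * t + 1))| ≤ 2 := by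
          simpa using a1
        have b2 : |q3 - B * ((-1) ^ t * (3⁻¹ : ℝ) ^ (2 * t + 1))| ≤ 2 := by
          simpa using a2
        linarith
      have a5 := abs_sub_le (((quotSeq B 2 (-4) t + quotSeq B 3 (-9) t) / (2 * t + 1) : ℤ) : ℝ)
        ((q2 + q3) / (2 * t + 1)) (B * ((-1) ^ t * (2⁻¹ : ℝ) ^ (2 * t + 1) / (2 * t + 1)
          + (-1) ^ t * (3⁻¹ : ℝ) ^ (2 * t + 1) / (2 * t + 1)))
      rw [add_sub_add_comm]
      refine (abs_add_le _ _).trans ?_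
      linarith
  have h2 := arctan_partial 2⁻¹ (by norm_num) (by norm_num) t
  have h3 := arctan_partial 3⁻¹ (by norm_num) (by norm_num) t
  have h4 := Real.arctan_inv_2_add_arctan_inv_3
  rw [Finset.sum_add_distrib] at h1
  set S2 := ∑ k ∈ Finset.range t, (-1) ^ k * (2⁻¹ : ℝ) ^ (2 * k + 1) / ((2 * k + 1 : ℕ) : ℝ)
  set S3 := ∑ k ∈ Finset.range t, (-1) ^ k * (3⁻¹ : ℝ) ^ (2 * k + 1) / ((2 * k + 1 : ℕ) : ℝ)
  have e : 4 * (piSum B t : ℝ) / B - Real.pi = 4 * ((piSum B t - B * (S2 + S3)) / B)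
      + 4 * ((S2 - Real.arctan 2⁻¹) + (S3 - Real.arctan 3⁻¹)) := by
    have : Real.pi = 4 * (Real.arctan 2⁻¹ + Real.arctan 3⁻¹) := by rw [h4]; ring
    rw [this]; field_simp; ring
  rw [e]
  refine (abs_add_le _ _).trans ?_
  rw [abs_mul, abs_mul, abs_div, abs_of_pos hB', abs_of_pos (by norm_num : (0 : ℝ) < 4)]
  have h5 := abs_add_le (S2 - Real.arctan 2⁻¹) (S3 - Real.arctan 3⁻¹)
  have h6 : |(piSum B t : ℝ) - B * (S2 + S3)| / B ≤ 5 * t / B := by gcongr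
  have e1 : 20 * (t : ℝ) / B = 4 * (5 * t / B) := by ring
  have e2 : (8 : ℝ) / 4 ^ t = 4 * (1 / 4 ^ t + 1 / 4 ^ t) := by ring
  rw [e1, e2]
  linarith

/-! ### Fixed-point cosines and damping factors. -/

/-- The cosine of the angle of mode `k`, in units `1 / B`, from an approximation `ps / B` of `π / 4`,
by `R` doublings of the angle. -/
def cosStart (B V ps : ℤ) (a k : ℕ) : ℤ :=
  B - (32 * ps * ps * k * k) / (B * (2 * a) * (2 * a) * V)

/-- The start is `1 - x ^ 2 / 2` at the angle divided by `2 ^ R`, with `V = 4 ^ R` supplying the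
square of that denominator; each round applies `cos 2y = 2 cos² y - 1`. -/
def cosFix (B V ps : ℤ) (a k : ℕ) : ℕ → ℤ
  | 0 => cosStart B V ps a k
  | r + 1 => (2 * cosFix B V ps a k r * cosFix B V ps a k r) / B - B

/-- In units of `16 ^ (-R)`: at most `6` from the Taylor remainder, `112` from the approximation of
`π`, and `1` from the division. -/
lemma cosStart_err {R a k : ℕ} {ps : ℤ} (hR : 6 ≤ R) (ha : 0 < a) (hk : k ≤ a)
    (hps : |4 * (ps : ℝ) / 16 ^ R - Real.pi| ≤ 28 / 4 ^ R) :
    |(cosStart (16 ^ R) (4 ^ R) ps a k : ℝ) / 16 ^ R - Real.cos (angle a k / 2 ^ R)|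
      ≤ 120 / 16 ^ R := by
  have ha' : (0 : ℝ) < a := by exact_mod_cast ha
  have hk' : (k : ℝ) / a ≤ 1 := by rw [div_le_one ha']; exact_mod_cast hk
  have hk0 : 0 ≤ (k : ℝ) / a := by positivity
  have hpi := Real.pi_pos
  have hpi4 := Real.pi_lt_d2
  have h16 : (16 : ℝ) ^ R = 4 ^ R * 4 ^ R := by rw [← mul_pow]; norm_num
  have h4 : (4 : ℝ) ^ R = 2 ^ R * 2 ^ R := by rw [← mul_pow]; norm_num
  have h4R : (4096 : ℝ) ≤ 4 ^ R := by
    calc (4096 : ℝ) = 4 ^ 6 := by norm_num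
      _ ≤ 4 ^ R := pow_le_pow_right₀ (by norm_num) hR
  have h2R : (64 : ℝ) ≤ 2 ^ R := by
    calc (64 : ℝ) = 2 ^ 6 := by norm_num
      _ ≤ 2 ^ R := pow_le_pow_right₀ (by norm_num) hR
  set x := angle a k / 2 ^ R with hx
  set ph := 4 * (ps : ℝ) / 16 ^ R with hph
  have hx0 : 0 ≤ x := by rw [hx, angle]; positivity
  have hxe : x = Real.pi * (k / a) / 2 ^ R := by rw [hx, angle]; ring
  have hxle : x ≤ Real.pi / 2 ^ R := by
    rw [hxe]; gcongr; nlinarith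
  have hx1 : |x| ≤ 1 := by
    rw [abs_of_nonneg hx0]
    refine hxle.trans ?_
    rw [div_le_one (by positivity)]; linarith
  have c1 := Real.cos_bound hx1
  rw [abs_of_nonneg hx0] at c1
  have c2 : x ^ 4 * (5 / 96) ≤ 6 / 16 ^ R := by
    have : x ^ 4 ≤ (3.15 / 2 ^ R) ^ 4 := by
      gcongr; exact hxle.trans (by gcongr)
    rw [div_pow (3.15 : ℝ)] at this
    have e : ((2 : ℝ) ^ R) ^ 4 = 16 ^ R := by rw [← pow_mul, mul_comm, pow_mul]; norm_num
    rw [e] at this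
    calc x ^ 4 * (5 / 96) ≤ 3.15 ^ 4 / 16 ^ R * (5 / 96) := by gcongr
      _ = (3.15 ^ 4 * (5 / 96)) / 16 ^ R := by ring
      _ ≤ _ := by gcongr; norm_num
  have c3 : |ph ^ 2 - Real.pi ^ 2| ≤ 224 / 4 ^ R := by
    have e1 : ph ^ 2 - Real.pi ^ 2 = (ph - Real.pi) * (ph - Real.pi + 2 * Real.pi) := by ring
    have e2 : (28 : ℝ) / 4 ^ R ≤ 1 := by rw [div_le_one (by positivity)]; linarith
    have e3 : |ph - Real.pi + 2 * Real.pi| ≤ 8 := by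
      refine (abs_add_le _ _).trans ?_
      rw [abs_of_pos (by positivity : 0 < 2 * Real.pi)]; linarith
    rw [e1, abs_mul]
    calc _ ≤ (28 : ℝ) / 4 ^ R * 8 := by gcongr
      _ = 224 / 4 ^ R := by ring
  have c4 : |(32 * ps * ps * k * k : ℝ) / (16 ^ R * (2 * a) * (2 * a) * 4 ^ R) / 16 ^ R - x ^ 2 / 2|
      ≤ 112 / 16 ^ R := by
    have e : (32 * ps * ps * k * k : ℝ) / (16 ^ R * (2 * a) * (2 * a) * 4 ^ R) / 16 ^ R - x ^ 2 / 2
        = (k / a) ^ 2 * (ph ^ 2 - Real.pi ^ 2) / (2 * 4 ^ R) := by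
      rw [hxe, hph, h4]; field_simp; ring
    rw [e, abs_div, abs_mul, abs_of_nonneg (by positivity : (0 : ℝ) ≤ (k / a) ^ 2),
      abs_of_pos (by positivity : (0 : ℝ) < 2 * 4 ^ R)]
    have : ((k : ℝ) / a) ^ 2 ≤ 1 := by nlinarith
    calc _ ≤ (1 : ℝ) * (224 / 4 ^ R) / (2 * 4 ^ R) := by gcongr
      _ = 112 / 16 ^ R := by rw [h16]; field_simp; norm_num
  have c5 := abs_ediv_sub_le (32 * ps * ps * k * k) (y := 16 ^ R * (2 * a) * (2 * a) * 4 ^ R)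
    (by positivity)
  push_cast at c5
  have h16p : (0 : ℝ) < 16 ^ R := by positivity
  have c6 : |((32 * ps * ps * k * k / (16 ^ R * (2 * a) * (2 * a) * 4 ^ R) : ℤ) : ℝ) / 16 ^ R
      - (32 * ps * ps * k * k : ℝ) / (16 ^ R * (2 * a) * (2 * a) * 4 ^ R) / 16 ^ R| ≤ 1 / 16 ^ R := by
    rw [← sub_div, abs_div, abs_of_pos h16p]; gcongr
  have e : (cosStart (16 ^ R) (4 ^ R) ps a k : ℝ) / 16 ^ R - Real.cos x
      = -(((32 * ps * ps * k * k / (16 ^ R * (2 * a) * (2 * a) * 4 ^ R) : ℤ) : ℝ) / 16 ^ R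
      - (32 * ps * ps * k * k : ℝ) / (16 ^ R * (2 * a) * (2 * a) * 4 ^ R) / 16 ^ R)
      - ((32 * ps * ps * k * k : ℝ) / (16 ^ R * (2 * a) * (2 * a) * 4 ^ R) / 16 ^ R - x ^ 2 / 2)
      - (Real.cos x - (1 - x ^ 2 / 2)) := by
    rw [cosStart, Int.cast_sub]
    push_cast
    field_simp
    ring
  rw [e]
  have e2 : (120 : ℝ) / 16 ^ R = 1 / 16 ^ R + 112 / 16 ^ R + 7 / 16 ^ R := by ring
  have e3 : (6 : ℝ) / 16 ^ R ≤ 7 / 16 ^ R := by gcongr; norm_num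
  have d1 := abs_le.1 c1
  have d4 := abs_le.1 c4
  have d6 := abs_le.1 c6
  rw [e2, abs_le]
  constructor <;> linarith [d1.1, d1.2, d4.1, d4.2, d6.1, d6.2]

lemma five_pow_le {R : ℕ} : (5 : ℝ) ^ R / 16 ^ R ≤ 1 / 3 ^ R := by
  rw [div_le_div_iff₀ (by positivity) (by positivity), one_mul, ← mul_pow]
  exact pow_le_pow_left₀ (by norm_num) (by norm_num) R

/-- Each doubling multiplies the error by at most `5`. After `R` doublings the initial accuracy `16
^ (-R)` is still better than `3 ^ (-R)`, since `5 * 3 ≤ 16`. -/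
lemma cosFix_err {R a k : ℕ} {ps : ℤ} (hR : 6 ≤ R) (ha : 0 < a) (hk : k ≤ a)
    (hps : |4 * (ps : ℝ) / 16 ^ R - Real.pi| ≤ 28 / 4 ^ R) :
    |(cosFix (16 ^ R) (4 ^ R) ps a k R : ℝ) / 16 ^ R - Real.cos (angle a k)| ≤ 121 / 3 ^ R := by
  have h16p : (0 : ℝ) < 16 ^ R := by positivity
  have h3R : (729 : ℝ) ≤ 3 ^ R := by
    calc (729 : ℝ) = 3 ^ 6 := by norm_num
      _ ≤ 3 ^ R := pow_le_pow_right₀ (by norm_num) hR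
  -- The extra quarter unit turns the affine recursion `e ↦ 5 e + 1` for the error into the purely
  -- geometric one for `e + 1 / 4`.
  have main : ∀ r ≤ R, |(cosFix (16 ^ R) (4 ^ R) ps a k r : ℝ) / 16 ^ R
      - Real.cos (2 ^ r * (angle a k / 2 ^ R))| + 1 / 4 / 16 ^ R ≤ 121 * 5 ^ r / 16 ^ R := by
    intro r
    induction r with
    | zero =>
      intro _
      have := cosStart_err hR ha hk hps
      rw [cosFix, pow_zero, one_mul]
      have e : (121 : ℝ) * 5 ^ 0 / 16 ^ R = 120 / 16 ^ R + 1 / 16 ^ R := by ring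
      have e1 : (1 / 4 : ℝ) / 16 ^ R ≤ 1 / 16 ^ R := by gcongr; norm_num
      rw [e]; linarith
    | succ r ih =>
      intro hr
      have ih := ih (by omega)
      set y := 2 ^ r * (angle a k / 2 ^ R)
      set C := cosFix (16 ^ R) (4 ^ R) ps a k r with hC
      have hy : (2 : ℝ) ^ (r + 1) * (angle a k / 2 ^ R) = 2 * y := by simp only [y]; ring
      have hsmall : (121 : ℝ) * 5 ^ r / 16 ^ R ≤ 1 / 2 := by
        have h1 : (5 : ℝ) ^ r ≤ 5 ^ R := pow_le_pow_right₀ (by norm_num) (by omega)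
        have h2 := five_pow_le (R := R)
        calc (121 : ℝ) * 5 ^ r / 16 ^ R ≤ 121 * 5 ^ R / 16 ^ R := by gcongr
          _ = 121 * (5 ^ R / 16 ^ R) := by ring
          _ ≤ 121 * (1 / 3 ^ R) := by gcongr
          _ ≤ 121 * (1 / 729) := by gcongr
          _ ≤ _ := by norm_num
      have hd := abs_ediv_sub_le (2 * C * C) (y := 16 ^ R) (by positivity)
      push_cast at hd
      have hd' : |((2 * C * C / 16 ^ R : ℤ) : ℝ) / 16 ^ R - 2 * ((C : ℝ) / 16 ^ R) ^ 2| ≤ 1 / 16 ^ R := by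
        have e : ((2 * C * C / 16 ^ R : ℤ) : ℝ) / 16 ^ R - 2 * ((C : ℝ) / 16 ^ R) ^ 2
            = (((2 * C * C / 16 ^ R : ℤ) : ℝ) - 2 * C * C / 16 ^ R) / 16 ^ R := by
          field_simp
        rw [e, abs_div, abs_of_pos h16p]; gcongr
      rw [hy, Real.cos_two_mul, cosFix, ← hC]
      push_cast
      set e := (C : ℝ) / 16 ^ R - Real.cos y with he
      have hcy := Real.abs_cos_le_one y
      have e1 : (((2 * C * C / 16 ^ R : ℤ) : ℝ) - 16 ^ R) / 16 ^ R - (2 * Real.cos y ^ 2 - 1)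
          = (((2 * C * C / 16 ^ R : ℤ) : ℝ) / 16 ^ R - 2 * ((C : ℝ) / 16 ^ R) ^ 2)
            + 2 * (e * (2 * Real.cos y + e)) := by
        rw [he]; field_simp; ring
      rw [e1]
      have h0 : (0 : ℝ) < 1 / 4 / 16 ^ R := by positivity
      have he2 : |e| ≤ 1 / 2 := by linarith
      have h5 : |e * (2 * Real.cos y + e)| ≤ |e| * (5 / 2) := by
        rw [abs_mul]
        refine mul_le_mul_of_nonneg_left ?_ (abs_nonneg e)
        refine (abs_add_le _ _).trans ?_
        rw [abs_mul, abs_of_pos (by norm_num : (0 : ℝ) < 2)]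
        linarith
      have h6 := abs_add_le (((2 * C * C / 16 ^ R : ℤ) : ℝ) / 16 ^ R - 2 * ((C : ℝ) / 16 ^ R) ^ 2)
        (2 * (e * (2 * Real.cos y + e)))
      rw [abs_mul 2, abs_of_pos (by norm_num : (0 : ℝ) < 2)] at h6
      have e3 : (121 : ℝ) * 5 ^ (r + 1) / 16 ^ R = 5 * (121 * 5 ^ r / 16 ^ R) := by ring
      have e4 : (1 : ℝ) / 16 ^ R = 4 * (1 / 4 / 16 ^ R) := by ring
      rw [e3]
      linarith
  have h := main R le_rfl
  have e : (2 : ℝ) ^ R * (angle a k / 2 ^ R) = angle a k := by field_simp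
  rw [e] at h
  have h2 := five_pow_le (R := R)
  have h0 : (0 : ℝ) < 1 / 4 / 16 ^ R := by positivity
  have e2 : (121 : ℝ) * 5 ^ R / 16 ^ R = 121 * (5 ^ R / 16 ^ R) := by ring
  have e3 : (121 : ℝ) / 3 ^ R = 121 * (1 / 3 ^ R) := by ring
  rw [e2] at h
  rw [e3]
  linarith

/-- The damping factor by repeated squaring, in units `1 / B`. -/
def dampFix (B ch C : ℤ) : ℕ → ℤ
  | 0 => B - (2 * ch * (B - C)) / B
  | r + 1 => (dampFix B ch C r * dampFix B ch C r) / B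

/-- As long as the error is at most `1`, squaring a number of modulus at most `1` multiplies it by
at most `3`; the rounding unit is covered by raising the factor to `4`. -/
lemma dampFix_err {B ch C : ℤ} (hB : 0 < B) {c : ℝ} (hc : c = ch / B) (hc0 : 0 ≤ c) (hc4 : c ≤ 1 / 4)
    {a k q : ℕ} {η : ℝ} (hη : |(C : ℝ) / B - Real.cos (angle a k)| ≤ η) (hηB : 2 / B ≤ η)
    (hq : 4 ^ q * η ≤ 1) :
    |(dampFix B ch C q : ℝ) / B - damping c (2 ^ q) a k| ≤ 4 ^ q * η := by
  have hB' : (0 : ℝ) < B := by exact_mod_cast hB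
  have hη0 : 0 < η := lt_of_lt_of_le (by positivity) hηB
  set μ := 1 - c * (2 - 2 * Real.cos (angle a k)) with hμ
  have hμ1 : |μ| ≤ 1 := by
    have h1 := Real.neg_one_le_cos (angle a k)
    have h2 := Real.cos_le_one (angle a k)
    rw [abs_le]; constructor <;> nlinarith
  have main : ∀ r ≤ q, |(dampFix B ch C r : ℝ) / B - μ ^ (2 ^ r)| ≤ 4 ^ r * η := by
    intro r
    induction r with
    | zero =>
      intro _
      rw [dampFix]
      have hd := abs_ediv_sub_le (2 * ch * (B - C)) (y := B) hB.ne'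
      push_cast at hd ⊢
      have hd' : |((2 * ch * (B - C) / B : ℤ) : ℝ) / B - 2 * ch * (B - C) / B / B| ≤ 1 / B := by
        rw [← sub_div, abs_div, abs_of_pos hB']; gcongr
      have e : ((B : ℝ) - ((2 * ch * (B - C) / B : ℤ) : ℝ)) / B - μ ^ 1
          = -(((2 * ch * (B - C) / B : ℤ) : ℝ) / B - 2 * ch * (B - C) / B / B)
            + 2 * c * (C / B - Real.cos (angle a k)) := by
        rw [hμ, hc]
        generalize (((2 * ch * (B - C) / B : ℤ)) : ℝ) = D
        rw [pow_one]; field_simp; ring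
      rw [e, pow_zero, one_mul]
      refine (abs_add_le _ _).trans ?_
      rw [abs_neg, abs_mul, abs_of_nonneg (by linarith : 0 ≤ 2 * c)]
      have h1 : 2 * c * |(C : ℝ) / B - Real.cos (angle a k)| ≤ 2 * (1 / 4) * η := by gcongr
      have h2 : (1 : ℝ) / B = (2 / B) / 2 := by ring
      linarith
    | succ r ih =>
      intro hr
      have ih := ih (by omega)
      set X := dampFix B ch C r with hX
      rw [dampFix, ← hX]
      have hd := abs_ediv_sub_le (X * X) (y := B) hB.ne'
      push_cast at hd ⊢
      have hd' : |((X * X / B : ℤ) : ℝ) / B - ((X : ℝ) / B) ^ 2| ≤ 1 / B := by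
        have e : ((X * X / B : ℤ) : ℝ) / B - ((X : ℝ) / B) ^ 2
            = (((X * X / B : ℤ) : ℝ) - X * X / B) / B := by field_simp
        rw [e, abs_div, abs_of_pos hB']; gcongr
      have hm : |μ ^ (2 ^ r)| ≤ 1 := by rw [abs_pow]; exact pow_le_one₀ (abs_nonneg _) hμ1
      set M := μ ^ (2 ^ r) with hM
      have hM2 : μ ^ (2 ^ (r + 1)) = M ^ 2 := by rw [hM, ← pow_mul, pow_succ]
      set e := (X : ℝ) / B - M with he
      have hE : (4 : ℝ) ^ r * η ≤ 1 := by
        refine le_trans ?_ hq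
        gcongr
        · norm_num
        · omega
      have e1 : ((X * X / B : ℤ) : ℝ) / B - M ^ 2
          = (((X * X / B : ℤ) : ℝ) / B - ((X : ℝ) / B) ^ 2) + e * (2 * M + e) := by
        rw [he]; ring
      rw [hM2, e1]
      refine (abs_add_le _ _).trans ?_
      have h5 : |e * (2 * M + e)| ≤ |e| * 3 := by
        rw [abs_mul]
        refine mul_le_mul_of_nonneg_left ?_ (abs_nonneg e)
        refine (abs_add_le _ _).trans ?_
        rw [abs_mul, abs_of_pos (by norm_num : (0 : ℝ) < 2)]
        linarith
      have h6 : (1 : ℝ) / B ≤ 4 ^ r * η := by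
        have h2 : (1 : ℝ) / B = (2 / B) / 2 := by ring
        have : (1 : ℝ) ≤ 4 ^ r := one_le_pow₀ (by norm_num)
        nlinarith
      have h7 : (4 : ℝ) ^ (r + 1) * η = 4 * (4 ^ r * η) := by ring
      rw [h7]
      linarith
  have := main q le_rfl
  simpa [damping, hμ] using this

end HeatFFT
end

open Set
noncomputable section
namespace HeatFFT

/-! ## Sliding window sums by a recurrence -/

/-- The difference of the entries entering and leaving a window of length `P`. -/
def delta (P : ℕ) (g : ℕ → ℤ) (t : ℕ) : ℤ := g t - if P ≤ t then g (t - P) else 0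

/-- The difference of the previous step. -/
def prevDelta (P : ℕ) (g : ℕ → ℤ) (t : ℕ) : ℤ := if t = 0 then 0 else delta P g (t - 1)

/-- The current and the previous window sum after `t` steps. -/
def ySeq (B C : ℤ) (P : ℕ) (g : ℕ → ℤ) : ℕ → ℤ × ℤ
  | 0 => (0, 0)
  | t + 1 => (((2 * (ySeq B C P g t).1 - prevDelta P g t) * C) / B - (ySeq B C P g t).2 + delta P g t,
      (ySeq B C P g t).1)

/-- Extension by zero to negative indices. -/
def extendZero (g : ℕ → ℤ) (x : ℤ) : ℝ := if x < 0 then 0 else (g x.toNat : ℝ)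

/-- The exact window sum after `t` steps. -/
def yExact (θ : ℝ) (P : ℕ) (g : ℕ → ℤ) (t : ℤ) : ℝ :=
  ∑ l ∈ Finset.range P, Real.cos (θ * l) * extendZero g (t - 1 - l)

/-- The addition theorem makes the interior terms cancel; only the two ends of the window
contribute. This is Goertzel's recurrence for a moving window. -/
lemma window_recurrence (θ : ℝ) (f : ℤ → ℝ) (t : ℤ) (P : ℕ) :
    ∑ l ∈ Finset.range P, Real.cos (θ * l) * f (t - l)
      - 2 * Real.cos θ * ∑ l ∈ Finset.range P, Real.cos (θ * l) * f (t - 1 - l)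
      + ∑ l ∈ Finset.range P, Real.cos (θ * l) * f (t - 2 - l)
      = f t - Real.cos θ * f (t - 1) - Real.cos (P * θ) * f (t - P)
        + Real.cos (P * θ - θ) * f (t - 1 - P) := by
  induction P with
  | zero => simp
  | succ P ih =>
    simp only [Finset.sum_range_succ, mul_add]
    have e1 : ((P + 1 : ℕ) : ℝ) * θ = P * θ + θ := by push_cast; ring
    have e2 : t - ((P + 1 : ℕ) : ℤ) = t - 1 - P := by push_cast; ring
    have e3 : t - 1 - ((P + 1 : ℕ) : ℤ) = t - 2 - P := by push_cast; ring
    rw [e1, e2, e3, add_sub_cancel_right, mul_comm θ (P : ℝ), Real.cos_add]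
    rw [Real.cos_sub] at ih
    linear_combination ih

lemma extendZero_delta (P : ℕ) (g : ℕ → ℤ) (t : ℕ) :
    extendZero g t - extendZero g (t - P) = delta P g t := by
  unfold extendZero delta
  by_cases h : P ≤ t
  · have h1 : ¬ ((t : ℤ) - P < 0) := by omega
    have h2 : ((t : ℤ) - P).toNat = t - P := by omega
    rw [if_neg (by omega), if_neg h1, if_pos h, h2]
    simp
  · have h1 : ((t : ℤ) - P < 0) := by omega
    rw [if_neg (by omega), if_pos h1, if_neg h]
    simp

/-- The window length `2 a` is a whole number of periods of the mode, so entering and leaving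
entries have the same coefficients and occur only through their differences. -/
lemma yExact_succ {a k : ℕ} (ha : 0 < a) (g : ℕ → ℤ) (t : ℕ) :
    yExact (angle a k) (2 * a) g (t + 1)
      = Real.cos (angle a k) * (2 * yExact (angle a k) (2 * a) g t - prevDelta (2 * a) g t)
        - yExact (angle a k) (2 * a) g (t - 1) + delta (2 * a) g t := by
  have ha' : (a : ℝ) ≠ 0 := by positivity
  have h := window_recurrence (angle a k) (extendZero g) t (2 * a)
  have e1 : Real.cos (((2 * a : ℕ) : ℝ) * angle a k) = 1 := by
    have : ((2 * a : ℕ) : ℝ) * angle a k = k * (2 * Real.pi) := by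
      unfold angle; push_cast; field_simp
    rw [this, Real.cos_nat_mul_two_pi]
  have e2 : Real.cos (((2 * a : ℕ) : ℝ) * angle a k - angle a k) = Real.cos (angle a k) := by
    have : ((2 * a : ℕ) : ℝ) * angle a k = k * (2 * Real.pi) := by
      unfold angle; push_cast; field_simp
    rw [this, Real.cos_nat_mul_two_pi_sub]
  have h3 := extendZero_delta (2 * a) g t
  have h4 : extendZero g (t - 1) - extendZero g (t - 1 - (2 * a : ℕ)) = prevDelta (2 * a) g t := by
    unfold prevDelta
    by_cases ht : t = 0
    · subst ht
      rw [if_pos rfl]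
      simp only [extendZero]
      rw [if_pos (by simp), if_pos (by push_cast; omega)]
      simp
    · rw [if_neg ht, ← extendZero_delta]
      congr 2 <;> push_cast [Nat.cast_sub (Nat.one_le_iff_ne_zero.2 ht)] <;> ring
  rw [e1, e2] at h
  unfold yExact
  rw [add_sub_cancel_right]
  have h5 : (t : ℤ) - 1 - 1 = t - 2 := by ring
  rw [h5, ← h3, ← h4]
  linear_combination h

/-- The characteristic roots `z = exp (iθ)` and `1 / z` have modulus `1`. Thus `e (t + 1) - z e t`
obeys a first-order recurrence and grows at most linearly, and summing once more gives the square.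
The defect need only be small while `|e| ≤ E`, which the conclusion itself guarantees through `hE`.
-/
lemma linear_recurrence_bound {θ ρ E : ℝ} {T : ℕ} {e : ℕ → ℝ} (h0 : e 0 = 0) (hρ : 0 ≤ ρ)
    (hE : T ^ 2 * ρ ≤ E) (h1 : 0 < T → |e 1| ≤ ρ)
    (hs : ∀ t, t + 2 ≤ T → |e (t + 1)| ≤ E → |e (t + 2) - 2 * Real.cos θ * e (t + 1) + e t| ≤ ρ) :
    ∀ t ≤ T, |e t| ≤ t ^ 2 * ρ := by
  set z : ℂ := Complex.exp (θ * Complex.I) with hz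
  have hz1 : ‖z‖ = 1 := Complex.norm_exp_ofReal_mul_I θ
  set z' : ℂ := Complex.exp (-(θ * Complex.I)) with hz'
  have hz1' : ‖z'‖ = 1 := by
    rw [hz', ← neg_mul, ← Complex.ofReal_neg]; exact Complex.norm_exp_ofReal_mul_I _
  have hsum : z + z' = 2 * Complex.cos θ := by
    rw [Complex.two_cos, hz, hz', neg_mul]
  have hprod : z * z' = 1 := by rw [hz, hz', ← Complex.exp_add]; simp
  have key : ∀ t, t + 1 ≤ T → |e t| ≤ t ^ 2 * ρ ∧ |e (t + 1)| ≤ (t + 1 : ℕ) ^ 2 * ρ ∧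
      ‖(e (t + 1) : ℂ) - z * e t‖ ≤ (t + 1) * ρ := by
    intro t
    induction t with
    | zero =>
      intro hT
      have := h1 (by omega)
      refine ⟨by simp [h0], by simpa using this, ?_⟩
      simpa [h0, Complex.norm_real] using this
    | succ t ih =>
      intro hT
      obtain ⟨-, i2, i3⟩ := ih (by omega)
      have hle : |e (t + 1)| ≤ E := by
        refine i2.trans (le_trans ?_ hE)
        gcongr; omega
      have hr := hs t (by omega) hle
      have hw : ‖(e (t + 2) : ℂ) - z * e (t + 1)‖ ≤ (t + 2) * ρ := by
        have e1 : (e (t + 2) : ℂ) - z * e (t + 1) = z' * ((e (t + 1) : ℂ) - z * e t)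
            + ((e (t + 2) - 2 * Real.cos θ * e (t + 1) + e t : ℝ) : ℂ) := by
          push_cast
          rw [← hsum]
          linear_combination (e t : ℂ) * hprod
        rw [e1]
        refine (norm_add_le _ _).trans ?_
        rw [norm_mul, hz1', one_mul, Complex.norm_real, Real.norm_eq_abs]
        linarith
      refine ⟨i2, ?_, ?_⟩
      · have e2 : (e (t + 2) : ℂ) = ((e (t + 2) : ℂ) - z * e (t + 1)) + z * e (t + 1) := by ring
        have h3 := norm_add_le ((e (t + 2) : ℂ) - z * e (t + 1)) (z * e (t + 1))
        rw [← e2, norm_mul, hz1, one_mul, Complex.norm_real, Complex.norm_real, Real.norm_eq_abs,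
          Real.norm_eq_abs] at h3
        push_cast at i2 ⊢
        have ht : (0 : ℝ) ≤ t := Nat.cast_nonneg t
        have := mul_nonneg ht hρ
        nlinarith
      · push_cast
        have : (t : ℝ) + 1 + 1 = t + 2 := by ring
        rw [this]
        exact hw
  intro t ht
  rcases t with _ | t
  · simp [h0]
  · exact (key t ht).2.1

lemma yExact_abs_le {θ : ℝ} {P : ℕ} {g : ℕ → ℤ} {X : ℝ} (hX : ∀ t, |(g t : ℝ)| ≤ X) (t : ℤ) :
    |yExact θ P g t| ≤ P * X := by
  have hX0 : 0 ≤ X := (abs_nonneg _).trans (hX 0)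
  refine (Finset.abs_sum_le_sum_abs _ _).trans ?_
  refine (Finset.sum_le_card_nsmul _ _ X fun l _ => ?_).trans (by simp)
  rw [abs_mul]
  have h1 := Real.abs_cos_le_one (θ * l)
  have h2 : |extendZero g (t - 1 - l)| ≤ X := by
    unfold extendZero; split_ifs
    · simpa using hX0
    · exact hX _
  calc _ ≤ 1 * X := by gcongr
    _ = X := one_mul X

lemma delta_abs_le {P : ℕ} {g : ℕ → ℤ} {X : ℝ} (hX : ∀ t, |(g t : ℝ)| ≤ X) (t : ℕ) :
    |(delta P g t : ℝ)| ≤ 2 * X := by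
  have hX0 : 0 ≤ X := (abs_nonneg _).trans (hX 0)
  unfold delta
  split_ifs
  · push_cast
    have := abs_sub (g t : ℝ) (g (t - P))
    linarith [hX t, hX (t - P)]
  · simpa using (hX t).trans (by linarith)

/-- Each step commits one rounding unit and the error `η` of the cosine times the current value. The
latter is bounded by the exact sum plus an error of at most `B`, a bound maintained along the
recurrence. -/
lemma ySeq_err {B C : ℤ} (hB : 0 < B) {a k : ℕ} (ha : 0 < a) {η X : ℝ} {T : ℕ}
    (hη : |(C : ℝ) / B - Real.cos (angle a k)| ≤ η) {g : ℕ → ℤ} (hX : ∀ t, |(g t : ℝ)| ≤ X)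
    (hT : T ^ 2 * (1 + η * (2 * (2 * a * X + B) + 2 * X)) ≤ B) :
    ∀ t ≤ T, |((ySeq B C (2 * a) g t).1 : ℝ) - yExact (angle a k) (2 * a) g t|
      ≤ t ^ 2 * (1 + η * (2 * (2 * a * X + B) + 2 * X)) := by
  have hB' : (0 : ℝ) < B := by exact_mod_cast hB
  have hη0 : 0 ≤ η := (abs_nonneg _).trans hη
  have hX0 : 0 ≤ X := (abs_nonneg _).trans (hX 0)
  set ρ := 1 + η * (2 * (2 * a * X + B) + 2 * X) with hρ
  have hρ1 : 1 ≤ ρ := by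
    have : 0 ≤ η * (2 * (2 * a * X + B) + 2 * X) := by positivity
    linarith
  have hpd : ∀ t, |(prevDelta (2 * a) g t : ℝ)| ≤ 2 * X := by
    intro t; unfold prevDelta; split_ifs
    · simp; linarith
    · exact delta_abs_le hX _
  have hy0 : ∀ t : ℤ, t ≤ 0 → yExact (angle a k) (2 * a) g t = 0 := by
    intro t ht
    refine Finset.sum_eq_zero fun l _ => ?_
    unfold extendZero
    rw [if_pos (by omega), mul_zero]
  have step : ∀ t, |((ySeq B C (2 * a) g t).1 : ℝ) - yExact (angle a k) (2 * a) g t| ≤ B →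
      |(((2 * (ySeq B C (2 * a) g t).1 - prevDelta (2 * a) g t) * C / B : ℤ) : ℝ)
        - Real.cos (angle a k) * (2 * ((ySeq B C (2 * a) g t).1 : ℝ) - prevDelta (2 * a) g t)| ≤ ρ := by
    intro t ht
    have h1 := abs_ediv_sub_le ((2 * (ySeq B C (2 * a) g t).1 - prevDelta (2 * a) g t) * C) hB.ne'
    have hyb : |((ySeq B C (2 * a) g t).1 : ℝ)| ≤ 2 * a * X + B := by
      have h2 := yExact_abs_le (θ := angle a k) (P := 2 * a) hX t
      have h3 := abs_sub_abs_le_abs_sub ((ySeq B C (2 * a) g t).1 : ℝ) (yExact (angle a k) (2 * a) g t)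
      push_cast at h2
      linarith
    set y : ℝ := ((ySeq B C (2 * a) g t).1 : ℝ)
    set D : ℝ := (prevDelta (2 * a) g t : ℝ)
    have h2 : |2 * y - D| ≤ 2 * (2 * a * X + B) + 2 * X := by
      have := abs_sub (2 * y) D
      rw [abs_mul, abs_of_pos (by norm_num : (0 : ℝ) < 2)] at this
      linarith [hpd t]
    have h3 : |(2 * y - D) * C / B - Real.cos (angle a k) * (2 * y - D)|
        ≤ η * (2 * (2 * a * X + B) + 2 * X) := by
      have e : (2 * y - D) * C / B - Real.cos (angle a k) * (2 * y - D)
          = ((C : ℝ) / B - Real.cos (angle a k)) * (2 * y - D) := by field_simp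
      rw [e, abs_mul]; gcongr
    push_cast at h1
    have := abs_sub_le (((2 * (ySeq B C (2 * a) g t).1 - prevDelta (2 * a) g t) * C / B : ℤ) : ℝ)
      ((2 * y - D) * C / B) (Real.cos (angle a k) * (2 * y - D))
    linarith
  refine linear_recurrence_bound (θ := angle a k)
    (e := fun t => ((ySeq B C (2 * a) g t).1 : ℝ) - yExact (angle a k) (2 * a) g t)
    ?_ (by linarith) hT (fun _ => ?_) (fun t ht hE => ?_)
  · simp [ySeq, hy0]
  · have h1 := step 0 (by simp [ySeq, hy0]; linarith)
    have h2 := yExact_succ (k := k) ha g 0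
    simp only [Nat.cast_zero, zero_add, zero_sub] at h2
    simp only [ySeq, Nat.cast_one] at h1 ⊢
    rw [h2, hy0 0 le_rfl, hy0 (-1) (by norm_num)]
    convert h1 using 2
    push_cast
    ring
  · have h1 := step (t + 1) hE
    have h2 := yExact_succ (k := k) ha g (t + 1)
    simp only [Nat.cast_add, Nat.cast_one, add_sub_cancel_right] at h2
    convert h1 using 2
    rw [show ((t + 2 : ℕ) : ℤ) = t + 1 + 1 by push_cast; ring, h2]
    have e : ySeq B C (2 * a) g (t + 2) = (((2 * (ySeq B C (2 * a) g (t + 1)).1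
      - prevDelta (2 * a) g (t + 1)) * C) / B - (ySeq B C (2 * a) g (t + 1)).2
      + delta (2 * a) g (t + 1), (ySeq B C (2 * a) g (t + 1)).1) := rfl
    have e2 : (ySeq B C (2 * a) g (t + 1)).2 = (ySeq B C (2 * a) g t).1 := rfl
    rw [e]
    simp only [e2]
    push_cast
    ring

/-- After enough steps the exact window sums are the mode coefficients of the periodic sequence. -/
lemma modeSum_eq_yExact {a n k : ℕ} (ha : 0 < a) (han : a ≤ n) (g : ℕ → ℤ)
    {G : ℤ → ℝ} (hG : ∀ t : ℕ, G t = g t) (hGp : ∀ x, G (x + n) = G x) (j : ℕ) :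
    modeSum a G j k = (-1) ^ k * yExact (angle a k) (2 * a) g ((n + a + j + 1 : ℕ)) := by
  have ha' : (a : ℝ) ≠ 0 := by positivity
  unfold modeSum yExact
  rw [sum_window, Finset.mul_sum]
  refine Finset.sum_congr rfl fun l hl => ?_
  have hl := Finset.mem_range.1 hl
  have e1 : angle a k * ((a - l : ℤ) : ℝ) = k * Real.pi - angle a k * l := by
    unfold angle; push_cast; field_simp
  rw [e1, Real.cos_nat_mul_pi_sub, mul_assoc]
  congr 2
  -- Since `l < 2 a ≤ n + a`, the extra period `n` keeps every index nonnegative, so the zero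
  -- extension never enters.
  have e2 : ((n + a + j + 1 : ℕ) : ℤ) - 1 - l = ((n + a + j - l : ℕ) : ℤ) := by omega
  rw [e2]
  unfold extendZero
  rw [if_neg (by omega), Int.toNat_natCast, ← hG, ← hGp]
  congr 1
  omega

/-! ## One pass of the algorithm -/

/-- The integer parameters of the algorithm. -/
structure Params where
  d : ℕ
  n : ℕ
  M : ℕ
  a : ℕ
  p : ℕ
  q : ℕ
  R : ℕ
  ps : ℤ
  ch : ℤ

namespace Params
variable (w : Params)

/-- The unit of fixed-point numbers. -/
def B : ℤ := 16 ^ w.R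

/-- The cosine of mode `k`. -/
def cosine (k : ℕ) : ℤ := cosFix w.B (4 ^ w.R) w.ps w.a k w.R

/-- The damping factor of mode `k`. -/
def damp (k : ℕ) : ℤ := dampFix w.B w.ch (w.cosine k) w.q

/-- The signed coefficient of mode `k`. -/
def coef (k : ℕ) : ℤ := (if k = 0 ∨ w.a ≤ k then w.damp k else 2 * w.damp k) * (-1) ^ k

/-- The entries of a line, repeated periodically. -/
def line (A : ℕ → ℤ) (row t : ℕ) : ℤ := A (row + t % w.n * w.M)

/-- The window sum of mode `k` in a line after `t` steps. -/
def wsum (A : ℕ → ℤ) (k row t : ℕ) : ℤ := (ySeq w.B (w.cosine k) (2 * w.a) (w.line A row) t).1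

/-- The contribution of mode `k` to entry `i`. -/
def term (A : ℕ → ℤ) (k i : ℕ) : ℤ :=
  w.coef k * w.wsum A k (i / w.n) (w.n + w.a + i % w.n + 1)

/-- The result of a pass. -/
def pass (A : ℕ → ℤ) (i : ℕ) : ℤ := (∑ k ∈ Finset.range (w.p + 1), w.term A k i) / (2 * w.a * w.B)

/-- The result of `t` passes. -/
def passes (A : ℕ → ℤ) : ℕ → ℕ → ℤ
  | 0 => A
  | t + 1 => w.pass (passes A t)

end Params

variable {w : Params}

lemma coef_err {η κ c : ℝ} (hc : c = w.ch / w.B) (hc0 : 0 ≤ c) (hc4 : c ≤ 1 / 4) {k : ℕ} (hk : k ≤ w.a)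
    (hη : |(w.cosine k : ℝ) / w.B - Real.cos (angle w.a k)| ≤ η) (hηB : 2 / w.B ≤ η)
    (hκ : κ = 4 ^ w.q * η) (hκ1 : κ ≤ 1) :
    |(w.coef k : ℝ) / w.B - weight w.a k * damping c (2 ^ w.q) w.a k * (-1) ^ k| ≤ 2 * κ := by
  have h := dampFix_err (B := w.B) (ch := w.ch) (by unfold Params.B; positivity) hc hc0 hc4 hη
    (by exact_mod_cast hηB) (by rw [← hκ]; exact hκ1)
  rw [← hκ] at h
  have hκ0 : 0 ≤ κ := (abs_nonneg _).trans h
  have e : (w.coef k : ℝ) / w.B - weight w.a k * damping c (2 ^ w.q) w.a k * (-1) ^ k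
      = weight w.a k * ((w.damp k : ℝ) / w.B - damping c (2 ^ w.q) w.a k) * (-1) ^ k := by
    have hiff : (k = 0 ∨ w.a ≤ k) ↔ (k = 0 ∨ k = w.a) := by
      constructor <;> (rintro (h | h) <;> [left; right] <;> omega)
    unfold Params.coef weight
    simp only [hiff]
    split_ifs <;> push_cast <;> ring
  rw [e, abs_mul, abs_mul, abs_pow, abs_neg, abs_one, one_pow, mul_one]
  exact mul_le_mul (weight_abs_le _ _) h (abs_nonneg _) (by norm_num)

/-- The three terms stem from the final division, the rounded coefficients, and the rounded window
sums. The at most `2 a` modes are averaged by the factor `1 / (2 a)`, so their number does not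
appear. -/
lemma pass_err {η κ c X : ℝ} (ha : 0 < w.a) (han : w.a ≤ w.n) (hp : w.p ≤ w.a)
    (hc : c = w.ch / w.B) (hc0 : 0 ≤ c) (hc4 : c ≤ 1 / 4)
    (hη : ∀ k ≤ w.a, |(w.cosine k : ℝ) / w.B - Real.cos (angle w.a k)| ≤ η) (hηB : 2 / w.B ≤ η)
    (hκ : κ = 4 ^ w.q * η) (hκ1 : κ ≤ 1) {A : ℕ → ℤ} {row : ℕ} (hX : ∀ t, |(w.line A row t : ℝ)| ≤ X)
    {ρ : ℝ} (hρ : ρ = 9 * w.n ^ 2 * (1 + η * (2 * (2 * w.a * X + w.B) + 2 * X))) (hρB : ρ ≤ w.B)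
    {G : ℤ → ℝ} (hG : ∀ t : ℕ, G t = w.line A row t) (hGp : ∀ x, G (x + w.n) = G x)
    {i : ℕ} (hi : i / w.n = row) :
    |(w.pass A i : ℝ) - kernel c (2 ^ w.q) w.a w.p G ((i % w.n : ℕ) : ℤ)|
      ≤ 1 + 2 * κ * (2 * w.a * X + w.B) + 2 * ρ := by
  have hB : 0 < w.B := by unfold Params.B; positivity
  have hB' : (0 : ℝ) < w.B := by exact_mod_cast hB
  have ha' : (0 : ℝ) < w.a := by exact_mod_cast ha
  have hn : 0 < w.n := by omega
  have hj : i % w.n < w.n := Nat.mod_lt _ hn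
  set j := i % w.n with hjd
  have hX0 : 0 ≤ X := (abs_nonneg _).trans (hX 0)
  have hη0 : 0 ≤ η := le_trans (by positivity) hηB
  have hκ0 : 0 ≤ κ := by rw [hκ]; positivity
  have hρ0 : 0 ≤ ρ := by rw [hρ]; positivity
  have hy : ∀ k ≤ w.a, |(w.wsum A k row (w.n + w.a + j + 1) : ℝ)
      - yExact (angle w.a k) (2 * w.a) (w.line A row) ((w.n + w.a + j + 1 : ℕ))| ≤ ρ := by
    intro k hk
    -- At most `3 n` steps of the recurrence are made, which explains the factor `9 n ^ 2` in `ρ`.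
    have hT : ((w.n + w.a + j + 1 : ℕ) : ℝ) ^ 2 * (1 + η * (2 * (2 * w.a * X + w.B) + 2 * X)) ≤ ρ := by
      rw [hρ]
      have : ((w.n + w.a + j + 1 : ℕ) : ℝ) ≤ 3 * w.n := by
        exact_mod_cast (by omega : w.n + w.a + j + 1 ≤ 3 * w.n)
      have h2 : ((w.n + w.a + j + 1 : ℕ) : ℝ) ^ 2 ≤ (3 * w.n) ^ 2 := by gcongr
      have e : (3 * (w.n : ℝ)) ^ 2 = 9 * w.n ^ 2 := by ring
      rw [e] at h2
      gcongr
    exact (ySeq_err hB ha (hη k hk) hX (hT.trans hρB) _ le_rfl).trans hT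
  have hterm : ∀ k ∈ Finset.range (w.p + 1), |(w.term A k i : ℝ) / w.B
      - weight w.a k * (damping c (2 ^ w.q) w.a k * modeSum w.a G j k)|
      ≤ 2 * κ * (2 * w.a * X + w.B) + 2 * ρ := by
    intro k hk
    have hk' : k ≤ w.a := by have := Finset.mem_range.1 hk; omega
    have h1 := coef_err hc hc0 hc4 hk' (hη k hk') hηB hκ hκ1
    have h2 := hy k hk'
    have h3 := modeSum_eq_yExact (k := k) ha han (w.line A row) hG hGp j
    rw [h3]
    unfold Params.term
    rw [hi, ← hjd]
    set y : ℝ := (w.wsum A k row (w.n + w.a + j + 1) : ℝ)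
    set Y := yExact (angle w.a k) (2 * w.a) (w.line A row) ((w.n + w.a + j + 1 : ℕ))
    have hY : |Y| ≤ 2 * w.a * X := by
      have := yExact_abs_le (θ := angle w.a k) (P := 2 * w.a) hX ((w.n + w.a + j + 1 : ℕ))
      push_cast at this ⊢
      exact this
    have hyb : |y| ≤ 2 * w.a * X + w.B := by
      have := abs_sub_abs_le_abs_sub y Y
      linarith
    have hwd : |weight w.a k * damping c (2 ^ w.q) w.a k * (-1) ^ k| ≤ 2 := by
      rw [abs_mul, abs_mul, abs_pow, abs_neg, abs_one, one_pow, mul_one]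
      have h5 := damping_le_exp hc0 hc4 (2 ^ w.q) ha hk'
      have h6 : Real.exp (-(c * (2 ^ w.q : ℕ) * (4 * k ^ 2 / w.a ^ 2))) ≤ 1 :=
        Real.exp_le_one_iff.2 (by simp only [Left.neg_nonpos_iff]; positivity)
      calc _ ≤ 2 * 1 := mul_le_mul (weight_abs_le _ _) (h5.trans h6) (abs_nonneg _) (by norm_num)
        _ = 2 := by norm_num
    have e : ((w.coef k * w.wsum A k row (w.n + w.a + j + 1) : ℤ) : ℝ) / w.B
        - weight w.a k * (damping c (2 ^ w.q) w.a k * ((-1) ^ k * Y))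
        = ((w.coef k : ℝ) / w.B - weight w.a k * damping c (2 ^ w.q) w.a k * (-1) ^ k) * y
          + weight w.a k * damping c (2 ^ w.q) w.a k * (-1) ^ k * (y - Y) := by
      push_cast; ring
    rw [e]
    refine (abs_add_le _ _).trans ?_
    rw [abs_mul, abs_mul]
    gcongr
  have hd := abs_ediv_sub_le (∑ k ∈ Finset.range (w.p + 1), w.term A k i) (y := 2 * w.a * w.B)
    (by positivity)
  have hsum : |((∑ k ∈ Finset.range (w.p + 1), w.term A k i : ℤ) : ℝ) / ((2 * w.a * w.B : ℤ) : ℝ)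
      - kernel c (2 ^ w.q) w.a w.p G j| ≤ 2 * κ * (2 * w.a * X + w.B) + 2 * ρ := by
    have e : ((∑ k ∈ Finset.range (w.p + 1), w.term A k i : ℤ) : ℝ) / ((2 * w.a * w.B : ℤ) : ℝ)
        - kernel c (2 ^ w.q) w.a w.p G j = 1 / (2 * w.a) * ∑ k ∈ Finset.range (w.p + 1),
        ((w.term A k i : ℝ) / w.B - weight w.a k * (damping c (2 ^ w.q) w.a k * modeSum w.a G j k)) := by
      rw [Finset.sum_sub_distrib, mul_sub, ← Finset.sum_div]
      unfold kernel
      push_cast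
      congr 1
      field_simp
    rw [e, abs_mul, abs_of_pos (by positivity), div_mul_eq_mul_div, one_mul, div_le_iff₀ (by positivity)]
    refine (Finset.abs_sum_le_sum_abs _ _).trans ((Finset.sum_le_card_nsmul _ _ _ hterm).trans ?_)
    rw [nsmul_eq_mul, Finset.card_range, mul_comm]
    refine mul_le_mul_of_nonneg_left ?_ (by positivity)
    exact_mod_cast (by omega : w.p + 1 ≤ 2 * w.a)
  have := abs_sub_le (w.pass A i : ℝ) (((∑ k ∈ Finset.range (w.p + 1), w.term A k i : ℤ) : ℝ)
    / ((2 * w.a * w.B : ℤ) : ℝ)) (kernel c (2 ^ w.q) w.a w.p G j)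
  unfold Params.pass at this ⊢
  linarith

end HeatFFT
end

open Set
noncomputable section
namespace HeatFFT

/-! ## The passes follow the split scheme -/

/-- The lattice point stored at address `q` after `t` passes, `t` rotations of the digits. -/
def dig (d n t q : ℕ) : ℕ → ℤ := fun k => if k < d then ((q / n ^ ((k + t) % d) % n : ℕ) : ℤ) else 0

lemma dig_self (d n : ℕ) : dig d n d = dig d n 0 := by
  funext q k
  simp [dig]

lemma mod_pred_iff {d t k : ℕ} (ht : t < d) (hk : k < d) : (k + t) % d = d - 1 ↔ k = d - 1 - t := by
  rcases lt_or_ge (k + t) d with h | h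
  · rw [Nat.mod_eq_of_lt h]; omega
  · rw [Nat.mod_eq_sub_mod h, Nat.mod_eq_of_lt (by omega)]; omega

lemma mod_succ_of_ne {d e : ℕ} (h : e % d ≠ d - 1) (hd : 0 < d) : (e + 1) % d = e % d + 1 := by
  have := Nat.mod_lt e hd
  rw [Nat.add_mod]
  rcases Nat.lt_or_ge 1 d with h1 | h1
  · rw [Nat.mod_eq_of_lt h1, Nat.mod_eq_of_lt (by omega)]
  · omega

lemma mod_succ_of_eq {d e : ℕ} (h : e % d = d - 1) (hd : 0 < d) : (e + 1) % d = 0 := by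
  obtain ⟨c, hc⟩ : ∃ c, e = d * c + (d - 1) := ⟨e / d, by rw [← h]; exact (Nat.div_add_mod e d).symm⟩
  have : e + 1 = d * (c + 1) := by rw [mul_add]; omega
  rw [this]; simp

lemma add_mul_pow_div_mod {d n e row x : ℕ} (hn : 0 < n) (he : e + 1 < d) :
    (row + x * n ^ (d - 1)) / n ^ e % n = row / n ^ e % n := by
  obtain ⟨r, hr⟩ : ∃ r, d - 1 = e + (r + 1) := ⟨d - 1 - e - 1, by omega⟩
  have : row + x * n ^ (d - 1) = row + n ^ e * (n * (x * n ^ r)) := by rw [hr]; ring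
  rw [this, Nat.add_mul_div_left _ _ (by positivity), Nat.add_mul_mod_self_left]

/-- Reading with stride `n ^ (d - 1)` varies the top digit of the address, which after `t` rotations
belongs to coordinate `d - 1 - t`. -/
lemma dig_line {d n t row x : ℕ} (ht : t < d) (hrow : row < n ^ (d - 1)) (hx : x < n) :
    dig d n t (row + x * n ^ (d - 1)) = dig d n t row + (x : ℤ) • unitVec (d - 1 - t) := by
  funext k
  simp only [dig, Pi.add_apply, Pi.smul_apply, unitVec, Pi.single_apply]
  split_ifs with hk hk' hk'
  · have he := (mod_pred_iff ht hk).2 hk'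
    have hM : 0 < n ^ (d - 1) := by omega
    rw [he, Nat.add_mul_div_right _ _ hM, Nat.div_eq_of_lt hrow, zero_add, Nat.mod_eq_of_lt hx]
    simp
  · have he := (mod_pred_iff ht hk).not.2 hk'
    have := Nat.mod_lt (k + t) (by omega : 0 < d)
    rw [add_mul_pow_div_mod (by omega) (by omega)]
    simp
  · omega
  · simp

/-- Writing the same line contiguously makes its coordinate the lowest digit: one further rotation.
No separate transposition is needed. -/
lemma dig_succ_line {d n t row j : ℕ} (ht : t < d) (hrow : row < n ^ (d - 1)) (hj : j < n) :
    dig d n (t + 1) (row * n + j) = dig d n t row + (j : ℤ) • unitVec (d - 1 - t) := by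
  have hn : 0 < n := by omega
  funext k
  simp only [dig, Pi.add_apply, Pi.smul_apply, unitVec, Pi.single_apply, ← add_assoc]
  split_ifs with hk hk' hk'
  · have he := (mod_pred_iff ht hk).2 hk'
    rw [mod_succ_of_eq he (by omega), he, Nat.div_eq_of_lt hrow, pow_zero, Nat.div_one, add_comm,
      Nat.add_mul_mod_self_right, Nat.mod_eq_of_lt hj]
    simp
  · have he := (mod_pred_iff ht hk).not.2 hk'
    rw [mod_succ_of_ne he (by omega), pow_succ', ← Nat.div_div_eq_div_mul, add_comm (row * n),
      Nat.add_mul_div_right _ _ hn, Nat.div_eq_of_lt hj, zero_add]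
    simp
  · omega
  · simp

/-- Properties of the exact data which are preserved by the heat steps. -/
structure Regular (d n : ℕ) (N Ω : ℝ) (v : Lat) : Prop where
  bdd : BoundedBy N v
  periodic : ∀ k < d, ∀ j, v (j + (n : ℤ) • unitVec k) = v j
  osc : ∀ k < d, ∀ j (x : ℤ), |v (j + x • unitVec k) - v j| ≤ Ω

lemma heatStep_pow_translate (c : ℝ) (k s : ℕ) (v : Lat) (b j : ℕ → ℤ) :
    (heatStep c k ^ s) v (j + b) = (heatStep c k ^ s) (translate b v) j := by
  have h := ((commute_heatStep_translate c k b).pow_left s).eq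
  have := congrArg (fun A : Module.End ℝ Lat => A v j) h
  simpa [Module.End.mul_apply] using this.symm

/-- Periodicity and oscillation are statements about `translate b v - v`. Heat steps commute with
translations and do not increase sup norms, so both survive. -/
lemma Regular.heatStep_pow {d n : ℕ} {N Ω c : ℝ} {v : Lat} (h : Regular d n N Ω v)
    (hc0 : 0 ≤ c) (hc : c ≤ 1 / 4) (k s : ℕ) : Regular d n N Ω ((heatStep c k ^ s) v) := by
  refine ⟨BoundedBy.heatStep_pow hc0 hc h.bdd k s, fun k' hk' j => ?_, fun k' hk' j x => ?_⟩
  · rw [heatStep_pow_translate]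
    rw [show translate ((n : ℤ) • unitVec k') v = v from funext fun j => h.periodic k' hk' j]
  · rw [heatStep_pow_translate]
    have e : (heatStep c k ^ s) (translate (x • unitVec k') v) j - (heatStep c k ^ s) v j
        = (heatStep c k ^ s) (translate (x • unitVec k') v - v) j := by
      rw [map_sub]; rfl
    rw [e]
    exact BoundedBy.heatStep_pow hc0 hc (f := translate (x • unitVec k') v - v)
      (fun j => h.osc k' hk' j x) k s j

lemma modeSum_sub (a : ℕ) (f g : ℤ → ℝ) (j : ℤ) (k : ℕ) :
    modeSum a (f - g) j k = modeSum a f j k - modeSum a g j k := by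
  simp only [modeSum, Pi.sub_apply, mul_sub, Finset.sum_sub_distrib]

lemma kernel_sub (c : ℝ) (s a p : ℕ) (f g : ℤ → ℝ) (j : ℤ) :
    kernel c s a p (f - g) j = kernel c s a p f j - kernel c s a p g j := by
  simp only [kernel, modeSum_sub, mul_sub, Finset.sum_sub_distrib]

lemma modeSum_smul (a : ℕ) (r : ℝ) (f : ℤ → ℝ) (j : ℤ) (k : ℕ) :
    modeSum a (r • f) j k = r * modeSum a f j k := by
  simp only [modeSum, Pi.smul_apply, smul_eq_mul, Finset.mul_sum]
  refine Finset.sum_congr rfl fun _ _ => by ring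

lemma kernel_smul (c : ℝ) (s a p : ℕ) (r : ℝ) (f : ℤ → ℝ) (j : ℤ) :
    kernel c s a p (r • f) j = r * kernel c s a p f j := by
  simp only [kernel, modeSum_smul, Finset.mul_sum]
  refine Finset.sum_congr rfl fun _ _ => by ring

/-- The parameters are adapted to the accuracy parameter `l` and the bound `m`. -/
structure Params.Fit (w : Params) (l m : ℕ) : Prop where
  d_pos : 0 < w.d
  n_two : 2 ≤ w.n
  M_eq : w.M = w.n ^ (w.d - 1)
  a_pos : 0 < w.a
  a_le : w.a ≤ w.n
  p_le : w.p ≤ w.a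
  ch_nonneg : 0 ≤ w.ch
  ch_le : 4 * w.ch ≤ w.B
  l_pos : 1 ≤ l
  n_le : w.n ≤ 2 ^ l
  nm_le : 4 * w.n * m ≤ 2 ^ (4 * l)
  time_le : w.d * (w.ch * 2 ^ w.q) ≤ 2 * m * w.B
  window : w.a = w.n ∨ 4 * l ≤ w.a ∧ 16 * (w.ch * 2 ^ w.q) * l ≤ w.a ^ 2 * w.B
  trunc : w.p = w.a ∨ 8 * l ≤ w.p ∧ w.a ^ 2 * w.B ≤ 64 * (w.ch * 2 ^ w.q) * l
  six_le : 6 ≤ w.R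
  ps_near : |4 * (w.ps : ℝ) / 16 ^ w.R - Real.pi| ≤ 28 / 4 ^ w.R
  prec : 256 * (4 ^ w.q * (121 / 3 ^ w.R)) * (w.n ^ 3 * w.n ^ w.d : ℝ) ≤ 1

namespace Params.Fit
variable {w : Params} {l m : ℕ} (h : w.Fit l m)

/-- The step parameter used by the algorithm. -/
abbrev step (_ : w.Fit l m) : ℝ := (w.ch : ℝ) / w.B

include h

omit h in
lemma B_pos : (0 : ℝ) < w.B := by unfold Params.B; push_cast; positivity

lemma pow_eq : w.n * w.M = w.n ^ w.d := by
  rw [h.M_eq, ← pow_succ']; congr 1; have := h.d_pos; omega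

lemma step_nonneg : 0 ≤ h.step := div_nonneg (by exact_mod_cast h.ch_nonneg) B_pos.le

lemma step_le : h.step ≤ 1 / 4 := by
  rw [step, div_le_iff₀ B_pos]
  have : (4 * w.ch : ℝ) ≤ w.B := by exact_mod_cast h.ch_le
  linarith

lemma kernel_spec :
    (∀ (g : ℤ → ℝ) (Ω : ℝ), (∀ x y, |g x - g y| ≤ Ω) → (∀ x, g (x + w.n) = g x) → ∀ j,
      |kernel h.step (2 ^ w.q) w.a w.p g j - (lineStep h.step ^ 2 ^ w.q) g j|
        ≤ 10 * (h.step * 2 ^ w.q) * Real.exp (-(2 * l)) * Ω) ∧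
    ∀ (g : ℤ → ℝ) (B : ℝ), (∀ x, |g x| ≤ B) → ∀ j,
      |kernel h.step (2 ^ w.q) w.a w.p g j| ≤ (1 + 1 / w.d) * B := by
  have hB := B_pos (w := w)
  have key := HeatFFT.kernel_spec h.step_nonneg h.step_le (s := 2 ^ w.q) (n := w.n) (a := w.a) (p := w.p)
    (l := l) (d := w.d) (m := m) h.a_pos h.p_le h.a_le h.d_pos h.l_pos h.n_le h.nm_le ?_ ?_ ?_
  · push_cast at key; exact key
  · have : (w.d * (w.ch * 2 ^ w.q) : ℝ) ≤ 2 * m * w.B := by exact_mod_cast h.time_le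
    have e : (w.d : ℝ) * (h.step * ((2 ^ w.q : ℕ) : ℝ)) = w.d * (w.ch * 2 ^ w.q) / w.B := by
      push_cast; unfold step; ring
    rw [e, div_le_iff₀ hB]; exact this
  · refine h.window.imp_right fun ⟨h1, h2⟩ => ⟨by exact_mod_cast h1, ?_⟩
    have : (16 * (w.ch * 2 ^ w.q) * l : ℝ) ≤ w.a ^ 2 * w.B := by exact_mod_cast h2
    have e : 16 * (h.step * ((2 ^ w.q : ℕ) : ℝ)) * l = 16 * (w.ch * 2 ^ w.q) * l / w.B := by
      push_cast; unfold step; ring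
    rw [e, div_le_iff₀ hB]; exact this
  · refine h.trunc.imp_right fun ⟨h1, h2⟩ => ⟨h1, ?_⟩
    have : (w.a ^ 2 * w.B : ℝ) ≤ 64 * (w.ch * 2 ^ w.q) * l := by exact_mod_cast h2
    have e : 64 * (h.step * ((2 ^ w.q : ℕ) : ℝ)) * l = 64 * (w.ch * 2 ^ w.q) * l / w.B := by
      push_cast; unfold step; ring
    rw [e, le_div_iff₀ hB]; exact this

/-- The relative rounding error of the fixed-point cosines and damping factors. -/
abbrev kappa (_ : w.Fit l m) : ℝ := 4 ^ w.q * (121 / 3 ^ w.R)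

lemma eta_le : 121 / 3 ^ w.R ≤ h.kappa := by
  have : (1 : ℝ) ≤ 4 ^ w.q := one_le_pow₀ (by norm_num)
  exact le_mul_of_one_le_left (by positivity) this

omit h in
lemma two_div_le : 2 / (w.B : ℝ) ≤ 121 / 3 ^ w.R := by
  unfold Params.B
  push_cast
  rw [div_le_div_iff₀ (by positivity) (by positivity)]
  have : (3 : ℝ) ^ w.R ≤ 16 ^ w.R := by gcongr; norm_num
  have : (0 : ℝ) < 16 ^ w.R := by positivity
  linarith

/-- The terms of `pass_err` are merged into one. Since `1 ≤ κ B`, even the pure rounding units can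
be charged to `κ B`, and `n ≥ 2` absorbs the lower powers of `n`. -/
lemma rounding {a : ℝ} (ha0 : 0 ≤ a) (ha : a ≤ w.n) {ρ : ℝ}
    (hρ : ρ = 9 * w.n ^ 2 * (1 + 121 / 3 ^ w.R * (2 * (2 * a * ((w.n ^ w.d + 1) * w.B) + w.B)
      + 2 * ((w.n ^ w.d + 1) * w.B)))) :
    (1 + 2 * h.kappa * (2 * a * ((w.n ^ w.d + 1) * w.B) + w.B) + 2 * ρ)
      ≤ 256 * h.kappa * (w.n ^ 3 * w.n ^ w.d) * w.B := by
  have hB := B_pos (w := w)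
  have hn : (2 : ℝ) ≤ w.n := by exact_mod_cast h.n_two
  have hN : (w.n : ℝ) ≤ w.n ^ w.d := le_self_pow₀ (by linarith) h.d_pos.ne'
  have hη := h.eta_le
  have h2 := two_div_le (w := w)
  rw [div_le_iff₀ hB] at h2
  set N : ℝ := (w.n : ℝ) ^ w.d
  set n : ℝ := (w.n : ℝ)
  set B : ℝ := (w.B : ℝ)
  set η : ℝ := 121 / 3 ^ w.R with hηd
  have hη0 : 0 ≤ η := by positivity
  set κ := h.kappa
  have hκ0 : 0 ≤ κ := hη0.trans hη
  have hN2 : 2 ≤ N := hn.trans hN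
  have e1 : 2 * a * ((N + 1) * B) + B ≤ 4 * (n * N) * B := by
    have : 2 * a * (N + 1) + 1 ≤ 4 * (n * N) := by
      have h3 : a * (N + 1) ≤ n * (N + 1) := by gcongr
      nlinarith
    calc _ = (2 * a * (N + 1) + 1) * B := by ring
      _ ≤ _ := by gcongr
  have e2 : 2 * (2 * a * ((N + 1) * B) + B) + 2 * ((N + 1) * B) ≤ 11 * (n * N) * B := by
    have : 2 * (N + 1) ≤ 3 * (n * N) := by nlinarith
    have h4 : 2 * ((N + 1) * B) ≤ 3 * (n * N) * B := by
      calc _ = (2 * (N + 1)) * B := by ring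
        _ ≤ _ := by gcongr
    linarith
  have e3 : η * (2 * (2 * a * ((N + 1) * B) + B) + 2 * ((N + 1) * B)) ≤ κ * (11 * (n * N) * B) := by
    gcongr
  have h1B : 1 ≤ κ * B := by
    have : η * B ≤ κ * B := by gcongr
    linarith
  have e4 : ρ ≤ 9 * n ^ 2 * (κ * B + κ * (11 * (n * N) * B)) := by
    rw [hρ]; gcongr
  have e5 : κ * (2 * a * ((N + 1) * B) + B) ≤ κ * (4 * (n * N) * B) := by gcongr
  have hκB : 0 ≤ κ * B := by positivity
  have e6 : 1 + 8 * (n * N) + 18 * n ^ 2 * (1 + 11 * (n * N)) ≤ 256 * (n ^ 3 * N) := by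
    have p1 : 4 ≤ n ^ 2 := by nlinarith
    have p2 : 4 ≤ n * N := by nlinarith
    have p3 : n ^ 2 * 4 ≤ n ^ 2 * (n * N) := by gcongr
    have p4 : 4 * (n * N) ≤ n ^ 2 * (n * N) := by gcongr
    have p5 : n ^ 3 * N = n ^ 2 * (n * N) := by ring
    rw [p5]
    nlinarith
  have := mul_le_mul_of_nonneg_left e6 hκB
  nlinarith

/-- One pass applies the heat steps in one coordinate. -/
lemma pass_spec {t : ℕ} (ht : t < w.d) {Ω e : ℝ} {v : Lat} (hv : Regular w.d w.n (w.n ^ w.d) Ω v)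
    (he : e ≤ 1) {A : ℕ → ℤ}
    (hA : ∀ q < w.n ^ w.d, |(A q : ℝ) / w.B - v (dig w.d w.n t q)| ≤ e) :
    ∀ q < w.n ^ w.d, |(w.pass A q : ℝ) / w.B
      - (heatStep h.step (w.d - 1 - t) ^ 2 ^ w.q) v (dig w.d w.n (t + 1) q)|
      ≤ (1 + 1 / w.d) * e + (10 * (h.step * 2 ^ w.q) * Real.exp (-(2 * l)) * Ω
        + 256 * h.kappa * (w.n ^ 3 * w.n ^ w.d)) := by
  intro q hq
  have hB := B_pos (w := w)
  have hn : 0 < w.n := by have := h.n_two; omega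
  have hNM := h.pow_eq
  set row := q / w.n with hrow
  set j := q % w.n with hj
  have hjn : j < w.n := Nat.mod_lt _ hn
  have hrM : row < w.M := by
    rw [hrow, Nat.div_lt_iff_lt_mul hn, mul_comm, hNM]; exact hq
  have hqe : q = row * w.n + j := by rw [hrow, hj, mul_comm]; exact (Nat.div_add_mod q w.n).symm
  set b := dig w.d w.n t row with hb
  set k := w.d - 1 - t with hk
  have hkd : k < w.d := by omega
  -- `g` is the exact line and `G` the stored one, continued periodically and still in units of `1 /
  -- B`.
  set g : ℤ → ℝ := fun x => v (b + x • unitVec k) with hg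
  set G : ℤ → ℝ := fun x => (w.line A row (x % w.n).toNat : ℝ) with hG
  have hgp : ∀ x, g (x + w.n) = g x := by
    intro x
    simp only [hg, add_smul, ← add_assoc]
    exact hv.periodic k hkd _
  have hgo : ∀ x y, |g x - g y| ≤ Ω := by
    intro x y
    have := hv.osc k hkd (b + y • unitVec k) (x - y)
    rw [add_assoc, ← add_smul, add_sub_cancel] at this
    exact this
  have hgm : ∀ x : ℤ, g x = g ((x % w.n).toNat : ℕ) := by
    intro x
    have h1 : (((x % w.n).toNat : ℕ) : ℤ) = x % w.n :=
      Int.toNat_of_nonneg (Int.emod_nonneg _ (by omega))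
    rw [h1]
    have h2 : Function.Periodic g (w.n : ℤ) := hgp
    have h3 := h2.int_mul (x / w.n) (x % w.n)
    rw [← h3]
    congr 1
    rw [mul_comm]
    simpa using (Int.emod_add_mul_ediv x w.n).symm
  have hline : ∀ x < w.n, |(w.line A row x : ℝ) / w.B - g x| ≤ e := by
    intro x hx
    have h1 : row + x * w.M < w.n ^ w.d := by
      have : (x + 1) * w.M ≤ w.n * w.M := Nat.mul_le_mul_right _ hx
      rw [add_mul] at this
      omega
    have h2 := hA _ h1
    rw [h.M_eq, dig_line ht (by rw [← h.M_eq]; exact hrM) hx] at h2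
    unfold Params.line
    rw [Nat.mod_eq_of_lt hx, h.M_eq]
    exact h2
  have hGg : ∀ x, |(1 / (w.B : ℝ)) • G x - g x| ≤ e := by
    intro x
    rw [hgm x, smul_eq_mul, one_div, inv_mul_eq_div]
    refine hline _ ?_
    have h1 := Int.emod_lt_of_pos x (by omega : (0 : ℤ) < w.n)
    have h2 := Int.emod_nonneg x (by omega : (w.n : ℤ) ≠ 0)
    omega
  have hX : ∀ t, |(w.line A row t : ℝ)| ≤ (w.n ^ w.d + 1) * w.B := by
    intro t
    have h1 : w.line A row t = w.line A row (t % w.n) := by simp [Params.line]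
    have h2 := hline _ (Nat.mod_lt t hn)
    rw [← h1] at h2
    have h3 := hv.bdd (b + ((t % w.n : ℕ) : ℤ) • unitVec k)
    have h4 := abs_sub_abs_le_abs_sub ((w.line A row t : ℝ) / w.B) (g (t % w.n : ℕ))
    have h5 : |(w.line A row t : ℝ) / w.B| ≤ w.n ^ w.d + 1 := by
      simp only [hg] at h2 h4; linarith
    rwa [abs_div, abs_of_pos hB, div_le_iff₀ hB] at h5
  have hr := h.rounding (a := w.a) (by positivity) (by exact_mod_cast h.a_le) rfl
  have hκ1 : 256 * h.kappa * (w.n ^ 3 * w.n ^ w.d) ≤ 1 := h.prec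
  have hnn : (1 : ℝ) ≤ w.n ^ 3 * w.n ^ w.d := by
    rw [← pow_add]
    exact one_le_pow₀ (by exact_mod_cast hn)
  have hκ0 : 0 ≤ h.kappa := by unfold kappa; positivity
  have hκ : h.kappa ≤ 1 := by nlinarith
  set X : ℝ := (w.n ^ w.d + 1) * w.B with hXd
  have hX0 : 0 ≤ X := by positivity
  have hp := pass_err (w := w) (η := 121 / 3 ^ w.R) (κ := h.kappa) (c := h.step) (X := X) h.a_pos h.a_le
    h.p_le rfl h.step_nonneg h.step_le
    (fun k hk => by
      have h1 := cosFix_err (k := k) (ps := w.ps) h.six_le h.a_pos hk h.ps_near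
      unfold Params.cosine Params.B
      push_cast
      exact h1)
    two_div_le rfl hκ (A := A) (row := row) hX rfl
    (by
      have h1 : 0 ≤ 2 * h.kappa * (2 * w.a * X + w.B) := by positivity
      have h2 : 256 * h.kappa * (w.n ^ 3 * w.n ^ w.d) * (w.B : ℝ) ≤ 1 * w.B := by gcongr
      have h3 : 0 ≤ 9 * (w.n : ℝ) ^ 2 * (1 + 121 / 3 ^ w.R * (2 * (2 * w.a * X + w.B) + 2 * X)) := by
        positivity
      linarith)
    (G := G) (fun t => by
      simp only [hG]
      congr 1
      have : ((t : ℤ) % w.n).toNat = t % w.n := by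
        rw [← Int.natCast_mod, Int.toNat_natCast]
      rw [this]
      simp [Params.line])
    (fun x => by simp [hG]) (i := q) rfl
  have hp' := hp.trans hr
  rw [← hj] at hp'
  have k1 := h.kernel_spec.1 g Ω hgo hgp j
  have k2 := h.kernel_spec.2 ((1 / (w.B : ℝ)) • G - g) e hGg j
  rw [kernel_sub, kernel_smul] at k2
  have e1 : (heatStep h.step k ^ 2 ^ w.q) v (dig w.d w.n (t + 1) q)
      = (lineStep h.step ^ 2 ^ w.q) g j := by
    rw [hqe, dig_succ_line ht (by rw [← h.M_eq]; exact hrM) hjn, heatStep_pow_line]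
  rw [e1]
  -- Rounding within the pass, propagation of the inherited error through the linear kernel, and
  -- truncation of window and modes.
  have e2 : (w.pass A q : ℝ) / w.B - (lineStep h.step ^ 2 ^ w.q) g j
      = ((w.pass A q : ℝ) - kernel h.step (2 ^ w.q) w.a w.p G j) / w.B
        + (1 / w.B * kernel h.step (2 ^ w.q) w.a w.p G j - kernel h.step (2 ^ w.q) w.a w.p g j)
        + (kernel h.step (2 ^ w.q) w.a w.p g j - (lineStep h.step ^ 2 ^ w.q) g j) := by ring
  rw [e2]
  refine (abs_add_three _ _ _).trans ?_
  have k3 : |((w.pass A q : ℝ) - kernel h.step (2 ^ w.q) w.a w.p G j) / w.B|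
      ≤ 256 * h.kappa * (w.n ^ 3 * w.n ^ w.d) := by
    rw [abs_div, abs_of_pos hB, div_le_iff₀ hB]; exact hp'
  linarith

/-- The error committed in a pass. -/
abbrev passErr (h : w.Fit l m) (Ω : ℝ) : ℝ :=
  10 * (h.step * 2 ^ w.q) * Real.exp (-(2 * l)) * Ω + 256 * h.kappa * (w.n ^ 3 * w.n ^ w.d)

omit h in
lemma one_add_inv_pow_le {d t : ℕ} (hd : 0 < d) (ht : t ≤ d) : (1 + 1 / (d : ℝ)) ^ t ≤ 3 := by
  have hd' : (0 : ℝ) < d := by exact_mod_cast hd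
  calc (1 + 1 / (d : ℝ)) ^ t ≤ Real.exp (1 / d) ^ t := by
        gcongr; linarith [Real.add_one_le_exp (1 / (d : ℝ))]
    _ = Real.exp (t / d) := by rw [← Real.exp_nat_mul]; congr 1; ring
    _ ≤ Real.exp 1 := by
        gcongr
        rw [div_le_one hd']; exact_mod_cast ht
    _ ≤ 3 := by linarith [Real.exp_one_lt_d9]

/-- After all passes the memory holds approximations of the solution of the split scheme; on the
way its entries stay bounded. -/
lemma passes_spec {Ω e₀ : ℝ} {v : Lat} (hv : Regular w.d w.n (w.n ^ w.d) Ω v) (he₀ : 0 ≤ e₀)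
    (he : 3 * (e₀ + w.d * h.passErr Ω) ≤ 1) {A : ℕ → ℤ}
    (hA : ∀ q < w.n ^ w.d, |(A q : ℝ) / w.B - v (dig w.d w.n 0 q)| ≤ e₀) :
    (∀ q < w.n ^ w.d, |(w.passes A w.d q : ℝ) / w.B
      - (splitStep h.step w.d ^ 2 ^ w.q) v (dig w.d w.n 0 q)| ≤ 3 * (e₀ + w.d * h.passErr Ω)) ∧
    ∀ t ≤ w.d, ∀ q < w.n ^ w.d, |(w.passes A t q : ℝ)| ≤ (w.n ^ w.d + 1) * w.B := by
  have hB := B_pos (w := w)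
  have hΩ : 0 ≤ Ω := (abs_nonneg _).trans (hv.osc 0 h.d_pos 0 0)
  have hc := h.step_nonneg
  set σ := h.passErr Ω with hσ
  have hσ0 : 0 ≤ σ := by rw [hσ]; unfold passErr kappa; positivity
  have hd' : (0 : ℝ) < w.d := by exact_mod_cast h.d_pos
  -- An amplification of `1 + 1 / d` per pass costs at most a factor `e ≤ 3` over all passes.
  have herr : ∀ t ≤ w.d, (1 + 1 / (w.d : ℝ)) ^ t * (e₀ + t * σ) ≤ 3 * (e₀ + w.d * σ) := by
    intro t ht
    have h1 := one_add_inv_pow_le h.d_pos ht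
    have : (t : ℝ) ≤ w.d := by exact_mod_cast ht
    gcongr
  have key : ∀ t ≤ w.d, ∃ v' : Lat, Regular w.d w.n (w.n ^ w.d) Ω v' ∧
      (splitStep h.step (w.d - t) ^ 2 ^ w.q) v' = (splitStep h.step w.d ^ 2 ^ w.q) v ∧
      ∀ q < w.n ^ w.d, |(w.passes A t q : ℝ) / w.B - v' (dig w.d w.n t q)|
        ≤ (1 + 1 / (w.d : ℝ)) ^ t * (e₀ + t * σ) := by
    intro t
    induction t with
    | zero => intro _; exact ⟨v, hv, rfl, by simpa [Params.passes] using hA⟩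
    | succ t ih =>
      intro ht
      obtain ⟨v', r1, r2, r3⟩ := ih (by omega)
      refine ⟨(heatStep h.step (w.d - 1 - t) ^ 2 ^ w.q) v', r1.heatStep_pow h.step_nonneg h.step_le _ _,
        ?_, ?_⟩
      · rw [← r2, show w.d - t = (w.d - 1 - t) + 1 by omega, splitStep_succ_pow,
          show w.d - (t + 1) = w.d - 1 - t by omega]
        rfl
      · intro q hq
        have h1 := h.pass_spec (by omega : t < w.d) r1 ((herr t (by omega)).trans he) r3 q hq
        refine h1.trans ?_
        have h2 : (1 : ℝ) ≤ (1 + 1 / (w.d : ℝ)) ^ (t + 1) :=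
          one_le_pow₀ (by have : 0 < 1 / (w.d : ℝ) := by positivity
                          linarith)
        have h3 : σ ≤ (1 + 1 / (w.d : ℝ)) ^ (t + 1) * σ := le_mul_of_one_le_left hσ0 h2
        push_cast
        calc _ = (1 + 1 / (w.d : ℝ)) ^ (t + 1) * (e₀ + t * σ) + σ := by
              rw [hσ]; ring
          _ ≤ (1 + 1 / (w.d : ℝ)) ^ (t + 1) * (e₀ + t * σ) + (1 + 1 / (w.d : ℝ)) ^ (t + 1) * σ := by
              linarith
          _ = _ := by ring
  refine ⟨fun q hq => ?_, fun t ht q hq => ?_⟩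
  · obtain ⟨v', -, r2, r3⟩ := key w.d le_rfl
    have h1 := (r3 q hq).trans (herr w.d le_rfl)
    rw [← r2, Nat.sub_self, ← dig_self]
    simpa [splitStep] using h1
  · obtain ⟨v', r1, -, r3⟩ := key t ht
    have h1 := (r3 q hq).trans ((herr t ht).trans he)
    have h2 := abs_sub_abs_le_abs_sub ((w.passes A t q : ℝ) / w.B) (v' (dig w.d w.n t q))
    have h3 := r1.bdd (dig w.d w.n t q)
    have h5 : |(w.passes A t q : ℝ) / w.B| ≤ w.n ^ w.d + 1 := by linarith
    rwa [abs_div, abs_of_pos hB, div_le_iff₀ hB] at h5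

end Params.Fit

end HeatFFT
end

open Set
noncomputable section
namespace HeatFFT

/-! ## Choice of the parameters -/

/-- The data on which the choice of the parameters depends: `θ = α T / L²` and the accuracy `ε`. -/
structure Task where
  d : ℕ
  n : ℕ
  m : ℕ
  i : ℕ
  θ : ℝ
  ε : ℝ

namespace Task
variable (τ : Task)

@[irreducible]
def ln : ℕ := Nat.clog 2 τ.n
@[irreducible]
def lm : ℕ := Nat.clog 2 τ.m
@[irreducible]
def le : ℕ := Nat.clog 2 ⌈1 / τ.ε⌉₊

/-- The number of squarings; the scheme makes `2 ^ q` time steps. -/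
@[irreducible]
def q : ℕ := τ.lm + 2 * τ.ln + 11

/-- The exponent of accuracy of the truncation of window and modes. -/
@[irreducible]
def l : ℕ := 2 * τ.ln + τ.lm + 6

/-- A quarter of the number of binary digits after the point. -/
@[irreducible]
def R : ℕ := τ.d * τ.ln + τ.d + 2 * τ.q + 3 * τ.ln + τ.le + 30

@[irreducible]
def B : ℤ := 16 ^ τ.R

/-- The numerator of the step parameter. -/
@[irreducible]
def ch : ℤ := ⌊(2 : ℝ) ^ (4 * τ.R) * τ.θ⌋ * τ.n * τ.n * τ.i / (τ.m * 2 ^ τ.q)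

/-- The number of doublings of the window. -/
@[irreducible]
def g : ℕ := Nat.clog 4 ⌈(τ.ch * 2 ^ τ.q : ℝ) / (τ.l * τ.B)⌉₊

/-- Half the length of the window. -/
@[irreducible]
def a : ℕ := min (4 * τ.l * 2 ^ τ.g) τ.n

/-- The parameters used by the algorithm. -/
def w : Params where
  d := τ.d
  n := τ.n
  M := τ.n ^ (τ.d - 1)
  a := τ.a
  p := min τ.a (8 * τ.l)
  q := τ.q
  R := τ.R
  ps := piSum τ.B τ.R
  ch := τ.ch

/-- Conditions on the data. -/
structure Valid : Prop where
  d_pos : 0 < τ.d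
  n_two : 2 ≤ τ.n
  m_pos : 0 < τ.m
  i_le : τ.i ≤ τ.m
  θ_nonneg : 0 ≤ τ.θ
  ε_pos : 0 < τ.ε
  ε_lt : τ.ε < 1
  time_le : τ.d * (τ.θ * τ.n ^ 2) ≤ 2 * τ.m

variable {τ}

lemma n_le : τ.n ≤ 2 ^ τ.ln := by unfold ln; exact Nat.le_pow_clog (by norm_num) _

lemma m_le : τ.m ≤ 2 ^ τ.lm := by unfold lm; exact Nat.le_pow_clog (by norm_num) _

lemma steps_le : 1600 * τ.m * τ.n ^ 2 ≤ 2 ^ τ.q := by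
  calc 1600 * τ.m * τ.n ^ 2 ≤ 2 ^ 11 * 2 ^ τ.lm * (2 ^ τ.ln) ^ 2 := by
        gcongr
        · norm_num
        · exact m_le
        · exact n_le
    _ = 2 ^ τ.q := by
      rw [← pow_mul, ← pow_add, ← pow_add]; congr 1; unfold q; ring

lemma w_B : τ.w.B = τ.B := by unfold B; rfl

lemma a_le : τ.a ≤ τ.n := by unfold a; exact min_le_right _ _

/-- The test by which the program finds this exponent from the digits of `ε`. -/
lemma le_le_iff (hε : 0 < τ.ε) {k : ℕ} : τ.le ≤ k ↔ 1 ≤ 2 ^ k * τ.ε := by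
  unfold le
  rw [Nat.clog_le_iff_le_pow (by norm_num), Nat.ceil_le, div_le_iff₀ hε]
  push_cast
  rfl

lemma one_le_mul (hε : 0 < τ.ε) : 1 ≤ 2 ^ τ.le * τ.ε := (le_le_iff hε).1 le_rfl

lemma B_pos : 0 < τ.B := by unfold B; positivity

lemma B_eq : (τ.B : ℝ) = 16 ^ τ.R := by unfold B; push_cast; rfl

lemma B_eq' : (τ.B : ℝ) = 2 ^ (4 * τ.R) := by rw [B_eq, pow_mul]; norm_num

lemma six_le_l : 6 ≤ τ.l := by unfold l; omega

/-- Equivalent to `c 2 ^ q ≤ l 4 ^ k`, stated in integers: it is the loop condition of the program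
and yields both the lower and the upper bound for the window. -/
lemma g_le_iff {k : ℕ} : τ.g ≤ k ↔ τ.ch * 2 ^ τ.q ≤ τ.l * τ.B * 4 ^ k := by
  have hl : (0 : ℝ) < τ.l := by exact_mod_cast (by have := six_le_l (τ := τ); omega : 0 < τ.l)
  have hB : (0 : ℝ) < τ.B := by exact_mod_cast B_pos
  unfold g
  rw [Nat.clog_le_iff_le_pow (by norm_num), Nat.ceil_le, div_le_iff₀ (by positivity)]
  push_cast
  rw [mul_comm (4 ^ k : ℝ)]
  exact_mod_cast Iff.rfl

namespace Valid
variable (h : τ.Valid)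
include h

lemma floor_nonneg : 0 ≤ ⌊(2 : ℝ) ^ (4 * τ.R) * τ.θ⌋ :=
  Int.floor_nonneg.2 (mul_nonneg (by positivity) h.θ_nonneg)

lemma ch_nonneg : 0 ≤ τ.ch := by
  have := h.floor_nonneg
  unfold ch
  exact Int.ediv_nonneg (by positivity) (by positivity)

lemma ch_mul_le : τ.ch * 2 ^ τ.q ≤ ⌊(2 : ℝ) ^ (4 * τ.R) * τ.θ⌋ * τ.n * τ.n := by
  have hm : (0 : ℤ) < τ.m := by exact_mod_cast h.m_pos
  have h1 : τ.ch * (τ.m * 2 ^ τ.q) ≤ ⌊(2 : ℝ) ^ (4 * τ.R) * τ.θ⌋ * τ.n * τ.n * τ.i :=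
    by unfold ch; exact Int.ediv_mul_le _ (by have := h.m_pos; positivity)
  have h2 : ⌊(2 : ℝ) ^ (4 * τ.R) * τ.θ⌋ * τ.n * τ.n * τ.i
      ≤ ⌊(2 : ℝ) ^ (4 * τ.R) * τ.θ⌋ * τ.n * τ.n * τ.m := by
    have := h.floor_nonneg
    have : (τ.i : ℤ) ≤ τ.m := by exact_mod_cast h.i_le
    gcongr
  refine le_of_mul_le_mul_right ?_ hm
  linarith

/-- All roundings in the step parameter go downwards, so the time restriction passes exactly from
the real data to the integers. -/
lemma time_le_int : τ.d * (τ.ch * 2 ^ τ.q) ≤ 2 * τ.m * τ.B := by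
  have h1 : (τ.ch * 2 ^ τ.q : ℝ) ≤ ⌊(2 : ℝ) ^ (4 * τ.R) * τ.θ⌋ * τ.n * τ.n := by
    exact_mod_cast h.ch_mul_le
  have h2 := Int.floor_le ((2 : ℝ) ^ (4 * τ.R) * τ.θ)
  have : (τ.d * (τ.ch * 2 ^ τ.q) : ℝ) ≤ 2 * τ.m * τ.B := by
    calc (τ.d * (τ.ch * 2 ^ τ.q) : ℝ) ≤ τ.d * (((2 : ℝ) ^ (4 * τ.R) * τ.θ) * τ.n * τ.n) := by
          refine mul_le_mul_of_nonneg_left (h1.trans ?_) (by positivity)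
          gcongr
      _ = τ.d * (τ.θ * τ.n ^ 2) * τ.B := by rw [B_eq']; ring
      _ ≤ _ := by
        have : (0 : ℝ) < τ.B := by exact_mod_cast B_pos
        have := h.time_le
        gcongr
  exact_mod_cast this

lemma ch_mul_le' : τ.ch * 2 ^ τ.q ≤ 2 * τ.m * τ.B := by
  refine le_trans ?_ h.time_le_int
  have := h.ch_nonneg
  exact le_mul_of_one_le_left (by positivity) (by exact_mod_cast h.d_pos)

lemma ch_le : 4 * τ.ch ≤ τ.B := by
  have h1 := h.ch_mul_le'
  have h2 : (8 * τ.m : ℤ) ≤ 2 ^ τ.q := by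
    have : 2 ^ (3 + τ.lm) ≤ 2 ^ τ.q := Nat.pow_le_pow_right (by norm_num) (by unfold q; omega)
    rw [pow_add] at this
    have h3 := m_le (τ := τ)
    exact_mod_cast (by omega : 8 * τ.m ≤ 2 ^ τ.q)
  have hm : (0 : ℤ) < 2 * τ.m := by have := h.m_pos; omega
  have h3 := mul_le_mul_of_nonneg_left h2 h.ch_nonneg
  refine le_of_mul_le_mul_left ?_ hm
  linarith

lemma g_le : τ.g ≤ τ.lm := by
  rw [g_le_iff]
  refine h.ch_mul_le'.trans ?_
  have h1 : (τ.m : ℤ) ≤ 2 ^ τ.lm := by exact_mod_cast m_le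
  have h2 : (2 : ℤ) ^ τ.lm ≤ 4 ^ τ.lm := by gcongr; norm_num
  have h3 : (6 : ℤ) ≤ τ.l := by exact_mod_cast six_le_l
  have hB := B_pos (τ := τ)
  calc 2 * τ.m * τ.B = 2 * τ.B * τ.m := by ring
    _ ≤ τ.l * τ.B * 4 ^ τ.lm := by
        have h4 : 2 * τ.B ≤ τ.l * τ.B := by nlinarith
        exact mul_le_mul h4 (h1.trans h2) (by positivity) (by positivity)

/-- The exponent `R` is the sum of the binary logarithms of the factors on the left and of `1 / ε`,
each rounded up, with `2 ^ d` in place of `d`. -/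
lemma precision : 2 ^ 30 * (4 ^ τ.q * (τ.n ^ 3 * τ.n ^ τ.d) * τ.d : ℝ) ≤ τ.ε * 2 ^ τ.R := by
  have h1 : (τ.n : ℝ) ≤ 2 ^ τ.ln := by exact_mod_cast n_le (τ := τ)
  have h2 := one_le_mul h.ε_pos
  have h3 : (τ.d : ℝ) ≤ 2 ^ τ.d := by exact_mod_cast Nat.lt_two_pow_self.le
  have hε := h.ε_pos
  have e : (2 : ℝ) ^ τ.R = 2 ^ 30 * (4 ^ τ.q * ((2 ^ τ.ln) ^ 3 * (2 ^ τ.ln) ^ τ.d) * 2 ^ τ.d) * 2 ^ τ.le := by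
    have : (4 : ℝ) ^ τ.q = 2 ^ (2 * τ.q) := by rw [pow_mul]; norm_num
    rw [this]
    simp only [← pow_mul, ← pow_add]
    congr 1
    unfold R
    ring
  rw [e]
  calc 2 ^ 30 * (4 ^ τ.q * (τ.n ^ 3 * τ.n ^ τ.d) * τ.d : ℝ)
      ≤ 2 ^ 30 * (4 ^ τ.q * ((2 ^ τ.ln) ^ 3 * (2 ^ τ.ln) ^ τ.d) * 2 ^ τ.d : ℝ) := by gcongr
    _ ≤ (2 ^ 30 * (4 ^ τ.q * ((2 ^ τ.ln) ^ 3 * (2 ^ τ.ln) ^ τ.d) * 2 ^ τ.d : ℝ)) * (2 ^ τ.le * τ.ε) :=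
        le_mul_of_one_le_right (by positivity) h2
    _ = _ := by ring

lemma kappa_le : 4 ^ τ.q * (121 / 3 ^ τ.R) * (τ.n ^ 3 * τ.n ^ τ.d) * τ.d ≤ τ.ε / 2 ^ 23 := by
  have h1 := h.precision
  have h2 : (2 : ℝ) ^ τ.R ≤ 3 ^ τ.R := by gcongr; norm_num
  have h3 : (0 : ℝ) < 3 ^ τ.R := by positivity
  have h4 := mul_le_mul_of_nonneg_left h2 h.ε_pos.le
  have e : 4 ^ τ.q * (121 / 3 ^ τ.R) * (τ.n ^ 3 * τ.n ^ τ.d) * τ.d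
      = 121 * (4 ^ τ.q * (τ.n ^ 3 * τ.n ^ τ.d) * τ.d : ℝ) / 3 ^ τ.R := by ring
  rw [e, div_le_iff₀ h3]
  set P : ℝ := 4 ^ τ.q * (τ.n ^ 3 * τ.n ^ τ.d) * τ.d
  have hP : 0 ≤ P := by positivity
  linarith

omit h in
lemma ps_near : |4 * (piSum τ.B τ.R : ℝ) / 16 ^ τ.R - Real.pi| ≤ 28 / 4 ^ τ.R := by
  have h1 := piSum_err (B := τ.B) B_pos τ.R
  rw [B_eq] at h1
  refine h1.trans ?_
  have h2 : (τ.R : ℝ) ≤ 4 ^ τ.R := by exact_mod_cast (Nat.lt_pow_self (by norm_num)).le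
  have e : (16 : ℝ) ^ τ.R = 4 ^ τ.R * 4 ^ τ.R := by rw [← mul_pow]; norm_num
  have h3 : 20 * (τ.R : ℝ) / 16 ^ τ.R ≤ 20 / 4 ^ τ.R := by
    rw [e, div_le_div_iff₀ (by positivity) (by positivity)]
    have : (0 : ℝ) < 4 ^ τ.R := by positivity
    nlinarith
  calc _ ≤ 20 / 4 ^ τ.R + 8 / (4 : ℝ) ^ τ.R := by gcongr
    _ = _ := by ring

/-- The substantial fields are `window` and `trunc`: minimality of `g` places the half length `a`
within constant factors of the right scale, unless `a = n` or all modes are kept. -/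
lemma fit : τ.w.Fit τ.l τ.m where
  d_pos := h.d_pos
  n_two := h.n_two
  M_eq := rfl
  a_pos := by
    have := six_le_l (τ := τ)
    have := h.n_two
    show 0 < τ.a
    unfold a
    exact lt_min (by positivity) (by omega)
  a_le := a_le
  p_le := min_le_left _ _
  ch_nonneg := h.ch_nonneg
  ch_le := by rw [w_B]; exact h.ch_le
  l_pos := by have := six_le_l (τ := τ); omega
  n_le := n_le.trans (Nat.pow_le_pow_right (by norm_num) (by unfold l; omega))
  nm_le := by
    calc 4 * τ.n * τ.m ≤ 2 ^ 2 * 2 ^ τ.ln * 2 ^ τ.lm := by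
          gcongr
          · norm_num
          · exact n_le
          · exact m_le
      _ = 2 ^ (2 + τ.ln + τ.lm) := by rw [← pow_add, ← pow_add]
      _ ≤ _ := Nat.pow_le_pow_right (by norm_num) (by unfold l; omega)
  time_le := by rw [w_B]; exact h.time_le_int
  -- With `a = 4 l 2 ^ g` and `c 2 ^ q ≤ l 4 ^ g` one gets `16 (c 2 ^ q) l ≤ 16 l ^ 2 4 ^ g = a ^
  -- 2`.
  window := by
    rcases min_choice (4 * τ.l * 2 ^ τ.g) τ.n with hc | hc
    · right
      have e : τ.w.a = 4 * τ.l * 2 ^ τ.g := by show τ.a = _; unfold a; exact hc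
      refine ⟨by rw [e]; exact Nat.le_mul_of_pos_right _ (by positivity), ?_⟩
      have h1 := g_le_iff.1 (le_refl τ.g)
      have h2 : (0 : ℤ) ≤ τ.l := by positivity
      rw [e]
      calc 16 * (τ.w.ch * 2 ^ τ.w.q) * (τ.l : ℤ) ≤ 16 * (τ.l * τ.B * 4 ^ τ.g) * τ.l := by
            exact mul_le_mul_of_nonneg_right (mul_le_mul_of_nonneg_left h1 (by norm_num)) h2
        _ = ((4 * τ.l * 2 ^ τ.g : ℕ) : ℤ) ^ 2 * τ.w.B := by
            have : (4 : ℤ) ^ τ.g = (2 ^ τ.g) ^ 2 := by rw [← pow_mul, mul_comm, pow_mul]; norm_num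
            have e2 := w_B (τ := τ)
            rw [this, e2]
            generalize τ.B = b
            push_cast; ring
    · left; show τ.a = τ.n; unfold a; exact hc
  -- If `a > 8 l` then `g` is positive, and by minimality the defining inequality fails for `g - 1`;
  -- hence `a ^ 2 ≤ 64 l (l 4 ^ (g - 1)) ≤ 64 (c 2 ^ q) l`.
  trunc := by
    rcases le_or_gt τ.a (8 * τ.l) with hc | hc
    · left; exact min_eq_left hc
    · right
      have e : τ.w.p = 8 * τ.l := min_eq_right hc.le
      refine ⟨e.ge, ?_⟩
      have ha : τ.a ≤ 4 * τ.l * 2 ^ τ.g := by unfold a; exact min_le_left _ _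
      obtain ⟨g', hg'⟩ : ∃ g', τ.g = g' + 1 := by
        refine ⟨τ.g - 1, ?_⟩
        rcases Nat.eq_zero_or_pos τ.g with h0 | h0
        · rw [h0] at ha; omega
        · omega
      have h1 : ¬ τ.g ≤ g' := by omega
      rw [g_le_iff, not_le] at h1
      have h2 : (0 : ℤ) ≤ τ.l := by positivity
      have ha' : (τ.a : ℤ) ≤ 4 * τ.l * 2 ^ τ.g := by exact_mod_cast ha
      have hB := B_pos (τ := τ)
      calc (τ.w.a : ℤ) ^ 2 * τ.w.B ≤ (4 * τ.l * 2 ^ τ.g) ^ 2 * τ.w.B :=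
            mul_le_mul_of_nonneg_right (pow_le_pow_left₀ (by positivity) ha' 2) (by rw [w_B]; exact hB.le)
        _ = 64 * (τ.l * τ.B * 4 ^ g') * τ.l := by
            have : (4 : ℤ) ^ g' = (2 ^ g') ^ 2 := by rw [← pow_mul, mul_comm, pow_mul]; norm_num
            have e2 := w_B (τ := τ)
            rw [this, e2, hg', pow_succ]
            generalize τ.B = b
            ring
        _ ≤ 64 * (τ.w.ch * 2 ^ τ.w.q) * τ.l := by
            exact mul_le_mul_of_nonneg_right (mul_le_mul_of_nonneg_left h1.le (by norm_num)) h2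
  six_le := by show 6 ≤ τ.R; unfold R; omega
  ps_near := ps_near
  prec := by
    have h1 := h.kappa_le
    have hd : (1 : ℝ) ≤ τ.d := by exact_mod_cast h.d_pos
    have h2 : 4 ^ τ.q * (121 / 3 ^ τ.R) * (τ.n ^ 3 * τ.n ^ τ.d : ℝ)
        ≤ 4 ^ τ.q * (121 / 3 ^ τ.R) * (τ.n ^ 3 * τ.n ^ τ.d) * τ.d :=
      le_mul_of_one_le_right (by positivity) hd
    have := h.ε_lt
    show 256 * (4 ^ τ.q * (121 / 3 ^ τ.R)) * (τ.n ^ 3 * τ.n ^ τ.d : ℝ) ≤ 1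
    linarith

/-- Two units of `2 ^ (-4 R)`: one from the digits of `θ`, scaled by `(n ^ 2 / 2 ^ q) (i / m) ≤ 1`,
and one from the integer division. -/
lemma step_close : 2 ^ τ.q * |τ.θ * τ.i / τ.m * τ.n ^ 2 / 2 ^ τ.q - τ.ch / τ.B|
    ≤ 2 * 2 ^ τ.q / 2 ^ (4 * τ.R) := by
  have hB : (0 : ℝ) < 2 ^ (4 * τ.R) := by positivity
  have hm : (0 : ℝ) < τ.m := by exact_mod_cast h.m_pos
  have hS : (0 : ℝ) < 2 ^ τ.q := by positivity
  have h1 := abs_ediv_sub_le (⌊(2 : ℝ) ^ (4 * τ.R) * τ.θ⌋ * τ.n * τ.n * τ.i) (y := τ.m * 2 ^ τ.q)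
    (by have := h.m_pos; positivity)
  have h2 : ((⌊(2 : ℝ) ^ (4 * τ.R) * τ.θ⌋ * τ.n * τ.n * τ.i / (τ.m * 2 ^ τ.q) : ℤ) : ℝ) = τ.ch := by
    unfold ch; rfl
  rw [h2] at h1
  push_cast at h1
  have hf : |(⌊(2 : ℝ) ^ (4 * τ.R) * τ.θ⌋ : ℝ) - 2 ^ (4 * τ.R) * τ.θ| ≤ 1 := by
    rw [abs_le]
    have := Int.floor_le ((2 : ℝ) ^ (4 * τ.R) * τ.θ)
    have := Int.lt_floor_add_one ((2 : ℝ) ^ (4 * τ.R) * τ.θ)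
    constructor <;> linarith
  set F : ℝ := (⌊(2 : ℝ) ^ (4 * τ.R) * τ.θ⌋ : ℝ)
  rw [B_eq']
  set B : ℝ := 2 ^ (4 * τ.R)
  set S : ℝ := 2 ^ τ.q with hSd
  have hn : (τ.n : ℝ) ^ 2 ≤ S := by
    have h3 : (τ.n : ℝ) ≤ 2 ^ τ.ln := by exact_mod_cast n_le (τ := τ)
    calc (τ.n : ℝ) ^ 2 ≤ (2 ^ τ.ln) ^ 2 := by gcongr
      _ = 2 ^ (2 * τ.ln) := by rw [← pow_mul, mul_comm]
      _ ≤ _ := pow_le_pow_right₀ (by norm_num) (by unfold q; omega)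
  have him : (τ.i : ℝ) / τ.m ≤ 1 := by
    rw [div_le_one hm]; exact_mod_cast h.i_le
  have h3 : |F * τ.n * τ.n * τ.i / (τ.m * S) - B * τ.θ * τ.n * τ.n * τ.i / (τ.m * S)| ≤ 1 := by
    have e : F * τ.n * τ.n * τ.i / (τ.m * S) - B * τ.θ * τ.n * τ.n * τ.i / (τ.m * S)
        = (F - B * τ.θ) * ((τ.n ^ 2 / S) * (τ.i / τ.m)) := by field_simp
    rw [e, abs_mul, abs_of_nonneg (a := (τ.n ^ 2 / S : ℝ) * _) (by positivity)]
    have h4 : (τ.n : ℝ) ^ 2 / S ≤ 1 := (div_le_one hS).2 hn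
    calc _ ≤ (1 : ℝ) * (1 * 1) := by gcongr
      _ = 1 := by norm_num
  have h5 := abs_sub_le (τ.ch : ℝ) (F * τ.n * τ.n * τ.i / (τ.m * S)) (B * τ.θ * τ.n * τ.n * τ.i / (τ.m * S))
  have e : τ.θ * τ.i / τ.m * τ.n ^ 2 / S - τ.ch / B
      = -((τ.ch - B * τ.θ * τ.n * τ.n * τ.i / (τ.m * S)) / B) := by field_simp; ring
  rw [e, abs_neg, abs_div, abs_of_pos hB, mul_div_assoc', div_le_div_iff_of_pos_right hB, mul_comm]
  gcongr
  linarith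

lemma param_budget : 2 * 2 ^ τ.q / 2 ^ (4 * τ.R) * (4 * τ.d * (τ.n : ℝ) ^ τ.d) ≤ τ.ε / 16 := by
  have h1 := h.precision
  have hn : (1 : ℝ) ≤ τ.n := by exact_mod_cast (by have := h.n_two; omega : 1 ≤ τ.n)
  have h2 : (2 : ℝ) ^ τ.q ≤ 4 ^ τ.q := by gcongr; norm_num
  have h3 : (1 : ℝ) ≤ (τ.n : ℝ) ^ 3 := one_le_pow₀ hn
  have h4 : (2 : ℝ) ^ τ.R ≤ 2 ^ (4 * τ.R) := pow_le_pow_right₀ (by norm_num) (by omega)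
  have hε := h.ε_pos
  have e : 2 * 2 ^ τ.q / 2 ^ (4 * τ.R) * (4 * τ.d * (τ.n : ℝ) ^ τ.d)
      = 8 * (2 ^ τ.q * (1 * (τ.n : ℝ) ^ τ.d) * τ.d) / 2 ^ (4 * τ.R) := by ring
  rw [e, div_le_iff₀ (by positivity)]
  have h5 : (2 ^ τ.q * (1 * (τ.n : ℝ) ^ τ.d) * τ.d) ≤ (4 ^ τ.q * (τ.n ^ 3 * τ.n ^ τ.d) * τ.d : ℝ) := by
    gcongr
  have h6 : τ.ε * 2 ^ τ.R ≤ τ.ε * 2 ^ (4 * τ.R) := by gcongr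
  have h7 : (0 : ℝ) ≤ (2 ^ τ.q * (1 * (τ.n : ℝ) ^ τ.d) * τ.d) := by positivity
  linarith

lemma step_le_exact : (τ.ch : ℝ) / τ.B * 2 ^ τ.q ≤ τ.θ * τ.i / τ.m * τ.n ^ 2 := by
  have hB : (0 : ℝ) < τ.B := by exact_mod_cast B_pos
  have hm : (0 : ℝ) < τ.m := by exact_mod_cast h.m_pos
  have h1 : τ.ch * (τ.m * 2 ^ τ.q) ≤ ⌊(2 : ℝ) ^ (4 * τ.R) * τ.θ⌋ * τ.n * τ.n * τ.i :=
    by unfold ch; exact Int.ediv_mul_le _ (by have := h.m_pos; positivity)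
  have h1' : (τ.ch : ℝ) * (τ.m * 2 ^ τ.q) ≤ ⌊(2 : ℝ) ^ (4 * τ.R) * τ.θ⌋ * τ.n * τ.n * τ.i := by
    exact_mod_cast h1
  have h2 := Int.floor_le ((2 : ℝ) ^ (4 * τ.R) * τ.θ)
  rw [← B_eq'] at h2 h1'
  rw [div_mul_eq_mul_div, div_mul_eq_mul_div, div_le_div_iff₀ hB hm]
  calc (τ.ch : ℝ) * 2 ^ τ.q * τ.m = τ.ch * (τ.m * 2 ^ τ.q) := by ring
    _ ≤ _ := h1'
    _ ≤ τ.B * τ.θ * τ.n * τ.n * τ.i := by gcongr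
    _ = _ := by ring

/-- The oscillation bound brings a factor `n ^ 4`, which `exp (-2 l)` cancels because `2 l` is at
least four binary logarithms of `n` plus `12`. What is left of the truncation term is `d τ Z`, again
of order `ε`; the rounding terms fall under `kappa_le`. -/
lemma passErr_budget {Z : ℝ} (hZ : 0 ≤ Z) (hτZ : τ.d * (τ.θ * τ.n ^ 2) * Z ≤ 3 * τ.ε) :
    3 * (1 / 2 ^ (4 * τ.R) + τ.d * h.fit.passErr (τ.n ^ 4 * Z)) ≤ τ.ε / 8 := by
  have hB : (0 : ℝ) < τ.B := by exact_mod_cast B_pos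
  have hm : (0 : ℝ) < τ.m := by exact_mod_cast h.m_pos
  have hε := h.ε_pos
  have hd : (1 : ℝ) ≤ τ.d := by exact_mod_cast h.d_pos
  have hn : (1 : ℝ) ≤ τ.n := by exact_mod_cast (by have := h.n_two; omega : 1 ≤ τ.n)
  have hk := h.kappa_le
  have hp := h.precision
  have w1 : τ.d * ((τ.ch : ℝ) / τ.B * 2 ^ τ.q) * Z ≤ 3 * τ.ε := by
    refine le_trans ?_ hτZ
    refine mul_le_mul_of_nonneg_right (mul_le_mul_of_nonneg_left ?_ (by positivity)) hZ
    refine h.step_le_exact.trans ?_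
    have him : (τ.i : ℝ) / τ.m ≤ 1 := by rw [div_le_one hm]; exact_mod_cast h.i_le
    have := h.θ_nonneg
    calc τ.θ * τ.i / τ.m * τ.n ^ 2 = (τ.θ * τ.n ^ 2) * (τ.i / τ.m) := by ring
      _ ≤ _ := mul_le_of_le_one_right (by positivity) him
  have w2 : (τ.n : ℝ) ^ 4 * 4096 ≤ Real.exp (2 * τ.l) := by
    have h3 : (τ.n : ℝ) ≤ 2 ^ τ.ln := by exact_mod_cast n_le (τ := τ)
    have h4 : (2 : ℝ) ≤ Real.exp 1 := by linarith [Real.add_one_le_exp (1 : ℝ)]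
    calc (τ.n : ℝ) ^ 4 * 4096 ≤ (2 ^ τ.ln) ^ 4 * 2 ^ 12 := by norm_num; gcongr
      _ = 2 ^ (τ.ln * 4 + 12) := by rw [← pow_mul, ← pow_add]
      _ ≤ 2 ^ (2 * τ.l) := pow_le_pow_right₀ (by norm_num) (by unfold l; omega)
      _ ≤ Real.exp 1 ^ (2 * τ.l) := by gcongr
      _ = Real.exp (2 * τ.l) := by rw [← Real.exp_nat_mul]; push_cast; rw [mul_one]
  have w3 : τ.d * (10 * ((τ.ch : ℝ) / τ.B * 2 ^ τ.q) * Real.exp (-(2 * τ.l)) * (τ.n ^ 4 * Z))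
      ≤ 30 / 4096 * τ.ε := by
    have w4 : (τ.n : ℝ) ^ 4 * Real.exp (-(2 * τ.l)) ≤ 1 / 4096 := by
      rw [Real.exp_neg, ← div_eq_mul_inv, div_le_div_iff₀ (Real.exp_pos _) (by norm_num)]
      linarith
    calc _ = 10 * (τ.d * ((τ.ch : ℝ) / τ.B * 2 ^ τ.q) * Z) * ((τ.n : ℝ) ^ 4 * Real.exp (-(2 * τ.l))) := by
          ring
      _ ≤ 10 * (3 * τ.ε) * (1 / 4096) := by gcongr
      _ = _ := by ring
  have w5 : 1 / (2 : ℝ) ^ (4 * τ.R) ≤ τ.ε / 2 ^ 30 := by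
    rw [div_le_div_iff₀ (by positivity) (by positivity)]
    have h4 : (2 : ℝ) ^ τ.R ≤ 2 ^ (4 * τ.R) := pow_le_pow_right₀ (by norm_num) (by omega)
    have h6 : τ.ε * 2 ^ τ.R ≤ τ.ε * 2 ^ (4 * τ.R) := by gcongr
    have h7 : (1 : ℝ) ≤ 4 ^ τ.q * (τ.n ^ 3 * τ.n ^ τ.d) * τ.d := by
      have a1 : (1 : ℝ) ≤ 4 ^ τ.q := one_le_pow₀ (by norm_num)
      have a2 : (1 : ℝ) ≤ (τ.n : ℝ) ^ 3 := one_le_pow₀ hn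
      have a3 : (1 : ℝ) ≤ (τ.n : ℝ) ^ τ.d := one_le_pow₀ hn
      calc (1 : ℝ) = 1 * (1 * 1) * 1 := by norm_num
        _ ≤ _ := by gcongr
    linarith
  have e : (τ.d : ℝ) * h.fit.passErr (τ.n ^ 4 * Z)
      = τ.d * (10 * ((τ.ch : ℝ) / τ.B * 2 ^ τ.q) * Real.exp (-(2 * τ.l)) * (τ.n ^ 4 * Z))
        + 256 * (4 ^ τ.q * (121 / 3 ^ τ.R) * (τ.n ^ 3 * τ.n ^ τ.d) * τ.d) := by
    unfold Params.Fit.passErr Params.Fit.kappa Params.Fit.step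
    rw [w_B]
    show (τ.d : ℝ) * (10 * ((τ.ch : ℝ) / τ.B * 2 ^ τ.q) * Real.exp (-(2 * τ.l)) * (τ.n ^ 4 * Z)
      + 256 * (4 ^ τ.q * (121 / 3 ^ τ.R)) * (τ.n ^ 3 * τ.n ^ τ.d)) = _
    ring
  rw [e]
  linarith

end Valid

/-- The initial content of the memory. -/
def start (τ : Task) (f : ℕ → ℝ) (q : ℕ) : ℤ := ⌊(2 : ℝ) ^ (4 * τ.R) * f q⌋

/-- The algorithm approximates the solution on the grid, and its intermediate results are bounded. -/
theorem Valid.accuracy {d n m i : ℕ} {L T α ζ ε : ℝ} {u : (Fin d → ℝ) → ℝ → ℝ}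
    (h : (⟨d, n, m, i, α * T / L ^ 2, ε⟩ : Task).Valid) (hL : 0 < L) (hT : 0 < T) (hα : 0 < α) (hζ : 0 < ζ)
    (hu : IsPeriodicHeatSolution α L T u) (hpos : ∀ x, 0 ≤ u x 0) (hb : FourthDerivBound ζ L T u)
    (hsum : ∑ j : Fin d → Fin n, u (gridPoint L n (fun k => (j k : ℕ))) 0 = ((n : ℝ) / L) ^ d)
    (hZ : d * (α * T / L ^ 2 * n ^ 2) * ((L / n) ^ 4 * ζ) ≤ 3 * ε) {f : ℕ → ℝ}
    (hf : ∀ q < n ^ d, f q = gridFun L n u 0 (dig d n 0 q)) :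
    let τ : Task := ⟨d, n, m, i, α * T / L ^ 2, ε⟩
    (∀ q < n ^ d, |(τ.w.passes (τ.start f) d q : ℝ) / τ.B
        - gridFun L n u (i * (T / m)) (dig d n 0 q)| ≤ ε) ∧
      ∀ t ≤ d, ∀ q < n ^ d, |(τ.w.passes (τ.start f) t q : ℝ)| ≤ (n ^ d + 1) * τ.B := by
  intro τ
  have hn : 0 < n := by have := h.n_two; exact (by omega : 0 < 2).trans_le this
  have hn' : (0 : ℝ) < n := by exact_mod_cast hn
  have hm : (0 : ℝ) < m := by exact_mod_cast h.m_pos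
  have hε : 0 < ε := h.ε_pos
  have hB : (0 : ℝ) < τ.B := by exact_mod_cast B_pos
  set Z := (L / n) ^ 4 * ζ with hZd
  have hZ0 : 0 ≤ Z := by positivity
  have him : (i : ℝ) / m ≤ 1 := by rw [div_le_one hm]; exact_mod_cast h.i_le
  have h0T : (0 : ℝ) ∈ Icc 0 T := ⟨le_rfl, hT.le⟩
  have htT : (i : ℝ) * (T / m) ∈ Icc 0 T := by
    refine ⟨by positivity, ?_⟩
    calc (i : ℝ) * (T / m) = T * (i / m) := by ring
      _ ≤ T * 1 := by gcongr
      _ = T := mul_one T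
  have hbd := (gridFun_initial_le hL hu hT hn hpos hsum).1
  have hreg : Regular d n (n ^ d) (n ^ 4 * Z) (gridFun L n u 0) := by
    refine ⟨hbd, fun k _ j => ?_, fun k hk j x => gridFun_osc hL hu hb hn h0T hk j x⟩
    have := gridFun_line_periodic hu hn h0T j k 0
    simpa using this
  have hbud := h.passErr_budget hZ0 hZ
  have hstart : ∀ q < n ^ d, |(τ.start f q : ℝ) / τ.w.B - gridFun L n u 0 (dig d n 0 q)|
      ≤ 1 / 2 ^ (4 * τ.R) := by
    intro q hq
    rw [w_B, ← hf q hq, B_eq']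
    unfold start
    have hP : (0 : ℝ) < 2 ^ (4 * τ.R) := by positivity
    have h1 := Int.floor_le ((2 : ℝ) ^ (4 * τ.R) * f q)
    have h2 := Int.lt_floor_add_one ((2 : ℝ) ^ (4 * τ.R) * f q)
    rw [show (⌊(2 : ℝ) ^ (4 * τ.R) * f q⌋ : ℝ) / 2 ^ (4 * τ.R) - f q
      = (⌊(2 : ℝ) ^ (4 * τ.R) * f q⌋ - 2 ^ (4 * τ.R) * f q) / 2 ^ (4 * τ.R) by field_simp,
      abs_div, abs_of_pos hP]
    gcongr
    rw [abs_le]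
    constructor <;> linarith
  have hε1 : ε < 1 := h.ε_lt
  have hbud' : 3 * (1 / 2 ^ (4 * τ.R) + (d : ℝ) * h.fit.passErr (n ^ 4 * Z)) ≤ ε / 8 := hbud
  obtain ⟨p1, p2⟩ := h.fit.passes_spec hreg (e₀ := 1 / 2 ^ (4 * τ.R)) (by positivity)
    (A := τ.start f) (by show 3 * (1 / 2 ^ (4 * τ.R) + (d : ℝ) * h.fit.passErr (n ^ 4 * Z)) ≤ 1; linarith)
    hstart
  rw [w_B] at p1 p2
  refine ⟨fun q hq => ?_, p2⟩
  have e1 := p1 q hq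
  have hle : α * (i * (T / m)) * n ^ 2 / L ^ 2 ≤ α * T / L ^ 2 * n ^ 2 := by
    calc α * (i * (T / m)) * n ^ 2 / L ^ 2 = α * T / L ^ 2 * n ^ 2 * (i / m) := by ring
      _ ≤ _ := mul_le_of_le_one_right (by positivity) him
  have hc2 : (8 * m * n ^ 2 : ℝ) ≤ 2 ^ τ.q ∧ 1600 * m * n ^ 2 ≤ 2 ^ τ.q := by
    have a3 : 1600 * m * n ^ 2 ≤ 2 ^ τ.q := steps_le (τ := τ)
    refine ⟨?_, a3⟩
    exact_mod_cast (by nlinarith [Nat.zero_le (m * n ^ 2)] : 8 * m * n ^ 2 ≤ 2 ^ τ.q)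
  have hτ2 : α * T / L ^ 2 * n ^ 2 ≤ 2 * m := by
    have h1 : (d : ℝ) * (α * T / L ^ 2 * n ^ 2) ≤ 2 * m := h.time_le
    have hd : (1 : ℝ) ≤ d := by exact_mod_cast h.d_pos
    exact (le_mul_of_one_le_left (by positivity) hd).trans h1
  have hS : (0 : ℝ) < 2 ^ τ.q := by positivity
  have hcq : α * (i * (T / m)) * n ^ 2 / L ^ 2 / ((2 ^ τ.q : ℕ) : ℝ) ≤ 1 / 4 := by
    push_cast
    rw [div_le_iff₀ hS]
    have hn2 : (1 : ℝ) ≤ (n : ℝ) ^ 2 := one_le_pow₀ (by exact_mod_cast hn)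
    have : (8 * m : ℝ) ≤ 8 * m * n ^ 2 := le_mul_of_one_le_right (by positivity) hn2
    linarith [hc2.1]
  have e2 := gridFun_splitStep hL hα.le hu hb hζ.le hn htT (s := 2 ^ τ.q) (by positivity) (ε := ε) (m := m)
    (le_trans (mul_le_mul_of_nonneg_left hle (by positivity)) h.time_le)
    (le_trans (mul_le_mul_of_nonneg_right (mul_le_mul_of_nonneg_left hle (by positivity)) hZ0) hZ)
    hcq hε.le hc2.2 (dig d n 0 q)
  have e3 := splitStep_pow_param (c := α * (i * (T / m)) * n ^ 2 / L ^ 2 / ((2 ^ τ.q : ℕ) : ℝ))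
    (c' := h.fit.step) (by positivity) hcq h.fit.step_nonneg h.fit.step_le hbd d (2 ^ τ.q) (dig d n 0 q)
  have e4 : ((2 ^ τ.q : ℕ) : ℝ) * (4 * d * |α * (i * (T / m)) * n ^ 2 / L ^ 2 / ((2 ^ τ.q : ℕ) : ℝ)
      - h.fit.step| * n ^ d) ≤ ε / 16 := by
    have f1 := h.step_close
    have f2 := h.param_budget
    have f3 : h.fit.step = (τ.ch : ℝ) / τ.B := by unfold Params.Fit.step; rw [w_B]; rfl
    have f4 : α * (i * (T / m)) * n ^ 2 / L ^ 2 / ((2 ^ τ.q : ℕ) : ℝ)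
        = α * T / L ^ 2 * i / m * n ^ 2 / 2 ^ τ.q := by push_cast; ring
    rw [f3, f4]
    refine le_trans ?_ f2
    calc _ = 2 ^ τ.q * |α * T / L ^ 2 * i / m * n ^ 2 / 2 ^ τ.q - τ.ch / τ.B| * (4 * d * (n : ℝ) ^ d) := by
          push_cast; ring
      _ ≤ _ := by gcongr
  have e5 := e3.trans e4
  simp only [Pi.sub_apply] at e2 e5
  have e6 : |(τ.w.passes (τ.start f) d q : ℝ) / τ.B
      - (splitStep h.fit.step d ^ 2 ^ τ.q) (gridFun L n u 0) (dig d n 0 q)| ≤ ε / 8 := e1.trans hbud'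
  -- The budget is `ε / 8` for the passes, `5 ε / 16` for the discretisation and `ε / 16` for the
  -- rounded step parameter: `ε / 2` in all.
  rw [abs_le] at e2 e5 e6 ⊢
  constructor <;> linarith [e2.1, e2.2, e5.1, e5.2, e6.1, e6.2]

end Task

end HeatFFT
end

open Set
noncomputable section
namespace HeatFFT

/-! ## Further rules for programs -/

/-- The store with a register changed. -/
def Store.set (σ : Store) (x : ℕ) (v : ℤ) : Store := { σ with reg := Function.update σ.reg x v }

/-- The store with a memory cell changed. -/
def Store.put (σ : Store) (a : ℕ) (v : ℤ) : Store := { σ with mem := Function.update σ.mem a v }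

@[simp] lemma Store.set_reg (σ : Store) (x y : ℕ) (v : ℤ) :
    (σ.set x v).reg y = if y = x then v else σ.reg y := by
  simp [Store.set, Function.update_apply]

@[simp] lemma Store.set_mem (σ : Store) (x : ℕ) (v : ℤ) : (σ.set x v).mem = σ.mem := rfl

@[simp] lemma Store.put_reg (σ : Store) (a : ℕ) (v : ℤ) : (σ.put a v).reg = σ.reg := rfl

@[simp] lemma Store.put_mem (σ : Store) (a b : ℕ) (v : ℤ) :
    (σ.put a v).mem b = if b = a then v else σ.mem b := by
  simp [Store.put, Function.update_apply]

variable {inp : Input} {β : ℕ} {σ : Store} {k k' : ℕ} {p q : Prog} {Q : Store → Prop}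

lemma Ends.assign' {x : ℕ} {e : Expr} {v : ℤ} (hβ : 7 ≤ β) (hx : x < 100)
    (he : (e.ok && decide (e.size ≤ 60)) = true) (hv : e.eval σ = v) (hb : |v| < 2 ^ β)
    (hQ : Q (σ.set x v)) : Ends inp β (HeatFFT.assign x e) σ 1 Q :=
  Ends.assign hβ hx he (by rw [hv]; exact hb) (by rw [hv]; exact hQ)

lemma Ends.assign_seq {x : ℕ} {e : Expr} {v : ℤ} (hβ : 7 ≤ β) (hx : x < 100)
    (he : (e.ok && decide (e.size ≤ 60)) = true) (hv : e.eval σ = v) (hb : |v| < 2 ^ β)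
    (hQ : Ends inp β p (σ.set x v) k Q) : Ends inp β (.seq (HeatFFT.assign x e) p) σ (1 + k) Q :=
  Ends.seq (Ends.assign' hβ hx he hv hb hQ)

lemma Ends.write' {a e : Expr} {b : ℕ} {v : ℤ} (hβ : 7 ≤ β)
    (ha : (a.ok && decide (a.size ≤ 30)) = true) (he : (e.ok && decide (e.size ≤ 30)) = true)
    (hb : a.eval σ = b) (hv : e.eval σ = v) (hvb : |v| < 2 ^ β) (hQ : Q (σ.put b v)) :
    Ends inp β (HeatFFT.write a e) σ 1 Q :=
  Ends.write hβ ha he (by rw [hv]; exact hvb) (by rw [hv, hb, Int.toNat_natCast]; exact hQ)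

lemma Ends.write_seq {a e : Expr} {b : ℕ} {v : ℤ} (hβ : 7 ≤ β)
    (ha : (a.ok && decide (a.size ≤ 30)) = true) (he : (e.ok && decide (e.size ≤ 30)) = true)
    (hb : a.eval σ = b) (hv : e.eval σ = v) (hvb : |v| < 2 ^ β)
    (hQ : Ends inp β p (σ.put b v) k Q) : Ends inp β (.seq (HeatFFT.write a e) p) σ (1 + k) Q :=
  Ends.seq (Ends.write' hβ ha he hb hv hvb hQ)

/-- `if y ≤ z then x := e else x := e'` -/
def condAssign (y z x : ℕ) (e e' : Expr) : Prog := .ite y z (assign x e) (assign x e')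

lemma Ends.condAssign_seq {x y z : ℕ} {e e' : Expr} {v : ℤ} (hβ : 7 ≤ β) (hx : x < 100) (hy : y < 100)
    (hz : z < 100) (he : (e.ok && decide (e.size ≤ 60)) = true)
    (he' : (e'.ok && decide (e'.size ≤ 60)) = true)
    (hv : (if σ.reg y ≤ σ.reg z then e.eval σ else e'.eval σ) = v) (hb : |v| < 2 ^ β)
    (hQ : Ends inp β p (σ.set x v) k Q) : Ends inp β (.seq (condAssign y z x e e') p) σ (2 + k) Q :=
  Ends.seq (Ends.ite hy hz (fun h => Ends.assign' hβ hx he (by rw [← hv, if_pos h]) hb hQ)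
    (fun h => Ends.assign' hβ hx he' (by rw [← hv, if_neg h]) hb hQ))

/-- `if y ≤ z then mem[a] := e` -/
def condWrite (y z : ℕ) (a e : Expr) : Prog := .ite y z (write a e) (assign y (.var y))

lemma Ends.condWrite_seq {y z : ℕ} {a e : Expr} {b : ℕ} {v : ℤ} (hβ : 7 ≤ β) (hy : y < 100)
    (hz : z < 100) (ha : (a.ok && decide (a.size ≤ 30)) = true)
    (he : (e.ok && decide (e.size ≤ 30)) = true)
    (h1 : σ.reg y ≤ σ.reg z → a.eval σ = b ∧ e.eval σ = v ∧ |v| < 2 ^ β)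
    (hQ : Ends inp β p (if σ.reg y ≤ σ.reg z then σ.put b v else σ) k Q) :
    Ends inp β (.seq (condWrite y z a e) p) σ (2 + k) Q := by
  refine Ends.seq (Ends.ite hy hz (fun h => ?_) (fun h => Ends.of_small fun hs => ?_))
  · obtain ⟨h2, h3, h4⟩ := h1 h
    rw [if_pos h] at hQ
    exact Ends.write' hβ ha he h2 h3 h4 hQ
  · rw [if_neg h] at hQ
    -- There is no empty statement; the idle branch assigns a register to itself.
    refine Ends.assign' (v := σ.reg y) hβ hy (by simp [Expr.ok, Expr.size, hy]) rfl
      (bits_le_iff.1 (hs.1 y hy)) ?_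
    have : σ.set y (σ.reg y) = σ := by simp [Store.set]
    rw [this]; exact hQ

/-! ## The recurrence along a line -/

/-- The remainder of `e` modulo the content of register `1`. -/
def modE (e : Expr) : Expr := .sub e (.mul (.div e (.var 1)) (.var 1))

lemma modE_eval {e : Expr} {t n : ℕ} (he : e.eval σ = t) (hn : σ.reg 1 = n) :
    (modE e).eval σ = (t % n : ℕ) := by
  simp only [modE, Expr.eval, he, hn]
  have := Int.emod_add_mul_ediv (t : ℤ) n
  push_cast
  linarith

/-- The address of entry `e` of the line named in register `46`. -/
def cellE (e : Expr) : Expr := .add (.var 46) (.mul (modE e) (.var 20))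

/-- The address of the entry written in step `t` (register `47`). -/
def targetE : Expr := .add (.var 21) (.add (.mul (.var 46) (.var 1)) (.sub (.var 47) (.var 23)))

/-- The permanent registers of the main part. -/
structure Env (w : Params) (σ : Store) : Prop where
  r0 : σ.reg 0 = w.d
  r1 : σ.reg 1 = w.n
  r4 : σ.reg 4 = 0
  r9 : σ.reg 9 = w.q
  r12 : σ.reg 12 = w.R
  r14 : σ.reg 14 = w.B
  r15 : σ.reg 15 = 4 ^ w.R
  r16 : σ.reg 16 = w.ch
  r17 : σ.reg 17 = w.a
  r18 : σ.reg 18 = w.p + 1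
  r19 : σ.reg 19 = w.ps
  r20 : σ.reg 20 = w.M
  r21 : σ.reg 21 = w.n * w.M
  r22 : σ.reg 22 = 2 * w.a
  r23 : σ.reg 23 = w.n + w.a
  r24 : σ.reg 24 = 2 * w.n + w.a
  r25 : σ.reg 25 = 2 * w.a * w.B

lemma Env.congr {w : Params} {σ σ' : Store} (h : Env w σ) (hr : ∀ r < 40, σ'.reg r = σ.reg r) :
    Env w σ' := by
  constructor <;> (rw [hr _ (by norm_num)]) <;> first
    | exact h.r0 | exact h.r1 | exact h.r4 | exact h.r9 | exact h.r12 | exact h.r14 | exact h.r15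
    | exact h.r16 | exact h.r17 | exact h.r18 | exact h.r19 | exact h.r20 | exact h.r21 | exact h.r22
    | exact h.r23 | exact h.r24 | exact h.r25

lemma Env.set {w : Params} {σ : Store} (h : Env w σ) {x : ℕ} (hx : 40 ≤ x) (v : ℤ) : Env w (σ.set x v) :=
  h.congr fun r hr => by simp; omega

lemma Env.put {w : Params} {σ : Store} (h : Env w σ) (a : ℕ) (v : ℤ) : Env w (σ.put a v) :=
  h.congr fun r hr => by simp

/-- Partially accumulated sums over the modes: modes below `k`, and mode `k` for the first entries. -/
def Params.acc (w : Params) (A : ℕ → ℤ) (k cnt i : ℕ) : ℤ :=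
  ∑ k' ∈ Finset.range k, w.term A k' i + if i < cnt then w.term A k i else 0

/-- Bounds for the integers which occur. -/
structure Params.Bdd (w : Params) (A : ℕ → ℤ) (β : ℕ) : Prop where
  seven_le : 7 ≤ β
  n_pos : 0 < w.n
  a_le : w.a ≤ w.n
  counter : ((3 * w.n + w.n * w.M + w.d + w.p + 2 + w.q + w.R : ℕ) : ℤ) < 2 ^ β
  two_B : 2 * w.B < 2 ^ β
  line : ∀ row < w.M, ∀ t, |w.line A row t| * 2 < 2 ^ β
  wsum : ∀ k ≤ w.p, ∀ row < w.M, ∀ t ≤ 2 * w.n + w.a, |w.wsum A k row t| < 2 ^ β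
  acc : ∀ k ≤ w.p, ∀ cnt, ∀ i < w.n * w.M, |w.acc A k cnt i| < 2 ^ β
  pass : ∀ i < w.n * w.M, |w.pass A i| < 2 ^ β

/-- One step of the recurrence along a line; the sum is accumulated from a certain step on. -/
def stepBody : Prog :=
  .seq (assign 51 (.load (cellE (.var 47)))) <|
  .seq (condAssign 22 47 51 (.sub (.var 51) (.load (cellE (.sub (.var 47) (.var 22))))) (.var 51)) <|
  .seq (assign 52 (.add (.sub (.div (.mul (.sub (.mul (.lit 2) (.var 48)) (.var 50)) (.var 42)) (.var 14))
    (.var 49)) (.var 51))) <|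
  .seq (assign 49 (.var 48)) <|
  .seq (assign 48 (.var 52)) <|
  .seq (assign 50 (.var 51)) <|
  .seq (condWrite 23 47 targetE (.add (.load targetE) (.mul (.var 44) (.var 48)))) <|
  assign 47 (.add (.var 47) (.lit 1))

/-- The content of the memory during a pass. -/
structure MemInv (w : Params) (A : ℕ → ℤ) (k cnt : ℕ) (σ : Store) : Prop where
  low : ∀ i < w.n * w.M, σ.mem i = A i
  high : ∀ i < w.n * w.M, σ.mem (w.n * w.M + i) = w.acc A k cnt i

/-- The state while mode `k` is processed. -/
structure ModeInv (w : Params) (s k : ℕ) (σ : Store) : Prop where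
  env : Env w σ
  r40 : σ.reg 40 = s
  r41 : σ.reg 41 = k
  r42 : σ.reg 42 = w.cosine k
  r44 : σ.reg 44 = w.coef k
  r45 : σ.reg 45 = (-1) ^ k

lemma ModeInv.set {w : Params} {s k : ℕ} (h : ModeInv w s k σ) {x : ℕ} (hx : 46 ≤ x) (v : ℤ) :
    ModeInv w s k (σ.set x v) := by
  refine ⟨h.env.set (by omega) v, ?_, ?_, ?_, ?_, ?_⟩ <;> rw [Store.set_reg, if_neg (by omega)]
  exacts [h.r40, h.r41, h.r42, h.r44, h.r45]

lemma ModeInv.put {w : Params} {s k : ℕ} (h : ModeInv w s k σ) (a : ℕ) (v : ℤ) :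
    ModeInv w s k (σ.put a v) :=
  ⟨h.env.put a v, h.r40, h.r41, h.r42, h.r44, h.r45⟩

/-- The state while a line is processed. -/
structure LineInv (w : Params) (A : ℕ → ℤ) (s k row t : ℕ) (σ : Store) : Prop where
  mode : ModeInv w s k σ
  r46 : σ.reg 46 = row
  r47 : σ.reg 47 = t
  r48 : σ.reg 48 = w.wsum A k row t
  r49 : σ.reg 49 = (ySeq w.B (w.cosine k) (2 * w.a) (w.line A row) t).2
  r50 : σ.reg 50 = prevDelta (2 * w.a) (w.line A row) t
  mem : MemInv w A k (row * w.n + (t - (w.n + w.a))) σ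

lemma delta_line_lt {w : Params} {A : ℕ → ℤ} {row : ℕ} (hA : ∀ t, |w.line A row t| * 2 < 2 ^ β) (t : ℕ) :
    |delta (2 * w.a) (w.line A row) t| < 2 ^ β := by
  unfold delta
  have h1 := hA t
  split_ifs
  · have h2 := hA (t - 2 * w.a)
    have := abs_sub (w.line A row t) (w.line A row (t - 2 * w.a))
    linarith
  · rw [sub_zero]
    have := abs_nonneg (w.line A row t)
    linarith

lemma Params.cell_lt {w : Params} {row : ℕ} (hn : 0 < w.n) (hrow : row < w.M) (t : ℕ) :
    row + t % w.n * w.M < w.n * w.M := by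
  have h1 := Nat.mod_lt t hn
  have : (t % w.n + 1) * w.M ≤ w.n * w.M := Nat.mul_le_mul_right _ h1
  rw [add_mul] at this
  omega

/-- The number of accumulated entries in the invariant uses the truncated difference `t - (n + a)`.
It stays zero while the window sum is warming up and then counts the outputs, so one invariant
covers both phases. -/
lemma stepBody_spec {w : Params} {A : ℕ → ℤ} (hb : w.Bdd A β) {s k row t : ℕ} (hk : k ≤ w.p)
    (hrow : row < w.M) (ht : t < 2 * w.n + w.a) (h : LineInv w A s k row t σ) :
    Ends inp β stepBody σ 10 (LineInv w A s k row (t + 1)) := by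
  have hβ := hb.seven_le
  have hcell : ∀ (σ' : Store) (e : Expr) (t' : ℕ), e.eval σ' = t' → Env w σ' → σ'.reg 46 = row →
      σ'.mem = σ.mem → (Expr.load (cellE e)).eval σ' = w.line A row t' := by
    intro σ' e t' he hE h46 hm
    have h1 : (cellE e).eval σ' = ((row + t' % w.n * w.M : ℕ) : ℤ) := by
      have := modE_eval he hE.r1
      simp only [cellE, Expr.eval] at this ⊢
      rw [this, h46, hE.r20]
      push_cast; rfl
    rw [Expr.eval, h1, Int.toNat_natCast, hm, h.mem.low _ (Params.cell_lt hb.n_pos hrow t')]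
    rfl
  have hE := h.mode.env
  unfold stepBody
  refine Ends.assign_seq (v := w.line A row t) (k := 9) hβ (by norm_num) (by rfl)
    (hcell σ (.var 47) t h.r47 hE h.r46 rfl) ?_ ?_
  · have h1 := hb.line row hrow t
    have := abs_nonneg (w.line A row t)
    linarith
  refine Ends.condAssign_seq (v := delta (2 * w.a) (w.line A row) t) (k := 7) hβ (by norm_num) (by norm_num)
    (by norm_num) (by rfl) (by rfl) ?_ (delta_line_lt (hb.line row hrow) t) ?_
  · simp only [Store.set_reg, Nat.reduceEqDiff, if_false, if_true, hE.r22, h.r47, delta, Expr.eval]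
    by_cases hp : 2 * w.a ≤ t
    · have h1 := hcell (σ.set 51 (w.line A row t)) (.sub (.var 47) (.var 22)) (t - 2 * w.a)
        (by simp [Expr.eval, h.r47, hE.r22, Nat.cast_sub hp]) (hE.set (by norm_num) _)
        (by simpa using h.r46) rfl
      rw [if_pos (by exact_mod_cast hp), if_pos hp]
      rw [Expr.eval] at h1
      rw [h1]
    · rw [if_neg (by exact_mod_cast hp), if_neg hp, sub_zero]
  have hw0 := hb.wsum k hk row hrow t (by omega)
  have hw1 := hb.wsum k hk row hrow (t + 1) (by omega)
  refine Ends.assign_seq (v := w.wsum A k row (t + 1)) (k := 6) hβ (by norm_num) (by rfl) ?_ hw1 ?_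
  · simp only [Expr.eval, Store.set_reg, Nat.reduceEqDiff, if_false, if_true, h.r48, h.r49, h.r50,
      h.mode.r42, hE.r14]
    rfl
  refine Ends.assign_seq (v := w.wsum A k row t) (k := 5) hβ (by norm_num) (by rfl)
    (by simp [Expr.eval, h.r48]) hw0 ?_
  refine Ends.assign_seq (v := w.wsum A k row (t + 1)) (k := 4) hβ (by norm_num) (by rfl)
    (by simp [Expr.eval]) hw1 ?_
  refine Ends.assign_seq (v := delta (2 * w.a) (w.line A row) t) (k := 3) hβ (by norm_num) (by rfl)
    (by simp [Expr.eval]) (delta_line_lt (hb.line row hrow) t) ?_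
  have hmode := ((((((h.mode.set (x := 51) (by norm_num) (w.line A row t)).set (x := 51) (by norm_num)
    (delta (2 * w.a) (w.line A row) t)).set (x := 52) (by norm_num) (w.wsum A k row (t + 1))).set (x := 49)
    (by norm_num) (w.wsum A k row t)).set (x := 48) (by norm_num) (w.wsum A k row (t + 1))).set (x := 50)
    (by norm_num) (delta (2 * w.a) (w.line A row) t))
  set σ1 := (((((σ.set 51 (w.line A row t)).set 51 (delta (2 * w.a) (w.line A row) t)).set 52
    (w.wsum A k row (t + 1))).set 49 (w.wsum A k row t)).set 48 (w.wsum A k row (t + 1))).set 50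
    (delta (2 * w.a) (w.line A row) t) with hσ1
  have m1 : MemInv w A k (row * w.n + (t - (w.n + w.a))) σ1 := ⟨h.mem.low, h.mem.high⟩
  have q46 : σ1.reg 46 = row := by simp [hσ1, h.r46]
  have q47 : σ1.reg 47 = t := by simp [hσ1, h.r47]
  have q48 : σ1.reg 48 = w.wsum A k row (t + 1) := by simp [hσ1]
  have q49 : σ1.reg 49 = w.wsum A k row t := by simp [hσ1]
  have q50 : σ1.reg 50 = delta (2 * w.a) (w.line A row) t := by simp [hσ1]
  have hE1 := hmode.env
  obtain ⟨i, hi⟩ : ∃ i, i = row * w.n + (t - (w.n + w.a)) := ⟨_, rfl⟩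
  rw [← hi] at m1
  have htest : σ1.reg 23 ≤ σ1.reg 47 ↔ w.n + w.a ≤ t := by
    rw [hE1.r23, q47]; exact_mod_cast Iff.rfl
  have hi_lt : w.n + w.a ≤ t → i < w.n * w.M := by
    intro hle
    have h2 : (row + 1) * w.n ≤ w.M * w.n := Nat.mul_le_mul_right _ hrow
    rw [add_mul, mul_comm w.M] at h2
    omega
  have hacc : ∀ j, w.acc A k (i + 1) j = w.acc A k i j + if j = i then w.term A k j else 0 := by
    intro j
    unfold Params.acc
    rcases lt_trichotomy j i with hj | hj | hj
    · rw [if_pos hj, if_pos (by omega), if_neg (by omega), add_zero]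
    · rw [if_pos (by omega), if_neg (by omega), if_pos hj, add_zero]
    · rw [if_neg (by omega), if_neg (by omega), if_neg (by omega), add_zero, add_zero]
  have hterm : w.n + w.a ≤ t → w.term A k i = w.coef k * w.wsum A k row (t + 1) := by
    intro hle
    have h3 : t - (w.n + w.a) < w.n := by omega
    have h4 : i / w.n = row := by
      rw [hi, add_comm, Nat.add_mul_div_right _ _ hb.n_pos, Nat.div_eq_of_lt h3, zero_add]
    have h5 : i % w.n = t - (w.n + w.a) := by
      rw [hi, add_comm, Nat.add_mul_mod_self_right, Nat.mod_eq_of_lt h3]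
    unfold Params.term
    rw [h4, h5]
    congr 2
    omega
  refine Ends.condWrite_seq (b := w.n * w.M + i) (v := w.acc A k (i + 1) i) (k := 1) hβ (by norm_num)
    (by norm_num) (by rfl) (by rfl) (fun hle => ?_) ?_
  · rw [htest] at hle
    have ha : targetE.eval σ1 = ((w.n * w.M + i : ℕ) : ℤ) := by
      simp only [targetE, Expr.eval, hE1.r21, hE1.r1, hE1.r23, q46, q47, hi]
      push_cast [Nat.cast_sub hle]
      ring
    refine ⟨ha, ?_, hb.acc k hk _ _ (hi_lt hle)⟩
    rw [hacc, if_pos rfl, hterm hle]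
    simp only [Expr.eval, ha, Int.toNat_natCast, m1.high i (hi_lt hle), hmode.r44, q48]
  set σ2 := (if σ1.reg 23 ≤ σ1.reg 47 then σ1.put (w.n * w.M + i) (w.acc A k (i + 1) i) else σ1) with hσ2
  have hreg : σ2.reg = σ1.reg := by rw [hσ2]; split_ifs <;> rfl
  have hmode2 : ModeInv w s k σ2 := by
    rw [hσ2]; split_ifs
    · exact hmode.put _ _
    · exact hmode
  have m2 : MemInv w A k (row * w.n + (t + 1 - (w.n + w.a))) σ2 := by
    by_cases hle : w.n + w.a ≤ t
    · have e : row * w.n + (t + 1 - (w.n + w.a)) = i + 1 := by omega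
      have e2 : σ2 = σ1.put (w.n * w.M + i) (w.acc A k (i + 1) i) := by rw [hσ2, if_pos (htest.2 hle)]
      rw [e, e2]
      refine ⟨fun j hj => ?_, fun j hj => ?_⟩
      · rw [Store.put_mem, if_neg (by omega)]; exact m1.low j hj
      · rw [Store.put_mem]
        by_cases hji : j = i
        · rw [if_pos (by omega), hji]
        · rw [if_neg (by omega), hacc, if_neg hji, add_zero]; exact m1.high j hj
    · have e : row * w.n + (t + 1 - (w.n + w.a)) = i := by omega
      have e2 : σ2 = σ1 := by rw [hσ2, if_neg (htest.not.2 hle)]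
      rw [e, e2]; exact m1
  refine Ends.assign' (v := (t + 1 : ℕ)) hβ (by norm_num) (by rfl) ?_ ?_ ?_
  · simp only [Expr.eval, hreg, q47]; push_cast; rfl
  · have := hb.counter
    have h2 : t + 1 ≤ 3 * w.n + w.n * w.M + w.d + w.p + 2 + w.q + w.R := by
      have : w.a ≤ w.n := hb.a_le
      omega
    rw [Nat.abs_cast]
    exact lt_of_le_of_lt (by exact_mod_cast h2) this
  · refine ⟨hmode2.set (by norm_num) _, ?_, ?_, ?_, ?_, ?_, ⟨m2.low, m2.high⟩⟩
    · simp [hreg, q46]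
    · simp
    · simp [hreg, q48]
    · simp only [Store.set_reg, Nat.reduceEqDiff, if_false, hreg, q49]; rfl
    · simp [hreg, q50, prevDelta]

/-- Processing of one line. -/
def lineBody : Prog :=
  .seq (assign 47 (.lit 0)) <|
  .seq (assign 48 (.lit 0)) <|
  .seq (assign 49 (.lit 0)) <|
  .seq (assign 50 (.lit 0)) <|
  .seq (.loop 47 24 stepBody) <|
  assign 46 (.add (.var 46) (.lit 1))

/-- The state between lines. -/
structure RowInv (w : Params) (A : ℕ → ℤ) (s k row : ℕ) (σ : Store) : Prop where
  mode : ModeInv w s k σ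
  r46 : σ.reg 46 = row
  mem : MemInv w A k (row * w.n) σ

lemma zero_lt_two_pow : |(0 : ℤ)| < 2 ^ β := by rw [abs_zero]; positivity

lemma Params.Bdd.natCast_lt {w : Params} {A : ℕ → ℤ} (hb : w.Bdd A β) {v : ℕ}
    (hv : v ≤ 3 * w.n + w.n * w.M + w.d + w.p + 2 + w.q + w.R) : |(v : ℤ)| < 2 ^ β := by
  rw [Nat.abs_cast]
  exact lt_of_le_of_lt (by exact_mod_cast hv) hb.counter

lemma Params.le_row_mul (w : Params) (hn : 0 < w.n) : w.M ≤ w.n * w.M := Nat.le_mul_of_pos_left _ hn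

/-- Of the `2 n + a` steps, `n + a` fill the window and each of the last `n` delivers one entry. -/
lemma lineBody_spec {w : Params} {A : ℕ → ℤ} (hb : w.Bdd A β) {s k row : ℕ} (hk : k ≤ w.p)
    (hrow : row < w.M) (h : RowInv w A s k row σ) :
    Ends inp β lineBody σ (11 * (2 * w.n + w.a) + 6) (RowInv w A s k (row + 1)) := by
  have hβ := hb.seven_le
  unfold lineBody
  refine Ends.mono (k := 1 + (1 + (1 + (1 + (((2 * w.n + w.a) * (10 + 1) + 1) + 1))))) ?_ (by omega)
    (fun _ _ h => h)
  refine Ends.assign_seq (v := 0) hβ (by norm_num) (by rfl) rfl zero_lt_two_pow ?_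
  refine Ends.assign_seq (v := 0) hβ (by norm_num) (by rfl) rfl zero_lt_two_pow ?_
  refine Ends.assign_seq (v := 0) hβ (by norm_num) (by rfl) rfl zero_lt_two_pow ?_
  refine Ends.assign_seq (v := 0) hβ (by norm_num) (by rfl) rfl zero_lt_two_pow ?_
  refine Ends.seq (Ends.loop (by norm_num) (by norm_num) (LineInv w A s k row) (2 * w.n + w.a) ?_ ?_ ?_)
  · refine ⟨(((h.mode.set (by norm_num) _).set (by norm_num) _).set (by norm_num) _).set (by norm_num) _,
      ?_, ?_, ?_, ?_, ?_, ?_⟩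
    · simpa using h.r46
    · simp
    · simp [Params.wsum, ySeq]
    · simp [ySeq]
    · simp [prevDelta]
    · rw [Nat.zero_sub, add_zero]; exact ⟨h.mem.low, h.mem.high⟩
  · intro t ht σ' h'
    refine ⟨?_, stepBody_spec hb hk hrow ht h'⟩
    rw [h'.r47, h'.mode.env.r24]; exact_mod_cast ht
  · intro σ' h'
    refine ⟨?_, ?_⟩
    · rw [h'.r47, h'.mode.env.r24]; push_cast; exact lt_irrefl _
    · have h1 := w.le_row_mul hb.n_pos
      refine Ends.assign' (v := (row + 1 : ℕ)) hβ (by norm_num) (by rfl) ?_ (hb.natCast_lt (by omega)) ?_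
      · simp [Expr.eval, h'.r46]
      · refine ⟨h'.mode.set (by norm_num) _, by simp, ?_⟩
        have e : row * w.n + (2 * w.n + w.a - (w.n + w.a)) = (row + 1) * w.n := by
          rw [add_mul, one_mul]; omega
        rw [← e]
        exact ⟨h'.mem.low, h'.mem.high⟩

/-! ## Modes and passes -/

/-- The interval `[-B, B]` is exactly invariant under the rounded doubling, as `2 x ^ 2 / B` stays
in `[0, 2 B]`. So lengths of integers need no error analysis here, and likewise for the damping
factors. -/
lemma cosFix_abs_le {B V ps : ℤ} {a k : ℕ} (hB : 0 < B) (hV : 8 ≤ V) (hps : |ps| ≤ B) (ha : 0 < a)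
    (hk : k ≤ a) (r : ℕ) : |cosFix B V ps a k r| ≤ B := by
  have ha' : (0 : ℤ) < a := by exact_mod_cast ha
  have hk' : (k : ℤ) ≤ a := by exact_mod_cast hk
  induction r with
  | zero =>
    have hD : 0 < B * (2 * a) * (2 * a) * V := by positivity
    have h1 : 0 ≤ 32 * ps * ps * k * k := by
      have := mul_self_nonneg ps
      have e : 32 * ps * ps * k * k = 32 * (ps * ps) * (k * k) := by ring
      rw [e]; positivity
    have h2 : 32 * ps * ps * k * k ≤ B * (B * (2 * a) * (2 * a) * V) := by
      have e1 : ps * ps ≤ B * B := by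
        rw [← abs_mul_abs_self ps]; exact mul_le_mul hps hps (abs_nonneg _) hB.le
      have e2 : (k : ℤ) * k ≤ a * a := mul_le_mul hk' hk' (by positivity) ha'.le
      calc 32 * ps * ps * k * k = 32 * (ps * ps) * (k * k) := by ring
        _ ≤ 32 * (B * B) * (a * a) := by gcongr
        _ = (B * B) * (a * a) * 4 * 8 := by ring
        _ ≤ (B * B) * (a * a) * 4 * V := by gcongr
        _ = _ := by ring
    have h3 := Int.ediv_nonneg h1 hD.le
    have h4 := Int.ediv_le_of_le_mul hD h2
    simp only [cosFix, cosStart]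
    rw [abs_le]
    constructor <;> linarith
  | succ r ih =>
    simp only [cosFix]
    set x := cosFix B V ps a k r
    have h0 : x * x ≤ B * B := by
      rw [← abs_mul_abs_self x]; exact mul_le_mul ih ih (abs_nonneg _) hB.le
    have h1 := mul_self_nonneg x
    have h3 : 0 ≤ 2 * x * x / B := Int.ediv_nonneg (by nlinarith) hB.le
    have h4 : 2 * x * x / B ≤ 2 * B := Int.ediv_le_of_le_mul hB (by nlinarith)
    rw [abs_le]
    constructor <;> linarith

lemma dampFix_abs_le {B ch C : ℤ} (hB : 0 < B) (hch : 0 ≤ ch) (hch' : 4 * ch ≤ B) (hC : |C| ≤ B) (r : ℕ) :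
    |dampFix B ch C r| ≤ B := by
  rw [abs_le] at hC
  induction r with
  | zero =>
    have h3 : 0 ≤ 2 * ch * (B - C) / B := Int.ediv_nonneg (mul_nonneg (by linarith) (by linarith)) hB.le
    have h4 : 2 * ch * (B - C) / B ≤ B := by
      refine Int.ediv_le_of_le_mul hB ?_
      have : 2 * ch * (B - C) ≤ 2 * ch * (2 * B) := mul_le_mul_of_nonneg_left (by linarith) (by linarith)
      nlinarith
    simp only [dampFix]
    rw [abs_le]
    constructor <;> linarith
  | succ r ih =>
    simp only [dampFix]
    set x := dampFix B ch C r
    have h0 : x * x ≤ B * B := by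
      rw [← abs_mul_abs_self x]; exact mul_le_mul ih ih (abs_nonneg _) hB.le
    have h3 : 0 ≤ x * x / B := Int.ediv_nonneg (mul_self_nonneg x) hB.le
    have h4 : x * x / B ≤ B := Int.ediv_le_of_le_mul hB h0
    rw [abs_le]
    constructor <;> linarith

/-- Conditions on the parameters needed for the bounds of the coefficients. -/
structure Params.CoefBdd (w : Params) : Prop where
  a_pos : 0 < w.a
  p_le : w.p ≤ w.a
  two_le : 2 ≤ w.R
  ps_le : |w.ps| ≤ w.B
  ch_nonneg : 0 ≤ w.ch
  ch_le : 4 * w.ch ≤ w.B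

lemma Params.CoefBdd.cos_le {w : Params} (h : w.CoefBdd) {k : ℕ} (hk : k ≤ w.p) (r : ℕ) :
    |cosFix w.B (4 ^ w.R) w.ps w.a k r| ≤ w.B := by
  refine cosFix_abs_le (by unfold Params.B; positivity) ?_ h.ps_le h.a_pos (hk.trans h.p_le) r
  calc (8 : ℤ) ≤ 4 ^ 2 := by norm_num
    _ ≤ 4 ^ w.R := pow_le_pow_right₀ (by norm_num) h.two_le

lemma Params.CoefBdd.damp_le {w : Params} (h : w.CoefBdd) {k : ℕ} (hk : k ≤ w.p) (r : ℕ) :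
    |dampFix w.B w.ch (w.cosine k) r| ≤ w.B :=
  dampFix_abs_le (by unfold Params.B; positivity) h.ch_nonneg h.ch_le (h.cos_le hk _) r

lemma Params.CoefBdd.coef_le {w : Params} (h : w.CoefBdd) {k : ℕ} (hk : k ≤ w.p) :
    |w.coef k| ≤ 2 * w.B := by
  have h1 := h.damp_le hk w.q
  have h2 : |w.damp k| ≤ w.B := h1
  have hB : 0 < w.B := by unfold Params.B; positivity
  unfold Params.coef
  rw [abs_mul, abs_pow, abs_neg, abs_one, one_pow, mul_one]
  split_ifs
  · linarith
  · rw [abs_mul, abs_two]; linarith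

/-- Computation of the coefficients of a mode. -/
def coefBody : Prog :=
  .seq (assign 42 (.sub (.var 14) (.div
    (.mul (.mul (.mul (.mul (.lit 32) (.var 19)) (.var 19)) (.var 41)) (.var 41))
    (.mul (.mul (.mul (.var 14) (.var 22)) (.var 22)) (.var 15))))) <|
  .seq (assign 43 (.lit 0)) <|
  .seq (.loop 43 12 (.seq (assign 42 (.sub (.div (.mul (.mul (.lit 2) (.var 42)) (.var 42)) (.var 14))
    (.var 14))) (assign 43 (.add (.var 43) (.lit 1))))) <|
  .seq (assign 44 (.sub (.var 14) (.div (.mul (.mul (.lit 2) (.var 16)) (.sub (.var 14) (.var 42)))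
    (.var 14)))) <|
  .seq (assign 43 (.lit 0)) <|
  .seq (.loop 43 9 (.seq (assign 44 (.div (.mul (.var 44) (.var 44)) (.var 14)))
    (assign 43 (.add (.var 43) (.lit 1))))) <|
  .seq (condAssign 17 41 53 (.lit 1) (.lit 2)) <|
  .seq (condAssign 41 4 53 (.lit 1) (.var 53)) <|
  assign 44 (.mul (.mul (.var 53) (.var 44)) (.var 45))

/-- The state between modes. -/
structure PassInv (w : Params) (A : ℕ → ℤ) (s k : ℕ) (σ : Store) : Prop where
  env : Env w σ
  r40 : σ.reg 40 = s
  r41 : σ.reg 41 = k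
  r45 : σ.reg 45 = (-1) ^ k
  mem : MemInv w A k 0 σ

lemma PassInv.set {w : Params} {A : ℕ → ℤ} {s k : ℕ} (h : PassInv w A s k σ) {x : ℕ} (hx : 42 ≤ x)
    (hx' : x ≠ 45) (v : ℤ) : PassInv w A s k (σ.set x v) := by
  refine ⟨h.env.set (by omega) v, ?_, ?_, ?_, h.mem.low, h.mem.high⟩ <;>
    rw [Store.set_reg, if_neg (by omega)]
  exacts [h.r40, h.r41, h.r45]

lemma coefBody_spec {w : Params} {A : ℕ → ℤ} (hb : w.Bdd A β) (hc : w.CoefBdd) {s k : ℕ} (hk : k ≤ w.p)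
    (h : PassInv w A s k σ) :
    Ends inp β coefBody σ (3 * w.R + 3 * w.q + 11)
      (fun σ' => ModeInv w s k σ' ∧ MemInv w A k 0 σ') := by
  have hβ := hb.seven_le
  have hB : 0 < w.B := by unfold Params.B; positivity
  have h2B := hb.two_B
  have lt_of : ∀ {v : ℤ}, |v| ≤ 2 * w.B → |v| < 2 ^ β := fun h => lt_of_le_of_lt h h2B
  unfold coefBody
  refine Ends.mono (k := 1 + (1 + ((w.R * (1 + 1 + 1) + 1) + (1 + (1 + ((w.q * (1 + 1 + 1) + 1)
    + (2 + (2 + 1)))))))) ?_ (by omega) (fun _ _ h => h)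
  refine Ends.assign_seq (v := cosFix w.B (4 ^ w.R) w.ps w.a k 0) hβ (by norm_num) (by rfl) ?_
    (lt_of ((hc.cos_le hk 0).trans (by linarith))) ?_
  · simp only [Expr.eval, h.env.r14, h.env.r19, h.r41, h.env.r22, h.env.r15, cosFix, cosStart]
  refine Ends.assign_seq (v := 0) hβ (by norm_num) (by rfl) rfl zero_lt_two_pow ?_
  refine Ends.seq (Ends.loop (by norm_num) (by norm_num) (fun r σ' => PassInv w A s k σ' ∧
    σ'.reg 42 = cosFix w.B (4 ^ w.R) w.ps w.a k r ∧ σ'.reg 43 = r) w.R ?_ ?_ ?_)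
  · exact ⟨(h.set (by norm_num) (by norm_num) _).set (by norm_num) (by norm_num) _, by simp, by simp⟩
  · rintro r hr σ' ⟨h', e42, e43⟩
    refine ⟨by rw [e43, h'.env.r12]; exact_mod_cast hr, ?_⟩
    refine Ends.assign_seq (v := cosFix w.B (4 ^ w.R) w.ps w.a k (r + 1)) hβ (by norm_num) (by rfl) ?_
      (lt_of ((hc.cos_le hk _).trans (by linarith))) ?_
    · simp only [Expr.eval, e42, h'.env.r14, cosFix]
    refine Ends.assign' (v := (r + 1 : ℕ)) hβ (by norm_num) (by rfl) ?_ (hb.natCast_lt (by omega)) ?_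
    · simp [Expr.eval, e43]
    · exact ⟨(h'.set (by norm_num) (by norm_num) _).set (by norm_num) (by norm_num) _, by simp, by simp⟩
  rintro σ' ⟨h', e42, e43⟩
  refine ⟨by rw [e43, h'.env.r12]; exact lt_irrefl _, ?_⟩
  change σ'.reg 42 = w.cosine k at e42
  refine Ends.assign_seq (v := dampFix w.B w.ch (w.cosine k) 0) hβ (by norm_num) (by rfl) ?_
    (lt_of ((hc.damp_le hk 0).trans (by linarith))) ?_
  · simp only [Expr.eval, h'.env.r14, e42, h'.env.r16, dampFix]
  refine Ends.assign_seq (v := 0) hβ (by norm_num) (by rfl) rfl zero_lt_two_pow ?_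
  refine Ends.seq (Ends.loop (by norm_num) (by norm_num) (fun r σ' => PassInv w A s k σ' ∧
    σ'.reg 42 = w.cosine k ∧ σ'.reg 44 = dampFix w.B w.ch (w.cosine k) r ∧ σ'.reg 43 = r) w.q ?_ ?_ ?_)
  · exact ⟨(h'.set (by norm_num) (by norm_num) _).set (by norm_num) (by norm_num) _,
      by simpa using e42, by simp, by simp⟩
  · rintro r hr σ' ⟨h', e42, e44, e43⟩
    refine ⟨by rw [e43, h'.env.r9]; exact_mod_cast hr, ?_⟩
    refine Ends.assign_seq (v := dampFix w.B w.ch (w.cosine k) (r + 1)) hβ (by norm_num) (by rfl) ?_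
      (lt_of ((hc.damp_le hk _).trans (by linarith))) ?_
    · simp only [Expr.eval, e44, h'.env.r14, dampFix]
    refine Ends.assign' (v := (r + 1 : ℕ)) hβ (by norm_num) (by rfl) ?_ (hb.natCast_lt (by omega)) ?_
    · simp [Expr.eval, e43]
    · exact ⟨(h'.set (by norm_num) (by norm_num) _).set (by norm_num) (by norm_num) _,
        by simpa using e42, by simp, by simp⟩
  rintro σ' ⟨h', e42, e44, e43⟩
  refine ⟨by rw [e43, h'.env.r9]; exact lt_irrefl _, ?_⟩
  change σ'.reg 44 = w.damp k at e44
  have small : ∀ v : ℤ, |v| ≤ 2 → |v| < 2 ^ β := fun v hv => lt_of (hv.trans (by linarith))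
  -- The machine branches only on `≤`. Since `k ≤ p ≤ a`, the test `a ≤ k` stands for `k = a`, and
  -- next `k ≤ 0` for `k = 0`: the two modes of weight one.
  refine Ends.condAssign_seq (v := if w.a ≤ k then 1 else 2) hβ (by norm_num) (by norm_num)
    (by norm_num) (by rfl) (by rfl) ?_ (small _ (by split_ifs <;> norm_num)) ?_
  · simp only [h'.env.r17, h'.r41, Expr.eval, Nat.cast_le]
  refine Ends.condAssign_seq (v := if k = 0 ∨ w.a ≤ k then 1 else 2) hβ (by norm_num) (by norm_num)
    (by norm_num) (by rfl) (by rfl) ?_ (small _ (by split_ifs <;> norm_num)) ?_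
  · have e : ((k : ℤ) ≤ 0) ↔ k = 0 := by omega
    simp only [Store.set_reg, Nat.reduceEqDiff, if_false, if_true, h'.env.r4, h'.r41, Expr.eval, e]
    split_ifs <;> omega
  refine Ends.assign' (v := w.coef k) hβ (by norm_num) (by rfl) ?_ (lt_of (hc.coef_le hk)) ?_
  · simp only [Expr.eval, Store.set_reg, Nat.reduceEqDiff, if_false, if_true, h'.r45, e44, Params.coef]
    split_ifs <;> ring
  · have h3 := ((h'.set (x := 53) (by norm_num) (by norm_num) (if w.a ≤ k then 1 else 2)).set (x := 53)
      (by norm_num) (by norm_num) (if k = 0 ∨ w.a ≤ k then 1 else 2)).set (x := 44)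
      (by norm_num) (by norm_num) (w.coef k)
    exact ⟨⟨h3.env, h3.r40, h3.r41, by simpa using e42, by simp, h3.r45⟩, h3.mem⟩

/-- Processing of one mode. -/
def modeBody : Prog :=
  .seq coefBody <|
  .seq (assign 46 (.lit 0)) <|
  .seq (.loop 46 20 lineBody) <|
  .seq (assign 45 (.sub (.lit 0) (.var 45))) <|
  assign 41 (.add (.var 41) (.lit 1))

lemma Params.acc_full (w : Params) (A : ℕ → ℤ) (k : ℕ) {i : ℕ} (hi : i < w.n * w.M) :
    w.acc A k (w.M * w.n) i = w.acc A (k + 1) 0 i := by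
  unfold Params.acc
  rw [if_pos (by rwa [mul_comm]), if_neg (by omega), Finset.sum_range_succ, add_zero]

lemma modeBody_spec {w : Params} {A : ℕ → ℤ} (hb : w.Bdd A β) (hc : w.CoefBdd) {s k : ℕ} (hk : k ≤ w.p)
    (h : PassInv w A s k σ) :
    Ends inp β modeBody σ (3 * w.R + 3 * w.q + 15 + w.M * (11 * (2 * w.n + w.a) + 7))
      (PassInv w A s (k + 1)) := by
  have hβ := hb.seven_le
  unfold modeBody
  refine Ends.mono (k := (3 * w.R + 3 * w.q + 11) + (1 + ((w.M * ((11 * (2 * w.n + w.a) + 6) + 1) + 1)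
    + (1 + 1)))) ?_ (le_of_eq (by ring)) (fun _ _ h => h)
  refine Ends.seq ((coefBody_spec hb hc hk h).mono le_rfl fun σ1 _ ⟨h1, m1⟩ => ?_)
  refine Ends.assign_seq (v := 0) hβ (by norm_num) (by rfl) rfl zero_lt_two_pow ?_
  refine Ends.seq (Ends.loop (by norm_num) (by norm_num) (RowInv w A s k) w.M ?_ ?_ ?_)
  · refine ⟨h1.set (by norm_num) _, by simp, ?_⟩
    rw [zero_mul]; exact ⟨m1.low, m1.high⟩
  · intro row hrow σ' h'
    refine ⟨?_, lineBody_spec hb hk hrow h'⟩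
    rw [h'.r46, h'.mode.env.r20]; exact_mod_cast hrow
  · intro σ' h'
    refine ⟨by rw [h'.r46, h'.mode.env.r20]; exact lt_irrefl _, ?_⟩
    refine Ends.assign_seq (v := (-1) ^ (k + 1)) hβ (by norm_num) (by rfl) ?_ ?_ ?_
    · simp [Expr.eval, h'.mode.r45, pow_succ]
    · rw [abs_pow, abs_neg, abs_one, one_pow]; exact one_lt_pow₀ (by norm_num) (by omega)
    refine Ends.assign' (v := (k + 1 : ℕ)) hβ (by norm_num) (by rfl) ?_ (hb.natCast_lt (by omega)) ?_
    · simp [Expr.eval, h'.mode.r41]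
    · refine ⟨(h'.mode.env.set (by norm_num) _).set (by norm_num) _, by simpa using h'.mode.r40, by simp,
        by simp, fun i hi => h'.mem.low i hi, fun i hi => ?_⟩
      rw [← w.acc_full A k hi]
      exact h'.mem.high i hi

/-- Replacement of an entry by the result of the pass. -/
def copyBody : Prog :=
  .seq (write (.var 54) (.div (.load (.add (.var 21) (.var 54))) (.var 25))) <|
  .seq (write (.add (.var 21) (.var 54)) (.lit 0)) <|
  assign 54 (.add (.var 54) (.lit 1))

/-- One pass. -/
def passBody : Prog :=
  .seq (assign 41 (.lit 0)) <|
  .seq (assign 45 (.lit 1)) <|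
  .seq (.loop 41 18 modeBody) <|
  .seq (assign 54 (.lit 0)) <|
  .seq (.loop 54 21 copyBody) <|
  assign 40 (.add (.var 40) (.lit 1))

/-- The state between passes. -/
structure MainInv (w : Params) (A : ℕ → ℤ) (s : ℕ) (σ : Store) : Prop where
  env : Env w σ
  r40 : σ.reg 40 = s
  low : ∀ i < w.n * w.M, σ.mem i = w.passes A s i
  high : ∀ i < w.n * w.M, σ.mem (w.n * w.M + i) = 0

/-- The data in the lower block stay untouched while all modes accumulate in the upper block. The
final copy divides, replaces the data and clears the accumulators for the next pass. -/
lemma passBody_spec {w : Params} {A : ℕ → ℤ} {s : ℕ} (hs : s < w.d) (hb : w.Bdd (w.passes A s) β)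
    (hc : w.CoefBdd) (h : MainInv w A s σ) :
    Ends inp β passBody σ ((w.p + 1) * (3 * w.R + 3 * w.q + 16 + w.M * (11 * (2 * w.n + w.a) + 7))
      + 4 * (w.n * w.M) + 6) (MainInv w A (s + 1)) := by
  have hβ := hb.seven_le
  unfold passBody
  refine Ends.mono (k := 1 + (1 + (((w.p + 1) * ((3 * w.R + 3 * w.q + 15
    + w.M * (11 * (2 * w.n + w.a) + 7)) + 1) + 1) + (1 + ((w.n * w.M * (1 + (1 + 1) + 1) + 1) + 1)))))
    ?_ (by ring_nf; omega) (fun _ _ h => h)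
  refine Ends.assign_seq (v := 0) hβ (by norm_num) (by rfl) rfl zero_lt_two_pow ?_
  refine Ends.assign_seq (v := 1) hβ (by norm_num) (by rfl) rfl
    (by rw [abs_one]; exact one_lt_pow₀ (by norm_num) (by omega)) ?_
  refine Ends.seq (Ends.loop (by norm_num) (by norm_num) (PassInv w (w.passes A s) s) (w.p + 1) ?_ ?_ ?_)
  · refine ⟨(h.env.set (by norm_num) _).set (by norm_num) _, by simpa using h.r40, by simp, by simp,
      fun i hi => h.low i hi, fun i hi => ?_⟩
    simp [Params.acc, h.high i hi]
  · intro k hk σ' h'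
    refine ⟨?_, modeBody_spec hb hc (by omega) h'⟩
    rw [h'.r41, h'.env.r18]; exact_mod_cast hk
  intro σ1 h1
  refine ⟨by rw [h1.r41, h1.env.r18]; push_cast; exact lt_irrefl _, ?_⟩
  refine Ends.assign_seq (v := 0) hβ (by norm_num) (by rfl) rfl zero_lt_two_pow ?_
  refine Ends.seq (Ends.loop (by norm_num) (by norm_num) (fun j σ' => Env w σ' ∧ σ'.reg 40 = s ∧
    σ'.reg 54 = j ∧
    (∀ i < w.n * w.M, σ'.mem i = if i < j then w.pass (w.passes A s) i else w.passes A s i) ∧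
    ∀ i < w.n * w.M, σ'.mem (w.n * w.M + i) = if i < j then 0 else w.acc (w.passes A s) (w.p + 1) 0 i)
    (w.n * w.M) ?_ ?_ ?_)
  · refine ⟨h1.env.set (by norm_num) _, by simpa using h1.r40, by simp, fun i hi => ?_, fun i hi => ?_⟩
    · rw [if_neg (by omega)]; exact h1.mem.low i hi
    · rw [if_neg (by omega)]; exact h1.mem.high i hi
  · rintro j hj σ' ⟨h', e40, e54, m1, m2⟩
    refine ⟨by rw [e54, h'.r21]; exact_mod_cast hj, ?_⟩
    refine Ends.write_seq (b := j) (v := w.pass (w.passes A s) j) hβ (by rfl) (by rfl) e54 ?_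
      (hb.pass j hj) ?_
    · have e : (Expr.add (.var 21) (.var 54)).eval σ' = ((w.n * w.M + j : ℕ) : ℤ) := by
        simp only [Expr.eval, h'.r21, e54]; push_cast; rfl
      simp only [Expr.eval] at e ⊢
      rw [e, Int.toNat_natCast, m2 j hj, if_neg (lt_irrefl _), h'.r25]
      simp [Params.pass, Params.acc]
    refine Ends.write_seq (b := w.n * w.M + j) (v := 0) (k := 1) hβ (by rfl) (by rfl) ?_ (by rfl)
      zero_lt_two_pow ?_
    · simp only [Expr.eval, Store.put_reg, h'.r21, e54]; push_cast; rfl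
    refine Ends.assign' (v := (j + 1 : ℕ)) hβ (by norm_num) (by rfl) ?_ (hb.natCast_lt (by omega)) ?_
    · simp [Expr.eval, e54]
    refine ⟨((h'.put _ _).put _ _).set (by norm_num) _, by simpa using e40, by simp, fun i hi => ?_,
      fun i hi => ?_⟩
    · rw [Store.set_mem, Store.put_mem, if_neg (by omega), Store.put_mem, m1 i hi]
      split_ifs <;> first | omega | simp_all
    · rw [Store.set_mem, Store.put_mem, Store.put_mem, m2 i hi]
      split_ifs <;> omega
  · rintro σ' ⟨h', e40, e54, m1, m2⟩
    refine ⟨by rw [e54, h'.r21]; push_cast; exact lt_irrefl _, ?_⟩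
    refine Ends.assign' (v := (s + 1 : ℕ)) hβ (by norm_num) (by rfl) ?_ (hb.natCast_lt (by omega)) ?_
    · simp [Expr.eval, e40]
    refine ⟨h'.set (by norm_num) _, by simp, fun i hi => ?_, fun i hi => ?_⟩
    · rw [Store.set_mem, m1 i hi, if_pos hi]; rfl
    · rw [Store.set_mem, m2 i hi, if_pos hi]

/-- All passes, and the output of the denominator. -/
def mainPart : Prog :=
  .seq (assign 40 (.lit 0)) <|
  .seq (.loop 40 0 passBody) <|
  assign 0 (.var 14)

/-- Register `0` holds `d` and bounds the loop over the passes; only afterwards is it overwritten by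
the output denominator. -/
lemma mainPart_spec {w : Params} {A : ℕ → ℤ} (hb : ∀ s < w.d, w.Bdd (w.passes A s) β) (hd : 0 < w.d)
    (hc : w.CoefBdd) (hE : Env w σ) (hlow : ∀ i < w.n * w.M, σ.mem i = A i)
    (hhigh : ∀ i < w.n * w.M, σ.mem (w.n * w.M + i) = 0) :
    Ends inp β mainPart σ (w.d * ((w.p + 1) * (3 * w.R + 3 * w.q + 16
      + w.M * (11 * (2 * w.n + w.a) + 7)) + 4 * (w.n * w.M) + 7) + 3)
      (fun σ' => σ'.reg 0 = w.B ∧ ∀ i < w.n * w.M, σ'.mem i = w.passes A w.d i) := by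
  have hb0 := hb 0 hd
  have hβ := hb0.seven_le
  unfold mainPart
  refine Ends.mono (k := 1 + ((w.d * (((w.p + 1) * (3 * w.R + 3 * w.q + 16
      + w.M * (11 * (2 * w.n + w.a) + 7)) + 4 * (w.n * w.M) + 6) + 1) + 1) + 1)) ?_ (le_of_eq (by ring))
    (fun _ _ h => h)
  refine Ends.assign_seq (v := 0) hβ (by norm_num) (by rfl) rfl zero_lt_two_pow ?_
  refine Ends.seq (Ends.loop (by norm_num) (by norm_num) (MainInv w A) w.d ?_ ?_ ?_)
  · exact ⟨hE.set (by norm_num) _, by simp, hlow, hhigh⟩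
  · intro s hs σ' h'
    exact ⟨by rw [h'.r40, h'.env.r0]; exact_mod_cast hs, passBody_spec hs (hb s hs) hc h'⟩
  · intro σ' h'
    refine ⟨by rw [h'.r40, h'.env.r0]; exact lt_irrefl _, ?_⟩
    have hB : 0 < w.B := by unfold Params.B; positivity
    refine Ends.assign' (v := w.B) hβ (by norm_num) (by rfl) h'.env.r14 ?_ ?_
    · rw [abs_of_pos hB]; linarith [hb0.two_B]
    · exact ⟨by simp, h'.low⟩

end HeatFFT
end

open Set
noncomputable section
namespace HeatFFT

/-! ## Sizes of the integers -/

namespace Params.Fit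
variable {w : Params} {l m : ℕ} (h : w.Fit l m)
include h

/-- The rounded recurrence is only marginally stable, so its size is controlled through its distance
from the exact window sum, by `ySeq_err`. -/
lemma wsum_le {A : ℕ → ℤ} (hA : ∀ q < w.n * w.M, |(A q : ℝ)| ≤ (w.n ^ w.d + 1) * w.B) {k : ℕ} (hk : k ≤ w.p)
    {row : ℕ} (hrow : row < w.M) {t : ℕ} (ht : t ≤ 2 * w.n + w.a) :
    |(w.wsum A k row t : ℝ)| ≤ 2 * w.a * ((w.n ^ w.d + 1) * w.B) + w.B := by
  have hB := B_pos (w := w)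
  have hn : 0 < w.n := by have := h.n_two; omega
  have hk' : k ≤ w.a := hk.trans h.p_le
  have hX : ∀ t, |(w.line A row t : ℝ)| ≤ (w.n ^ w.d + 1) * w.B := fun t =>
    hA _ (Params.cell_lt hn hrow t)
  set X : ℝ := (w.n ^ w.d + 1) * w.B with hXd
  have hX0 : 0 ≤ X := by positivity
  have hη : |(w.cosine k : ℝ) / w.B - Real.cos (angle w.a k)| ≤ 121 / 3 ^ w.R := by
    have h1 := cosFix_err (k := k) (ps := w.ps) h.six_le h.a_pos hk' h.ps_near
    unfold Params.cosine Params.B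
    push_cast
    exact h1
  have hr := h.rounding (a := w.a) (by positivity) (by exact_mod_cast h.a_le) rfl
  have hκ1 : 256 * h.kappa * (w.n ^ 3 * w.n ^ w.d) ≤ 1 := h.prec
  have hκ0 : 0 ≤ h.kappa := by unfold kappa; positivity
  have h3 : 256 * h.kappa * (w.n ^ 3 * w.n ^ w.d) * (w.B : ℝ) ≤ 1 * w.B := by gcongr
  have h4 : 0 ≤ 2 * h.kappa * (2 * w.a * X + w.B) := by positivity
  have hT : ((2 * w.n + w.a : ℕ) : ℝ) ^ 2 * (1 + 121 / 3 ^ w.R * (2 * (2 * w.a * X + w.B) + 2 * X)) ≤ w.B := by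
    have h5 : ((2 * w.n + w.a : ℕ) : ℝ) ≤ 3 * w.n := by
      exact_mod_cast (by have := h.a_le; omega : 2 * w.n + w.a ≤ 3 * w.n)
    have h6 : ((2 * w.n + w.a : ℕ) : ℝ) ^ 2 ≤ 9 * w.n ^ 2 := by
      calc _ ≤ (3 * (w.n : ℝ)) ^ 2 := by gcongr
        _ = _ := by ring
    have h7 := mul_le_mul_of_nonneg_right h6
      (by positivity : 0 ≤ 1 + 121 / 3 ^ w.R * (2 * (2 * w.a * X + w.B) + 2 * X))
    have h8 : 0 ≤ 9 * (w.n : ℝ) ^ 2 * (1 + 121 / 3 ^ w.R * (2 * (2 * w.a * X + w.B) + 2 * X)) := by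
      positivity
    linarith
  have h1 := ySeq_err (B := w.B) (by exact_mod_cast hB) h.a_pos hη hX hT t ht
  have h2 := yExact_abs_le (θ := angle w.a k) (P := 2 * w.a) hX t
  have ht' : (t : ℝ) ^ 2 ≤ ((2 * w.n + w.a : ℕ) : ℝ) ^ 2 := by gcongr
  have h9 := mul_le_mul_of_nonneg_right ht'
    (by positivity : 0 ≤ 1 + 121 / 3 ^ w.R * (2 * (2 * w.a * X + w.B) + 2 * X))
  have h10 := abs_sub_abs_le_abs_sub ((ySeq w.B (w.cosine k) (2 * w.a) (w.line A row) t).1 : ℝ)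
    (yExact (angle w.a k) (2 * w.a) (w.line A row) t)
  push_cast at h2
  unfold Params.wsum
  linarith

end Params.Fit

namespace Task
variable {τ : Task}

/-- The bound for the length of integers. -/
def β (τ : Task) : ℕ := 16 * τ.R

lemma thirty_le_R : 30 ≤ τ.R := by unfold R; omega

lemma le_two_pow {x : ℕ} (h : x ≤ τ.R) : (x : ℤ) ≤ 2 ^ τ.R := by
  exact_mod_cast (Nat.lt_two_pow_self.le.trans (Nat.pow_le_pow_right (by norm_num) h))

lemma two_pow_R : (2 : ℤ) ^ 30 ≤ 2 ^ τ.R := pow_le_pow_right₀ (by norm_num) thirty_le_R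

lemma two_pow_β : (2 : ℤ) ^ τ.β = (2 ^ τ.R) ^ 16 := by rw [← pow_mul, β, mul_comm]

lemma B_eq_pow : τ.B = (2 ^ τ.R) ^ 4 := by
  unfold B
  rw [← pow_mul, mul_comm, pow_mul]; norm_num

lemma seven_le_β : 7 ≤ τ.β := by have := thirty_le_R (τ := τ); unfold β; omega

/-- All sizes are measured in powers of `W = 2 ^ R`, with `B = W ^ 4`; any exponent below `16` is
admissible. -/
lemma pow_lt_two_pow_β {e : ℕ} (he : e < 16) {x : ℤ} (h : |x| ≤ (2 ^ τ.R) ^ e) : |x| < 2 ^ τ.β := by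
  rw [two_pow_β]
  refine lt_of_le_of_lt h (pow_lt_pow_right₀ ?_ he)
  linarith [two_pow_R (τ := τ)]

lemma n_pow_le : (τ.n : ℤ) ^ τ.d * 2 ^ 30 ≤ 2 ^ τ.R := by
  have h1 : τ.n ^ τ.d * 2 ^ 30 ≤ 2 ^ τ.R := by
    calc τ.n ^ τ.d * 2 ^ 30 ≤ (2 ^ τ.ln) ^ τ.d * 2 ^ 30 := by
          gcongr; exact n_le
      _ = 2 ^ (τ.ln * τ.d + 30) := by rw [← pow_mul, ← pow_add]
      _ ≤ _ := Nat.pow_le_pow_right (by norm_num) (by rw [R, mul_comm]; omega)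
  exact_mod_cast h1

lemma n_le_pow : (τ.n : ℤ) * 2 ^ 30 ≤ 2 ^ τ.R := by
  have h1 : τ.n * 2 ^ 30 ≤ 2 ^ τ.R := by
    calc τ.n * 2 ^ 30 ≤ 2 ^ τ.ln * 2 ^ 30 := by gcongr; exact n_le
      _ = 2 ^ (τ.ln + 30) := by rw [← pow_add]
      _ ≤ _ := Nat.pow_le_pow_right (by norm_num) (by unfold R; omega)
  exact_mod_cast h1

lemma q_add_le : 2 * τ.q + τ.d + τ.le + 30 ≤ τ.R := by unfold R; omega

lemma lm_ln_le : 2 * τ.lm + 4 * τ.ln + 22 + τ.d + τ.le + 30 ≤ τ.R := by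
  have := q_add_le (τ := τ)
  unfold q at this
  omega

lemma l_le : 2 * τ.l ≤ τ.R := by
  have := lm_ln_le (τ := τ)
  unfold l; omega

lemma m_le_pow : 2 * (τ.m : ℤ) ≤ 2 ^ τ.R := by
  have h1 : 2 * τ.m ≤ 2 ^ τ.R := by
    calc 2 * τ.m ≤ 2 ^ 1 * 2 ^ τ.lm := by gcongr; · norm_num
                                          · exact m_le
      _ = 2 ^ (1 + τ.lm) := by rw [← pow_add]
      _ ≤ _ := Nat.pow_le_pow_right (by norm_num) (by have := lm_ln_le (τ := τ); omega)
  exact_mod_cast h1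

namespace Valid
variable (h : τ.Valid)
include h

lemma coefBdd : τ.w.CoefBdd where
  a_pos := h.fit.a_pos
  p_le := h.fit.p_le
  two_le := by have := h.fit.six_le; omega
  ch_nonneg := h.fit.ch_nonneg
  ch_le := h.fit.ch_le
  ps_le := by
    have h1 := h.fit.ps_near
    have h6 := h.fit.six_le
    have h2 : (28 : ℝ) / 4 ^ τ.w.R ≤ 1 / 2 := by
      rw [div_le_div_iff₀ (by positivity) (by norm_num)]
      have : (4 : ℝ) ^ 6 ≤ 4 ^ τ.w.R := pow_le_pow_right₀ (by norm_num) h6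
      norm_num at this ⊢
      linarith
    rw [abs_le] at h1
    have hB : (0 : ℝ) < 16 ^ τ.w.R := by positivity
    have h3 : 4 * (τ.w.ps : ℝ) / 16 ^ τ.w.R ≤ 4 := by linarith [Real.pi_lt_d2]
    have h4 : 0 ≤ 4 * (τ.w.ps : ℝ) / 16 ^ τ.w.R := by linarith [Real.pi_gt_three]
    rw [div_le_iff₀ hB] at h3
    have h5 := mul_nonneg h4 hB.le
    rw [div_mul_cancel₀ _ hB.ne'] at h5
    have h7 : |(τ.w.ps : ℝ)| ≤ 16 ^ τ.w.R := by rw [abs_le]; constructor <;> linarith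
    have : |τ.w.ps| ≤ 16 ^ τ.w.R := by exact_mod_cast h7
    exact this

lemma nM : τ.w.n * τ.w.M = τ.n ^ τ.d := h.fit.pow_eq

/-- With `W = 2 ^ R`: entries are at most `W ^ 5`, window sums `W ^ 6`, terms `W ^ 11`, and
accumulated sums `W ^ 12`. The result of a pass is bounded by hypothesis, through the accuracy
analysis. -/
lemma bdd {A : ℕ → ℤ} (hA : ∀ q < τ.n ^ τ.d, |(A q : ℝ)| ≤ (τ.n ^ τ.d + 1) * τ.B)
    (hA' : ∀ q < τ.n ^ τ.d, |(τ.w.pass A q : ℝ)| ≤ (τ.n ^ τ.d + 1) * τ.B) : τ.w.Bdd A τ.β := by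
  have hW := two_pow_R (τ := τ)
  set W : ℤ := 2 ^ τ.R with hWd
  have hN := n_pow_le (τ := τ)
  have hn := n_le_pow (τ := τ)
  rw [← hWd] at hN hn
  have hB : τ.w.B = W ^ 4 := by rw [w_B, B_eq_pow]
  have hB' : τ.B = W ^ 4 := by rw [B_eq_pow]
  have ha : τ.w.a ≤ τ.n := h.fit.a_le
  have hp : τ.w.p ≤ τ.w.a := h.fit.p_le
  have hfl := h.fit
  have hn2 : 2 ≤ τ.n := h.n_two
  have hn0 : 0 < τ.w.n := by show 0 < τ.n; omega
  have hNM : τ.w.n * τ.w.M = τ.n ^ τ.d := h.nM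
  have hX : ((τ.n : ℤ) ^ τ.d + 1) ≤ W := by linarith [pow_nonneg (Int.natCast_nonneg τ.n) τ.d]
  have hX2 : ((τ.n : ℤ) ^ τ.d + 1) * τ.B ≤ W ^ 5 := by
    rw [hB', pow_succ' W 4]; gcongr
  have line : ∀ row < τ.w.M, ∀ t, |τ.w.line A row t| ≤ (τ.n ^ τ.d + 1) * τ.B := by
    intro row hrow t
    have := hA _ (hNM ▸ Params.cell_lt hn0 hrow t)
    exact_mod_cast this
  have wsum : ∀ k ≤ τ.w.p, ∀ row < τ.w.M, ∀ t ≤ 2 * τ.w.n + τ.w.a, |τ.w.wsum A k row t| ≤ W ^ 6 := by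
    intro k hk row hrow t ht
    have h1 := h.fit.wsum_le (by rw [hNM, w_B]; exact hA) hk hrow ht
    rw [w_B] at h1
    have h2 : |τ.w.wsum A k row t| ≤ 2 * τ.w.a * ((τ.n ^ τ.d + 1) * τ.B) + τ.B := by
      have h3 : |(τ.w.wsum A k row t : ℝ)| ≤ 2 * τ.w.a * ((τ.n ^ τ.d + 1) * τ.B) + τ.B := h1
      exact_mod_cast h3
    refine h2.trans ?_
    have h4 : 2 * (τ.w.a : ℤ) ≤ W - 1 := by
      have : (τ.w.a : ℤ) ≤ τ.n := by exact_mod_cast ha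
      linarith
    have h5 : 2 * (τ.w.a : ℤ) * ((τ.n ^ τ.d + 1) * τ.B) ≤ (W - 1) * W ^ 5 := by
      have := B_pos (τ := τ)
      exact mul_le_mul h4 hX2 (by positivity) (by linarith)
    have h6 : W ^ 4 ≤ W ^ 5 := pow_le_pow_right₀ (by linarith) (by norm_num)
    rw [hB'] at h5 ⊢
    nlinarith
  have term : ∀ k ≤ τ.w.p, ∀ i < τ.w.n * τ.w.M, |τ.w.term A k i| ≤ W ^ 11 := by
    intro k hk i hi
    unfold Params.term
    have h1 := h.coefBdd.coef_le hk
    have hmod := Nat.mod_lt i hn0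
    have h2 := wsum k hk (i / τ.w.n) (by rw [Nat.div_lt_iff_lt_mul hn0, mul_comm]; exact hi)
      (τ.w.n + τ.w.a + i % τ.w.n + 1) (by omega)
    rw [abs_mul]
    calc _ ≤ (2 * τ.w.B) * W ^ 6 := mul_le_mul h1 h2 (abs_nonneg _) (by rw [hB]; positivity)
      _ = 2 * W ^ 10 := by rw [hB]; ring
      _ ≤ W * W ^ 10 := by gcongr; linarith
      _ = _ := by ring
  have hpow : ∀ {e : ℕ} {x : ℤ}, e < 16 → |x| ≤ W ^ e → |x| < 2 ^ τ.β := fun he hx => pow_lt_two_pow_β he hx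
  refine ⟨seven_le_β, hn0, h.fit.a_le, ?_, ?_, ?_, ?_, ?_, ?_⟩
  · refine (le_abs_self _).trans_lt (hpow (e := 2) (by norm_num) ?_)
    rw [Nat.abs_cast, hNM]
    have e1 : (τ.q : ℤ) ≤ W := le_two_pow (by have := q_add_le (τ := τ); omega)
    have e2 : (τ.d : ℤ) ≤ W := le_two_pow (by have := q_add_le (τ := τ); omega)
    have e3 : (τ.R : ℤ) ≤ W := le_two_pow le_rfl
    have e4 : (τ.w.p : ℤ) ≤ τ.n := by exact_mod_cast hp.trans ha
    show ((3 * τ.n + τ.n ^ τ.d + τ.d + τ.w.p + 2 + τ.q + τ.R : ℕ) : ℤ) ≤ W ^ 2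
    push_cast
    nlinarith
  · refine (le_abs_self _).trans_lt (hpow (e := 5) (by norm_num) ?_)
    rw [hB, abs_of_nonneg (by positivity), pow_succ' W 4]
    gcongr; linarith
  · intro row hrow t
    refine (le_abs_self _).trans_lt (hpow (e := 6) (by norm_num) ?_)
    rw [abs_mul, abs_abs, pow_succ W 5]
    have := (line row hrow t).trans hX2
    gcongr
    rw [abs_two]; linarith
  · intro k hk row hrow t ht
    exact hpow (by norm_num) (wsum k hk row hrow t ht)
  · intro k hk cnt i hi
    refine hpow (e := 12) (by norm_num) ?_
    unfold Params.acc
    have h1 : |∑ k' ∈ Finset.range k, τ.w.term A k' i| ≤ k * W ^ 11 := by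
      refine (Finset.abs_sum_le_sum_abs _ _).trans ?_
      refine (Finset.sum_le_card_nsmul _ _ (W ^ 11) fun k' hk' => ?_).trans (by simp)
      exact term k' (by have := Finset.mem_range.1 hk'; omega) i hi
    have h2 : |if i < cnt then τ.w.term A k i else 0| ≤ W ^ 11 := by
      split_ifs
      · exact term k hk i hi
      · rw [abs_zero]; positivity
    refine (abs_add_le _ _).trans ?_
    have h3 : (k : ℤ) + 1 ≤ W := by
      have : (k : ℤ) ≤ τ.n := by exact_mod_cast hk.trans (hp.trans ha)
      linarith
    calc _ ≤ k * W ^ 11 + W ^ 11 := add_le_add h1 h2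
      _ = (k + 1) * W ^ 11 := by ring
      _ ≤ W * W ^ 11 := by gcongr
      _ = _ := by ring
  · intro i hi
    refine hpow (e := 5) (by norm_num) ?_
    have := hA' i (by rwa [← hNM])
    have h1 : |τ.w.pass A i| ≤ (τ.n ^ τ.d + 1) * τ.B := by exact_mod_cast this
    exact h1.trans hX2

end Valid
end Task

end HeatFFT
end

open Set
noncomputable section
namespace HeatFFT

/-! ## Computation of the parameters -/

/-- The content of the permanent registers. -/
def Task.st (τ : Task) : ℕ → ℤ
  | 0 => τ.d
  | 1 => τ.n
  | 2 => τ.m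
  | 3 => τ.i
  | 4 => 0
  | 5 => 1
  | 6 => τ.ln
  | 7 => τ.lm
  | 8 => τ.le
  | 9 => τ.q
  | 10 => 2 ^ τ.q
  | 11 => τ.l
  | 12 => τ.R
  | 13 => (4 * τ.R : ℕ)
  | 14 => τ.B
  | 15 => 4 ^ τ.R
  | 16 => τ.ch
  | 17 => τ.a
  | 18 => τ.w.p + 1
  | 19 => τ.w.ps
  | 20 => τ.w.M
  | 21 => τ.n * τ.w.M
  | 22 => 2 * τ.a
  | 23 => τ.n + τ.a
  | 24 => 2 * τ.n + τ.a
  | 25 => 2 * τ.a * τ.B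
  | _ => 0

/-- The first `k` permanent registers are computed. -/
def Done (τ : Task) (k : ℕ) (σ : Store) : Prop := (∀ r < k, σ.reg r = τ.st r) ∧ σ.mem = fun _ => 0

variable {inp : Input} {β : ℕ} {σ : Store} {τ : Task} {k c : ℕ} {p q : Prog} {Q : Store → Prop}

lemma Done.tmp (h : Done τ k σ) {x : ℕ} (hx : k ≤ x) (v : ℤ) : Done τ k (σ.set x v) :=
  ⟨fun r hr => by rw [Store.set_reg, if_neg (by omega)]; exact h.1 r hr, h.2⟩

lemma Done.next (h : Done τ k σ) {v : ℤ} (hv : v = τ.st k) : Done τ (k + 1) (σ.set k v) := by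
  refine ⟨fun r hr => ?_, h.2⟩
  rw [Store.set_reg]
  split_ifs with h1
  · rw [h1, hv]
  · exact h.1 r (by omega)

lemma Done.of_reg (h : Done τ k σ) (hv : σ.reg k = τ.st k) : Done τ (k + 1) σ := by
  refine ⟨fun r hr => ?_, h.2⟩
  rcases Nat.lt_succ_iff_lt_or_eq.1 hr with h1 | h1
  · exact h.1 r h1
  · rw [h1, hv]

/-- Repeated multiplication: `x := e ^ (y - s)`, with counter `c`. -/
def powerLoop (x c y : ℕ) (s : ℤ) (e : Expr) : Prog :=
  .seq (assign x (.lit 1)) <|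
  .seq (assign c (.lit s)) <|
  .loop c y (.seq (assign x (.mul (.var x) e)) (assign c (.add (.var c) (.lit 1))))

lemma powerLoop_spec (hβ : 7 ≤ β) (h : Done τ k σ) {c y s v : ℕ} {e : Expr} {b : ℤ} (hc : k < c) (hc' : c < 100)
    (hy : y < k) (hs : s < 128) (he : (e.ok && decide (e.size ≤ 50)) = true)
    (hb : ∀ σ', Done τ k σ' → e.eval σ' = b) (hv : τ.st y = (s + v : ℕ)) (hst : τ.st k = b ^ v)
    (hpow : ∀ j ≤ v, |b ^ j| < 2 ^ β) (hsv : s + v < 2 ^ β) :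
    Ends inp β (powerLoop k c y s e) σ (3 * v + 3) (Done τ (k + 1)) := by
  simp only [Bool.and_eq_true, decide_eq_true_eq] at he
  refine Ends.mono (k := 1 + (1 + (v * (1 + 1 + 1) + 1))) ?_ (by omega) (fun _ _ h => h)
  have hsv' : (s : ℤ) + v < 2 ^ β := by exact_mod_cast hsv
  refine Ends.assign_seq (v := 1) hβ (by omega) (by rfl) rfl
    (by rw [abs_one]; exact one_lt_pow₀ (by norm_num) (by omega)) ?_
  refine Ends.assign_seq (v := s) hβ hc' (by simpa [Expr.ok, Expr.size] using hs) rfl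
    (by rw [Nat.abs_cast]; linarith [Int.natCast_nonneg v]) ?_
  refine Ends.loop hc' (by omega) (fun j σ' => Done τ k σ' ∧ σ'.reg k = b ^ j ∧ σ'.reg c = s + j) v ?_ ?_ ?_
  · refine ⟨(h.tmp le_rfl _).tmp hc.le _, ?_, by simp⟩
    rw [Store.set_reg, if_neg (by omega), Store.set_reg, if_pos rfl, pow_zero]
  · rintro j hj σ' ⟨h1, h2, h3⟩
    have hj' : (j : ℤ) + 1 ≤ v := by exact_mod_cast hj
    refine ⟨?_, ?_⟩
    · rw [h3, h1.1 y hy, hv]; push_cast; linarith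
    refine Ends.assign_seq (v := b ^ (j + 1)) hβ (by omega) ?_ ?_ (hpow _ hj) ?_
    · simp only [Expr.ok, Expr.size, Bool.and_eq_true, decide_eq_true_eq]
      exact ⟨⟨by omega, he.1⟩, decide_eq_true (by omega)⟩
    · rw [Expr.eval, Expr.eval, h2, hb σ' h1, pow_succ]
    refine Ends.assign' (v := s + (j + 1 : ℕ)) hβ hc' ?_ ?_ ?_ ?_
    · simpa [Expr.ok, Expr.size] using hc'
    · simp only [Expr.eval]
      rw [Store.set_reg, if_neg (by omega), h3]; push_cast; ring
    · rw [abs_of_nonneg (by positivity)]; push_cast; linarith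
    · refine ⟨(h1.tmp le_rfl _).tmp hc.le _, ?_, by simp⟩
      rw [Store.set_reg, if_neg (by omega), Store.set_reg, if_pos rfl]
  · rintro σ' ⟨h1, h2, h3⟩
    refine ⟨?_, h1.of_reg (by rw [h2, hst])⟩
    rw [h3, h1.1 y hy, hv]; push_cast; exact lt_irrefl _

/-- `x := ⌈log₂ y⌉`, with auxiliary register `c`. -/
def logLoop (x c y : ℕ) : Prog :=
  .seq (assign c (.lit 1)) <|
  .seq (assign x (.lit 0)) <|
  .loop c y (.seq (assign c (.mul (.lit 2) (.var c))) (assign x (.add (.var x) (.lit 1))))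

lemma logLoop_spec (hβ : 7 ≤ β) (h : Done τ k σ) {c y v : ℕ} (hc : k < c) (hc' : c < 100)
    (hy : y < k) (hv : τ.st y = v) (hst : τ.st k = Nat.clog 2 v) (hvβ : Nat.clog 2 v < β) :
    Ends inp β (logLoop k c y) σ (3 * Nat.clog 2 v + 3) (Done τ (k + 1)) := by
  refine Ends.mono (k := 1 + (1 + (Nat.clog 2 v * (1 + 1 + 1) + 1))) ?_ (by omega) (fun _ _ h => h)
  have hlt : ∀ j ≤ Nat.clog 2 v, (2 : ℤ) ^ j < 2 ^ β := fun j hj =>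
    pow_lt_pow_right₀ (by norm_num) (by omega)
  refine Ends.assign_seq (v := 1) hβ hc' (by rfl) rfl
    (by rw [abs_one]; exact one_lt_pow₀ (by norm_num) (by omega)) ?_
  refine Ends.assign_seq (v := 0) hβ (by omega) (by rfl) rfl zero_lt_two_pow ?_
  refine Ends.loop hc' (by omega) (fun j σ' => Done τ k σ' ∧ σ'.reg k = j ∧ σ'.reg c = 2 ^ j) _ ?_ ?_ ?_
  · refine ⟨(h.tmp hc.le _).tmp le_rfl _, by simp, ?_⟩
    rw [Store.set_reg, if_neg (by omega), Store.set_reg, if_pos rfl, pow_zero]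
  · rintro j hj σ' ⟨h1, h2, h3⟩
    refine ⟨?_, ?_⟩
    · rw [h3, h1.1 y hy, hv]
      have := (Nat.lt_clog_iff_pow_lt (by norm_num)).1 hj
      exact_mod_cast this
    refine Ends.assign_seq (v := 2 ^ (j + 1)) hβ hc' ?_ ?_ ?_ ?_
    · simpa [Expr.ok, Expr.size] using hc'
    · simp only [Expr.eval, h3, pow_succ']
    · rw [abs_of_pos (by positivity)]; exact hlt _ hj
    refine Ends.assign' (v := (j + 1 : ℕ)) hβ (by omega) ?_ ?_ ?_ ?_
    · simp only [Expr.ok, Expr.size, Bool.and_eq_true, decide_eq_true_eq]; norm_num; omega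
    · simp only [Expr.eval]
      rw [Store.set_reg, if_neg (by omega), h2]; push_cast; ring
    · rw [Nat.abs_cast]
      refine lt_of_le_of_lt ?_ (hlt _ hj)
      exact_mod_cast Nat.lt_two_pow_self.le
    · refine ⟨(h1.tmp hc.le _).tmp le_rfl _, by simp, ?_⟩
      rw [Store.set_reg, if_neg (by omega), Store.set_reg, if_pos rfl]
  · rintro σ' ⟨h1, h2, h3⟩
    refine ⟨?_, h1.of_reg (by rw [h2, hst])⟩
    rw [h3, h1.1 y hy, hv, not_lt]
    exact_mod_cast Nat.le_pow_clog (by norm_num) v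

/-- The next permanent register is computed by an expression. -/
lemma assign_done (hβ : 7 ≤ β) (h : Done τ k σ) (hk : k < 100) {e : Expr}
    (he : (e.ok && decide (e.size ≤ 60)) = true) (hv : e.eval σ = τ.st k) (hb : |τ.st k| < 2 ^ β) :
    Ends inp β (assign k e) σ 1 (Done τ (k + 1)) :=
  Ends.assign' hβ hk he hv hb (h.next rfl)

/-- `⌈log₂ (1 / ε)⌉` by trial. -/
def epsLoop : Prog :=
  .seq (assign 8 (.lit 0)) <|
  .seq (assign 40 (.lit 0)) <|
  .loop 40 5 (.seq (assign 8 (.add (.var 8) (.lit 1))) (.instr (.param 40 1 8)))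

lemma epsLoop_spec (hβ : 7 ≤ β) (hε : 0 < τ.ε) (hε1 : τ.ε < 1) (hp : inp.param 1 = τ.ε) (h : Done τ 8 σ)
    (hle : τ.le < β) : Ends inp β epsLoop σ (3 * τ.le + 3) (Done τ 9) := by
  have hlt : ∀ j ≤ τ.le, (2 : ℤ) ^ j < 2 ^ β := fun j hj => pow_lt_pow_right₀ (by norm_num) (by omega)
  refine Ends.mono (k := 1 + (1 + (τ.le * (1 + 1 + 1) + 1))) ?_ (by omega) (fun _ _ h => h)
  unfold epsLoop
  refine Ends.assign_seq (v := 0) hβ (by norm_num) (by rfl) rfl zero_lt_two_pow ?_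
  refine Ends.assign_seq (v := 0) hβ (by norm_num) (by rfl) rfl zero_lt_two_pow ?_
  refine Ends.loop (by norm_num) (by norm_num) (fun j σ' => Done τ 8 σ' ∧ σ'.reg 8 = j ∧
    σ'.reg 40 = ⌊(2 : ℝ) ^ j * τ.ε⌋) _ ?_ ?_ ?_
  · refine ⟨(h.tmp (by norm_num) _).tmp (by norm_num) _, by simp, ?_⟩
    simp only [Store.set_reg, if_true, pow_zero, one_mul]
    -- The initial zero is the correct answer for `j = 0` because `0 < ε < 1`, so the first question
    -- can be skipped.
    exact (Int.floor_eq_zero_iff.2 ⟨hε.le, hε1⟩).symm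
  · rintro j hj σ' ⟨h1, h2, h3⟩
    refine ⟨?_, ?_⟩
    · have := (Task.le_le_iff hε (k := j)).not.1 (by omega)
      rw [h3, h1.1 5 (by norm_num)]
      exact Int.floor_lt.2 (by push_cast [Task.st]; linarith)
    refine Ends.seq (Ends.assign' (v := (j + 1 : ℕ)) hβ (by norm_num) (by rfl) ?_ ?_ ?_)
    · simp only [Expr.eval, h2]; push_cast; ring
    · rw [Nat.abs_cast]
      refine lt_of_le_of_lt ?_ (hlt _ hj)
      exact_mod_cast Nat.lt_two_pow_self.le
    · refine Ends.param (by norm_num) (by norm_num) (v := j + 1) (by simp) (by nlinarith) ?_ ?_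
      · rw [hp]
        have h0 : 0 ≤ ⌊(2 : ℝ) ^ (j + 1) * τ.ε⌋ := Int.floor_nonneg.2 (by positivity)
        rw [abs_of_nonneg h0]
        refine lt_of_le_of_lt ?_ (hlt _ hj)
        have h5 := Int.floor_le ((2 : ℝ) ^ (j + 1) * τ.ε)
        have h6 : (2 : ℝ) ^ (j + 1) * τ.ε ≤ 2 ^ (j + 1) := mul_le_of_le_one_right (by positivity) hε1.le
        exact_mod_cast h5.trans h6
      · rw [hp]
        exact ⟨(h1.tmp (by norm_num) _).tmp (x := 40) (by norm_num) _,
          by simp [Store.set], by simp⟩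
  · rintro σ' ⟨h1, h2, h3⟩
    refine ⟨?_, h1.of_reg (by rw [h2]; rfl)⟩
    rw [h3, h1.1 5 (by norm_num), not_lt]
    exact Int.le_floor.2 (by push_cast [Task.st]; exact Task.one_le_mul hε)

/-- The step parameter. -/
def stepCode : Prog :=
  .seq (.instr (.param 40 0 13)) <|
  assign 16 (.div (.mul (.mul (.mul (.var 40) (.var 1)) (.var 1)) (.var 3)) (.mul (.var 2) (.var 10)))

lemma stepCode_spec (hβ : 7 ≤ β) (hp : inp.param 0 = τ.θ) (h : Done τ 16 σ)
    (hR : 4 * τ.R ≤ β) (hF : |⌊(2 : ℝ) ^ (4 * τ.R) * τ.θ⌋| < 2 ^ β) (hch : |τ.ch| < 2 ^ β) :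
    Ends inp β stepCode σ 2 (Done τ 17) := by
  refine Ends.seq (k := 1) (k' := 1) (Ends.param (by norm_num) (by norm_num) (v := 4 * τ.R)
    (h.1 13 (by norm_num)) (by nlinarith) (by rwa [hp]) ?_)
  rw [hp]
  refine assign_done hβ (h.tmp (x := 40) (by norm_num) _) (by norm_num) (by rfl) ?_ hch
  simp only [Expr.eval]
  have d := h.tmp (x := 40) (by norm_num) ⌊(2 : ℝ) ^ (4 * τ.R) * τ.θ⌋
  rw [d.1 1 (by norm_num), d.1 2 (by norm_num), d.1 3 (by norm_num), d.1 10 (by norm_num), Store.set_reg,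
    if_pos rfl]
  show _ = τ.ch
  rw [Task.ch]
  rfl

/-- Half the length of the window. -/
def windowCode : Prog :=
  .seq (assign 40 (.mul (.lit 4) (.var 11))) <|
  .seq (assign 41 (.mul (.var 11) (.var 14))) <|
  .seq (assign 42 (.mul (.var 16) (.var 10))) <|
  .seq (.loop 41 42 (.seq (assign 41 (.mul (.lit 4) (.var 41))) (assign 40 (.mul (.lit 2) (.var 40))))) <|
  .seq (condAssign 40 1 17 (.var 40) (.var 1)) <|
  .seq (assign 41 (.mul (.lit 8) (.var 11))) <|
  condAssign 17 41 18 (.add (.var 17) (.lit 1)) (.add (.var 41) (.lit 1))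

lemma windowCode_spec (hβ : 7 ≤ β) (h : Done τ 17 σ)
    (h1 : ∀ j ≤ τ.g, |(4 * τ.l * 2 ^ j : ℤ)| < 2 ^ β) (h2 : ∀ j ≤ τ.g, |τ.l * τ.B * 4 ^ j| < 2 ^ β)
    (h3 : |τ.ch * 2 ^ τ.q| < 2 ^ β) (h4 : |(8 * τ.l : ℤ)| < 2 ^ β) (h5 : |τ.st 17| < 2 ^ β)
    (h6 : |τ.st 18| < 2 ^ β) :
    Ends inp β windowCode σ (3 * τ.g + 9) (Done τ 19) := by
  refine Ends.mono (k := 1 + (1 + (1 + ((τ.g * (1 + 1 + 1) + 1) + (2 + (1 + 2)))))) ?_ (by omega)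
    (fun _ _ h => h)
  unfold windowCode
  refine Ends.assign_seq (v := 4 * τ.l * 2 ^ 0) hβ (by norm_num) (by rfl) ?_ (h1 0 (by omega)) ?_
  · simp only [Expr.eval, h.1 11 (by norm_num), Task.st, pow_zero, mul_one]
  refine Ends.assign_seq (v := τ.l * τ.B * 4 ^ 0) hβ (by norm_num) (by rfl) ?_ (h2 0 (by omega)) ?_
  · have h' := h.tmp (x := 40) (by norm_num) (4 * τ.l * 2 ^ 0)
    simp only [Expr.eval]
    rw [h'.1 11 (by norm_num), h'.1 14 (by norm_num), pow_zero, mul_one]; rfl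
  refine Ends.assign_seq (v := τ.ch * 2 ^ τ.q) hβ (by norm_num) (by rfl) ?_ h3 ?_
  · have h' := (h.tmp (x := 40) (by norm_num) (4 * τ.l * 2 ^ 0)).tmp (x := 41) (by norm_num)
      (τ.l * τ.B * 4 ^ 0)
    simp only [Expr.eval]
    rw [h'.1 16 (by norm_num), h'.1 10 (by norm_num)]; rfl
  refine Ends.seq (Ends.loop (by norm_num) (by norm_num) (fun j σ' => Done τ 17 σ' ∧
    σ'.reg 40 = 4 * τ.l * 2 ^ j ∧ σ'.reg 41 = τ.l * τ.B * 4 ^ j ∧ σ'.reg 42 = τ.ch * 2 ^ τ.q) τ.g ?_ ?_ ?_)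
  · exact ⟨((h.tmp (by norm_num) _).tmp (by norm_num) _).tmp (by norm_num) _, by simp, by simp, by simp⟩
  · rintro j hj σ' ⟨d, e40, e41, e42⟩
    refine ⟨?_, ?_⟩
    · rw [e41, e42, ← not_le, ← Task.g_le_iff]; omega
    refine Ends.assign_seq (v := τ.l * τ.B * 4 ^ (j + 1)) hβ (by norm_num) (by rfl) ?_ (h2 _ hj) ?_
    · simp only [Expr.eval, e41, pow_succ]; ring
    refine Ends.assign' (v := 4 * τ.l * 2 ^ (j + 1)) hβ (by norm_num) (by rfl) ?_ (h1 _ hj) ?_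
    · simp only [Expr.eval, Store.set_reg, Nat.reduceEqDiff, if_false, e40, pow_succ]; ring
    · exact ⟨(d.tmp (by norm_num) _).tmp (by norm_num) _, by simp, by simp, by simpa using e42⟩
  rintro σ' ⟨d, e40, e41, e42⟩
  refine ⟨by rw [e41, e42, not_lt, ← Task.g_le_iff], ?_⟩
  have hst : ((4 * τ.l * 2 ^ τ.g : ℕ) : ℤ) = 4 * τ.l * 2 ^ τ.g := by push_cast; ring
  refine Ends.condAssign_seq (v := τ.st 17) hβ (by norm_num) (by norm_num) (by norm_num) (by rfl) (by rfl)
    ?_ h5 ?_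
  · simp only [Expr.eval, e40, d.1 1 (by norm_num)]
    show (if (4 * τ.l * 2 ^ τ.g : ℤ) ≤ τ.n then (4 * τ.l * 2 ^ τ.g : ℤ) else τ.n) = τ.a
    rw [← hst, Task.a, ← min_def, ← Nat.cast_min]
  have d1 := d.next (v := τ.st 17) rfl
  refine Ends.assign_seq (v := 8 * τ.l) hβ (by norm_num) (by rfl) ?_ h4 ?_
  · simp only [Expr.eval]
    rw [d1.1 11 (by norm_num)]; rfl
  have d2 := d1.tmp (x := 41) (by norm_num) (8 * τ.l)
  set σ2 := (σ'.set 17 (τ.st 17)).set 41 (8 * τ.l) with hσ2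
  have e41' : σ2.reg 41 = 8 * τ.l := by simp [hσ2]
  have hv : (if σ2.reg 17 ≤ σ2.reg 41 then (Expr.add (.var 17) (.lit 1)).eval σ2
      else (Expr.add (.var 41) (.lit 1)).eval σ2) = τ.st 18 := by
    simp only [Expr.eval, d2.1 17 (by norm_num), e41']
    show (if (τ.a : ℤ) ≤ 8 * τ.l then (τ.a + 1 : ℤ) else 8 * τ.l + 1) = (min τ.a (8 * τ.l) : ℕ) + 1
    rw [Nat.cast_min, min_def]
    push_cast
    split_ifs <;> rfl
  refine Ends.ite (k := 1) (by norm_num) (by norm_num) (fun hc => ?_) (fun hc => ?_)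
  · rw [if_pos hc] at hv
    exact assign_done hβ d2 (by norm_num) (by rfl) hv h6
  · rw [if_neg hc] at hv
    exact assign_done hβ d2 (by norm_num) (by rfl) hv h6

/-- The approximation of `π / 4`. -/
def piCode : Prog :=
  .seq (assign 19 (.lit 0)) <|
  .seq (assign 40 (.div (.var 14) (.lit 2))) <|
  .seq (assign 41 (.div (.var 14) (.lit 3))) <|
  .seq (assign 42 (.lit 0)) <|
  .loop 42 12 <|
    .seq (assign 19 (.add (.var 19) (.div (.add (.var 40) (.var 41)) (.add (.mul (.lit 2) (.var 42)) (.lit 1))))) <|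
    .seq (assign 40 (.div (.var 40) (.lit (-4)))) <|
    .seq (assign 41 (.div (.var 41) (.lit (-9)))) <|
    assign 42 (.add (.var 42) (.lit 1))

lemma quotSeq_abs_le (B r e : ℤ) (t : ℕ) : |quotSeq B r e t| ≤ |B| := by
  induction t with
  | zero =>
    have := Int.natAbs_ediv_le_natAbs B r
    rw [quotSeq, Int.abs_eq_natAbs, Int.abs_eq_natAbs]; exact_mod_cast this
  | succ t ih =>
    refine le_trans ?_ ih
    have := Int.natAbs_ediv_le_natAbs (quotSeq B r e t) e
    rw [quotSeq, Int.abs_eq_natAbs, Int.abs_eq_natAbs]; exact_mod_cast this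

lemma piSum_abs_le (B : ℤ) (t : ℕ) : |piSum B t| ≤ 2 * t * |B| := by
  induction t with
  | zero => simp [piSum]
  | succ t ih =>
    rw [piSum]
    have h1 := Int.natAbs_ediv_le_natAbs (quotSeq B 2 (-4) t + quotSeq B 3 (-9) t) (2 * t + 1)
    have h2 : |(quotSeq B 2 (-4) t + quotSeq B 3 (-9) t) / (2 * t + 1)|
        ≤ |quotSeq B 2 (-4) t + quotSeq B 3 (-9) t| := by
      rw [Int.abs_eq_natAbs, Int.abs_eq_natAbs]; exact_mod_cast h1
    have h3 := abs_add_le (quotSeq B 2 (-4) t) (quotSeq B 3 (-9) t)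
    have h4 := quotSeq_abs_le B 2 (-4) t
    have h5 := quotSeq_abs_le B 3 (-9) t
    refine (abs_add_le _ _).trans ?_
    push_cast
    linarith

lemma piCode_spec (hβ : 7 ≤ β) (h : Done τ 19 σ) (hB : 2 * τ.R * τ.B < 2 ^ β) (hR : 1 ≤ τ.R) :
    Ends inp β piCode σ (5 * τ.R + 5) (Done τ 20) := by
  have hB0 := Task.B_pos (τ := τ)
  have hR' : (1 : ℤ) ≤ τ.R := by exact_mod_cast hR
  have hB1 : τ.B ≤ τ.R * τ.B := le_mul_of_one_le_left hB0.le hR'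
  have hR1 : (τ.R : ℤ) ≤ τ.R * τ.B := le_mul_of_one_le_right (by positivity) hB0
  have hquot : ∀ r e t, |quotSeq τ.B r e t| < 2 ^ β := fun r e t => by
    refine (quotSeq_abs_le _ _ _ _).trans_lt ?_
    rw [abs_of_pos hB0]; linarith
  have hsum : ∀ t ≤ τ.R, |piSum τ.B t| < 2 ^ β := fun t ht => by
    refine (piSum_abs_le _ _).trans_lt (lt_of_le_of_lt ?_ hB)
    rw [abs_of_pos hB0]
    have : (t : ℤ) ≤ τ.R := by exact_mod_cast ht
    gcongr
  refine Ends.mono (k := 1 + (1 + (1 + (1 + (τ.R * ((1 + (1 + (1 + 1))) + 1) + 1))))) ?_ (by omega)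
    (fun _ _ h => h)
  unfold piCode
  refine Ends.assign_seq (v := 0) hβ (by norm_num) (by rfl) rfl zero_lt_two_pow ?_
  have d1 := h.tmp (x := 19) (by norm_num) 0
  refine Ends.assign_seq (v := quotSeq τ.B 2 (-4) 0) hβ (by norm_num) (by rfl) ?_ (hquot _ _ _) ?_
  · simp only [Expr.eval]
    rw [d1.1 14 (by norm_num)]; rfl
  have d2 := d1.tmp (x := 40) (by norm_num) (quotSeq τ.B 2 (-4) 0)
  refine Ends.assign_seq (v := quotSeq τ.B 3 (-9) 0) hβ (by norm_num) (by rfl) ?_ (hquot _ _ _) ?_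
  · simp only [Expr.eval]
    rw [d2.1 14 (by norm_num)]; rfl
  have d3 := d2.tmp (x := 41) (by norm_num) (quotSeq τ.B 3 (-9) 0)
  refine Ends.assign_seq (v := 0) hβ (by norm_num) (by rfl) rfl zero_lt_two_pow ?_
  refine Ends.loop (by norm_num) (by norm_num) (fun t σ' => Done τ 19 σ' ∧ σ'.reg 19 = piSum τ.B t ∧
    σ'.reg 40 = quotSeq τ.B 2 (-4) t ∧ σ'.reg 41 = quotSeq τ.B 3 (-9) t ∧ σ'.reg 42 = t) τ.R ?_ ?_ ?_
  · exact ⟨d3.tmp (by norm_num) _, by simp [piSum], by simp, by simp, by simp⟩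
  · rintro t ht σ' ⟨d, e19, e40, e41, e42⟩
    refine ⟨by rw [e42, d.1 12 (by norm_num)]; show (t : ℤ) < τ.R; exact_mod_cast ht, ?_⟩
    refine Ends.assign_seq (v := piSum τ.B (t + 1)) (k := 1 + (1 + 1)) hβ (by norm_num) (by rfl) ?_ (hsum _ ht) ?_
    · simp only [Expr.eval, e19, e40, e41, e42, piSum]
    refine Ends.assign_seq (v := quotSeq τ.B 2 (-4) (t + 1)) (k := 1 + 1) hβ (by norm_num) (by rfl) ?_ (hquot _ _ _) ?_
    · simp only [Expr.eval, Store.set_reg, Nat.reduceEqDiff, if_false, e40, quotSeq]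
    refine Ends.assign_seq (v := quotSeq τ.B 3 (-9) (t + 1)) (k := 1) hβ (by norm_num) (by rfl) ?_ (hquot _ _ _) ?_
    · simp only [Expr.eval, Store.set_reg, Nat.reduceEqDiff, if_false, e41, quotSeq]
    refine Ends.assign' (v := (t + 1 : ℕ)) hβ (by norm_num) (by rfl) ?_ ?_ ?_
    · simp [Expr.eval, e42]
    · rw [Nat.abs_cast]
      have : ((t + 1 : ℕ) : ℤ) ≤ τ.R := by exact_mod_cast ht
      linarith
    · exact ⟨(((d.tmp (by norm_num) _).tmp (by norm_num) _).tmp (by norm_num) _).tmp (by norm_num) _,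
        by simp, by simp, by simp, by simp⟩
  · rintro σ' ⟨d, e19, -, -, e42⟩
    refine ⟨by rw [e42, d.1 12 (by norm_num)]; exact lt_irrefl _, d.of_reg ?_⟩
    rw [e19]; rfl

end HeatFFT
end

open Set
noncomputable section
namespace HeatFFT

/-! ## The program -/

/-- Computation of all parameters on which the main part depends. -/
def setupCode : Prog :=
  .seq (logLoop 6 40 1) <|
  .seq (logLoop 7 40 2) <|
  .seq epsLoop <|
  .seq (assign 9 (.add (.add (.var 7) (.mul (.lit 2) (.var 6))) (.lit 11))) <|
  .seq (powerLoop 10 40 9 0 (.lit 2)) <|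
  .seq (assign 11 (.add (.add (.mul (.lit 2) (.var 6)) (.var 7)) (.lit 6))) <|
  .seq (assign 12 (.add (.add (.add (.add (.add (.mul (.var 0) (.var 6)) (.var 0))
    (.mul (.lit 2) (.var 9))) (.mul (.lit 3) (.var 6))) (.var 8)) (.lit 30))) <|
  .seq (assign 13 (.mul (.lit 4) (.var 12))) <|
  .seq (powerLoop 14 40 12 0 (.lit 16)) <|
  .seq (powerLoop 15 40 12 0 (.lit 4)) <|
  .seq stepCode <|
  .seq windowCode <|
  .seq piCode <|
  .seq (powerLoop 20 40 0 1 (.var 1)) <|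
  .seq (assign 21 (.mul (.var 1) (.var 20))) <|
  .seq (assign 22 (.mul (.lit 2) (.var 17))) <|
  .seq (assign 23 (.add (.var 1) (.var 17))) <|
  .seq (assign 24 (.add (.mul (.lit 2) (.var 1)) (.var 17))) <|
  assign 25 (.mul (.mul (.lit 2) (.var 17)) (.var 14))

/-- The initial values are copied into the memory. -/
def sampleCode : Prog :=
  .seq (assign 40 (.lit 0)) <|
  .loop 40 21 <|
    .seq (.instr (.sample 41 40 13)) <|
    .seq (write (.var 40) (.var 41)) <|
    assign 40 (.add (.var 40) (.lit 1))

/-- The output for grids with only one point. -/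
def trivialCode : Prog := .seq (write (.lit 0) (.lit 1)) (assign 0 (.lit 1))

/-- The program of the diagonalisation method. -/
def program : Prog :=
  .seq (assign 4 (.lit 0)) <|
  .seq (assign 5 (.lit 1)) <|
  .ite 1 5 trivialCode (.seq setupCode (.seq sampleCode mainPart))

variable {inp : Input} {β : ℕ} {σ : Store} {τ : Task} {k c : ℕ} {Q : Store → Prop}

lemma assign_done_seq {p : Prog} (hβ : 7 ≤ β) (h : Done τ k σ) (hk : k < 100) {e : Expr}
    (he : (e.ok && decide (e.size ≤ 60)) = true) (hv : e.eval σ = τ.st k) (hb : |τ.st k| < 2 ^ β)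
    (hQ : ∀ σ', Done τ (k + 1) σ' → Ends inp β p σ' c Q) :
    Ends inp β (.seq (assign k e) p) σ (1 + c) Q :=
  Ends.seq ((assign_done hβ h hk he hv hb).mono le_rfl fun σ' _ h' => hQ σ' h')

lemma Ends.seq_of {p q : Prog} {k' : ℕ} {Q' : Store → Prop} (hp : Ends inp β p σ k Q')
    (hQ : ∀ σ', Q' σ' → Ends inp β q σ' k' Q) : Ends inp β (.seq p q) σ (k + k') Q :=
  Ends.seq (hp.mono le_rfl fun σ' _ h' => hQ σ' h')

namespace Task.Valid
variable (h : τ.Valid)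
include h

lemma a_le_nat : τ.a ≤ τ.n := h.fit.a_le

lemma p_le_nat : τ.w.p ≤ τ.a := h.fit.p_le

lemma st_lt {r : ℕ} (hr : r < 26) : |τ.st r| < 2 ^ τ.β := by
  have hW := two_pow_R (τ := τ)
  have e1 := q_add_le (τ := τ)
  have e2 := lm_ln_le (τ := τ)
  have e3 := l_le (τ := τ)
  have small : ∀ x : ℕ, x ≤ τ.R → |(x : ℤ)| ≤ (2 ^ τ.R) ^ 1 := fun x hx => by
    rw [Nat.abs_cast, pow_one]; exact le_two_pow hx
  have hn := n_le_pow (τ := τ)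
  have hn3 : 3 * (τ.n : ℤ) + 1 ≤ 2 ^ τ.R := by have := h.n_two; linarith
  have ha : (τ.a : ℤ) ≤ τ.n := by exact_mod_cast h.a_le_nat
  have hp : (τ.w.p : ℤ) ≤ τ.a := by exact_mod_cast h.p_le_nat
  have hm := m_le_pow (τ := τ)
  have hi : (τ.i : ℤ) ≤ τ.m := by exact_mod_cast h.i_le
  have hN := n_pow_le (τ := τ)
  have hNM : (τ.n : ℤ) * τ.w.M = τ.n ^ τ.d := by exact_mod_cast h.nM
  have hM : (τ.w.M : ℤ) ≤ τ.n * τ.w.M :=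
    le_mul_of_one_le_left (by positivity) (by have := h.n_two; exact_mod_cast (by omega : 1 ≤ τ.n))
  have hN0 : (0 : ℤ) ≤ τ.n ^ τ.d := by positivity
  have hB := B_eq_pow (τ := τ)
  have hB0 := B_pos (τ := τ)
  have h0a : (0 : ℤ) ≤ τ.a := by positivity
  have of_nonneg : ∀ {x : ℤ}, 0 ≤ x → x ≤ 2 ^ τ.R → |x| < 2 ^ τ.β := fun {x} hx hx' =>
    pow_lt_two_pow_β (e := 1) (by norm_num) (by rw [abs_of_nonneg hx, pow_one]; exact hx')
  interval_cases r
  · exact pow_lt_two_pow_β (by norm_num) (small τ.d (by omega))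
  · exact of_nonneg (x := τ.n) (by positivity) (by linarith)
  · exact of_nonneg (x := τ.m) (by positivity) (by linarith)
  · exact of_nonneg (x := τ.i) (by positivity) (by linarith)
  · exact of_nonneg (x := 0) le_rfl (by linarith)
  · exact of_nonneg (x := 1) (by norm_num) (by linarith)
  · exact pow_lt_two_pow_β (by norm_num) (small τ.ln (by omega))
  · exact pow_lt_two_pow_β (by norm_num) (small τ.lm (by omega))
  · exact pow_lt_two_pow_β (by norm_num) (small τ.le (by omega))
  · exact pow_lt_two_pow_β (by norm_num) (small τ.q (by omega))
  · exact of_nonneg (x := 2 ^ τ.q) (by positivity) (pow_le_pow_right₀ (by norm_num) (by omega))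
  · exact pow_lt_two_pow_β (by norm_num) (small τ.l (by omega))
  · exact pow_lt_two_pow_β (by norm_num) (small τ.R le_rfl)
  · refine pow_lt_two_pow_β (e := 2) (by norm_num) ?_
    show |((4 * τ.R : ℕ) : ℤ)| ≤ _
    have := le_two_pow (τ := τ) le_rfl
    rw [Nat.abs_cast]; push_cast
    nlinarith
  · refine pow_lt_two_pow_β (e := 4) (by norm_num) ?_
    show |τ.B| ≤ _
    rw [abs_of_pos hB0, hB]
  · refine pow_lt_two_pow_β (e := 2) (by norm_num) ?_
    show |(4 : ℤ) ^ τ.R| ≤ _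
    rw [abs_of_pos (by positivity), ← pow_mul, mul_comm, pow_mul]; norm_num
  · refine pow_lt_two_pow_β (e := 4) (by norm_num) ?_
    show |τ.ch| ≤ _
    have h1 := h.ch_nonneg
    have h2 := h.ch_le
    rw [abs_of_nonneg h1, ← hB]; linarith
  · exact of_nonneg (x := τ.a) h0a (by linarith)
  · exact of_nonneg (x := τ.w.p + 1) (by positivity) (by linarith)
  · refine pow_lt_two_pow_β (e := 4) (by norm_num) ?_
    have h1 := h.coefBdd.ps_le
    rw [w_B, hB] at h1
    exact h1
  · exact of_nonneg (x := τ.w.M) (by positivity) (by linarith)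
  · exact of_nonneg (x := τ.n * τ.w.M) (by positivity) (by linarith)
  · exact of_nonneg (x := 2 * τ.a) (by positivity) (by linarith)
  · exact of_nonneg (x := τ.n + τ.a) (by positivity) (by linarith)
  · exact of_nonneg (x := 2 * τ.n + τ.a) (by positivity) (by linarith)
  · refine pow_lt_two_pow_β (e := 5) (by norm_num) ?_
    show |2 * τ.a * τ.B| ≤ _
    rw [abs_of_nonneg (by positivity), hB, pow_succ' _ 4]
    gcongr; linarith

lemma setup_cost : (3 * Nat.clog 2 τ.n + 3) + ((3 * Nat.clog 2 τ.m + 3) + ((3 * τ.le + 3) + (1 +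
    ((3 * τ.q + 3) + (1 + (1 + (1 + ((3 * τ.R + 3) + ((3 * τ.R + 3) + (2 + ((3 * τ.g + 9) +
    ((5 * τ.R + 5) + ((3 * (τ.d - 1) + 3) + (1 + (1 + (1 + (1 + 1))))))))))))))))) ≤ 20 * τ.R := by
  have e1 := q_add_le (τ := τ)
  have e2 := lm_ln_le (τ := τ)
  have hg := h.g_le
  have hln : Nat.clog 2 τ.n = τ.ln := by unfold Task.ln; rfl
  have hlm : Nat.clog 2 τ.m = τ.lm := by unfold Task.lm; rfl
  rw [hln, hlm]
  have hd : τ.d - 1 ≤ τ.d := Nat.sub_le _ _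
  linarith

set_option maxHeartbeats 1000000 in
lemma setup_spec (hp0 : inp.param 0 = τ.θ) (hp1 : inp.param 1 = τ.ε) (hD : Done τ 6 σ) :
    Ends inp τ.β setupCode σ (20 * τ.R) (Done τ 26) := by
  have hcost := h.setup_cost
  have hW := two_pow_R (τ := τ)
  have hβ := seven_le_β (τ := τ)
  have e1 := q_add_le (τ := τ)
  have e2 := lm_ln_le (τ := τ)
  have e3 := l_le (τ := τ)
  have hg := h.g_le
  have hR30 := thirty_le_R (τ := τ)
  have hβR : τ.β = 16 * τ.R := rfl
  have hln : τ.ln = Nat.clog 2 τ.n := by unfold Task.ln; rfl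
  have hlm : τ.lm = Nat.clog 2 τ.m := by unfold Task.lm; rfl
  have hd := h.d_pos
  have hB0 := B_pos (τ := τ)
  have hB := B_eq_pow (τ := τ)
  have hR' : (τ.R : ℤ) ≤ 2 ^ τ.R := le_two_pow le_rfl
  have hlt2 : ∀ v ≤ τ.R, v < 2 ^ τ.β := fun v hv =>
    lt_of_le_of_lt hv (Nat.lt_two_pow_self.trans_le (Nat.pow_le_pow_right (by norm_num) (by rw [hβR]; omega)))
  have hpw : ∀ e ≤ 4, ∀ j ≤ τ.R, |((2 : ℤ) ^ e) ^ j| < 2 ^ τ.β := fun e he j hj => by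
    rw [abs_of_pos (by positivity), ← pow_mul]
    refine pow_lt_pow_right₀ (by norm_num) ?_
    calc e * j ≤ 4 * τ.R := Nat.mul_le_mul he hj
      _ < 16 * τ.R := by omega
  refine Ends.mono (k := _) ?_ hcost (fun _ _ h => h)
  unfold setupCode
  refine Ends.seq_of (logLoop_spec hβ hD (by norm_num) (by norm_num) (by norm_num) rfl
    (by rw [← hln]; rfl) (by omega)) fun σ hD => ?_
  refine Ends.seq_of (logLoop_spec hβ hD (by norm_num) (by norm_num) (by norm_num) rfl
    (by rw [← hlm]; rfl) (by omega)) fun σ hD => ?_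
  refine Ends.seq_of (epsLoop_spec hβ h.ε_pos h.ε_lt hp1 hD (by omega)) fun σ hD => ?_
  refine assign_done_seq hβ hD (by norm_num) (by rfl) ?_ (h.st_lt (by norm_num)) fun σ hD => ?_
  · simp only [Expr.eval]
    rw [hD.1 7 (by norm_num), hD.1 6 (by norm_num)]
    show (τ.lm + 2 * τ.ln + 11 : ℤ) = τ.q
    rw [Task.q]; push_cast; rfl
  refine Ends.seq_of (powerLoop_spec (s := 0) (v := τ.q) (b := 2) hβ hD (by norm_num) (by norm_num)
    (by norm_num) (by norm_num) (by rfl) (fun _ _ => rfl) (by rw [zero_add]; rfl) rfl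
    (fun j hj => hpw 1 (by norm_num) j (by omega)) (by rw [zero_add]; exact hlt2 _ (by omega))) fun σ hD => ?_
  refine assign_done_seq hβ hD (by norm_num) (by rfl) ?_ (h.st_lt (by norm_num)) fun σ hD => ?_
  · simp only [Expr.eval]
    rw [hD.1 7 (by norm_num), hD.1 6 (by norm_num)]
    show (2 * τ.ln + τ.lm + 6 : ℤ) = τ.l
    rw [Task.l]; push_cast; rfl
  refine assign_done_seq hβ hD (by norm_num) (by rfl) ?_ (h.st_lt (by norm_num)) fun σ hD => ?_
  · simp only [Expr.eval]
    rw [hD.1 0 (by norm_num), hD.1 6 (by norm_num), hD.1 8 (by norm_num), hD.1 9 (by norm_num)]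
    show (τ.d * τ.ln + τ.d + 2 * τ.q + 3 * τ.ln + τ.le + 30 : ℤ) = τ.R
    rw [Task.R]; push_cast; rfl
  refine assign_done_seq hβ hD (by norm_num) (by rfl) ?_ (h.st_lt (by norm_num)) fun σ hD => ?_
  · simp only [Expr.eval]
    rw [hD.1 12 (by norm_num)]
    show (4 * τ.R : ℤ) = (4 * τ.R : ℕ)
    push_cast; rfl
  refine Ends.seq_of (powerLoop_spec (s := 0) (v := τ.R) (b := 16) hβ hD (by norm_num) (by norm_num)
    (by norm_num) (by norm_num) (by rfl) (fun _ _ => rfl) (by rw [zero_add]; rfl)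
    (by show τ.B = _; rw [Task.B])
    (fun j hj => hpw 4 (by norm_num) j hj) (by rw [zero_add]; exact hlt2 _ le_rfl)) fun σ hD => ?_
  refine Ends.seq_of (powerLoop_spec (s := 0) (v := τ.R) (b := 4) hβ hD (by norm_num) (by norm_num)
    (by norm_num) (by norm_num) (by rfl) (fun _ _ => rfl) (by rw [zero_add]; rfl) rfl
    (fun j hj => hpw 2 (by norm_num) j hj) (by rw [zero_add]; exact hlt2 _ le_rfl)) fun σ hD => ?_
  refine Ends.seq_of (stepCode_spec hβ hp0 hD (by omega) ?_ (h.st_lt (r := 16) (by norm_num)))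
    fun σ hD => ?_
  · refine pow_lt_two_pow_β (e := 5) (by norm_num) ?_
    rw [abs_of_nonneg h.floor_nonneg]
    have hd1 : (1 : ℝ) ≤ τ.d := by exact_mod_cast hd
    have hn1 : (1 : ℝ) ≤ (τ.n : ℝ) ^ 2 :=
      one_le_pow₀ (by exact_mod_cast (by have := h.n_two; omega : 1 ≤ τ.n))
    -- The time restriction also bounds the real parameter, so the integer read from it has at most
    -- about `5 R` digits.
    have h1 : τ.θ ≤ 2 * τ.m := by
      have hθ := h.θ_nonneg
      calc τ.θ ≤ τ.θ * τ.n ^ 2 := le_mul_of_one_le_right hθ hn1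
        _ ≤ τ.d * (τ.θ * τ.n ^ 2) := le_mul_of_one_le_left (by positivity) hd1
        _ ≤ _ := h.time_le
    have hm : 2 * (τ.m : ℝ) ≤ 2 ^ τ.R := by exact_mod_cast m_le_pow (τ := τ)
    have h2 : (2 : ℝ) ^ (4 * τ.R) * τ.θ ≤ ((2 : ℝ) ^ τ.R) ^ 5 := by
      calc (2 : ℝ) ^ (4 * τ.R) * τ.θ ≤ 2 ^ (4 * τ.R) * 2 ^ τ.R := by gcongr; exact h1.trans hm
        _ = _ := by rw [← pow_mul, ← pow_add]; congr 1; ring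
    have h3 := (Int.floor_le _).trans h2
    exact_mod_cast h3
  have hl : (τ.l : ℤ) ≤ 2 ^ τ.R := le_two_pow (by omega)
  refine Ends.seq_of (windowCode_spec hβ hD ?_ ?_ ?_ ?_ (h.st_lt (by norm_num)) (h.st_lt (by norm_num)))
    fun σ hD => ?_
  · intro j hj
    refine pow_lt_two_pow_β (e := 3) (by norm_num) ?_
    rw [abs_of_nonneg (by positivity), pow_succ, pow_two]
    have : (2 : ℤ) ^ j ≤ 2 ^ τ.R := pow_le_pow_right₀ (by norm_num) (by omega)
    gcongr; linarith
  · intro j hj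
    refine pow_lt_two_pow_β (e := 6) (by norm_num) ?_
    have : (4 : ℤ) ^ j ≤ 2 ^ τ.R := by
      rw [show (4 : ℤ) = 2 ^ 2 by norm_num, ← pow_mul]
      exact pow_le_pow_right₀ (by norm_num) (by omega)
    rw [abs_of_nonneg (by positivity)]
    calc τ.l * τ.B * 4 ^ j ≤ 2 ^ τ.R * τ.B * 2 ^ τ.R := by gcongr
      _ = _ := by rw [hB]; ring
  · refine pow_lt_two_pow_β (e := 5) (by norm_num) ?_
    have h0 := h.ch_nonneg
    rw [abs_of_nonneg (by positivity)]
    refine h.ch_mul_le'.trans ?_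
    rw [hB, pow_succ' _ 4]
    have := m_le_pow (τ := τ)
    gcongr
  · refine pow_lt_two_pow_β (e := 2) (by norm_num) ?_
    rw [abs_of_nonneg (by positivity), pow_two]
    gcongr; linarith
  refine Ends.seq_of (piCode_spec hβ hD ?_ (by omega)) fun σ hD => ?_
  · refine (le_abs_self _).trans_lt (pow_lt_two_pow_β (e := 6) (by norm_num) ?_)
    rw [abs_of_nonneg (by positivity)]
    calc 2 * τ.R * τ.B ≤ 2 ^ τ.R * 2 ^ τ.R * τ.B := by gcongr; linarith
      _ = _ := by rw [hB]; ring
  refine Ends.seq_of (powerLoop_spec (s := 1) (v := τ.d - 1) (b := τ.n) hβ hD (by norm_num) (by norm_num)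
    (by norm_num) (by norm_num) (by rfl) (fun σ' hD' => hD'.1 1 (by norm_num))
    (by rw [add_comm, Nat.sub_add_cancel hd]; rfl) (by show ((τ.n ^ (τ.d - 1) : ℕ) : ℤ) = _; push_cast; rfl)
    (fun j hj => ?_) (by rw [add_comm, Nat.sub_add_cancel hd]; exact hlt2 _ (by omega))) fun σ hD => ?_
  · have hn1 : (1 : ℤ) ≤ τ.n := by exact_mod_cast (by have := h.n_two; omega : 1 ≤ τ.n)
    have h1 : (τ.n : ℤ) ^ j ≤ τ.n ^ τ.d := pow_le_pow_right₀ hn1 (by omega)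
    have hN := n_pow_le (τ := τ)
    refine pow_lt_two_pow_β (e := 1) (by norm_num) ?_
    rw [abs_of_nonneg (by positivity), pow_one]
    have : (0 : ℤ) ≤ τ.n ^ τ.d := by positivity
    linarith
  refine assign_done_seq hβ hD (by norm_num) (by rfl) ?_ (h.st_lt (by norm_num)) fun σ hD => ?_
  · simp only [Expr.eval]; rw [hD.1 1 (by norm_num), hD.1 20 (by norm_num)]; rfl
  refine assign_done_seq hβ hD (by norm_num) (by rfl) ?_ (h.st_lt (by norm_num)) fun σ hD => ?_
  · simp only [Expr.eval]; rw [hD.1 17 (by norm_num)]; rfl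
  refine assign_done_seq hβ hD (by norm_num) (by rfl) ?_ (h.st_lt (by norm_num)) fun σ hD => ?_
  · simp only [Expr.eval]; rw [hD.1 1 (by norm_num), hD.1 17 (by norm_num)]; rfl
  refine assign_done_seq hβ hD (by norm_num) (by rfl) ?_ (h.st_lt (by norm_num)) fun σ hD => ?_
  · simp only [Expr.eval]; rw [hD.1 1 (by norm_num), hD.1 17 (by norm_num)]; rfl
  refine assign_done hβ hD (by norm_num) (by rfl) ?_ (h.st_lt (by norm_num))
  simp only [Expr.eval]; rw [hD.1 17 (by norm_num), hD.1 14 (by norm_num)]; rfl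

omit h in
lemma env_of_reg (hD : ∀ r < 26, σ.reg r = τ.st r) : Env τ.w σ where
  r0 := hD 0 (by norm_num)
  r1 := hD 1 (by norm_num)
  r4 := hD 4 (by norm_num)
  r9 := hD 9 (by norm_num)
  r12 := hD 12 (by norm_num)
  r14 := by rw [w_B]; exact hD 14 (by norm_num)
  r15 := hD 15 (by norm_num)
  r16 := hD 16 (by norm_num)
  r17 := hD 17 (by norm_num)
  r18 := hD 18 (by norm_num)
  r19 := hD 19 (by norm_num)
  r20 := hD 20 (by norm_num)
  r21 := hD 21 (by norm_num)
  r22 := hD 22 (by norm_num)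
  r23 := hD 23 (by norm_num)
  r24 := hD 24 (by norm_num)
  r25 := by rw [w_B]; exact hD 25 (by norm_num)

/-- The setup leaves the memory empty, so after the samples are written the upper block is still
zero, as the accumulators require. -/
lemma sample_spec (hb : ∀ i < τ.w.n * τ.w.M, |τ.start inp.sample i| < 2 ^ τ.β) (hD : Done τ 26 σ) :
    Ends inp τ.β sampleCode σ (4 * (τ.w.n * τ.w.M) + 2) (fun σ' => Env τ.w σ' ∧
      (∀ i < τ.w.n * τ.w.M, σ'.mem i = τ.start inp.sample i) ∧
      ∀ i < τ.w.n * τ.w.M, σ'.mem (τ.w.n * τ.w.M + i) = 0) := by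
  have hβ := seven_le_β (τ := τ)
  have hR30 := thirty_le_R (τ := τ)
  have hβR : τ.β = 16 * τ.R := rfl
  refine Ends.mono (k := 1 + (τ.w.n * τ.w.M * ((1 + (1 + 1)) + 1) + 1)) ?_ (by omega) (fun _ _ h => h)
  unfold sampleCode
  refine Ends.assign_seq (v := 0) hβ (by norm_num) (by rfl) rfl zero_lt_two_pow ?_
  refine Ends.loop (by norm_num) (by norm_num) (fun j σ' => (∀ r < 26, σ'.reg r = τ.st r) ∧ σ'.reg 40 = j ∧
    ∀ i, σ'.mem i = if i < j then τ.start inp.sample i else 0) _ ?_ ?_ ?_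
  · refine ⟨(hD.tmp (by norm_num) _).1, by simp, fun i => ?_⟩
    rw [Store.set_mem, hD.2, if_neg (by omega)]
  · rintro j hj σ' ⟨d, e40, m⟩
    refine ⟨by rw [e40, d 21 (by norm_num)]; show (j : ℤ) < τ.n * τ.w.M; exact_mod_cast hj, ?_⟩
    refine Ends.seq (Ends.sample (v := 4 * τ.R) (w := j) (by norm_num) (by norm_num) (by norm_num)
      (d 13 (by norm_num)) e40 (by nlinarith) (hb j hj) ?_)
    refine Ends.write_seq (b := j) (v := τ.start inp.sample j) (k := 1) hβ (by rfl) (by rfl) ?_ ?_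
      (hb j hj) ?_
    · simpa [Expr.eval] using e40
    · simp [Expr.eval, start]
    refine Ends.assign' (v := (j + 1 : ℕ)) hβ (by norm_num) (by rfl) ?_ ?_ ?_
    · simp [Expr.eval, e40]
    · have h1 := h.st_lt (r := 21) (by norm_num)
      have h2 : ((j + 1 : ℕ) : ℤ) ≤ τ.st 21 := by
        show ((j + 1 : ℕ) : ℤ) ≤ τ.n * τ.w.M
        exact_mod_cast hj
      rw [Nat.abs_cast]
      exact lt_of_le_of_lt (h2.trans (le_abs_self _)) h1
    · refine ⟨fun r hr => ?_, by simp, fun i => ?_⟩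
      · have h1 : r ≠ 40 := by omega
        have h2 : r ≠ 41 := by omega
        simpa [h1, h2, Store.put] using d r hr
      · rw [Store.set_mem, Store.put_mem]
        show (if i = j then _ else σ'.mem i) = _
        rw [m i]
        split_ifs with h1 h2 h3 h4 h5
        · rw [h1]
        · omega
        · rfl
        · omega
        · omega
        · rfl
  · rintro σ' ⟨d, e40, m⟩
    refine ⟨by rw [e40, d 21 (by norm_num)]; exact lt_irrefl _, ?_, fun i hi => ?_, fun i hi => ?_⟩
    · exact env_of_reg d
    · rw [m i, if_pos hi]
    · rw [m, if_neg (by omega)]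

end Task.Valid

end HeatFFT
end

open Set
noncomputable section
namespace HeatFFT

/-! ## Running the program -/

variable {inp : Input} {β : ℕ} {τ : Task}

lemma view_initStore (d n m i : ℕ) : view (initStore d n m i) = initStore d n m i := by
  unfold view initStore
  congr 1
  funext r
  dsimp only
  split_ifs <;> first | rfl | omega

lemma small_initStore {d n m i : ℕ} (hd : d < 2 ^ β) (hn : n < 2 ^ β) (hm : m < 2 ^ β) (hi : i < 2 ^ β) :
    Small β (initStore d n m i) := by
  refine ⟨fun r _ => ?_, fun _ => by rw [bits_le_iff]; exact zero_lt_two_pow⟩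
  rw [bits_le_iff]
  show |if r = 0 then (d : ℤ) else if r = 1 then n else if r = 2 then m else if r = 3 then i else 0| < _
  split_ifs
  · rw [Nat.abs_cast]; exact_mod_cast hd
  · rw [Nat.abs_cast]; exact_mod_cast hn
  · rw [Nat.abs_cast]; exact_mod_cast hm
  · rw [Nat.abs_cast]; exact_mod_cast hi
  · exact zero_lt_two_pow

/-- On a one-point grid no real data are consulted: the program writes `1 / 1`. The bit length must
still hold `d`, `m` and `i`, which sit in registers. -/
lemma run_of_one {d m i : ℕ} (hβ : 7 ≤ β) (hd : d < 2 ^ β) (hm : m < 2 ^ β) (hi : i < 2 ^ β) :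
    ∃ s c, Run inp program (initStore d 1 m i) s c ∧ c ≤ 5 * unitCost β ∧ s.reg 0 = 1 ∧ s.mem 0 = 1 := by
  have h1 : |(1 : ℤ)| < 2 ^ β := by rw [abs_one]; exact one_lt_pow₀ (by norm_num) (by omega)
  have key : Ends inp β program (initStore d 1 m i) (1 + (1 + (1 + 1 + 1)))
      (fun σ' => σ'.reg 0 = 1 ∧ σ'.mem 0 = 1) := by
    unfold program
    refine Ends.assign_seq (v := 0) hβ (by norm_num) (by rfl) rfl zero_lt_two_pow ?_
    refine Ends.assign_seq (v := 1) hβ (by norm_num) (by rfl) rfl h1 ?_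
    refine Ends.ite (by norm_num) (by norm_num) (fun _ => ?_) (fun h => absurd (by simp [initStore]) h)
    refine Ends.write_seq (b := 0) (v := 1) hβ (by rfl) (by rfl) rfl rfl h1 ?_
    exact Ends.assign' (v := 1) hβ (by norm_num) (by rfl) rfl h1 (by simp [Store.put])
  obtain ⟨s, c, r, hc, -, e0, e1⟩ := key (small_initStore hd (Nat.one_lt_two_pow (by omega)) hm hi) _ (view_initStore _ _ _ _)
  exact ⟨s, c, r, hc, by rwa [view_reg (by norm_num)] at e0, e1⟩

namespace Task.Valid
variable (h : τ.Valid)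
include h

lemma cost_le : 1 + (1 + (20 * τ.R + (4 * (τ.w.n * τ.w.M) + 2 + (τ.w.d * ((τ.w.p + 1) * (3 * τ.w.R + 3 * τ.w.q + 16
    + τ.w.M * (11 * (2 * τ.w.n + τ.w.a) + 7)) + 4 * (τ.w.n * τ.w.M) + 7) + 3)) + 1))
    ≤ 100 * (τ.d * (τ.w.p + 1) * (τ.R + τ.n ^ τ.d)) := by
  have hR := thirty_le_R (τ := τ)
  have hq := q_add_le (τ := τ)
  have e1 : τ.w.M * (11 * (2 * τ.w.n + τ.w.a) + 7) ≤ 40 * τ.n ^ τ.d := by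
    have ha : τ.w.a ≤ τ.w.n := h.fit.a_le
    have hn : 2 ≤ τ.w.n := h.n_two
    calc τ.w.M * (11 * (2 * τ.w.n + τ.w.a) + 7) ≤ τ.w.M * (40 * τ.w.n) :=
          Nat.mul_le_mul_left _ (by omega)
      _ = 40 * (τ.w.n * τ.w.M) := by ring
      _ = _ := by rw [h.nM]
  have e2 : 3 * τ.w.R + 3 * τ.w.q + 16 ≤ 6 * τ.R := by
    show 3 * τ.R + 3 * τ.q + 16 ≤ _
    linarith
  have hd := h.d_pos
  rw [h.nM]
  change 1 + (1 + (20 * τ.R + (4 * τ.n ^ τ.d + 2 + (τ.d * _ + 3)) + 1)) ≤ _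
  set N := τ.n ^ τ.d
  set p := τ.w.p + 1 with hp
  have hp1 : 1 ≤ p := by omega
  have e3 : p * (3 * τ.w.R + 3 * τ.w.q + 16 + τ.w.M * (11 * (2 * τ.w.n + τ.w.a) + 7)) ≤ p * (40 * (τ.R + N)) :=
    Nat.mul_le_mul_left _ (by linarith)
  have e4 : 4 * N + 7 ≤ p * (5 * (τ.R + N)) := by
    calc 4 * N + 7 ≤ 1 * (5 * (τ.R + N)) := by linarith
      _ ≤ _ := Nat.mul_le_mul_right _ hp1
  have e5 : τ.R + N ≤ τ.d * p * (τ.R + N) := Nat.le_mul_of_pos_left _ (by positivity)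
  have e6 := Nat.mul_le_mul_left τ.d (Nat.add_le_add e3 e4)
  have e7 : τ.d * (p * (40 * (τ.R + N)) + p * (5 * (τ.R + N))) = 45 * (τ.d * p * (τ.R + N)) := by ring
  rw [e7] at e6
  have e8 : p * (3 * τ.w.R + 3 * τ.w.q + 16 + τ.w.M * (11 * (2 * τ.w.n + τ.w.a) + 7)) + (4 * N + 7)
    = p * (3 * τ.w.R + 3 * τ.w.q + 16 + τ.w.M * (11 * (2 * τ.w.n + τ.w.a) + 7)) + 4 * N + 7 := by ring
  rw [e8] at e6
  linarith

/-- The bound `hb` after `s` and after `s + 1` passes gives the size conditions for pass `s`; thus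
the accuracy analysis also guarantees the bit lengths used in the cost. -/
lemma run (hp0 : inp.param 0 = τ.θ) (hp1 : inp.param 1 = τ.ε)
    (hb : ∀ s ≤ τ.d, ∀ q < τ.n ^ τ.d, |(τ.w.passes (τ.start inp.sample) s q : ℝ)| ≤ (τ.n ^ τ.d + 1) * τ.B) :
    ∃ s c, Run inp program (initStore τ.d τ.n τ.m τ.i) s c ∧
      c ≤ 100 * (τ.d * (τ.w.p + 1) * (τ.R + τ.n ^ τ.d)) * unitCost τ.β ∧ s.reg 0 = τ.B ∧
      ∀ q < τ.n ^ τ.d, s.mem q = τ.w.passes (τ.start inp.sample) τ.d q := by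
  have hβ := seven_le_β (τ := τ)
  have hW := two_pow_R (τ := τ)
  have bnd : ∀ {r : ℕ} {x : ℕ}, r < 26 → τ.st r = x → x < 2 ^ τ.β := fun {r x} hr hx => by
    have := h.st_lt hr
    rw [hx, Nat.abs_cast] at this
    exact_mod_cast this
  have hstart : ∀ q < τ.w.n * τ.w.M, |τ.start inp.sample q| < 2 ^ τ.β := fun q hq => by
    have h1 := hb 0 (by omega) q (h.nM ▸ hq)
    have h2 : |τ.start inp.sample q| ≤ (τ.n ^ τ.d + 1) * τ.B := by exact_mod_cast h1
    refine pow_lt_two_pow_β (e := 5) (by norm_num) (h2.trans ?_)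
    have := n_pow_le (τ := τ)
    rw [B_eq_pow, pow_succ' _ 4]
    have h0 : (0 : ℤ) ≤ τ.n ^ τ.d := by positivity
    gcongr
    linarith
  have key : Ends inp τ.β program (initStore τ.d τ.n τ.m τ.i)
      (100 * (τ.d * (τ.w.p + 1) * (τ.R + τ.n ^ τ.d)))
      (fun σ' => σ'.reg 0 = τ.w.B ∧ ∀ q < τ.w.n * τ.w.M, σ'.mem q = τ.w.passes (τ.start inp.sample) τ.w.d q) := by
    refine Ends.mono ?_ h.cost_le (fun _ _ h => h)
    unfold program
    have hD : Done τ 4 (initStore τ.d τ.n τ.m τ.i) :=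
      ⟨fun r hr => by interval_cases r <;> rfl, rfl⟩
    refine assign_done_seq hβ hD (by norm_num) (by rfl) rfl (h.st_lt (by norm_num)) fun σ hD => ?_
    refine assign_done_seq hβ hD (by norm_num) (by rfl) rfl (h.st_lt (by norm_num)) fun σ hD => ?_
    refine Ends.ite (by norm_num) (by norm_num) (fun hle => ?_) (fun _ => ?_)
    · exfalso
      rw [hD.1 1 (by norm_num), hD.1 5 (by norm_num)] at hle
      have h1 : (τ.n : ℤ) ≤ 1 := hle
      have := h.n_two
      omega
    refine Ends.seq_of (h.setup_spec hp0 hp1 hD) fun σ hD => ?_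
    refine Ends.seq_of (h.sample_spec hstart hD) fun σ hE => ?_
    refine mainPart_spec (fun s hs => ?_) h.d_pos h.coefBdd hE.1 hE.2.1 hE.2.2
    exact h.bdd (hb s (le_of_lt hs)) (hb (s + 1) hs)
  obtain ⟨s, c, r, hc, -, e0, e1⟩ := key (small_initStore (bnd (r := 0) (by norm_num) rfl)
    (bnd (r := 1) (by norm_num) rfl) (bnd (r := 2) (by norm_num) rfl) (bnd (r := 3) (by norm_num) rfl)) _
    (view_initStore _ _ _ _)
  refine ⟨s, c, r, hc, ?_, fun q hq => ?_⟩
  · rw [view_reg (by norm_num)] at e0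
    rw [e0, w_B]
  · exact e1 q (by rw [h.nM]; exact hq)

end Task.Valid

end HeatFFT
end

open Set
noncomputable section
namespace HeatFFT

/-! ## The running time -/

lemma one_le_log {X : ℝ} (hX : 3 ≤ X) : 1 ≤ Real.log X := by
  rw [Real.le_log_iff_exp_le (by linarith)]
  linarith [Real.exp_one_lt_d9]

/-- The factor `2` is a bound for `1 / log 2`, and the summand `1` pays for rounding up. -/
lemma clog_le_log {X : ℝ} (hX : 3 ≤ X) {x k : ℕ} (h : (x : ℝ) ≤ X ^ k) :
    (Nat.clog 2 x : ℝ) ≤ 2 * k * Real.log X + 1 := by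
  have hl := one_le_log hX
  have h0 : 0 ≤ 2 * k * Real.log X := by positivity
  rcases le_or_gt x 1 with h1 | h1
  · rw [Nat.clog_of_right_le_one h1]
    push_cast; linarith
  have h2 : (2 : ℝ) ^ (Nat.clog 2 x).pred ≤ X ^ k := by
    refine le_trans ?_ h
    exact_mod_cast (Nat.pow_pred_clog_lt_self (by norm_num) h1).le
  have h3 := Real.log_le_log (by positivity) h2
  rw [Real.log_pow, Real.log_pow] at h3
  have h4 : (Nat.clog 2 x : ℝ) ≤ (Nat.clog 2 x).pred + 1 := by
    exact_mod_cast Nat.le_succ_of_pred_le le_rfl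
  have h5 := Real.log_two_gt_d9
  have h6 : (0 : ℝ) ≤ (Nat.clog 2 x).pred := by positivity
  nlinarith

namespace Task.Valid
variable {τ : Task} (h : τ.Valid) {X : ℝ} {K : ℕ}
include h

omit h in
lemma ln_le_log (hX : 3 ≤ X) (hn : (τ.n : ℝ) ≤ X) : (τ.ln : ℝ) ≤ 3 * Real.log X := by
  have h1 := clog_le_log (k := 1) hX (by rwa [pow_one])
  have h2 := one_le_log hX
  unfold ln
  push_cast at h1
  linarith

omit h in
lemma lm_le_log (hX : 3 ≤ X) (hm : (τ.m : ℝ) ≤ X ^ K) : (τ.lm : ℝ) ≤ (2 * K + 1) * Real.log X := by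
  have h1 := clog_le_log hX hm
  have h2 := one_le_log hX
  unfold lm
  linarith

lemma le_le_log (hX : 3 ≤ X) (hε : 1 / τ.ε ≤ X ^ K) : (τ.le : ℝ) ≤ (2 * K + 3) * Real.log X := by
  have h0 : 0 < 1 / τ.ε := by have := h.ε_pos; positivity
  have h3 : ((⌈1 / τ.ε⌉₊ : ℕ) : ℝ) ≤ X ^ (K + 1) := by
    have h4 := (Nat.ceil_lt_add_one h0.le).le
    have h5 : 1 ≤ X ^ K := one_le_pow₀ (by linarith)
    rw [pow_succ]
    nlinarith
  have h1 := clog_le_log hX h3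
  have h2 := one_le_log hX
  unfold le
  push_cast at h1
  linarith

/-- The dimension enters through `d * ln`, the digits needed for values up to `n ^ d`. Squared by
schoolbook arithmetic, it yields two of the three powers of `d`; the number of passes gives the
third. -/
lemma R_le_log (hX : 3 ≤ X) (hn : (τ.n : ℝ) ≤ X) (hm : (τ.m : ℝ) ≤ X ^ K) (hε : 1 / τ.ε ≤ X ^ K) :
    (τ.R : ℝ) ≤ (6 * K + 82) * (τ.d * Real.log X) := by
  have h0 := one_le_log hX
  have h1 := ln_le_log hX hn
  have h2 := lm_le_log hX hm
  have h3 := h.le_le_log hX hε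
  have hd : (1 : ℝ) ≤ τ.d := by exact_mod_cast h.d_pos
  have h4 : (τ.R : ℝ) = τ.d * τ.ln + τ.d + 2 * (τ.lm + 2 * τ.ln + 11) + 3 * τ.ln + τ.le + 30 := by
    unfold R q; push_cast; rfl
  have hK : (0 : ℝ) ≤ K := by positivity
  set ℓ := Real.log X
  have h5 : (τ.d : ℝ) * τ.ln ≤ 3 * (τ.d * ℓ) := by nlinarith
  have h6 : (τ.d : ℝ) ≤ τ.d * ℓ := by nlinarith
  have h7 : ℓ ≤ τ.d * ℓ := by nlinarith
  have h8 := mul_le_mul_of_nonneg_left h7 hK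
  nlinarith

omit h in
lemma p_le_log (hX : 3 ≤ X) (hn : (τ.n : ℝ) ≤ X) (hm : (τ.m : ℝ) ≤ X ^ K) :
    ((τ.w.p + 1 : ℕ) : ℝ) ≤ (16 * K + 105) * Real.log X := by
  have h0 := one_le_log hX
  have h1 := ln_le_log hX hn
  have h2 := lm_le_log hX hm
  have h3 : τ.w.p ≤ 8 * τ.l := min_le_right _ _
  have h4 : (τ.w.p : ℝ) ≤ 8 * (2 * τ.ln + τ.lm + 6) := by
    have : (τ.l : ℝ) = 2 * τ.ln + τ.lm + 6 := by unfold l; push_cast; rfl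
    rw [← this]
    exact_mod_cast h3
  push_cast
  linarith

/-- From `d log n = log (n ^ d) ≤ n ^ d` and `d ≤ n ^ d`. It allows the cost of the setup and of the
coefficients to be absorbed into the work on the grid. -/
lemma log_le_pow (hX : 3 ≤ X) (hXn : X ≤ 3 * τ.n ^ 2) : τ.d * Real.log X ≤ 4 * (τ.n : ℝ) ^ τ.d := by
  have hn2 : (2 : ℝ) ≤ τ.n := by exact_mod_cast h.n_two
  have h1 := Real.log_le_log (by linarith) hXn
  rw [Real.log_mul (by norm_num) (by positivity), Real.log_pow] at h1
  have h2 : Real.log 3 ≤ 2 := by linarith [Real.log_le_sub_one_of_pos (show (0 : ℝ) < 3 by norm_num)]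
  have h3 : (τ.d : ℝ) ≤ (τ.n : ℝ) ^ τ.d := by
    have : τ.d ≤ τ.n ^ τ.d := (Nat.lt_pow_self (by have := h.n_two; omega)).le
    exact_mod_cast this
  have h4 : τ.d * Real.log τ.n ≤ (τ.n : ℝ) ^ τ.d := by
    rw [← Real.log_pow]
    linarith [Real.log_le_sub_one_of_pos (show (0 : ℝ) < (τ.n : ℝ) ^ τ.d by positivity)]
  have hd : (0 : ℝ) ≤ τ.d := by positivity
  push_cast at h1
  nlinarith

lemma time_bound (hX : 3 ≤ X) (hn : (τ.n : ℝ) ≤ X) (hXn : X ≤ 3 * τ.n ^ 2) (hm : (τ.m : ℝ) ≤ X ^ K)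
    (hε : 1 / τ.ε ≤ X ^ K) :
    ((100 * (τ.d * (τ.w.p + 1) * (τ.R + τ.n ^ τ.d)) * unitCost τ.β : ℕ) : ℝ)
      ≤ 200000000 * (16 * K + 105) * (4 * (6 * K + 82) + 1) * (17 * (6 * K + 82)) ^ 2
        * (τ.d ^ 3 * (τ.n : ℝ) ^ τ.d * Real.log X ^ 3) := by
  have h1 := h.R_le_log hX hn hm hε
  have h2 := p_le_log hX hn hm
  have h3 := h.log_le_pow hX hXn
  have h0 := one_le_log hX
  have hK : (0 : ℝ) ≤ K := by positivity
  set ℓ := Real.log X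
  set A : ℝ := 6 * K + 82
  set P : ℝ := 16 * K + 105
  have hA : 0 ≤ A := by positivity
  have h4 : (τ.R : ℝ) + (τ.n : ℝ) ^ τ.d ≤ (4 * A + 1) * (τ.n : ℝ) ^ τ.d := by nlinarith
  have h5 : (τ.β : ℝ) + 1 ≤ 17 * A * (τ.d * ℓ) := by
    have h6 : (30 : ℝ) ≤ τ.R := by exact_mod_cast thirty_le_R
    have h7 : (τ.β : ℝ) = 16 * τ.R := by unfold β; push_cast; rfl
    linarith
  have e : ((100 * (τ.d * (τ.w.p + 1) * (τ.R + τ.n ^ τ.d)) * unitCost τ.β : ℕ) : ℝ)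
      = 200000000 * (τ.d * ((τ.w.p + 1 : ℕ) : ℝ) * (τ.R + (τ.n : ℝ) ^ τ.d) * ((τ.β : ℝ) + 1) ^ 2) := by
    unfold unitCost; push_cast; ring
  rw [e]
  calc _ ≤ 200000000 * (τ.d * (P * ℓ) * ((4 * A + 1) * (τ.n : ℝ) ^ τ.d) * (17 * A * (τ.d * ℓ)) ^ 2) := by
        gcongr
    _ = _ := by ring

end Task.Valid

section Scales
variable {d : ℕ} {L T α ζ ε : ℝ}

lemma spaceSteps_sq (hα : 0 < α) (hζ : 0 < ζ) (hT : 0 < T) (hε : 0 < ε) :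
    T * L ^ 2 * d * α * ζ / ε = 3 * spaceSteps d L T α ζ ε ^ 2 := by
  unfold spaceSteps
  rw [mul_pow, Real.sq_sqrt (by positivity)]
  field_simp

/-- The number of time steps is tied to the mesh ratio; this is how a bound on `m` controls `d θ n ^
2`, with `θ = α T / L ^ 2`. -/
lemma timeSteps_eq (hL : 0 < L) (hα : 0 < α) (hζ : 0 < ζ) (hT : 0 < T) (hε : 0 < ε) :
    timeSteps d T α ζ ε = 2 * (d * (α * T / L ^ 2 * spaceSteps d L T α ζ ε ^ 2)) := by
  have h := spaceSteps_sq (d := d) (L := L) hα hζ hT hε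
  have h2 : spaceSteps d L T α ζ ε ^ 2 = T * L ^ 2 * d * α * ζ / ε / 3 := by linarith
  rw [h2]
  unfold timeSteps
  field_simp

lemma timeBound_eq (hd : 0 < d) (hα : 0 < α) (hζ : 0 < ζ) (hT : 0 < T) (hε : 0 < ε) :
    timeBound d L T α ζ ε
      = d ^ 3 * spaceSteps d L T α ζ ε ^ d * Real.log (T * L ^ 2 * d * α * ζ / ε) ^ 3 := by
  have hd' : (0 : ℝ) < d := by exact_mod_cast hd
  have e1 : √((d : ℝ) * α * ζ * T / (3 * ε)) ^ d
      = (3 : ℝ) ^ (-(d : ℝ) / 2) * (d : ℝ) ^ ((d : ℝ) / 2) * (T * α * ζ / ε) ^ ((d : ℝ) / 2) := by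
    have e2 : (d : ℝ) * α * ζ * T / (3 * ε) = 3⁻¹ * d * (T * α * ζ / ε) := by field_simp
    rw [Real.sqrt_eq_rpow, ← Real.rpow_natCast, ← Real.rpow_mul (by positivity), e2,
      Real.mul_rpow (by positivity) (by positivity), Real.mul_rpow (by positivity) (by positivity),
      Real.inv_rpow (by norm_num), ← Real.rpow_neg (by norm_num)]
    have e3 : (1 : ℝ) / 2 * d = d / 2 := by ring
    rw [e3, neg_div]
  unfold timeBound spaceSteps
  rw [mul_pow, e1, Real.rpow_add hd']
  have e4 : (d : ℝ) ^ (3 : ℝ) = (d : ℝ) ^ 3 := by exact_mod_cast Real.rpow_natCast (d : ℝ) 3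
  rw [e4]
  ring

end Scales

/-! ## The grid -/

section Grid
variable {d : ℕ} {L : ℝ} {n : ℕ} {u : (Fin d → ℝ) → ℝ → ℝ}

lemma gridIndex_eq (j : Fin d → Fin n) : gridIndex n j = (finFunctionFinEquiv j : ℕ) := by
  rw [finFunctionFinEquiv_apply]; rfl

lemma gridIndex_lt (j : Fin d → Fin n) : gridIndex n j < n ^ d := by
  rw [gridIndex_eq]; exact Fin.is_lt _

lemma gridIndex_digit (j : Fin d → Fin n) (k : Fin d) : gridIndex n j / n ^ (k : ℕ) % n = j k := by
  have h := finFunctionFinEquiv_symm_apply_val (finFunctionFinEquiv j) k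
  rw [Equiv.symm_apply_apply] at h
  rw [gridIndex_eq, h]

lemma gridFun_dig (q : ℕ) (t : ℝ) : gridFun L n u t (dig d n 0 q)
    = L ^ d * u (gridPoint L n (fun k : Fin d => q / n ^ (k : ℕ) % n)) t := by
  unfold gridFun gridPoint
  congr 2
  funext k
  simp only [dig, k.2, if_true, add_zero, Nat.mod_eq_of_lt k.2]
  norm_cast

lemma sample_eq (T α ε : ℝ) (q : ℕ) :
    (heatInput L T α ε n (fun x => u x 0)).sample q = gridFun L n u 0 (dig d n 0 q) := by
  rw [gridFun_dig]; rfl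

lemma gridFun_gridIndex (t : ℝ) (j : Fin d → Fin n) : gridFun L n u t (dig d n 0 (gridIndex n j))
    = L ^ d * u (gridPoint L n (fun k => (j k : ℕ))) t := by
  rw [gridFun_dig]
  simp only [gridIndex_digit]

lemma output_close (hL : 0 < L) {s : Store} {j : Fin d → Fin n} {t ε : ℝ}
    (h : |(s.mem (gridIndex n j) : ℝ) / s.reg 0 - gridFun L n u t (dig d n 0 (gridIndex n j))| ≤ ε) :
    |output L n s j - u (gridPoint L n (fun k => (j k : ℕ))) t| ≤ ε / L ^ d := by
  rw [gridFun_gridIndex] at h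
  have hLd : (0 : ℝ) < L ^ d := by positivity
  unfold output
  have e : (s.mem (gridIndex n j) : ℝ) / s.reg 0 / L ^ d - u (gridPoint L n (fun k => (j k : ℕ))) t
      = ((s.mem (gridIndex n j) : ℝ) / s.reg 0 - L ^ d * u (gridPoint L n (fun k => (j k : ℕ))) t) / L ^ d := by
    field_simp
  rw [e, abs_div, abs_of_pos hLd]
  gcongr

end Grid

end HeatFFT
end

/-! ### The one-point grid and the assembly of the theorem. -/

open Set
noncomputable section
namespace HeatFFT

lemma splitStep_pow_const (c : ℝ) (d s : ℕ) (x : ℝ) :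
    (splitStep c d ^ s) (fun _ => x) = fun _ => x := by
  have h1 : ∀ k, heatStep c k (fun _ => x) = fun _ => x := fun k => by
    funext j; rw [heatStep_apply, secondDiff_apply]; ring
  have h2 : splitStep c d (fun _ => x) = fun _ => x := by
    induction d with
    | zero => rfl
    | succ d ih => simp [splitStep, h1, ih]
  induction s with
  | zero => rfl
  | succ s ih => rw [pow_succ, Module.End.mul_apply, h2, ih]

section
variable {d : ℕ} {L T α ζ ε : ℝ} {u : (Fin d → ℝ) → ℝ → ℝ} {m : ℕ}

/-- On a grid with one point the solution is almost constant. -/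
lemma gridFun_one (hL : 0 < L) (hT : 0 < T) (hα : 0 < α) (hζ : 0 < ζ) (hε : 0 < ε)
    (hu : IsPeriodicHeatSolution α L T u) (hb : FourthDerivBound ζ L T u)
    (hsum : ∑ j : Fin d → Fin 1, u (gridPoint L 1 (fun k => (j k : ℕ))) 0 = (1 / L) ^ d)
    (hm : 0 < m) (hτ : d * (α * T / L ^ 2) ≤ 2 * m) (hd : 0 < d)
    (hZ : d * (α * T / L ^ 2) * (L ^ 4 * ζ) ≤ 3 * ε) {t : ℝ} (ht : t ∈ Icc 0 T) (j : ℕ → ℤ) :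
    |1 - gridFun L 1 u t j| ≤ ε := by
  have hm' : (1 : ℝ) ≤ m := by exact_mod_cast hm
  have hd' : (1 : ℝ) ≤ d := by exact_mod_cast hd
  -- With a single grid point, the normalisation fixes the initial value and periodicity spreads it
  -- over the lattice.
  have h0 : gridFun L 1 u 0 = fun _ => 1 := by
    funext j
    have h1 := gridFun_add_periodic hu one_pos (⟨le_rfl, hT.le⟩ : (0 : ℝ) ∈ Icc 0 T) 0 j
    have e : (0 : ℕ → ℤ) + (fun k => j k * ((1 : ℕ) : ℤ)) = j := by funext k; simp
    rw [e] at h1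
    rw [h1]
    rw [Fintype.sum_unique] at hsum
    have e2 : gridFun L 1 u 0 0 = L ^ d * u (gridPoint L 1 (fun k => ((default : Fin d → Fin 1) k : ℕ))) 0 := by
      unfold gridFun gridPoint
      simp
    rw [e2, hsum, ← mul_pow, mul_one_div_cancel hL.ne', one_pow]
  have htT : α * t / L ^ 2 ≤ α * T / L ^ 2 := by have := ht.2; gcongr
  have h0T : 0 ≤ α * t / L ^ 2 := by have := ht.1; positivity
  -- Split steps fix constants, so the discretisation estimate alone keeps the solution within `5 ε
  -- / 16` of `1`; `1600 m` is the required number of steps for `n = 1`.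
  have h1 := gridFun_splitStep (ε := ε) (m := m) (s := 1600 * m) hL hα.le hu hb hζ.le one_pos ht (by omega)
    (by
      have := mul_le_mul_of_nonneg_left htT (by positivity : (0 : ℝ) ≤ d)
      simp only [Nat.cast_one, one_pow, mul_one]
      linarith)
    (by
      have := mul_le_mul_of_nonneg_right (mul_le_mul_of_nonneg_left htT (by positivity : (0 : ℝ) ≤ d))
        (by positivity : 0 ≤ L ^ 4 * ζ)
      simp only [Nat.cast_one, one_pow, mul_one, div_one]
      linarith)
    (by
      rw [div_le_iff₀ (by positivity)]
      push_cast
      simp only [one_pow, mul_one]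
      have : α * T / L ^ 2 ≤ d * (α * T / L ^ 2) := le_mul_of_one_le_left (by positivity) hd'
      linarith)
    hε.le (by simp) j
  rw [h0, splitStep_pow_const] at h1
  rw [abs_sub_comm]
  refine le_trans h1 ?_
  linarith

/-- The computation on a grid with several points. -/
lemma exists_run {n i : ℕ} (hv : (⟨d, n, m, i, α * T / L ^ 2, ε⟩ : Task).Valid) (hL : 0 < L) (hT : 0 < T)
    (hα : 0 < α) (hζ : 0 < ζ) (hu : IsPeriodicHeatSolution α L T u) (hpos : ∀ x, 0 ≤ u x 0)
    (hb : FourthDerivBound ζ L T u)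
    (hsum : ∑ j : Fin d → Fin n, u (gridPoint L n (fun k => (j k : ℕ))) 0 = ((n : ℝ) / L) ^ d)
    (hZ : d * (α * T / L ^ 2 * n ^ 2) * ((L / n) ^ 4 * ζ) ≤ 3 * ε) {X : ℝ} {K : ℕ} (hX : 3 ≤ X)
    (hnX : (n : ℝ) ≤ X) (hXn : X ≤ 3 * (n : ℝ) ^ 2) (hmX : (m : ℝ) ≤ X ^ K) (hε : 1 / ε ≤ X ^ K) :
    ∃ s c, Run (heatInput L T α ε n (fun x => u x 0)) program (initStore d n m i) s c ∧
      (c : ℝ) ≤ 200000000 * (16 * K + 105) * (4 * (6 * K + 82) + 1) * (17 * (6 * K + 82)) ^ 2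
        * (d ^ 3 * (n : ℝ) ^ d * Real.log X ^ 3) ∧
      ∀ j : Fin d → Fin n, |output L n s j
        - u (gridPoint L n (fun k => (j k : ℕ))) ((i : ℝ) * (T / m))| ≤ ε / L ^ d := by
  have hacc := hv.accuracy hL hT hα hζ hu hpos hb hsum hZ
    (fun q _ => sample_eq (u := u) (n := n) T α ε q)
  have hXn' := hv.time_bound hX hnX hXn hmX hε
  have hrun := hv.run (inp := heatInput L T α ε n (fun x => u x 0)) (by simp [heatInput]) (by simp [heatInput])
    hacc.2
  obtain ⟨s, c, hrun, hc, e0, e1⟩ := hrun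
  refine ⟨s, c, hrun, (Nat.cast_le.2 hc).trans hXn', fun j => output_close hL ?_⟩
  rw [e0, e1 _ (gridIndex_lt j)]
  exact hacc.1 _ (gridIndex_lt j)

end

end HeatFFT
end

theorem mainTheorem6 :
    ∃ P : HeatFFT.Prog, ∀ K : ℕ, ∃ C : ℝ,
      ∀ (d : ℕ) (L T α ζ ε : ℝ) (u : (Fin d → ℝ) → ℝ → ℝ) (n m : ℕ),
        0 < d → 0 < L → 0 < T → 0 < α → 0 < ζ → 0 < ε → ε < 1 →
        HeatFFT.IsPeriodicHeatSolution α L T u →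
        (∀ x, 0 ≤ u x 0) →
        HeatFFT.FourthDerivBound ζ L T u →
        n = ⌈HeatFFT.spaceSteps d L T α ζ ε⌉₊ →
        m = ⌈HeatFFT.timeSteps d T α ζ ε⌉₊ →
        ∑ j : Fin d → Fin n, u (HeatFFT.gridPoint L n (fun k => (j k : ℕ))) 0 = ((n : ℝ) / L) ^ d →
        1 ≤ HeatFFT.spaceSteps d L T α ζ ε →
        (n : ℝ) ^ d ≤ K * HeatFFT.spaceSteps d L T α ζ ε ^ d →
        (m : ℝ) ≤ (T * L ^ 2 * d * α * ζ / ε) ^ K →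
        1 / ε ≤ (T * L ^ 2 * d * α * ζ / ε) ^ K →
        ∀ i : ℕ, i ≤ m →
          ∃ (s : HeatFFT.Store) (c : ℕ),
            HeatFFT.Run (HeatFFT.heatInput L T α ε n (fun x => u x 0)) P
              (HeatFFT.initStore d n m i) s c ∧
            (c : ℝ) ≤ C * HeatFFT.timeBound d L T α ζ ε ∧
            ∀ j : Fin d → Fin n,
              |HeatFFT.output L n s j
                - u (HeatFFT.gridPoint L n (fun k => (j k : ℕ))) ((i : ℝ) * (T / m))| ≤ ε / L ^ d := by
  open HeatFFT in
  -- The first summand is the constant of `Task.Valid.time_bound` times the `K` lost between `n ^ d`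
  -- and `spaceSteps ^ d`; the second serves the one-point grid.
  refine ⟨program, fun K => ⟨200000000 * (16 * K + 105) * (4 * (6 * K + 82) + 1) * (17 * (6 * K + 82)) ^ 2 * K
    + 10000000 * (2 * K + 9) ^ 2, ?_⟩⟩
  intro d L T α ζ ε u n m hd hL hT hα hζ hε hε1 hu hpos hb hn hm hsum hs hnK hmX hεX i hi
  have hd' : (1 : ℝ) ≤ d := by exact_mod_cast hd
  have hXs := spaceSteps_sq (d := d) (L := L) hα hζ hT hε
  have hms := timeSteps_eq (d := d) hL hα hζ hT hε
  rw [timeBound_eq hd hα hζ hT hε]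
  set X := T * L ^ 2 * d * α * ζ / ε with hXd
  set b := spaceSteps d L T α ζ ε with hbd
  set θ := α * T / L ^ 2 with hθd
  clear_value X b
  have hθ : 0 < θ := by positivity
  have hX : 3 ≤ X := by nlinarith
  have hlog := one_le_log hX
  have hbn : b ≤ n := by rw [hn]; exact Nat.le_ceil _
  -- Here `b ≥ 1` is needed: rounding up at most doubles the mesh number. The resulting factor `4`
  -- in `n ^ 2` is why the time restriction reads `2 m`.
  have hn2 : (n : ℝ) ≤ 2 * b := by
    have := Nat.ceil_lt_add_one (show 0 ≤ b by linarith)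
    rw [← hn] at this
    linarith
  have hm1 : timeSteps d T α ζ ε ≤ m := by rw [hm]; exact Nat.le_ceil _
  have hm0 : 0 < m := by
    have : (0 : ℝ) < m := lt_of_lt_of_le (by rw [hms]; positivity) hm1
    exact_mod_cast this
  have hm0' : (0 : ℝ) < m := by exact_mod_cast hm0
  have htime : d * (θ * n ^ 2) ≤ 2 * m := by
    calc d * (θ * n ^ 2) ≤ d * (θ * (2 * b) ^ 2) := by gcongr
      _ = 2 * (2 * (d * (θ * b ^ 2))) := by ring
      _ ≤ 2 * m := by rw [← hms]; linarith
  have hn0 : (0 : ℝ) < n := by linarith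
  -- The left side equals `X ε / n ^ 2`, and `X = 3 b ^ 2 ≤ 3 n ^ 2`.
  have hZ : d * (θ * n ^ 2) * ((L / n) ^ 4 * ζ) ≤ 3 * ε := by
    have e : d * (θ * n ^ 2) * ((L / n) ^ 4 * ζ) = X * ε / n ^ 2 := by
      rw [hθd, hXd]; field_simp
    rw [e, div_le_iff₀ (by positivity), hXs]
    have : b ^ 2 ≤ (n : ℝ) ^ 2 := by gcongr
    nlinarith
  have htT : (i : ℝ) * (T / m) ∈ Set.Icc 0 T := by
    refine ⟨by positivity, ?_⟩
    have him : (i : ℝ) / m ≤ 1 := by rw [div_le_one hm0']; exact_mod_cast hi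
    calc (i : ℝ) * (T / m) = T * (i / m) := by ring
      _ ≤ T * 1 := by gcongr
      _ = T := mul_one T
  have hb0 : 0 ≤ b ^ d := by positivity
  set D : ℝ := 200000000 * (16 * K + 105) * (4 * (6 * K + 82) + 1) * (17 * (6 * K + 82)) ^ 2 with hD
  have hD0 : 0 ≤ D := by positivity
  have hnpos : 0 < n := by exact_mod_cast hn0
  rcases Nat.lt_or_ge n 2 with h1 | h2
  -- Then `b = 1` and `X = 3`, so `m ≤ 3 ^ K`; bit length `d + 2 K + 7` suffices, and its square is
  -- absorbed by `d ^ 3`.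
  · obtain rfl : n = 1 := by omega
    have hb1 : b = 1 := le_antisymm (by exact_mod_cast hbn) hs
    rw [hb1] at hXs
    norm_num at hXs
    have hdβ : d < 2 ^ (d + 2 * K + 7) :=
      Nat.lt_two_pow_self.trans_le (Nat.pow_le_pow_right (by norm_num) (by omega))
    have hmβ : m < 2 ^ (d + 2 * K + 7) := by
      have h3 : m ≤ 3 ^ K := by rw [hXs] at hmX; exact_mod_cast hmX
      calc m ≤ 3 ^ K := h3
        _ ≤ 4 ^ K := by gcongr; norm_num
        _ = 2 ^ (2 * K) := by rw [pow_mul]; norm_num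
        _ < _ := Nat.pow_lt_pow_right (by norm_num) (by omega)
    obtain ⟨s, c, hrun, hc, e0, e1⟩ := run_of_one
      (inp := heatInput L T α ε 1 (fun x => u x 0)) (by omega) hdβ hmβ (hi.trans_lt hmβ)
    refine ⟨s, c, hrun, ?_, fun j => output_close hL ?_⟩
    · have hc' : (c : ℝ) ≤ (5 * unitCost (d + 2 * K + 7) : ℕ) := by exact_mod_cast hc
      have h3 : (1 : ℝ) ≤ Real.log X ^ 3 := one_le_pow₀ hlog
      have hK : (0 : ℝ) ≤ K := by positivity
      refine hc'.trans ?_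
      unfold unitCost
      rw [hb1, one_pow, mul_one]
      push_cast
      calc (5 * (2000000 * (d + 2 * K + 7 + 1) ^ 2) : ℝ) ≤ 5 * (2000000 * ((2 * K + 9) * d) ^ 2) := by
            gcongr; nlinarith
        _ = 10000000 * (2 * K + 9) ^ 2 * (d ^ 2 * 1 * 1) := by ring
        _ ≤ 10000000 * (2 * K + 9) ^ 2 * (d ^ 2 * d * Real.log X ^ 3) := by gcongr
        _ = 10000000 * (2 * K + 9) ^ 2 * (d ^ 3 * Real.log X ^ 3) := by ring
        _ ≤ _ := mul_le_mul_of_nonneg_right (le_add_of_nonneg_left (by positivity)) (by positivity)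
    · have hj : gridIndex 1 j = 0 := by have := gridIndex_lt j; simpa using this
      rw [hj, e0, e1]
      have := gridFun_one hL hT hα hζ hε hu hb (by simpa using hsum) hm0 (by simpa using htime) hd
        (by simpa using hZ) htT (dig d 1 0 0)
      simpa using this
  · have hv : Task.Valid ⟨d, n, m, i, θ, ε⟩ := ⟨hd, h2, hm0, hi, hθ.le, hε, hε1, htime⟩
    have hnX : (n : ℝ) ≤ X := by
      have := le_self_pow₀ hs two_ne_zero
      rw [hXs]; linarith
    have hXn : X ≤ 3 * (n : ℝ) ^ 2 := by rw [hXs]; gcongr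
    obtain ⟨s, c, hrun, hc, hout⟩ := exists_run hv hL hT hα hζ hu hpos hb hsum hZ hX hnX hXn hmX hεX
    refine ⟨s, c, hrun, hc.trans ?_, hout⟩
    calc D * (d ^ 3 * (n : ℝ) ^ d * Real.log X ^ 3) ≤ D * (d ^ 3 * (K * b ^ d) * Real.log X ^ 3) := by gcongr
      _ = D * K * (d ^ 3 * b ^ d * Real.log X ^ 3) := by ring
      _ ≤ _ := mul_le_mul_of_nonneg_right (le_add_of_nonneg_right (by positivity)) (by positivity)
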